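/- **Conventions.** A *PRO* is a strict monoidal category whose objects are the natural numbers, with monoidal product $m+n$ on objects. For morphisms $f\colon l\to m$, $g\colon m\to n$ of a PRO, $f;g\colon l\to n$ is the composite "first $f$, then $g$"; $f\otimes g$ is the monoidal product ($\otimes$ binds more tightly than $;$), and $1=\mathrm{id}_1$ is a single wire. **The model.** Let $B=\mathbb C\oplus\mathbb C$, with even part spanned by $|0\rangle$ and odd part spanned by $|1\rangle$; $B^{\otimes n}$ has the basis $|b_1\dots b_n\rangle$, $b_i\in\{0,1\}$, and is $\mathbb Z_2$-graded by the parity of $b_1+\dots+b_n$. $\mathbf{LFM}$ is the monoidal category with objects $B^{\otimes n}$, $n\in\mathbb N$, whose morphisms are the linear maps that are either even (parity-preserving) or odd (parity-reversing), with the usual tensor product of linear maps as monoidal product. **The language.** $F[T]$ is the free PRO on the operations $\mathsf{swap}=\sigma\colon 2\to 2$, $\mathsf{dual}=\eta\colon 0\to 2$, $\mathsf{dual}^\dagger=\epsilon\colon 2\to 0$, $\mathsf{fswap}=\varphi\colon 2\to2$, $\mathsf{black}_2=\beta_2\colon 0\to 2$, $\mathsf{black}_3=\beta_3\colon 0\to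 3$ and $\mathsf{white}_z=\omega_z\colon 0\to 2$ for all $z\in\mathbb C$. The interpretation is the strict monoidal functor $f\colon F[T]\to\mathbf{LFM}$ with $f(n)=B^{\otimes n}$ and $$\sigma:|b_1b_2\rangle\mapsto|b_2b_1\rangle,\quad \eta:1\mapsto|00\rangle+|11\rangle,\quad \epsilon:|b_1b_2\rangle\mapsto\delta_{b_1b_2},\quad \varphi:|b_1b_2\rangle\mapsto(-1)^{b_1b_2}|b_2b_1\rangle,$$ $$\beta_2:1\mapsto|10\rangle+|01\rangle,\quad \beta_3:1\mapsto|100\rangle+|010\rangle+|001\rangle,\quad \omega_z:1\mapsto|00\rangle+z|11\rangle.$$ **Abbreviations.** $\nu=(1\otimes\beta_2);(\epsilon\otimes1)\colon1\to1$; $s=(1\otimes\beta_3);(\epsilon\otimes1\otimes1)\colon1\to2$; $t=(1\otimes s);(\epsilon\otimes1)\colon2\to1$; $\delta=\nu;s\colon1\to2$; $\mu=t;\nu\colon2\to1$; $p_z=(1\otimes\omega_z);(\epsilon\otimes1)\colon1\to1$; $\omega_z^{\dagger}=(1\otimes p_z);\epsilon\colon 2\to0$; $c=(\eta\otimes1);(1\otimes\varphi);(\epsilon\otimes1)\colon1\to1$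 (fermionic self-crossing); and the projector $$\pi=(1\otimes\omega_{1/2}\otimes1);(\varphi\otimes\varphi);(\nu\otimes1\otimes1\otimes\nu);(\sigma\otimes\sigma);(1\otimes\omega_{1/2}^{\dagger}\otimes1)\colon2\to2.$$ **The axioms $E$**, for all $z,w\in\mathbb C$. 1. *Structural.* $(1\otimes\eta);(\epsilon\otimes1)=1$; $\eta;\sigma=\eta$; $\sigma;\sigma=1\otimes1$; $(\sigma\otimes1);(1\otimes\sigma);(\sigma\otimes1)=(1\otimes\sigma);(\sigma\otimes1);(1\otimes\sigma)$; $\epsilon\otimes1=(1\otimes\sigma);(\sigma\otimes1);(1\otimes\epsilon)$; $(\theta\otimes1);(1\otimes\sigma);(\sigma\otimes1)=1\otimes\theta$ for $\theta=\eta,\beta_2,\omega_z$; $(\beta_3\otimes1);(1\otimes1\otimes\sigma);(1\otimes\sigma\otimes1);(\sigma\otimes1\otimes1)=1\otimes\beta_3$; $(\varphi\otimes1);(1\otimes\sigma);(\sigma\otimes1)=(1\otimes\sigma);(\sigma\otimes1);(1\otimes\varphi)$. 2. *Fermionic swap.* $\varphi;\varphi=1\otimes1$; $(\theta\otimes1);(1\otimes\varphi);(\varphi\otimes1)=(1\otimes\varphi);(\varphi\otimes1);(1\otimes\theta)$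 for $\theta=\varphi,\sigma$; $(\theta\otimes1);(1\otimes\varphi);(\varphi\otimes1)=1\otimes\theta$ for $\theta=\eta,\omega_z$; $\epsilon\otimes1=(1\otimes\varphi);(\varphi\otimes1);(1\otimes\epsilon)$; $\varphi;\sigma=\sigma;\varphi$; $(\beta_2\otimes1);(1\otimes\varphi);(\varphi\otimes1)=c\otimes\beta_2$; $(\beta_3\otimes1);(1\otimes1\otimes\varphi);(1\otimes\varphi\otimes1);(\varphi\otimes1\otimes1)=c\otimes\beta_3$. 3. *Black vertices.* $\beta_2;\sigma=\beta_2$; $\beta_3;(\sigma\otimes1)=\beta_3=\beta_3;(1\otimes\sigma)$; $\beta_3;(1\otimes\sigma)=\beta_3;(1\otimes\varphi)$; $\nu;\nu=1$; $\delta;(\delta\otimes1)=\delta;(1\otimes\delta)$; $\delta;((\delta;\epsilon)\otimes1)=1$; $(\delta\otimes\delta);(1\otimes\varphi\otimes1);(\mu\otimes\mu)=\mu;\delta$; $(\eta;\mu)\otimes(\eta;\mu)=\eta;\mu;\delta$; $\mathrm{id}_0=\eta;\mu;\delta;\epsilon$; $o\otimes o=o$, where $o=\eta;t;\nu;s;\epsilon\colon0\to0$.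 4. *White vertices.* $\omega_z;\sigma=\omega_z$; $\delta;(p_z\otimes p_z)=p_z;\delta$; $\delta;\epsilon=p_z;\delta;\epsilon$; $p_1=1$; $p_0=\delta;\epsilon;\eta;\mu$; $\delta;(p_z\otimes p_w);\mu=p_{z+w}$; $p_z;p_w=p_{zw}$; $\pi=(1\otimes1\otimes\eta);(1\otimes\pi\otimes1);(\epsilon\otimes1\otimes1)$; $(\delta\otimes\delta);(1\otimes\sigma\otimes1);(\pi\otimes\pi);(1\otimes\sigma\otimes1);(\mu\otimes1\otimes1)=\pi;(1\otimes\delta)$. Let $F[T/E]$ be the PRO obtained from $F[T]$ by quotienting by the smallest equivalence relation that contains $E$ and is compatible with composition and monoidal product, and $p_E\colon F[T]\to F[T/E]$ the quotient functor. **Theorem (Completeness).** The interpretation $f$ factors through $p_E$ (that is, $E$ is sound), and the induced functor $f_E\colon F[T/E]\to\mathbf{LFM}$, with $f=f_E\circ p_E$, is a monoidal equivalence. In particular, for all $m,n$ and all $D,D'\colon m\to n$ in $F[T]$, $f(D)=f(D')$ if and only if $p_E(D)=p_E(D')$: two diagrams have the same interpretation exactly when the axioms prove them equal. -/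

import Mathlib

open CategoryTheory MonoidalCategory

/-! ## PROs -/

/-- A PRO: a strict monoidal category whose set of objects is `ℕ`, with the monoidal product given
on objects by addition. -/
structure PRO where
  Hom : ℕ → ℕ → Type
  id : ∀ n, Hom n n
  comp : ∀ {l m n}, Hom l m → Hom m n → Hom l n
  tensor : ∀ {m n m' n'}, Hom m n → Hom m' n' → Hom (m + m') (n + n')
  id_comp : ∀ {m n} (f : Hom m n), comp (id m) f = f
  comp_id : ∀ {m n} (f : Hom m n), comp f (id n) = f
  assoc : ∀ {k l m n} (f : Hom k l) (g : Hom l m) (h : Hom m n),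
    comp (comp f g) h = comp f (comp g h)
  tensor_id : ∀ m n, tensor (id m) (id n) = id (m + n)
  tensor_comp : ∀ {l m n l' m' n'} (f : Hom l m) (g : Hom m n) (f' : Hom l' m') (g' : Hom m' n'),
    tensor (comp f g) (comp f' g') = comp (tensor f f') (tensor g g')
  tensor_assoc : ∀ {m n m' n' m'' n''} (f : Hom m n) (g : Hom m' n') (h : Hom m'' n''),
    HEq (tensor (tensor f g) h) (tensor f (tensor g h))
  id_zero_tensor : ∀ {m n} (f : Hom m n), HEq (tensor (id 0) f) f
  tensor_id_zero : ∀ {m n} (f : Hom m n), HEq (tensor f (id 0)) f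

/-- Sequential composition, in diagrammatic order: first `f`, then `g`. -/
notation:60 f:61 " ⨾ " g:60 => PRO.comp _ f g

/-- Parallel composition: `f` on the left of `g`. -/
notation:70 f:71 " ⊠ " g:70 => (PRO.tensor _ f g :)

/-- A morphism of PROs: an identity-on-objects strict monoidal functor. -/
@[ext]
structure PROHom (P Q : PRO) where
  map : ∀ {m n}, P.Hom m n → Q.Hom m n
  map_id : ∀ n, map (P.id n) = Q.id n
  map_comp : ∀ {l m n} (f : P.Hom l m) (g : P.Hom m n), map (f ⨾ g) = map f ⨾ map g
  map_tensor : ∀ {m n m' n'} (f : P.Hom m n) (g : P.Hom m' n'), map (f ⊠ g) = map f ⊠ map g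

/-- Composition of morphisms of PROs, in diagrammatic order. -/
def PROHom.comp {P Q R : PRO} (F : PROHom P Q) (G : PROHom Q R) : PROHom P R where
  map f := G.map (F.map f)
  map_id n := by rw [F.map_id, G.map_id]
  map_comp f g := by rw [F.map_comp, G.map_comp]
  map_tensor f g := by rw [F.map_tensor, G.map_tensor]

/-! ### The monoidal category underlying a PRO -/

/-- The type of objects of a PRO, which is a copy of `ℕ`. -/
@[ext]
structure PRO.Obj (P : PRO) where
  n : ℕ

namespace PRO

variable {P : PRO}

instance : Category P.Obj where
  Hom X Y := P.Hom X.n Y.n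
  id X := P.id X.n
  comp f g := P.comp f g
  id_comp := P.id_comp
  comp_id := P.comp_id
  assoc := P.assoc

theorem Obj.tensor_assoc_eq (X Y Z : P.Obj) :
    (⟨(X.n + Y.n) + Z.n⟩ : P.Obj) = ⟨X.n + (Y.n + Z.n)⟩ := by rw [Nat.add_assoc]

theorem Obj.unit_tensor_eq (X : P.Obj) : (⟨0 + X.n⟩ : P.Obj) = X := by rw [Nat.zero_add]

theorem Obj.tensor_unit_eq (X : P.Obj) : (⟨X.n + 0⟩ : P.Obj) = X := rfl

section Monoidal

/-- Strictness: the associators and unitors are identities, that is, the isomorphisms induced by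
equalities of objects. -/
@[reducible]
def monoidalStruct (P : PRO) : MonoidalCategoryStruct P.Obj where
  tensorObj X Y := ⟨X.n + Y.n⟩
  tensorHom f g := P.tensor f g
  whiskerLeft X _ _ f := P.tensor (P.id X.n) f
  whiskerRight f Y := P.tensor f (P.id Y.n)
  tensorUnit := ⟨0⟩
  associator X Y Z := eqToIso (Obj.tensor_assoc_eq X Y Z)
  leftUnitor X := eqToIso (Obj.unit_tensor_eq X)
  rightUnitor X := eqToIso (Obj.tensor_unit_eq X)

attribute [local instance] monoidalStruct

theorem comp_eqToHom_of_heq {X Y X' Y' : P.Obj} (f : X ⟶ Y) (f' : X' ⟶ Y') (hX : X = X')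
    (hY : Y = Y') (h : HEq f f') : f ≫ eqToHom hY = eqToHom hX ≫ f' := by
  subst hX hY
  simp [eq_of_heq h]

theorem tensorHom_eqToHom_id {X X' : P.Obj} (h : X = X') (Y : P.Obj) :
    (tensorHom (eqToHom h) (𝟙 Y) : X ⊗ Y ⟶ X' ⊗ Y) = eqToHom (by rw [h]) := by
  subst h
  exact P.tensor_id _ _

theorem tensorHom_id_eqToHom (X : P.Obj) {Y Y' : P.Obj} (h : Y = Y') :
    (tensorHom (𝟙 X) (eqToHom h) : X ⊗ Y ⟶ X ⊗ Y') = eqToHom (by rw [h]) := by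
  subst h
  exact P.tensor_id _ _

instance : MonoidalCategory P.Obj :=
  MonoidalCategory.ofTensorHom
    (id_tensorHom_id := fun _ _ => P.tensor_id _ _)
    (id_tensorHom := fun _ _ _ _ => rfl)
    (tensorHom_id := fun _ _ => rfl)
    (tensorHom_comp_tensorHom := fun f₁ f₂ g₁ g₂ => (P.tensor_comp f₁ g₁ f₂ g₂).symm)
    (associator_naturality := fun f₁ f₂ f₃ =>
      comp_eqToHom_of_heq _ _ (Obj.tensor_assoc_eq _ _ _) (Obj.tensor_assoc_eq _ _ _)
        (P.tensor_assoc f₁ f₂ f₃))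
    (leftUnitor_naturality := fun f =>
      comp_eqToHom_of_heq _ _ (Obj.unit_tensor_eq _) (Obj.unit_tensor_eq _) (P.id_zero_tensor f))
    (rightUnitor_naturality := fun f =>
      comp_eqToHom_of_heq _ _ (Obj.tensor_unit_eq _) (Obj.tensor_unit_eq _) (P.tensor_id_zero f))
    (pentagon := fun W X Y Z => by
      have h (X Y Z : P.Obj) : (MonoidalCategoryStruct.associator X Y Z).hom =
        eqToHom (Obj.tensor_assoc_eq X Y Z) := rfl
      rw [h W X Y, h X Y Z, tensorHom_eqToHom_id, tensorHom_id_eqToHom, h, h, h]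
      simp only [eqToHom_trans])
    (triangle := fun X Y => by
      have h : (MonoidalCategoryStruct.associator X (𝟙_ P.Obj) Y).hom =
        eqToHom (Obj.tensor_assoc_eq X ⟨0⟩ Y) := rfl
      have hl : (MonoidalCategoryStruct.leftUnitor Y).hom = eqToHom (Obj.unit_tensor_eq Y) := rfl
      have hr : (MonoidalCategoryStruct.rightUnitor X).hom = eqToHom (Obj.tensor_unit_eq X) := rfl
      rw [h, hl, hr, tensorHom_eqToHom_id, tensorHom_id_eqToHom]
      exact eqToHom_trans _ _)

end Monoidal

theorem associator_hom_eq (X Y Z : P.Obj) :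
    (α_ X Y Z).hom = eqToHom (Obj.tensor_assoc_eq X Y Z) := rfl

theorem leftUnitor_hom_eq (X : P.Obj) : (λ_ X).hom = eqToHom (Obj.unit_tensor_eq X) := rfl

theorem rightUnitor_hom_eq (X : P.Obj) : (ρ_ X).hom = eqToHom (Obj.tensor_unit_eq X) := rfl

end PRO

namespace PROHom

variable {P Q : PRO}

/-- The functor of categories given by a morphism of PROs. -/
def functor (F : PROHom P Q) : P.Obj ⥤ Q.Obj where
  obj X := ⟨X.n⟩
  map f := F.map f
  map_id X := F.map_id X.n
  map_comp f g := F.map_comp f g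

theorem functor_obj_tensor (F : PROHom P Q) (X Y : P.Obj) :
    F.functor.obj X ⊗ F.functor.obj Y = F.functor.obj (X ⊗ Y) := rfl

theorem functor_obj_unit (F : PROHom P Q) : 𝟙_ Q.Obj = F.functor.obj (𝟙_ P.Obj) := rfl

theorem functor_map_whiskerRight (F : PROHom P Q) {X Y : P.Obj} (f : X ⟶ Y) (Z : P.Obj) :
    HEq (F.functor.map f ▷ F.functor.obj Z) (F.functor.map (f ▷ Z)) :=
  heq_of_eq ((F.map_tensor f (P.id Z.n)).trans
    (congrArg (Q.tensor (F.map f)) (F.map_id Z.n))).symm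

theorem functor_map_whiskerLeft (F : PROHom P Q) (Z : P.Obj) {X Y : P.Obj} (f : X ⟶ Y) :
    HEq (F.functor.obj Z ◁ F.functor.map f) (F.functor.map (Z ◁ f)) :=
  heq_of_eq ((F.map_tensor (P.id Z.n) f).trans
    (congrArg (Q.tensor · (F.map f)) (F.map_id Z.n))).symm

/-- The functor given by a morphism of PROs is strict monoidal: its coherence isomorphisms are
identities. -/
instance (F : PROHom P Q) : F.functor.Monoidal :=
  Functor.CoreMonoidal.toMonoidal
    { εIso := eqToIso F.functor_obj_unit
      μIso := fun X Y => eqToIso (F.functor_obj_tensor X Y)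
      μIso_hom_natural_left := fun f X' =>
        PRO.comp_eqToHom_of_heq _ _ (F.functor_obj_tensor _ _) (F.functor_obj_tensor _ _)
          (F.functor_map_whiskerRight f X')
      μIso_hom_natural_right := fun X' f =>
        PRO.comp_eqToHom_of_heq _ _ (F.functor_obj_tensor _ _) (F.functor_obj_tensor _ _)
          (F.functor_map_whiskerLeft X' f)
      associativity := fun X Y Z => by
        simp only [eqToIso.hom, PRO.associator_hom_eq, eqToHom_map, eqToHom_whiskerRight,
          whiskerLeft_eqToHom, eqToHom_trans]
      left_unitality := fun X => by
        simp only [eqToIso.hom, PRO.leftUnitor_hom_eq, eqToHom_map, eqToHom_whiskerRight,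
          eqToHom_trans]
      right_unitality := fun X => by
        simp only [eqToIso.hom, PRO.rightUnitor_hom_eq, eqToHom_map, whiskerLeft_eqToHom,
          eqToHom_trans] }

end PROHom

/-- A monoidal functor is a monoidal equivalence if it is part of an equivalence of categories
whose inverse is monoidal and whose unit and counit are monoidal natural transformations. -/
def IsMonoidalEquivalence {C D : Type*} [Category C] [Category D] [MonoidalCategory C]
    [MonoidalCategory D] (F : C ⥤ D) [F.Monoidal] : Prop :=
  ∃ (_ : F.IsEquivalence) (_ : F.inv.Monoidal),
    letI : F.asEquivalence.functor.Monoidal := inferInstanceAs F.Monoidal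
    letI : F.asEquivalence.inverse.Monoidal := inferInstanceAs F.inv.Monoidal
    F.asEquivalence.IsMonoidal

/-! ### Free PROs -/

/-- Formal sequential and parallel composites of operations of the monoidal signature `T`, where
`T m n` is the type of operations with `m` inputs and `n` outputs. -/
inductive DTerm (T : ℕ → ℕ → Type) : ℕ → ℕ → Type
  | gen {m n} (t : T m n) : DTerm T m n
  | id (n) : DTerm T n n
  | comp {l m n} (f : DTerm T l m) (g : DTerm T m n) : DTerm T l n
  | tensor {m n m' n'} (f : DTerm T m n) (g : DTerm T m' n') : DTerm T (m + m') (n + n')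

namespace DTerm

variable {T : ℕ → ℕ → Type}

/-- Transport along equalities of arities. -/
def cast {m n m' n' : ℕ} (hm : m = m') (hn : n = n') (f : DTerm T m n) : DTerm T m' n' :=
  hm ▸ hn ▸ f

theorem cast_heq {m n m' n' : ℕ} (hm : m = m') (hn : n = n') (f : DTerm T m n) :
    HEq (cast hm hn f) f := by
  subst hm hn
  rfl

/-- The congruence generated by the axioms of strict monoidal categories. -/
inductive Rel : ∀ {m n}, DTerm T m n → DTerm T m n → Prop
  | refl {m n} (f : DTerm T m n) : Rel f f
  | symm {m n} {f g : DTerm T m n} : Rel f g → Rel g f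
  | trans {m n} {f g h : DTerm T m n} : Rel f g → Rel g h → Rel f h
  | comp_congr {l m n} {f f' : DTerm T l m} {g g' : DTerm T m n} :
      Rel f f' → Rel g g' → Rel (comp f g) (comp f' g')
  | tensor_congr {m n m' n'} {f f' : DTerm T m n} {g g' : DTerm T m' n'} :
      Rel f f' → Rel g g' → Rel (tensor f g) (tensor f' g')
  | id_comp {m n} (f : DTerm T m n) : Rel (comp (id m) f) f
  | comp_id {m n} (f : DTerm T m n) : Rel (comp f (id n)) f
  | assoc {k l m n} (f : DTerm T k l) (g : DTerm T l m) (h : DTerm T m n) :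
      Rel (comp (comp f g) h) (comp f (comp g h))
  | tensor_id (m n) : Rel (tensor (id m) (id n)) (id (m + n))
  | tensor_comp {l m n l' m' n'} (f : DTerm T l m) (g : DTerm T m n) (f' : DTerm T l' m')
      (g' : DTerm T m' n') :
      Rel (tensor (comp f g) (comp f' g')) (comp (tensor f f') (tensor g g'))
  | tensor_assoc {m n m' n' m'' n''} (f : DTerm T m n) (g : DTerm T m' n')
      (h : DTerm T m'' n'') :
      Rel (cast (Nat.add_assoc m m' m'') (Nat.add_assoc n n' n'') (tensor (tensor f g) h))
        (tensor f (tensor g h))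
  | id_zero_tensor {m n} (f : DTerm T m n) :
      Rel (cast (Nat.zero_add m) (Nat.zero_add n) (tensor (id 0) f)) f
  | tensor_id_zero {m n} (f : DTerm T m n) :
      Rel (cast (Nat.add_zero m) (Nat.add_zero n) (tensor f (id 0))) f

/-- Equality of formal composites modulo the axioms of strict monoidal categories. -/
def setoid (T : ℕ → ℕ → Type) (m n : ℕ) : Setoid (DTerm T m n) :=
  ⟨Rel, Rel.refl, Rel.symm, Rel.trans⟩

theorem mk_heq_of_rel_cast {m n m' n' : ℕ} (hm : m = m') (hn : n = n') {f : DTerm T m n}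
    {g : DTerm T m' n'} (h : Rel (cast hm hn f) g) :
    HEq (Quotient.mk (setoid T m n) f) (Quotient.mk (setoid T m' n') g) := by
  subst hm hn
  exact heq_of_eq (Quotient.sound h)

/-- The value of a formal composite in a PRO, given values for the operations. -/
def eval (Q : PRO) (φ : ∀ {m n}, T m n → Q.Hom m n) : ∀ {m n}, DTerm T m n → Q.Hom m n
  | _, _, gen t => φ t
  | _, _, id n => Q.id n
  | _, _, comp f g => eval Q φ f ⨾ eval Q φ g
  | _, _, tensor f g => eval Q φ f ⊠ eval Q φ g

theorem eval_cast_heq (Q : PRO) (φ : ∀ {m n}, T m n → Q.Hom m n) {m n m' n' : ℕ} (hm : m = m')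
    (hn : n = n') (f : DTerm T m n) : HEq (eval Q φ (cast hm hn f)) (eval Q φ f) := by
  subst hm hn
  rfl

theorem eval_eq_of_rel (Q : PRO) (φ : ∀ {m n}, T m n → Q.Hom m n) {m n : ℕ} {f g : DTerm T m n}
    (h : Rel f g) : eval Q φ f = eval Q φ g := by
  induction h with
  | refl => rfl
  | symm _ ih => exact ih.symm
  | trans _ _ ih₁ ih₂ => exact ih₁.trans ih₂
  | comp_congr _ _ ih₁ ih₂ => simp only [eval, ih₁, ih₂]
  | tensor_congr _ _ ih₁ ih₂ => simp only [eval, ih₁, ih₂]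
  | id_comp f => exact Q.id_comp _
  | comp_id f => exact Q.comp_id _
  | assoc f g h => exact Q.assoc _ _ _
  | tensor_id m n => exact Q.tensor_id m n
  | tensor_comp f g f' g' => exact Q.tensor_comp _ _ _ _
  | tensor_assoc f g h => exact eq_of_heq ((eval_cast_heq Q φ _ _ _).trans (Q.tensor_assoc _ _ _))
  | id_zero_tensor f => exact eq_of_heq ((eval_cast_heq Q φ _ _ _).trans (Q.id_zero_tensor _))
  | tensor_id_zero f => exact eq_of_heq ((eval_cast_heq Q φ _ _ _).trans (Q.tensor_id_zero _))

end DTerm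

/-- The free PRO on a monoidal signature. -/
def freePRO (T : ℕ → ℕ → Type) : PRO where
  Hom m n := Quotient (DTerm.setoid T m n)
  id n := Quotient.mk _ (DTerm.id n)
  comp := Quotient.map₂ DTerm.comp fun _ _ h _ _ h' => DTerm.Rel.comp_congr h h'
  tensor := Quotient.map₂ DTerm.tensor fun _ _ h _ _ h' => DTerm.Rel.tensor_congr h h'
  id_comp := by rintro _ _ ⟨f⟩; exact Quotient.sound (.id_comp f)
  comp_id := by rintro _ _ ⟨f⟩; exact Quotient.sound (.comp_id f)
  assoc := by rintro _ _ _ _ ⟨f⟩ ⟨g⟩ ⟨h⟩; exact Quotient.sound (.assoc f g h)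
  tensor_id m n := Quotient.sound (.tensor_id m n)
  tensor_comp := by
    rintro _ _ _ _ _ _ ⟨f⟩ ⟨g⟩ ⟨f'⟩ ⟨g'⟩; exact Quotient.sound (.tensor_comp f g f' g')
  tensor_assoc := by
    rintro _ _ _ _ _ _ ⟨f⟩ ⟨g⟩ ⟨h⟩; exact DTerm.mk_heq_of_rel_cast _ _ (.tensor_assoc f g h)
  id_zero_tensor := by
    rintro _ _ ⟨f⟩; exact DTerm.mk_heq_of_rel_cast _ _ (.id_zero_tensor f)
  tensor_id_zero := by
    rintro _ _ ⟨f⟩; exact DTerm.mk_heq_of_rel_cast _ _ (.tensor_id_zero f)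

/-- An operation of the signature, as a morphism of the free PRO. -/
def freePRO.gen {T : ℕ → ℕ → Type} {m n : ℕ} (t : T m n) : (freePRO T).Hom m n :=
  Quotient.mk _ (DTerm.gen t)

/-- The morphism of PROs induced by an interpretation of the operations of the signature. -/
def freePRO.lift {T : ℕ → ℕ → Type} (Q : PRO) (φ : ∀ {m n}, T m n → Q.Hom m n) :
    PROHom (freePRO T) Q where
  map := Quotient.lift (DTerm.eval Q φ) fun _ _ h => DTerm.eval_eq_of_rel Q φ h
  map_id _ := rfl
  map_comp := by rintro _ _ _ ⟨f⟩ ⟨g⟩; rfl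
  map_tensor := by rintro _ _ _ _ ⟨f⟩ ⟨g⟩; rfl

/-! ### Quotients of PROs -/

namespace PRO

variable (P : PRO) (E : ∀ m n, P.Hom m n → P.Hom m n → Prop)

/-- The smallest equivalence relation including `E` and compatible with composition and monoidal
product. -/
inductive Derivable : ∀ {m n}, P.Hom m n → P.Hom m n → Prop
  | of {m n} {f g : P.Hom m n} : E m n f g → Derivable f g
  | refl {m n} (f : P.Hom m n) : Derivable f f
  | symm {m n} {f g : P.Hom m n} : Derivable f g → Derivable g f
  | trans {m n} {f g h : P.Hom m n} : Derivable f g → Derivable g h → Derivable f h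
  | comp {l m n} {f f' : P.Hom l m} {g g' : P.Hom m n} :
      Derivable f f' → Derivable g g' → Derivable (f ⨾ g) (f' ⨾ g')
  | tensor {m n m' n'} {f f' : P.Hom m n} {g g' : P.Hom m' n'} :
      Derivable f f' → Derivable g g' → Derivable (f ⊠ g) (f' ⊠ g')

/-- Derivability from `E`, as a setoid on each hom-set. -/
def setoid (m n : ℕ) : Setoid (P.Hom m n) :=
  ⟨P.Derivable E, Derivable.refl, Derivable.symm, Derivable.trans⟩

theorem mk_heq_of_heq {m n m' n' : ℕ} (hm : m = m') (hn : n = n') {f : P.Hom m n}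
    {g : P.Hom m' n'} (h : HEq f g) :
    HEq (Quotient.mk (P.setoid E m n) f) (Quotient.mk (P.setoid E m' n') g) := by
  subst hm hn
  rw [eq_of_heq h]

/-- The quotient of a PRO by a set of equations between morphisms of the same arity. -/
def quot : PRO where
  Hom m n := Quotient (P.setoid E m n)
  id n := Quotient.mk _ (P.id n)
  comp := Quotient.map₂ P.comp fun _ _ h _ _ h' => Derivable.comp h h'
  tensor := Quotient.map₂ P.tensor fun _ _ h _ _ h' => Derivable.tensor h h'
  id_comp := by rintro _ _ ⟨f⟩; exact congrArg (Quotient.mk _) (P.id_comp f)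
  comp_id := by rintro _ _ ⟨f⟩; exact congrArg (Quotient.mk _) (P.comp_id f)
  assoc := by rintro _ _ _ _ ⟨f⟩ ⟨g⟩ ⟨h⟩; exact congrArg (Quotient.mk _) (P.assoc f g h)
  tensor_id m n := congrArg (Quotient.mk _) (P.tensor_id m n)
  tensor_comp := by
    rintro _ _ _ _ _ _ ⟨f⟩ ⟨g⟩ ⟨f'⟩ ⟨g'⟩
    exact congrArg (Quotient.mk _) (P.tensor_comp f g f' g')
  tensor_assoc := by
    rintro _ _ _ _ _ _ ⟨f⟩ ⟨g⟩ ⟨h⟩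
    exact P.mk_heq_of_heq E (Nat.add_assoc _ _ _) (Nat.add_assoc _ _ _) (P.tensor_assoc f g h)
  id_zero_tensor := by
    rintro _ _ ⟨f⟩
    exact P.mk_heq_of_heq E (Nat.zero_add _) (Nat.zero_add _) (P.id_zero_tensor f)
  tensor_id_zero := by
    rintro _ _ ⟨f⟩
    exact P.mk_heq_of_heq E (Nat.add_zero _) (Nat.add_zero _) (P.tensor_id_zero f)

/-- The quotient functor. -/
def proj : PROHom P (P.quot E) where
  map f := Quotient.mk _ f
  map_id _ := rfl
  map_comp _ _ := rfl
  map_tensor _ _ := rfl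

end PRO

/-! ## Local fermionic modes -/

/-- The Hilbert space `B^{⊗ n}` of `n` local fermionic modes, where `B = ℂ ⊕ ℂ`: the space with
orthonormal basis `|b₁ … bₙ⟩`, for bit strings `b` of length `n`. -/
abbrev Modes (n : ℕ) : Type := EuclideanSpace ℂ (Fin n → Bool)

namespace Modes

/-- The basis state `|b₁ … bₙ⟩`. -/
noncomputable def ket {n : ℕ} (b : Fin n → Bool) : Modes n := EuclideanSpace.single b 1

/-- The number of occupied modes, modulo 2. -/
def parity {n : ℕ} (b : Fin n → Bool) : ZMod 2 := ∑ i, if b i then 1 else 0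

/-- The even part `H₀` (for `p = 0`) and the odd part `H₁` (for `p = 1`) of `H = B^{⊗ n}`. -/
def part (n : ℕ) (p : ZMod 2) : Submodule ℂ (Modes n) :=
  Submodule.span ℂ (ket '' {b | parity b = p})

/-- The universal bilinear map `B^{⊗ m} × B^{⊗ n} → B^{⊗ (m + n)}`, sending the pair of
`|b₁ … bₘ⟩` and `|c₁ … cₙ⟩` to `|b₁ … bₘ c₁ … cₙ⟩`. -/
noncomputable def tmul (m n : ℕ) : Modes m →ₗ[ℂ] Modes n →ₗ[ℂ] Modes (m + n) :=
  LinearMap.mk₂ ℂ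
    (fun x y => WithLp.toLp 2 fun b =>
      x (fun i => b (Fin.castAdd n i)) * y (fun j => b (Fin.natAdd m j)))
    (fun x x' y => by ext b; simp [add_mul])
    (fun c x y => by ext b; simp [mul_assoc])
    (fun x y y' => by ext b; simp [mul_add])
    (fun c x y => by ext b; simp [mul_left_comm])

@[simp]
theorem tmul_apply {m n : ℕ} (x : Modes m) (y : Modes n) (b : Fin (m + n) → Bool) :
    tmul m n x y b = x (fun i => b (Fin.castAdd n i)) * y (fun j => b (Fin.natAdd m j)) := rfl

theorem ket_apply {n : ℕ} (b c : Fin n → Bool) : ket b c = if c = b then 1 else 0 := by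
  simp [ket]

theorem tmul_ket {m n : ℕ} (b : Fin m → Bool) (c : Fin n → Bool) :
    tmul m n (ket b) (ket c) = ket (Fin.append b c) := by
  ext d
  have h : d = Fin.append b c ↔
      (fun i => d (Fin.castAdd n i)) = b ∧ (fun j => d (Fin.natAdd m j)) = c := by
    constructor
    · rintro rfl; simp
    · rintro ⟨rfl, rfl⟩; exact (Fin.append_castAdd_natAdd).symm
  rw [tmul_apply, ket_apply, ket_apply, ket_apply]
  simp only [h]
  split_ifs <;> simp_all

theorem ket_eq_tmul {m n : ℕ} (b : Fin (m + n) → Bool) :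
    ket b = tmul m n (ket fun i => b (Fin.castAdd n i)) (ket fun j => b (Fin.natAdd m j)) := by
  rw [tmul_ket, Fin.append_castAdd_natAdd]

/-- The basis of basis states. -/
noncomputable def basis (n : ℕ) : Module.Basis (Fin n → Bool) ℂ (Modes n) :=
  (EuclideanSpace.basisFun (Fin n → Bool) ℂ).toBasis

@[simp]
theorem basis_apply {n : ℕ} (b : Fin n → Bool) : basis n b = ket b := by
  simp [basis, ket]

/-- `B^{⊗ (m + n)}` is the tensor product of `B^{⊗ m}` and `B^{⊗ n}`. -/
theorem isTensorProduct_tmul (m n : ℕ) : IsTensorProduct (tmul m n) := by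
  let e : TensorProduct ℂ (Modes m) (Modes n) ≃ₗ[ℂ] Modes (m + n) :=
    ((basis m).tensorProduct (basis n)).equiv (basis (m + n)) (Fin.appendEquiv m n)
  have he : TensorProduct.lift (tmul m n) = e.toLinearMap := by
    refine ((basis m).tensorProduct (basis n)).ext fun ⟨b, c⟩ => ?_
    have h1 : e (((basis m).tensorProduct (basis n)) (b, c)) = ket (Fin.append b c) := by
      rw [Module.Basis.equiv_apply, basis_apply]; rfl
    rw [LinearEquiv.coe_coe, h1, Module.Basis.tensorProduct_apply]
    simp [tmul_ket]
  unfold IsTensorProduct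
  rw [he]
  exact e.bijective

/-- The tensor product of two linear maps. -/
noncomputable def tensorMap {m n m' n' : ℕ} (f : Modes m →ₗ[ℂ] Modes n)
    (g : Modes m' →ₗ[ℂ] Modes n') : Modes (m + m') →ₗ[ℂ] Modes (n + n') :=
  (isTensorProduct_tmul m m').map (isTensorProduct_tmul n n') f g

theorem tensorMap_tmul {m n m' n' : ℕ} (f : Modes m →ₗ[ℂ] Modes n)
    (g : Modes m' →ₗ[ℂ] Modes n') (x : Modes m) (y : Modes m') :
    tensorMap f g (tmul m m' x y) = tmul n n' (f x) (g y) :=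
  IsTensorProduct.map_eq _ _ f g x y

theorem tensorMap_ket_apply {m n m' n' : ℕ} (f : Modes m →ₗ[ℂ] Modes n)
    (g : Modes m' →ₗ[ℂ] Modes n') (b : Fin (m + m') → Bool) (c : Fin (n + n') → Bool) :
    tensorMap f g (ket b) c =
      f (ket fun i => b (Fin.castAdd m' i)) (fun i => c (Fin.castAdd n' i)) *
      g (ket fun i => b (Fin.natAdd m i)) (fun i => c (Fin.natAdd n i)) := by
  rw [ket_eq_tmul, tensorMap_tmul, tmul_apply]

theorem hom_ext {m n : ℕ} {f g : Modes m →ₗ[ℂ] Modes n} (h : ∀ b, f (ket b) = g (ket b)) :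
    f = g :=
  (basis m).ext fun b => by simpa using h b

/-- `f` has degree 0 if it is an even map, that is, `f(H₀) ⊆ K₀` and `f(H₁) ⊆ K₁`, and degree 1
if it is an odd map, that is, `f(H₀) ⊆ K₁` and `f(H₁) ⊆ K₀`. -/
def HasDegree {m n : ℕ} (f : Modes m →ₗ[ℂ] Modes n) (e : ZMod 2) : Prop :=
  ∀ p, ∀ x ∈ part m p, f x ∈ part n (p + e)

/-- A pure map is a linear map that is either even or odd. (Boundedness is automatic, as the spaces
have finite dimension.) -/
def IsPure {m n : ℕ} (f : Modes m →ₗ[ℂ] Modes n) : Prop :=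
  HasDegree f 0 ∨ HasDegree f 1

theorem ket_mem_part {n : ℕ} {b : Fin n → Bool} {p : ZMod 2} (h : parity b = p) :
    ket b ∈ part n p :=
  Submodule.subset_span ⟨b, h, rfl⟩

theorem hasDegree_iff {m n : ℕ} (f : Modes m →ₗ[ℂ] Modes n) (e : ZMod 2) :
    HasDegree f e ↔ ∀ b, f (ket b) ∈ part n (parity b + e) := by
  refine ⟨fun h b => h _ _ (ket_mem_part rfl), fun h p x hx => ?_⟩
  have : part m p ≤ (part n (p + e)).comap f := by
    refine Submodule.span_le.2 ?_
    rintro _ ⟨b, rfl, rfl⟩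
    exact h b
  exact this hx

theorem isPure_iff {m n : ℕ} (f : Modes m →ₗ[ℂ] Modes n) : IsPure f ↔ ∃ e, HasDegree f e := by
  refine ⟨fun h => h.elim (fun h => ⟨0, h⟩) fun h => ⟨1, h⟩, fun ⟨e, h⟩ => ?_⟩
  fin_cases e
  exacts [Or.inl h, Or.inr h]

theorem parity_append {m n : ℕ} (b : Fin m → Bool) (c : Fin n → Bool) :
    parity (Fin.append b c) = parity b + parity c := by
  simp only [parity, Fin.sum_univ_add, Fin.append_left, Fin.append_right]

theorem tmul_mem_part {m n : ℕ} {p q : ZMod 2} {x : Modes m} {y : Modes n} (hx : x ∈ part m p)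
    (hy : y ∈ part n q) : tmul m n x y ∈ part (m + n) (p + q) := by
  have h := Submodule.apply_mem_map₂ (tmul m n) hx hy
  rw [part, part, Submodule.map₂_span_span] at h
  refine Submodule.span_mono ?_ h
  rintro _ ⟨_, ⟨b, rfl, rfl⟩, _, ⟨c, rfl, rfl⟩, rfl⟩
  exact ⟨Fin.append b c, parity_append b c, (tmul_ket b c).symm⟩

theorem isPure_id (n : ℕ) : IsPure (LinearMap.id : Modes n →ₗ[ℂ] Modes n) :=
  Or.inl fun p x hx => by simpa using hx

theorem IsPure.comp {l m n : ℕ} {f : Modes l →ₗ[ℂ] Modes m} {g : Modes m →ₗ[ℂ] Modes n}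
    (hf : IsPure f) (hg : IsPure g) : IsPure (g ∘ₗ f) := by
  rw [isPure_iff] at *
  obtain ⟨d, hd⟩ := hf
  obtain ⟨e, he⟩ := hg
  exact ⟨d + e, fun p x hx => by rw [← add_assoc]; exact he _ _ (hd _ _ hx)⟩

theorem IsPure.tensorMap {m n m' n' : ℕ} {f : Modes m →ₗ[ℂ] Modes n}
    {g : Modes m' →ₗ[ℂ] Modes n'} (hf : IsPure f) (hg : IsPure g) : IsPure (tensorMap f g) := by
  rw [isPure_iff] at *
  obtain ⟨d, hd⟩ := hf
  obtain ⟨e, he⟩ := hg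
  refine ⟨d + e, (hasDegree_iff _ _).2 fun b => ?_⟩
  rw [ket_eq_tmul, tensorMap_tmul]
  have hb : parity b + (d + e) = (parity (fun i => b (Fin.castAdd m' i)) + d) +
      (parity (fun j => b (Fin.natAdd m j)) + e) := by
    conv_lhs => rw [← Fin.append_castAdd_natAdd (f := b), parity_append]
    ring
  rw [hb]
  exact tmul_mem_part (hd _ _ (ket_mem_part rfl)) (he _ _ (ket_mem_part rfl))

/-- The linear map with prescribed values on the basis states. -/
noncomputable def ofKets {m n : ℕ} (v : (Fin m → Bool) → Modes n) : Modes m →ₗ[ℂ] Modes n :=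
  (basis m).constr ℂ v

@[simp]
theorem ofKets_ket {m n : ℕ} (v : (Fin m → Bool) → Modes n) (b : Fin m → Bool) :
    ofKets v (ket b) = v b := by
  rw [ofKets, ← basis_apply, Module.Basis.constr_basis]

theorem isPure_ofKets {m n : ℕ} {v : (Fin m → Bool) → Modes n} (e : ZMod 2)
    (h : ∀ b, v b ∈ part n (parity b + e)) : IsPure (ofKets v) :=
  (isPure_iff _).2 ⟨e, (hasDegree_iff _ _).2 fun b => by simpa using h b⟩

theorem pureHom_heq {m n m' n' : ℕ} (hm : m = m') (hn : n = n')
    (f : {f : Modes m →ₗ[ℂ] Modes n // IsPure f}) (g : {f : Modes m' →ₗ[ℂ] Modes n' // IsPure f})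
    (h : ∀ b c, f.1 (ket b) c = g.1 (ket fun i => b (Fin.cast hm.symm i))
      (fun i => c (Fin.cast hn.symm i))) : HEq f g := by
  subst hm hn
  refine heq_of_eq (Subtype.ext (hom_ext fun b => ?_))
  ext c
  exact h b c

end Modes

open Modes in
/-- The monoidal category `LFM` of systems of finitely many local fermionic modes and pure maps,
with the tensor product as monoidal product; the object `n` is `B^{⊗ n}`. -/
noncomputable def LFM : PRO where
  Hom m n := {f : Modes m →ₗ[ℂ] Modes n // IsPure f}
  id n := ⟨LinearMap.id, isPure_id n⟩
  comp f g := ⟨g.1 ∘ₗ f.1, f.2.comp g.2⟩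
  tensor f g := ⟨tensorMap f.1 g.1, f.2.tensorMap g.2⟩
  id_comp _ := rfl
  comp_id _ := rfl
  assoc _ _ _ := rfl
  tensor_id _ _ := Subtype.ext (IsTensorProduct.map_id _)
  tensor_comp _ _ _ _ := Subtype.ext (IsTensorProduct.map_comp _ _ _ _ _ _ _)
  tensor_assoc {m n m' n' m'' n''} f g h := by
    refine pureHom_heq (Nat.add_assoc _ _ _) (Nat.add_assoc _ _ _) _ _ fun b c => ?_
    simp only [tensorMap_ket_apply, mul_assoc]
    have hb (i) : Fin.cast (Nat.add_assoc m m' m'').symm (Fin.natAdd m (Fin.natAdd m' i)) =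
        Fin.natAdd (m + m') i := Fin.ext (Nat.add_assoc _ _ _).symm
    have hc (i) : Fin.cast (Nat.add_assoc n n' n'').symm (Fin.natAdd n (Fin.natAdd n' i)) =
        Fin.natAdd (n + n') i := Fin.ext (Nat.add_assoc _ _ _).symm
    simp only [hb, hc]
    rfl
  id_zero_tensor {m n} f := by
    refine pureHom_heq (Nat.zero_add _) (Nat.zero_add _) _ _ fun b c => ?_
    simp only [tensorMap_ket_apply, LinearMap.id_coe, id_eq]
    rw [Subsingleton.elim (fun i : Fin 0 => c (Fin.castAdd n i)) fun i => b (Fin.castAdd m i)]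
    have hb (i) : Fin.cast (Nat.zero_add m).symm i = Fin.natAdd 0 i := Fin.ext (by simp)
    have hc (i) : Fin.cast (Nat.zero_add n).symm i = Fin.natAdd 0 i := Fin.ext (by simp)
    simp only [ket_apply, if_true, one_mul, hb, hc]
  tensor_id_zero {m n} f := by
    refine pureHom_heq (Nat.add_zero _) (Nat.add_zero _) _ _ fun b c => ?_
    simp only [tensorMap_ket_apply, LinearMap.id_coe, id_eq]
    rw [Subsingleton.elim (fun i : Fin 0 => c (Fin.natAdd n i)) fun i => b (Fin.natAdd m i)]
    simp only [ket_apply, if_true, mul_one]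
    rfl

/-! ## The fermionic ZW calculus -/

/-- The monoidal signature of the fermionic ZW calculus. -/
inductive ZWSig : ℕ → ℕ → Type
  | swap : ZWSig 2 2
  | dual : ZWSig 0 2
  | dualDag : ZWSig 2 0
  | fswap : ZWSig 2 2
  | black₂ : ZWSig 0 2
  | black₃ : ZWSig 0 3
  | white (z : ℂ) : ZWSig 0 2

/-- The language of the fermionic ZW calculus. -/
abbrev ZW : PRO := freePRO ZWSig

namespace ZW

open Modes in
/-- The interpretation of the operations of the fermionic ZW calculus as pure maps. -/
noncomputable def interpGen : ∀ {m n}, ZWSig m n → LFM.Hom m n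
  | _, _, .swap => ⟨ofKets fun b => ket ![b 1, b 0],
      isPure_ofKets 0 fun b => ket_mem_part (by revert b; decide)⟩
  | _, _, .dual => ⟨ofKets fun _ => ket ![false, false] + ket ![true, true],
      isPure_ofKets 0 fun b => add_mem (ket_mem_part (by revert b; decide))
        (ket_mem_part (by revert b; decide))⟩
  | _, _, .dualDag => ⟨ofKets fun b => if b 0 = b 1 then ket ![] else 0,
      isPure_ofKets 0 fun b => by
        split_ifs with h
        · exact ket_mem_part (by revert b; decide)
        · exact zero_mem _⟩
  | _, _, .fswap => ⟨ofKets fun b => (if b 0 ∧ b 1 then -1 else 1 : ℂ) • ket ![b 1, b 0],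
      isPure_ofKets 0 fun b => Submodule.smul_mem _ _ (ket_mem_part (by revert b; decide))⟩
  | _, _, .black₂ => ⟨ofKets fun _ => ket ![true, false] + ket ![false, true],
      isPure_ofKets 1 fun b => add_mem (ket_mem_part (by revert b; decide))
        (ket_mem_part (by revert b; decide))⟩
  | _, _, .black₃ => ⟨ofKets fun _ =>
        ket ![true, false, false] + ket ![false, true, false] + ket ![false, false, true],
      isPure_ofKets 1 fun b => add_mem (add_mem (ket_mem_part (by revert b; decide))
        (ket_mem_part (by revert b; decide))) (ket_mem_part (by revert b; decide))⟩
  | _, _, .white z => ⟨ofKets fun _ => ket ![false, false] + z • ket ![true, true],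
      isPure_ofKets 0 fun b => add_mem (ket_mem_part (by revert b; decide))
        (Submodule.smul_mem _ _ (ket_mem_part (by revert b; decide)))⟩

/-- The interpretation functor from the language of the fermionic ZW calculus to `LFM`. -/
noncomputable def interp : PROHom ZW LFM := freePRO.lift LFM interpGen

/-! ### Diagrams

Diagrams are read from bottom to top: inputs are at the bottom and outputs at the top. -/

def swap : ZW.Hom 2 2 := freePRO.gen .swap

def dual : ZW.Hom 0 2 := freePRO.gen .dual

def dualDag : ZW.Hom 2 0 := freePRO.gen .dualDag

def fswap : ZW.Hom 2 2 := freePRO.gen .fswap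

def black₂ : ZW.Hom 0 2 := freePRO.gen .black₂

def black₃ : ZW.Hom 0 3 := freePRO.gen .black₃

def white (z : ℂ) : ZW.Hom 0 2 := freePRO.gen (.white z)

/-- A single wire. -/
def wire : ZW.Hom 1 1 := ZW.id 1

/-- The empty diagram. -/
def empty : ZW.Hom 0 0 := ZW.id 0

/-- The binary black vertex with one input and one output (the left leg is bent down). -/
def not : ZW.Hom 1 1 := (wire ⊠ black₂) ⨾ (dualDag ⊠ wire)

/-- The ternary black vertex with one input and two outputs (the left leg is bent down). -/
def split : ZW.Hom 1 2 := (wire ⊠ black₃) ⨾ (dualDag ⊠ wire ⊠ wire)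

/-- The ternary black vertex with two inputs and one output (the two left legs are bent down, to
the left). -/
def merge : ZW.Hom 2 1 := (wire ⊠ split) ⨾ (dualDag ⊠ wire)

/-- The binary white vertex with one input and one output. -/
def phase (z : ℂ) : ZW.Hom 1 1 := (wire ⊠ white z) ⨾ (dualDag ⊠ wire)

/-- The binary white vertex with two inputs. -/
def phaseDag (z : ℂ) : ZW.Hom 2 0 := (wire ⊠ phase z) ⨾ dualDag

/-- The projector, or quaternary white vertex with two inputs and two outputs: a loop around the
two wires, with a binary black vertex at its left and right, and a binary white vertex with
parameter `1/2` at its bottom and top (both between the two wires); the bottom of the loop crosses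
each wire by a fermionic swap, and the top by a structural swap. -/
noncomputable def projector : ZW.Hom 2 2 :=
  (wire ⊠ white (1 / 2) ⊠ wire) ⨾ (fswap ⊠ fswap) ⨾ (not ⊠ wire ⊠ wire ⊠ not) ⨾
    (swap ⊠ swap) ⨾ (wire ⊠ phaseDag (1 / 2) ⊠ wire)

/-- A wire with a fermionic self-crossing. -/
def curl : ZW.Hom 1 1 := (dual ⊠ wire) ⨾ (wire ⊠ fswap) ⨾ (dualDag ⊠ wire)

/-- The axioms of the fermionic ZW calculus. -/
inductive Ax : ∀ m n, ZW.Hom m n → ZW.Hom m n → Prop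
  -- Structural axioms.
  | dual_snake : Ax 1 1 ((wire ⊠ dual) ⨾ (dualDag ⊠ wire)) wire
  | dual_swap : Ax 0 2 (dual ⨾ swap) dual
  | swap_swap : Ax 2 2 (swap ⨾ swap) (wire ⊠ wire)
  | swap_slide : Ax 3 3
      ((swap ⊠ wire) ⨾ (wire ⊠ swap) ⨾ (swap ⊠ wire))
      ((wire ⊠ swap) ⨾ (swap ⊠ wire) ⨾ (wire ⊠ swap))
  | dual_slide : Ax 1 3 ((dual ⊠ wire) ⨾ (wire ⊠ swap) ⨾ (swap ⊠ wire)) (wire ⊠ dual)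
  | dualDag_slide : Ax 3 1 (dualDag ⊠ wire) ((wire ⊠ swap) ⨾ (swap ⊠ wire) ⨾ (wire ⊠ dualDag))
  | black₂_slide : Ax 1 3 ((black₂ ⊠ wire) ⨾ (wire ⊠ swap) ⨾ (swap ⊠ wire)) (wire ⊠ black₂)
  | black₃_slide : Ax 1 4
      ((black₃ ⊠ wire) ⨾ (wire ⊠ wire ⊠ swap) ⨾ (wire ⊠ swap ⊠ wire) ⨾ (swap ⊠ wire ⊠ wire))
      (wire ⊠ black₃)
  | white_slide (z : ℂ) : Ax 1 3
      ((white z ⊠ wire) ⨾ (wire ⊠ swap) ⨾ (swap ⊠ wire)) (wire ⊠ white z)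
  | fswap_slide : Ax 3 3
      ((fswap ⊠ wire) ⨾ (wire ⊠ swap) ⨾ (swap ⊠ wire))
      ((wire ⊠ swap) ⨾ (swap ⊠ wire) ⨾ (wire ⊠ fswap))
  -- Axioms for the fermionic swap.
  | fswap_fswap : Ax 2 2 (fswap ⨾ fswap) (wire ⊠ wire)
  | fswap_fslide : Ax 3 3
      ((fswap ⊠ wire) ⨾ (wire ⊠ fswap) ⨾ (fswap ⊠ wire))
      ((wire ⊠ fswap) ⨾ (fswap ⊠ wire) ⨾ (wire ⊠ fswap))
  | dual_fslide : Ax 1 3 ((dual ⊠ wire) ⨾ (wire ⊠ fswap) ⨾ (fswap ⊠ wire)) (wire ⊠ dual)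
  | dualDag_fslide : Ax 3 1
      (dualDag ⊠ wire) ((wire ⊠ fswap) ⨾ (fswap ⊠ wire) ⨾ (wire ⊠ dualDag))
  | fswap_swap : Ax 2 2 (fswap ⨾ swap) (swap ⨾ fswap)
  | swap_fslide : Ax 3 3
      ((swap ⊠ wire) ⨾ (wire ⊠ fswap) ⨾ (fswap ⊠ wire))
      ((wire ⊠ fswap) ⨾ (fswap ⊠ wire) ⨾ (wire ⊠ swap))
  | black₂_fslide : Ax 1 3 ((black₂ ⊠ wire) ⨾ (wire ⊠ fswap) ⨾ (fswap ⊠ wire)) (curl ⊠ black₂)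
  | black₃_fslide : Ax 1 4
      ((black₃ ⊠ wire) ⨾ (wire ⊠ wire ⊠ fswap) ⨾ (wire ⊠ fswap ⊠ wire) ⨾ (fswap ⊠ wire ⊠ wire))
      (curl ⊠ black₃)
  | white_fslide (z : ℂ) : Ax 1 3
      ((white z ⊠ wire) ⨾ (wire ⊠ fswap) ⨾ (fswap ⊠ wire)) (wire ⊠ white z)
  -- Axioms for black vertices.
  | black₂_swap : Ax 0 2 (black₂ ⨾ swap) black₂
  | black₃_swap_left : Ax 0 3 (black₃ ⨾ (swap ⊠ wire)) black₃
  | black₃_swap_right : Ax 0 3 (black₃ ⨾ (wire ⊠ swap)) black₃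
  | black₃_fswap : Ax 0 3 (black₃ ⨾ (wire ⊠ swap)) (black₃ ⨾ (wire ⊠ fswap))
  | not_not : Ax 1 1 (not ⨾ not) wire
  | black_coassoc : Ax 1 3
      (not ⨾ split ⨾ ((not ⨾ split) ⊠ wire)) (not ⨾ split ⨾ (wire ⊠ (not ⨾ split)))
  | black_counit : Ax 1 1 (not ⨾ split ⨾ ((not ⨾ split ⨾ dualDag) ⊠ wire)) wire
  | black_bialgebra : Ax 2 2
      (((not ⨾ split) ⊠ (not ⨾ split)) ⨾ (wire ⊠ fswap ⊠ wire) ⨾ ((merge ⨾ not) ⊠ (merge ⨾ not)))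
      (merge ⨾ not ⨾ not ⨾ split)
  | black_unit_copy : Ax 0 2
      ((dual ⨾ merge ⨾ not) ⊠ (dual ⨾ merge ⨾ not)) (dual ⨾ merge ⨾ not ⨾ not ⨾ split)
  | black_unit_counit : Ax 0 0 empty (dual ⨾ merge ⨾ not ⨾ not ⨾ split ⨾ dualDag)
  | black_zero : Ax 0 0
      ((dual ⨾ merge ⨾ not ⨾ split ⨾ dualDag) ⊠ (dual ⨾ merge ⨾ not ⨾ split ⨾ dualDag))
      (dual ⨾ merge ⨾ not ⨾ split ⨾ dualDag)
  -- Axioms for white vertices.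
  | white_swap (z : ℂ) : Ax 0 2 (white z ⨾ swap) (white z)
  | phase_split (z : ℂ) : Ax 1 2
      (not ⨾ split ⨾ (phase z ⊠ phase z)) (phase z ⨾ not ⨾ split)
  | phase_counit (z : ℂ) : Ax 1 0 (not ⨾ split ⨾ dualDag) (phase z ⨾ not ⨾ split ⨾ dualDag)
  | phase_one : Ax 1 1 (phase 1) wire
  | phase_zero : Ax 1 1 (phase 0) (not ⨾ split ⨾ dualDag ⨾ dual ⨾ merge ⨾ not)
  | phase_add (z w : ℂ) : Ax 1 1
      (not ⨾ split ⨾ (phase z ⊠ phase w) ⨾ merge ⨾ not) (phase (z + w))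
  | phase_mul (z w : ℂ) : Ax 1 1 (phase z ⨾ phase w) (phase (z * w))
  | projector_rotate : Ax 2 2
      projector
      ((wire ⊠ wire ⊠ dual) ⨾ (wire ⊠ projector ⊠ wire) ⨾ (dualDag ⊠ wire ⊠ wire))
  | projector_split : Ax 2 3
      (((not ⨾ split) ⊠ (not ⨾ split)) ⨾ (wire ⊠ swap ⊠ wire) ⨾ (projector ⊠ projector) ⨾
        (wire ⊠ swap ⊠ wire) ⨾ ((merge ⨾ not) ⊠ wire ⊠ wire))
      (projector ⨾ (wire ⊠ (not ⨾ split)))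

end ZW

/-- The PRO of diagrams of the fermionic ZW calculus modulo its axioms. -/
abbrev ZWModAx : PRO := PRO.quot ZW ZW.Ax

/-- The quotient functor from diagrams to diagrams modulo the axioms. -/
abbrev ZW.toModAx : PROHom ZW ZWModAx := PRO.proj ZW ZW.Ax

open CategoryTheory MonoidalCategory

/-! The functor `fE` is the identity on objects, so it is an equivalence as soon as it is bijective
on hom-sets. A cup and a cap bend inputs into outputs (`PROHom.bijective_of_states`), hence it
suffices to treat states `0 → n`. Soundness is a finite computation for each axiom: both sides are
evaluated on basis states, with coefficients that are polynomials in the parameters.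

The normal form for states is that of fermionic Fock space: every odd vector is a linear combination
of products of an odd number of creation operators applied to the vacuum, and such a product may be
sorted at the cost of a sign. This is imitated inside the calculus. An odd operator `A` is presented
by a diagram `K : n + 1 → n` whose last input is a control: nothing happens for the control `|0⟩`,
and `A` is applied for `|1⟩`. Thus `K` behaves like `1 + θA` with a Grassmann variable `θ`. Diagrams
placed on the controls provide the sum (`addO`), the multiples (`smulO`) and the product of three
operators (`triO`; three, because the result has to be odd again). The fermionic bialgebra law and
its analogues show that all operators generated by the creation operators commute up to a crossing
of their controls (`IsOp.com`), that they satisfy the laws of a vector space, and that words in the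
creation operators are antisymmetric (`word_swap`).

Let `W` be the class of states obtained from combinations of sorted words. It is closed under
fermionic swaps, white vertices, merging of wires, two cups with a controlled sign, and the effect
that asks two wires to be occupied. Caps are made from these operations (`cap_eq`), and then
structural swaps (`sw_eq`). Even states are treated by adding a wire in the state `|1⟩`, which leads
to the class `Good`; black vertices are made from `|1⟩` and `dl`. So every state is good (`good`).
The coefficients of sorted words are the coordinates of the interpreted vector, so an element of `W`
is determined by its vector (`W.injective`). The two parities meet only in the vector 0, for which
`stt_zeroO_k1` provides the missing identification. As every vector of definite parity comes from
such a state, the functor is bijective on states.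

The numerous identities between small diagrams are proved by reflection. The structural axioms imply
that a diagram depends only on its net: the collection of its vertices together with the way in
which their legs are joined. The coherence result behind this is `Mt.pull`: capping the equally
labelled wires of a stack does not depend on the order of the caps. Hence nets may be renamed
(`E_map`), their lines contracted (`E_line`), and subnets replaced (`E_replace`). A derivation is a
list of rules, executed and checked by evaluation (`Rule.sound_of_derives`, `dval_eq_of_proves`). -/

namespace PRO
variable {P : PRO}

/-! ### Composites with idle wires in a PRO -/

theorem comp_heq {l m n l' m' n' : ℕ} (hl : l = l') (hm : m = m') (hn : n = n')
    {f : P.Hom l m} {g : P.Hom m n} {f' : P.Hom l' m'} {g' : P.Hom m' n'}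
    (hf : HEq f f') (hg : HEq g g') : HEq (f ⨾ g) (f' ⨾ g') := by
  subst hl hm hn
  rw [eq_of_heq hf, eq_of_heq hg]

theorem tensor_heq {a b c d a' b' c' d' : ℕ} (ha : a = a') (hb : b = b') (hc : c = c')
    (hd : d = d') {f : P.Hom a b} {g : P.Hom c d} {f' : P.Hom a' b'} {g' : P.Hom c' d'}
    (hf : HEq f f') (hg : HEq g g') : HEq (f ⊠ g) (f' ⊠ g') := by
  subst ha hb hc hd
  rw [eq_of_heq hf, eq_of_heq hg]

theorem id_heq {m n : ℕ} (h : m = n) : HEq (P.id m) (P.id n) := by subst h; rfl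

/-- `g` acting on the rightmost wires, with `n` idle wires on its left. -/
def T (n : ℕ) {a b : ℕ} (g : P.Hom a b) : P.Hom (n + a) (n + b) := P.id n ⊠ g

/-- `h` with an idle wire on its right. -/
def U {m n : ℕ} (h : P.Hom m n) : P.Hom (m + 1) (n + 1) := h ⊠ P.id 1

theorem T_comp (n : ℕ) {a b c : ℕ} (f : P.Hom a b) (g : P.Hom b c) :
    T n (f ⨾ g) = T n f ⨾ T n g := by
  unfold T
  rw [← P.tensor_comp, P.id_comp]

theorem U_comp {a b c : ℕ} (f : P.Hom a b) (g : P.Hom b c) : U (f ⨾ g) = U f ⨾ U g := by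
  unfold U
  rw [← P.tensor_comp, P.id_comp]

theorem T_id (n a : ℕ) : T n (P.id a) = P.id (n + a) := P.tensor_id n a

theorem U_id (a : ℕ) : U (P.id a) = P.id (a + 1) := P.tensor_id a 1

theorem T_zero_heq {a b : ℕ} (f : P.Hom a b) : HEq (T 0 f) f := P.id_zero_tensor f

theorem T_U (n : ℕ) {a b : ℕ} (g : P.Hom a b) : T n (U g) = U (T n g) :=
  (eq_of_heq (P.tensor_assoc (P.id n) g (P.id 1))).symm

theorem T_T_heq (n k : ℕ) {a b : ℕ} (g : P.Hom a b) : HEq (T n (T k g)) (T (n + k) g) := by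
  refine (P.tensor_assoc (P.id n) (P.id k) g).symm.trans ?_
  rw [P.tensor_id]; rfl

theorem tensor_id_zero_eq {m n : ℕ} (h : P.Hom m n) : (h ⊠ P.id 0) = h :=
  eq_of_heq (P.tensor_id_zero h)

theorem tensor_id_succ {m n : ℕ} (h : P.Hom m n) (k : ℕ) :
    P.tensor h (P.id (k + 1)) = U (h ⊠ P.id k) := by
  refine eq_of_heq (HEq.trans ?_ (P.tensor_assoc h (P.id k) (P.id 1)).symm)
  rw [P.tensor_id]

theorem tensor_eq_comp {m n a b : ℕ} (f : P.Hom m n) (g : P.Hom a b) :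
    (f ⊠ g) = (f ⊠ P.id a) ⨾ T n g := by
  unfold T
  rw [← P.tensor_comp, P.id_comp, P.comp_id]

theorem interchange {m n a b : ℕ} (f : P.Hom m n) (g : P.Hom a b) :
    (f ⊠ P.id a) ⨾ T n g = T m g ⨾ (f ⊠ P.id b) := by
  unfold T
  rw [← P.tensor_comp, ← P.tensor_comp, P.id_comp, P.comp_id, P.id_comp, P.comp_id]

/-- `h` with `k` idle wires on its right. -/
def V {m n : ℕ} (h : P.Hom m n) : ∀ k, P.Hom (m + k) (n + k)
  | 0 => h
  | k + 1 => U (V h k)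

theorem V_eq {m n : ℕ} (h : P.Hom m n) (k : ℕ) : V h k = (h ⊠ P.id k) := by
  induction k with
  | zero => exact (tensor_id_zero_eq h).symm
  | succ k ih => rw [tensor_id_succ, V, ih]

theorem V_T {m n a b : ℕ} (f : P.Hom m n) (g : P.Hom a b) :
    V f a ⨾ T n g = T m g ⨾ V f b := by rw [V_eq, V_eq, interchange]

theorem tensor_eq_V {m n a b : ℕ} (f : P.Hom m n) (g : P.Hom a b) :
    (f ⊠ g) = V f a ⨾ T n g := by rw [V_eq, tensor_eq_comp]

theorem V_comp {a b c : ℕ} (f : P.Hom a b) (g : P.Hom b c) (k : ℕ) :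
    V (f ⨾ g) k = V f k ⨾ V g k := by
  induction k with
  | zero => rfl
  | succ k ih => rw [V, ih, U_comp]; rfl

/-! ### Moving a wire with a swap -/

/-- The rightmost wire moved to the left of `n` wires by repeated use of `s`. -/
def X (s : P.Hom 2 2) (a : ℕ) : ∀ n, P.Hom (a + n + 1) (a + 1 + n)
  | 0 => P.id (a + 1)
  | n + 1 => P.comp (l := a + (n + 1) + 1) (n := a + 1 + (n + 1)) (T (a + n) s) (U (X s a n))

theorem X_add_heq (s : P.Hom 2 2) (a n : ℕ) : ∀ k,
    HEq (X s a (n + k)) (P.comp (l := a + n + k + 1) (X s (a + n) k) (V (X s a n) k))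
  | 0 => by
    show HEq (X s a n) (P.comp (P.id (a + n + 1)) (X s a n))
    rw [P.id_comp]
  | k + 1 => by
    show HEq ((T (a + (n + k)) s) ⨾ (U (X s a (n + k))))
      (((T (a + n + k) s) ⨾ (U (X s (a + n) k))) ⨾ (U (V (X s a n) k)))
    rw [P.assoc, ← U_comp]
    have h : a + (n + k) = a + n + k := (Nat.add_assoc _ _ _).symm
    refine comp_heq (by omega) (by omega) (by omega) ?_ ?_
    · rw [h]
    · exact tensor_heq (by omega) (by omega) rfl rfl (X_add_heq s a n k) HEq.rfl

theorem V_X {m n : ℕ} (s : P.Hom 2 2) (h : P.Hom m n) : ∀ k,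
    U (V h k) ⨾ X s n k = X s m k ⨾ V (U h) k
  | 0 => by
    show U h ⨾ P.id (n + 1) = P.id (m + 1) ⨾ U h
    rw [P.id_comp, P.comp_id]
  | k + 1 => by
    have e : P.comp (l := m + k + 2) (V (V h k) 2) (T (n + k) s) =
      P.comp (T (m + k) s) (V (V h k) 2) := V_T _ _
    show P.comp (l := m + k + 1 + 1) (V (V h k) 2) ((T (n + k) s) ⨾ (U (X s n k))) =
      ((T (m + k) s) ⨾ (U (X s m k))) ⨾ (U (V (U h) k))
    rw [← P.assoc]
    refine (congrArg (fun t => P.comp t (U (X s n k))) e).trans ?_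
    rw [P.assoc, P.assoc, ← U_comp, ← V_X s h k, U_comp]
    rfl

/-- `f` can be slid through a wire crossing by `s`. -/
def Slides (s : P.Hom 2 2) {m n : ℕ} (f : P.Hom m n) : Prop :=
  ∀ a, U (T a f) ⨾ X s a n = X s a m ⨾ T (a + 1) f

variable {s : P.Hom 2 2}

theorem Slides.id (n : ℕ) : Slides s (P.id n) := fun a => by
  rw [T_id, T_id, U_id, P.id_comp, P.comp_id]

theorem Slides.comp {l m n : ℕ} {f : P.Hom l m} {g : P.Hom m n} (hf : Slides s f)
    (hg : Slides s g) : Slides s (f ⨾ g) := fun a => by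
  rw [T_comp, T_comp, U_comp, P.assoc, hg, ← P.assoc, hf, P.assoc]

theorem Slides.tensor {m n m' n' : ℕ} {f : P.Hom m n} {g : P.Hom m' n'} (hf : Slides s f)
    (hg : Slides s g) : Slides s (f ⊠ g) := fun a => by
  have key : ∀ b, HEq (T b (f ⊠ g)) (V (T b f) m' ⨾ T (b + n) g) := fun b => by
    rw [← tensor_eq_V]
    exact (P.tensor_assoc (P.id b) f g).symm
  -- The moving wire crosses the outputs of `g` and then those of `f`, and each factor slides past
  -- its own half of this motion.
  have e : P.comp (l := a + m + m' + 1) (U (V (T a f) m' ⨾ T (a + n) g))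
      (X s (a + n) n' ⨾ V (X s a n) n') =
      (X s (a + m) m' ⨾ V (X s a m) m') ⨾ (V (T (a + 1) f) m' ⨾ T (a + 1 + n) g) := by
    have h1 : P.comp (l := a + n + m' + 1) (U (T (a + n) g)) (X s (a + n) n' ⨾ V (X s a n) n') =
        X s (a + n) m' ⨾ (V (X s a n) m' ⨾ T (a + 1 + n) g) := by
      rw [← P.assoc, hg, P.assoc, V_T]
    rw [U_comp, P.assoc, h1, ← P.assoc, V_X, P.assoc, P.assoc]
    congr 1
    rw [← P.assoc, ← P.assoc, ← V_comp, ← V_comp, hf]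
  refine eq_of_heq (HEq.trans ?_ ((heq_of_eq e).trans ?_))
  · refine comp_heq (by omega) (by omega) (by omega) ?_ (X_add_heq s a n n')
    exact tensor_heq (by omega) (by omega) rfl rfl (key a) HEq.rfl
  · exact (comp_heq (by omega) (by omega) (by omega) (X_add_heq s a m m') (key (a + 1))).symm

/-- In the presence of an involutive swap, `X` is invertible. -/
def X' (s : P.Hom 2 2) (a : ℕ) : ∀ n, P.Hom (a + 1 + n) (a + n + 1)
  | 0 => P.id (a + 1)
  | n + 1 => P.comp (l := a + 1 + (n + 1)) (n := a + (n + 1) + 1) (U (X' s a n)) (T (a + n) s)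

theorem X_X' (hs : s ⨾ s = P.id 2) (a : ℕ) : ∀ n, X s a n ⨾ X' s a n = P.id (a + n + 1)
  | 0 => P.id_comp _
  | n + 1 => by
    show ((T (a + n) s) ⨾ (U (X s a n))) ⨾ ((U (X' s a n)) ⨾ (T (a + n) s)) = P.id (a + n + 1 + 1)
    rw [P.assoc, ← P.assoc (U (X s a n)), ← U_comp, X_X' hs a n, U_id]
    have := P.id_comp (T (a + n) s)
    refine (congrArg (fun t => P.comp (T (a + n) s) t) this).trans ?_
    rw [← T_comp, hs, T_id]

theorem X'_X (hs : s ⨾ s = P.id 2) (a : ℕ) : ∀ n, X' s a n ⨾ X s a n = P.id (a + 1 + n)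
  | 0 => P.id_comp _
  | n + 1 => by
    show ((U (X' s a n)) ⨾ (T (a + n) s)) ⨾ ((T (a + n) s) ⨾ (U (X s a n))) = P.id (a + 1 + n + 1)
    have h : P.comp (T (a + n) s) (T (a + n) s) = P.id (a + n + 2) := by rw [← T_comp, hs, T_id]
    rw [P.assoc, ← P.assoc (T (a + n) s)]
    refine (congrArg (fun t => P.comp (U (X' s a n)) (P.comp t (U (X s a n)))) h).trans ?_
    refine (congrArg (P.comp (U (X' s a n))) (P.id_comp (U (X s a n)))).trans ?_
    rw [← U_comp, X'_X hs a n, U_id]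

end PRO

/-! ### Structural consequences of the axioms -/

namespace ZW
open PRO

/-- Diagrams modulo the axioms. -/
abbrev H (m n : ℕ) : Type := ZWModAx.Hom m n

/-- The class of a diagram modulo the axioms. -/
abbrev cls {m n : ℕ} (f : ZW.Hom m n) : H m n := toModAx.map f

def sg : H 2 2 := cls swap
def et : H 0 2 := cls dual
def ep : H 2 0 := cls dualDag
def fs : H 2 2 := cls fswap
def b2 : H 0 2 := cls black₂
def b3 : H 0 3 := cls black₃
def om (z : ℂ) : H 0 2 := cls (white z)

theorem cls_ax {m n : ℕ} {f g : ZW.Hom m n} (h : Ax m n f g) : cls f = cls g :=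
  Quotient.sound (Derivable.of h)

theorem sg_sg : sg ⨾ sg = ZWModAx.id 2 :=
  (cls_ax .swap_swap).trans (ZWModAx.tensor_id 1 1)

theorem sg_yb : U sg ⨾ T 1 sg ⨾ U sg = T 1 sg ⨾ U sg ⨾ T 1 sg := cls_ax .swap_slide

theorem fs_fs : fs ⨾ fs = ZWModAx.id 2 :=
  (cls_ax .fswap_fswap).trans (ZWModAx.tensor_id 1 1)

theorem fs_yb : U fs ⨾ T 1 fs ⨾ U fs = T 1 fs ⨾ U fs ⨾ T 1 fs := cls_ax .fswap_fslide

/-- A state slides through the swap as soon as it slides through a single swapped wire. -/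
theorem slides_of {s : H 2 2} {m n : ℕ} {f : H m n}
    (hf : U (T 0 f) ⨾ X s 0 n = X s 0 m ⨾ T (0 + 1) f) : Slides s f := fun a => by
  have hX : ∀ k, HEq (T a (X s 0 k)) (X s a k) := by
    intro k
    induction k with
    | zero => exact heq_of_eq (T_id _ _)
    | succ k ih =>
      show HEq (T a ((T (0 + k) s) ⨾ (U (X s 0 k)))) ((T (a + k) s) ⨾ (U (X s a k)))
      rw [T_comp]
      refine comp_heq (by omega) (by omega) (by omega) ?_ ?_
      · refine (T_T_heq a (0 + k) s).trans ?_
        rw [Nat.zero_add]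
      · refine HEq.trans (heq_of_eq (T_U a (X s 0 k))) ?_
        exact tensor_heq (by omega) (by omega) rfl rfl ih HEq.rfl
  have := congrArg (T a) hf
  rw [T_comp, T_comp] at this
  refine eq_of_heq (HEq.trans ?_ ((heq_of_eq this).trans ?_))
  · refine (comp_heq (by omega) (by omega) (by omega) ?_ (hX n)).symm
    refine (heq_of_eq (T_U a (T 0 f))).trans ?_
    exact tensor_heq (by omega) (by omega) rfl rfl (T_T_heq a 0 f) HEq.rfl
  · refine comp_heq (by omega) (by omega) (by omega) (hX m) ?_
    exact T_T_heq a 1 f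

theorem X_zero_one : X sg 0 1 = sg := by
  show (T 0 sg) ⨾ (U (ZWModAx.id 1)) = sg
  rw [U_id]
  exact (ZWModAx.comp_id _).trans (eq_of_heq (T_zero_heq sg))

theorem X_zero_two : X sg 0 2 = T 1 sg ⨾ U sg := by
  show (T 1 sg) ⨾ (U (X sg 0 1)) = _
  rw [X_zero_one]

theorem X_zero_three : X sg 0 3 = T 2 sg ⨾ U (T 1 sg ⨾ U sg) := by
  show (T 2 sg) ⨾ (U (X sg 0 2)) = _
  rw [X_zero_two]

theorem UU_eq {m n : ℕ} (f : H m n) : (f ⊠ ZWModAx.id 2) = U (U f) := by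
  rw [← V_eq]; rfl

theorem id_tensor_id : (ZWModAx.id 1 ⊠ ZWModAx.id 1) = ZWModAx.id 2 := ZWModAx.tensor_id 1 1

theorem slides_state_two {f : H 0 2} (h : (f ⊠ cls wire) ⨾ (cls wire ⊠ sg) ⨾ (sg ⊠ cls wire) =
    cls wire ⊠ f) : Slides sg f := by
  apply slides_of
  rw [X_zero_two, eq_of_heq (T_zero_heq f)]
  exact h.trans (ZWModAx.id_comp _).symm

theorem snake : T 1 et ⨾ U ep = ZWModAx.id 1 := cls_ax .dual_snake

theorem et_sg : et ⨾ sg = et := cls_ax .dual_swap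

theorem ep_slide : U ep = T 1 sg ⨾ U sg ⨾ T 1 ep := cls_ax .dualDag_slide

theorem et_slide : U et ⨾ T 1 sg ⨾ U sg = T 1 et := cls_ax .dual_slide

theorem fs_slide : U fs ⨾ T 1 sg ⨾ U sg = T 1 sg ⨾ U sg ⨾ T 1 fs := cls_ax .fswap_slide

/-- Each structural axiom is the sliding of one generator with no further wires on its left;
`slides_of` supplies the others. -/
theorem slides_gen {m n : ℕ} (g : ZWSig m n) : Slides sg (cls (freePRO.gen g)) := by
  cases g with
  | swap =>
    apply slides_of
    rw [X_zero_two, eq_of_heq (T_zero_heq (cls (freePRO.gen .swap)))]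
    exact sg_yb.trans (ZWModAx.assoc _ _ _).symm
  | fswap =>
    apply slides_of
    rw [X_zero_two, eq_of_heq (T_zero_heq (cls (freePRO.gen .fswap)))]
    exact fs_slide.trans (ZWModAx.assoc _ _ _).symm
  | dual => exact slides_state_two (cls_ax .dual_slide)
  | black₂ => exact slides_state_two (cls_ax .black₂_slide)
  | white z => exact slides_state_two (cls_ax (.white_slide z))
  | dualDag =>
    apply slides_of
    rw [X_zero_two, eq_of_heq (T_zero_heq (cls (freePRO.gen .dualDag)))]
    exact (ZWModAx.comp_id _).trans (ep_slide.trans (ZWModAx.assoc _ _ _).symm)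
  | black₃ =>
    apply slides_of
    rw [X_zero_three, eq_of_heq (T_zero_heq (cls (freePRO.gen .black₃)))]
    have h := cls_ax .black₃_slide
    have e1 : cls (wire ⊠ wire ⊠ swap) = T 2 sg := eq_of_heq (T_T_heq 1 1 sg)
    have e2 : cls (wire ⊠ swap ⊠ wire) = U (T 1 sg) := T_U 1 sg
    have e3 : cls (swap ⊠ wire ⊠ wire) = U (U sg) := by
      rw [← UU_eq, ← id_tensor_id]; rfl
    refine Eq.trans ?_ (h.trans (ZWModAx.id_comp _).symm)
    show _ = cls (black₃ ⊠ wire) ⨾ cls (wire ⊠ wire ⊠ swap) ⨾ cls (wire ⊠ swap ⊠ wire) ⨾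
      cls (swap ⊠ wire ⊠ wire)
    rw [e1, e2, e3, U_comp]
    rfl

/-- Every diagram slides through a swapped wire. -/
theorem slides {m n : ℕ} (f : H m n) : Slides sg f := by
  induction f using Quotient.ind with | _ f
  induction f using Quotient.ind with | _ f
  induction f with
  | gen g => exact slides_gen g
  | id n => exact Slides.id n
  | comp f g hf hg => exact hf.comp hg
  | tensor f g hf hg => exact hf.tensor hg

/-- Both the cup and the cap of the snake equation are slid to the other side of the straight wire.
The slid cup leaves one swap behind, which stays on the cap. -/
theorem snake_sg : U et ⨾ T 1 (sg ⨾ ep) = ZWModAx.id 1 := by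
  have h : U et ⨾ T 1 sg = T 1 et ⨾ U sg := by
    rw [← et_slide, ZWModAx.assoc, ZWModAx.assoc, ← U_comp, sg_sg, U_id]
    congr 1
    exact (ZWModAx.comp_id _).symm
  have h2 : T 1 et ⨾ T 1 sg = T 1 et := by rw [← T_comp, et_sg]
  have e1 : T 1 et ⨾ (T 1 sg ⨾ (U sg ⨾ T 1 ep)) = ZWModAx.id 1 := by
    rw [← ep_slide]; exact snake
  rw [← ZWModAx.assoc, h2, ← ZWModAx.assoc, ← h, ZWModAx.assoc] at e1
  rw [T_comp]
  exact e1

/-- The symmetry of the cap is not an axiom. One cup is joined to two caps, `ep` on its left and `sg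
⨾ ep` on its right: straightening it with the right one by `snake_sg` leaves `ep`, with the left one
by `snake` leaves `sg ⨾ ep`. -/
theorem sg_ep : sg ⨾ ep = ep := by
  have h := congrArg (T 1) snake_sg
  rw [T_id, T_comp, T_U, eq_of_heq (T_T_heq 1 1 (sg ⨾ ep))] at h
  have e : ZWModAx.comp (T 2 (sg ⨾ ep)) ep = V ep 2 ⨾ (sg ⨾ ep) := by
    have := V_T ep (sg ⨾ ep)
    rw [eq_of_heq (T_zero_heq (sg ⨾ ep))] at this
    exact this.symm
  have h3 := congrArg (fun t => ZWModAx.comp t ep) h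
  simp only [ZWModAx.assoc] at h3
  rw [ZWModAx.id_comp] at h3
  refine Eq.trans ?_ h3
  refine Eq.trans ?_ (congrArg (fun t => ZWModAx.comp (U (T 1 et)) t) e).symm
  have h4 : U (T 1 et) ⨾ V ep 2 = ZWModAx.id 2 := by
    show U (T 1 et) ⨾ U (U ep) = _
    rw [← U_comp, snake, U_id]
  rw [← ZWModAx.assoc]
  exact (ZWModAx.id_comp _).symm.trans (congrArg (fun t => ZWModAx.comp t (sg ⨾ ep)) h4.symm)

/-- The mirror image of the snake equation. -/
theorem snake' : U et ⨾ T 1 ep = ZWModAx.id 1 := by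
  have h := snake_sg
  rwa [sg_ep] at h

end ZW

namespace ZW
open PRO

/-- The swap of the two rightmost wires. -/
def sgn (n : ℕ) : H (n + 1 + 1) (n + 1 + 1) := T n sg

/-- The cap on the two rightmost wires. -/
def epn (n : ℕ) : H (n + 1 + 1) n := T n ep

theorem sgn_sgn (n : ℕ) : sgn n ⨾ sgn n = ZWModAx.id (n + 1 + 1) := by
  unfold sgn
  rw [← T_comp, sg_sg, T_id]

theorem sgn_nat {m n : ℕ} (h : H m n) : sgn m ⨾ U (U h) = U (U h) ⨾ sgn n := (V_T h sg).symm

theorem epn_nat {m n : ℕ} (h : H m n) : epn m ⨾ h = U (U h) ⨾ epn n := (V_T h ep).symm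

theorem sgn_epn (n : ℕ) : sgn n ⨾ epn n = epn n := by
  unfold sgn epn
  rw [← T_comp, sg_ep]

theorem sgn_yb (n : ℕ) :
    U (sgn n) ⨾ sgn (n + 1) ⨾ U (sgn n) = sgn (n + 1) ⨾ U (sgn n) ⨾ sgn (n + 1) := by
  have h := congrArg (T n) sg_yb
  simp only [T_comp, T_U] at h
  rw [eq_of_heq (T_T_heq n 1 sg)] at h
  exact h

theorem epn_slide (n : ℕ) : U (epn n) = sgn (n + 1) ⨾ U (sgn n) ⨾ epn (n + 1) := by
  have h := congrArg (T n) ep_slide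
  simp only [T_comp, T_U] at h
  rw [eq_of_heq (T_T_heq n 1 sg), eq_of_heq (T_T_heq n 1 ep)] at h
  exact h

/-! ### Labelled stacks of wires -/

/-- `Ins a t t'`: the list `t` is `t'` with `a` inserted at some place. -/
inductive Ins (a : ℕ) : List ℕ → List ℕ → Type
  | here (t) : Ins a (a :: t) t
  | there (b) {t t'} (i : Ins a t t') : Ins a (b :: t) (b :: t')

/-- The wire labelled `a` brought to the top. -/
def Ins.pull {a : ℕ} : ∀ {t t' : List ℕ}, Ins a t t' → H t.length (t'.length + 1)
  | _, _, .here t => ZWModAx.id (t.length + 1)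
  | _, _, .there (t' := t') _ i => U i.pull ⨾ sgn t'.length

theorem Ins.perm {a : ℕ} {t t' : List ℕ} (i : Ins a t t') : t.Perm (a :: t') := by
  induction i with
  | here t => rfl
  | there b i ih => exact (ih.cons b).trans (List.Perm.swap _ _ _)

theorem Ins.exists_of_mem {a : ℕ} {t : List ℕ} (h : a ∈ t) : ∃ t', Nonempty (Ins a t t') := by
  induction t with
  | nil => simp at h
  | cons b t ih =>
    by_cases e : a = b
    · subst e; exact ⟨t, ⟨.here t⟩⟩
    · obtain ⟨t', ⟨i⟩⟩ := ih (by simpa [e] using h)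
      exact ⟨b :: t', ⟨.there b i⟩⟩

theorem Ins.unique {a : ℕ} {t t' t'' : List ℕ} (i : Ins a t t') (j : Ins a t t'')
    (h : t.count a = 1) : ∃ e : t' = t'', e ▸ i = j := by
  induction i generalizing t'' with
  | here t =>
    cases j with
    | here => exact ⟨rfl, rfl⟩
    | there _ j =>
      have := j.perm.count_eq a
      simp at h this
      omega
  | there b i ih =>
    cases j with
    | here =>
      have := i.perm.count_eq a
      simp at h this
      omega
    | there _ j =>
      have h' := i.perm.count_eq a
      have : b ≠ a := by
        rintro rfl
        simp at h h'
        omega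
      obtain ⟨rfl, rfl⟩ := ih j (by simpa [List.count_cons, this] using h)
      exact ⟨rfl, rfl⟩

/-- The order in which two wires are brought to the top matters only up to a swap of these two. The
base cases use that the swap is an involution, the inductive step is the Yang–Baxter equation
`sgn_yb`. -/
theorem Ins.exch {x a : ℕ} {u t u' : List ℕ} (i : Ins x u t) (k : Ins a u u') (hxa : x ≠ a) :
    ∃ v, ∃ k' : Ins x u' v, ∃ i' : Ins a t v,
      i.pull ⨾ U i'.pull ⨾ sgn v.length = k.pull ⨾ U k'.pull := by
  induction i generalizing u' with
  | here t =>
    cases k with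
    | here => exact absurd rfl hxa
    | there _ k =>
      refine ⟨_, .here _, k, ?_⟩
      show ZWModAx.id _ ⨾ U k.pull ⨾ sgn _ = (U k.pull ⨾ sgn _) ⨾ U (ZWModAx.id _)
      rw [U_id, ZWModAx.id_comp, ZWModAx.comp_id]
  | there b i ih =>
    cases k with
    | here =>
      refine ⟨_, i, .here _, ?_⟩
      show (U i.pull ⨾ sgn _) ⨾ U (ZWModAx.id _) ⨾ sgn _ = ZWModAx.id _ ⨾ U i.pull
      rw [U_id, ZWModAx.id_comp, ZWModAx.id_comp, ZWModAx.assoc, sgn_sgn, ZWModAx.comp_id]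
    | there _ k =>
      obtain ⟨v, k', i', h⟩ := ih k
      refine ⟨_, .there b k', .there b i', ?_⟩
      show (U i.pull ⨾ sgn _) ⨾ U (U i'.pull ⨾ sgn _) ⨾ sgn (v.length + 1) =
        (U k.pull ⨾ sgn _) ⨾ U (U k'.pull ⨾ sgn _)
      have h' := congrArg U h
      simp only [U_comp] at h' ⊢
      simp only [ZWModAx.assoc]
      rw [← ZWModAx.assoc (sgn _) (U (U i'.pull)), ← ZWModAx.assoc (sgn _) (U (U k'.pull)),
        sgn_nat, sgn_nat, ZWModAx.assoc, ZWModAx.assoc, ← sgn_yb, ← ZWModAx.assoc (U k.pull), ← h']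
      simp only [ZWModAx.assoc]

/-- Matchings: caps joining the wires of a stack with equal labels. -/
inductive Mt : ∀ ℓ : List ℕ, H ℓ.length 0 → Prop
  | nil : Mt [] (ZWModAx.id 0)
  | cons {a : ℕ} {t t' : List ℕ} (i : Ins a t t') {f} (h : Mt t' f) :
      Mt (a :: t) (U i.pull ⨾ epn t'.length ⨾ f)

/-- Every label occurs exactly twice, if at all. -/
def OK (ℓ : List ℕ) : Prop := ∀ a ∈ ℓ, ℓ.count a = 2

instance (ℓ : List ℕ) : Decidable (OK ℓ) := by unfold OK; infer_instance

theorem ok_iff {ℓ : List ℕ} : OK ℓ ↔ ∀ a, ℓ.count a = 0 ∨ ℓ.count a = 2 := by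
  refine ⟨fun h a => ?_, fun h a ha => ?_⟩
  · by_cases ha : a ∈ ℓ
    · exact Or.inr (h a ha)
    · exact Or.inl (List.count_eq_zero.2 ha)
  · have := List.count_pos_iff.2 ha
    have := h a
    omega

theorem OK.perm {ℓ ℓ' : List ℕ} (h : OK ℓ) (p : ℓ.Perm ℓ') : OK ℓ' := by
  rw [ok_iff] at *
  intro a
  rw [← p.count_eq]
  exact h a

theorem OK.cap {a : ℕ} {ℓ : List ℕ} (h : OK (a :: a :: ℓ)) : OK ℓ := by
  rw [ok_iff] at *
  intro b
  have := h b
  simp only [List.count_cons] at this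
  split_ifs at this <;> simp at this <;> omega

theorem OK.count {a : ℕ} {t : List ℕ} (h : OK (a :: t)) : t.count a = 1 := by
  have := h a (by simp)
  simpa using this

theorem OK.tail {a : ℕ} {t t' : List ℕ} (h : OK (a :: t)) (i : Ins a t t') : OK t' :=
  (h.perm (i.perm.cons a)).cap

theorem Mt.exists {ℓ : List ℕ} (h : OK ℓ) : ∃ f, Mt ℓ f := by
  match ℓ with
  | [] => exact ⟨_, .nil⟩
  | a :: t =>
    obtain ⟨t', ⟨i⟩⟩ := Ins.exists_of_mem (List.count_pos_iff.1 (by rw [h.count]; exact one_pos))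
    have hlt : t'.length < t.length := by rw [i.perm.length_eq]; exact Nat.lt_succ_self _
    obtain ⟨f, hf⟩ := Mt.exists (h.tail i)
    exact ⟨_, .cons i hf⟩
termination_by ℓ.length
decreasing_by exact hlt.trans (Nat.lt_succ_self _)

theorem Mt.unique {ℓ : List ℕ} {f g} (hf : Mt ℓ f) (hg : Mt ℓ g) (h : OK ℓ) : f = g := by
  induction hf with
  | nil => cases hg; rfl
  | cons i hf ih =>
    cases hg with
    | cons j hg =>
      obtain ⟨rfl, rfl⟩ := i.unique j h.count
      rw [ih hg (h.tail i)]

/-- The coherence theorem for caps: any wire may be the first to be capped. If the top wire is `a`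
and another wire `x` is pulled, the induction hypothesis turns one side into "cap the pair `a`, then
the pair `x`", the other being "cap `x`, then `a`". These agree by `Ins.exch`, naturality, and the
sliding of a cap past a wire. -/
theorem Mt.pull {ℓ : List ℕ} {f} (hf : Mt ℓ f) (h : OK ℓ) {x : ℕ} {t : List ℕ} (i : Ins x ℓ t)
    {f'} (hf' : Mt (x :: t) f') : f = i.pull ⨾ f' := by
  induction hf generalizing x t with
  | nil => cases i
  | @cons a u u' k g hg ih =>
    have hu := h.tail k
    cases i with
    | here =>
      show _ = ZWModAx.id _ ⨾ _
      rw [ZWModAx.id_comp]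
      exact Mt.unique (.cons k hg) hf' h
    | @there _ _ t1 i =>
      -- If `x = a`, the wire pulled is the partner of the top wire, so only the two legs of one cap
      -- are exchanged, and `sgn_epn` absorbs this.
      by_cases hxa : x = a
      · subst hxa
        obtain ⟨rfl, hik⟩ := i.unique k h.count
        subst hik
        have hx : t1.count x = 0 := by
          have := i.perm.count_eq x
          have := h.count
          simp at *
          omega
        have h0 : Mt (x :: x :: t1) (U (ZWModAx.id _) ⨾ epn t1.length ⨾ g) := .cons (.here _) hg
        rw [hf'.unique h0 (h.perm (i.perm.cons x)), U_id]
        show U i.pull ⨾ _ = (U i.pull ⨾ sgn _) ⨾ ZWModAx.id _ ⨾ _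
        rw [ZWModAx.id_comp, ZWModAx.assoc, ← ZWModAx.assoc (sgn _), sgn_epn]
      · obtain ⟨v, k', i', e⟩ := i.exch k hxa
        have hv : OK (x :: v) := hu.perm k'.perm
        obtain ⟨g', hg'⟩ := Mt.exists hv
        have e2 := ih hu k' hg'
        cases hg' with
        | @cons _ _ v' y g3 hg3 =>
        cases hf' with
        | @cons _ _ t2 l h' hh' =>
        have hxt : OK (x :: a :: t1) := h.perm ((i.perm.cons a).trans (List.Perm.swap _ _ _))
        cases l with
        | here => exact absurd rfl hxa
        | @there _ _ t1' l =>
        have hat : OK (a :: t1') := hxt.tail (.there a l)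
        cases hh' with
        | @cons _ _ t1'' r h'' hh'' =>
        obtain ⟨w, y', r', e3⟩ := l.exch i' hxa
        obtain ⟨rfl, hy⟩ := y.unique y' hv.count
        obtain ⟨rfl, hr⟩ := r.unique r' hat.count
        subst hy hr
        rw [hh''.unique hg3 (hat.tail r), e2]
        show U k.pull ⨾ epn _ ⨾ k'.pull ⨾ U y.pull ⨾ epn _ ⨾ g3 =
          (U i.pull ⨾ sgn _) ⨾ U (U l.pull ⨾ sgn t1'.length) ⨾ epn (t1'.length + 1) ⨾
            U r.pull ⨾ epn t1''.length ⨾ g3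
        -- The wire `a` stays on top and the pair `x` is capped beneath it; `epn_slide` removes the
        -- detour of the cap over `a`.
        have a1 : U i.pull ⨾ sgn _ ⨾ U (U l.pull ⨾ sgn t1'.length) ⨾ epn (t1'.length + 1) =
            U (i.pull ⨾ U l.pull ⨾ epn t1'.length) := by
          rw [U_comp, U_comp, U_comp, ← ZWModAx.assoc (sgn _), ← ZWModAx.assoc (sgn _), sgn_nat,
            ZWModAx.assoc, ZWModAx.assoc, epn_slide]
        have b1 : l.pull ⨾ U r.pull = i'.pull ⨾ U y.pull ⨾ sgn _ := by
          rw [← ZWModAx.assoc, ← e3, ZWModAx.assoc, ZWModAx.assoc, sgn_sgn, ZWModAx.comp_id]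
        have b2 : i.pull ⨾ U i'.pull = k.pull ⨾ U k'.pull ⨾ sgn _ := by
          rw [← ZWModAx.assoc, ← e, ZWModAx.assoc, ZWModAx.assoc, sgn_sgn, ZWModAx.comp_id]
        have a2 : (i.pull ⨾ U l.pull ⨾ epn t1'.length) ⨾ r.pull =
            k.pull ⨾ U k'.pull ⨾ U (U y.pull) ⨾ U (epn t1''.length) := by
          have b1' := congrArg U b1
          simp only [U_comp] at b1'
          calc (i.pull ⨾ U l.pull ⨾ epn t1'.length) ⨾ r.pull
              = i.pull ⨾ (U l.pull ⨾ U (U r.pull)) ⨾ epn (t1''.length + 1) := by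
                rw [ZWModAx.assoc, ZWModAx.assoc, epn_nat, ZWModAx.assoc]
            _ = (i.pull ⨾ U i'.pull) ⨾ U (U y.pull) ⨾ U (sgn t1''.length) ⨾
                  epn (t1''.length + 1) := by
                rw [b1']; simp only [ZWModAx.assoc]
            _ = k.pull ⨾ U k'.pull ⨾ (sgn _ ⨾ U (U y.pull)) ⨾ U (sgn t1''.length) ⨾
                  epn (t1''.length + 1) := by
                rw [b2]; simp only [ZWModAx.assoc]
            _ = _ := by
                rw [sgn_nat, epn_slide]; simp only [ZWModAx.assoc]
        have a2' := congrArg U a2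
        simp only [U_comp] at a1 a2' ⊢
        calc U k.pull ⨾ epn _ ⨾ k'.pull ⨾ U y.pull ⨾ epn _ ⨾ g3
            = U k.pull ⨾ U (U k'.pull) ⨾ (epn _ ⨾ U y.pull) ⨾ epn _ ⨾ g3 := by
              rw [← ZWModAx.assoc (epn _), epn_nat]; simp only [ZWModAx.assoc]
          _ = U k.pull ⨾ U (U k'.pull) ⨾ U (U (U y.pull)) ⨾ (epn _ ⨾ epn _) ⨾ g3 := by
              rw [epn_nat]; simp only [ZWModAx.assoc]
          _ = (U k.pull ⨾ U (U k'.pull) ⨾ U (U (U y.pull)) ⨾ U (U (epn _))) ⨾ epn _ ⨾ g3 := by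
              rw [epn_nat]; simp only [ZWModAx.assoc]
          _ = (U i.pull ⨾ sgn _ ⨾ (U (U l.pull) ⨾ U (sgn t1'.length)) ⨾ epn (t1'.length + 1)) ⨾
                U r.pull ⨾ epn t1''.length ⨾ g3 := by
              rw [← a2', a1]; simp only [ZWModAx.assoc]
          _ = _ := by simp only [ZWModAx.assoc]

end ZW

namespace ZW
open PRO

/-! ### Nets -/

/-- Kinds of vertices of a net: caps, black vertices, white vertices, fermionic crossings, curls,
black vertices with a negated leg, basis states, quaternary white vertices. -/
inductive Kind
  | e | n | b | p (k : ℕ) | z | c | d | v0 | v1 | w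
  deriving DecidableEq

/-- A vertex of a net, with its legs labelled from right to left. -/
structure Atom where
  k : Kind
  l : List ℕ
  deriving DecidableEq

/-- `anyState` and `anyEffect` are default values, for vertices with a wrong number of legs and for
stacks that cannot be matched. Any morphism of the right type would do. -/
def anyState : ∀ n, H 0 n
  | 0 => ZWModAx.id 0
  | n + 1 => anyState n ⨾ T n (b3 ⨾ T 1 ep)

def anyEffect : ∀ n, H n 0
  | 0 => ZWModAx.id 0
  | n + 1 => T n (T 1 (b3 ⨾ T 1 ep) ⨾ ep) ⨾ anyEffect n

/-- The fermionic swap with its inputs bent. -/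
def zst : H 0 4 := (et ⨾ ((ZWModAx.id 1 ⊠ et) ⊠ ZWModAx.id 1)) ⨾ (ZWModAx.id 2 ⊠ fs)

/-- The projector with its inputs bent. -/
noncomputable def wst : H 0 4 :=
  (et ⨾ ((ZWModAx.id 1 ⊠ et) ⊠ ZWModAx.id 1)) ⨾ (ZWModAx.id 2 ⊠ cls projector)

def cst : H 0 2 := zst ⨾ ((ZWModAx.id 1 ⊠ ep) ⊠ ZWModAx.id 1)

def dst : H 0 3 := (b2 ⨾ (ZWModAx.id 2 ⊠ b3)) ⨾ ((ZWModAx.id 1 ⊠ ep) ⊠ ZWModAx.id 2)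

def v0st : H 0 1 := dst ⨾ (ZWModAx.id 1 ⊠ ep)

def v1st : H 0 1 := b3 ⨾ (ZWModAx.id 1 ⊠ ep)

/-- The parameters of white vertices: four constants followed by variables. -/
noncomputable def pv (ζ : ℕ → ℂ) : ℕ → ℂ
  | 0 => 0
  | 1 => 1
  | 2 => -1
  | 3 => 1 / 2
  | k + 4 => ζ k

/-- The interpretation of the vertices, depending on the parameters of white vertices. -/
noncomputable def kst (ζ : ℕ → ℂ) : Kind → ∀ n, H 0 n
  | .e, 2 => et
  | .n, 2 => b2
  | .b, 3 => b3
  | .p k, 2 => om (pv ζ k)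
  | .z, 4 => zst
  | .c, 2 => cst
  | .d, 3 => dst
  | .v0, 1 => v0st
  | .v1, 1 => v1st
  | .w, 4 => wst
  | _, n => anyState n

def push (l : List ℕ) (s : H 0 l.length) (ℓ : List ℕ) : H ℓ.length (l ++ ℓ).length :=
  cast (congrArg (H ℓ.length) (by rw [List.length_append, Nat.add_comm])) (T ℓ.length s)

theorem push_heq (l : List ℕ) (s : H 0 l.length) (ℓ : List ℕ) :
    HEq (push l s ℓ) (T ℓ.length s) := cast_heq _ _

/-- `h` with the wires `l` on its right. -/
def under {ℓ ℓ' : List ℕ} (h : H ℓ.length ℓ'.length) : ∀ l : List ℕ,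
    H (l ++ ℓ).length (l ++ ℓ').length
  | [] => h
  | _ :: l => U (under h l)

theorem under_heq {ℓ ℓ' : List ℕ} (h : H ℓ.length ℓ'.length) (l : List ℕ) :
    HEq (under h l) (V h l.length) := by
  induction l with
  | nil => rfl
  | cons a l ih =>
    exact tensor_heq (by simp [Nat.add_comm]) (by simp [Nat.add_comm]) rfl rfl ih HEq.rfl

theorem push_nat (l : List ℕ) (s : H 0 l.length) {ℓ ℓ' : List ℕ} (h : H ℓ.length ℓ'.length) :
    h ⨾ push l s ℓ' = push l s ℓ ⨾ under h l := by
  have e : h ⨾ T ℓ'.length s = T ℓ.length s ⨾ V h l.length := V_T h s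
  have h1 : (l ++ ℓ).length = ℓ.length + l.length := by simp [Nat.add_comm]
  have h2 : (l ++ ℓ').length = ℓ'.length + l.length := by simp [Nat.add_comm]
  refine eq_of_heq (HEq.trans ?_ ((heq_of_eq e).trans ?_))
  · exact comp_heq rfl rfl h2 HEq.rfl (push_heq _ _ _)
  · exact (comp_heq rfl h1 h2 (push_heq _ _ _) (under_heq _ _)).symm

/-- An insertion below the wires `l`. -/
def Ins.shift {a : ℕ} : ∀ (l : List ℕ) {t t' : List ℕ}, Ins a t t' → Ins a (l ++ t) (l ++ t')
  | [], _, _, i => i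
  | b :: l, _, _, i => .there b (i.shift l)

theorem Ins.pull_shift {a : ℕ} (l : List ℕ) {t t' : List ℕ} (i : Ins a t t') :
    (i.shift l).pull = under (ℓ' := a :: t') i.pull l ⨾ ((Ins.here t').shift l).pull := by
  induction l with
  | nil => exact (ZWModAx.comp_id _).symm
  | cons b l ih =>
    show U (i.shift l).pull ⨾ _ = U (under (ℓ' := a :: t') i.pull l) ⨾ U _ ⨾ _
    rw [ih, U_comp, ZWModAx.assoc]

theorem sgn_heq {m n : ℕ} (h : m = n) : HEq (sgn m) (sgn n) := by subst h; rfl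

theorem Ins.pull_shift_here_heq (a : ℕ) (l t : List ℕ) :
    HEq ((Ins.here (a := a) t).shift l).pull (X' sg t.length l.length) := by
  induction l with
  | nil => rfl
  | cons b l ih =>
    refine comp_heq (by simp; omega) (by simp; omega) (by simp; omega) ?_ ?_
    · exact tensor_heq (by simp; omega) (by simp; omega) rfl rfl ih HEq.rfl
    · have : (l ++ t).length = t.length + l.length := by simp [Nat.add_comm]
      exact sgn_heq this

/-- A wire pulled out from under the legs of a new vertex crosses these legs, and the state of the
vertex slides through it by `slides`. -/
theorem push_pull (l : List ℕ) (s : H 0 l.length) (x : ℕ) (ℓ : List ℕ) :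
    push l s (x :: ℓ) ⨾ ((Ins.here (a := x) ℓ).shift l).pull = U (push l s ℓ) := by
  have e : U (T ℓ.length s) = T (ℓ.length + 1) s ⨾ X' sg ℓ.length l.length := by
    have h := slides s ℓ.length
    have h0 : X sg ℓ.length 0 ⨾ T (ℓ.length + 1) s = T (ℓ.length + 1) s := ZWModAx.id_comp _
    rw [← h0, ← h, ZWModAx.assoc, X_X' sg_sg, ZWModAx.comp_id]
  refine eq_of_heq (HEq.trans ?_ ((heq_of_eq e.symm).trans ?_))
  · exact comp_heq rfl (by simp; omega) (by simp; omega) (push_heq _ _ _)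
      (Ins.pull_shift_here_heq _ _ _)
  · exact (tensor_heq rfl (by simp; omega) rfl rfl (push_heq _ _ _) HEq.rfl).symm

open Classical in
/-- The matching on a stack whose labels occur twice. -/
noncomputable def mt (ℓ : List ℕ) : H ℓ.length 0 :=
  if h : OK ℓ then (Mt.exists h).choose else anyEffect _

theorem mt_spec {ℓ : List ℕ} (h : OK ℓ) : Mt ℓ (mt ℓ) := by
  rw [mt, dif_pos h]
  exact (Mt.exists h).choose_spec

theorem mt_pull {ℓ : List ℕ} (h : OK ℓ) {x : ℕ} {t : List ℕ} (i : Ins x ℓ t) :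
    mt ℓ = i.pull ⨾ mt (x :: t) := (mt_spec h).pull h i (mt_spec (h.perm i.perm))

theorem mt_cap {a : ℕ} {ℓ : List ℕ} (h : OK (a :: a :: ℓ)) : mt (a :: a :: ℓ) = epn _ ⨾ mt ℓ := by
  have h0 : Mt (a :: a :: ℓ) (U (ZWModAx.id _) ⨾ epn ℓ.length ⨾ mt ℓ) :=
    .cons (.here _) (mt_spec h.cap)
  rw [(mt_spec h).unique h0 h, U_id]
  exact ZWModAx.id_comp _

section Nets

variable (ζ : ℕ → ℂ)

/-- The labels of the stack once the legs of the vertices have been added to it. -/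
def labs : List Atom → List ℕ → List ℕ
  | [], ℓ => ℓ
  | A :: N, ℓ => labs N (A.l ++ ℓ)

/-- The vertices of a net put on the right of a stack. -/
noncomputable def net : ∀ (N : List Atom) (ℓ : List ℕ), H ℓ.length (labs N ℓ).length
  | [], ℓ => ZWModAx.id ℓ.length
  | A :: N, ℓ => push A.l (kst ζ A.k _) ℓ ⨾ net N (A.l ++ ℓ)

/-- The effect on a stack given by a net. -/
noncomputable def E (N : List Atom) (ℓ : List ℕ) : H ℓ.length 0 := net ζ N ℓ ⨾ mt (labs N ℓ)

variable {ζ}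

theorem labs_count (a : ℕ) (N : List Atom) (ℓ : List ℕ) :
    (labs N ℓ).count a = (labs N []).count a + ℓ.count a := by
  induction N generalizing ℓ with
  | nil => simp [labs]
  | cons A N ih =>
    simp only [labs]
    rw [ih, ih (A.l ++ []), List.count_append, List.count_append, List.count_nil]
    omega

theorem labs_perm (N : List Atom) {ℓ ℓ' : List ℕ} (h : ℓ.Perm ℓ') :
    (labs N ℓ).Perm (labs N ℓ') := by
  rw [List.perm_iff_count]
  intro a
  rw [labs_count, labs_count _ _ ℓ', h.count_eq]

theorem E_nil (ℓ : List ℕ) : E ζ [] ℓ = mt ℓ := ZWModAx.id_comp _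

theorem E_cons (A : Atom) (N : List Atom) (ℓ : List ℕ) :
    E ζ (A :: N) ℓ = push A.l (kst ζ A.k _) ℓ ⨾ E ζ N (A.l ++ ℓ) := ZWModAx.assoc _ _ _

/-- `Mt.pull` extended to stacks that still await vertices. By induction both sides are compared
with the net in which `x` has been pulled above the legs of the first vertex as well; `push_nat`
moves the pull past that vertex. -/
theorem E_pull (N : List Atom) {ℓ t : List ℕ} {x : ℕ} (h : OK (labs N ℓ)) (i : Ins x ℓ t) :
    E ζ N ℓ = i.pull ⨾ E ζ N (x :: t) := by
  induction N generalizing ℓ t with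
  | nil =>
    have h : OK ℓ := h
    rw [E_nil, E_nil, mt_pull h i]
  | cons A N ih =>
    have h' : OK (labs N (A.l ++ x :: t)) := h.perm (labs_perm N (i.perm.append_left _))
    rw [E_cons, ih h (i.shift A.l), E_cons, ih h' ((Ins.here t).shift A.l), Ins.pull_shift,
      ZWModAx.assoc, ← ZWModAx.assoc, ← push_nat, ZWModAx.assoc]

theorem E_under (A : Atom) (N : List Atom) {ℓ : List ℕ} {x : ℕ} (h : OK (labs (A :: N) (x :: ℓ))) :
    E ζ (A :: N) (x :: ℓ) = U (push A.l (kst ζ A.k _) ℓ) ⨾ E ζ N (x :: (A.l ++ ℓ)) := by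
  rw [E_cons, E_pull N h ((Ins.here ℓ).shift A.l), ← ZWModAx.assoc, push_pull]

theorem E_sw (N : List Atom) {ℓ : List ℕ} {a b : ℕ} (h : OK (labs N (a :: b :: ℓ))) :
    E ζ N (a :: b :: ℓ) = sgn _ ⨾ E ζ N (b :: a :: ℓ) := by
  rw [E_pull N h (.there a (.here ℓ))]
  show (U (ZWModAx.id _) ⨾ sgn _) ⨾ _ = _
  rw [U_id, ZWModAx.id_comp]

/-- A pair of adjacent open ends may be capped before the vertices are added: the pair is first
brought above the legs of each vertex, and capping it there leaves the other wires alone. -/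
theorem E_cap (N : List Atom) {ℓ : List ℕ} {a : ℕ} (h : OK (labs N (a :: a :: ℓ))) :
    E ζ N (a :: a :: ℓ) = epn _ ⨾ E ζ N ℓ := by
  induction N generalizing ℓ with
  | nil =>
    have h : OK (a :: a :: ℓ) := h
    rw [E_nil, E_nil, mt_cap h]
  | cons A N ih =>
    have h1 : OK (labs N (a :: (A.l ++ a :: ℓ))) := h.perm (labs_perm N List.perm_middle)
    have h2 : OK (labs N (a :: a :: (A.l ++ ℓ))) :=
      h1.perm (labs_perm N (List.perm_middle.cons a))
    rw [E_under A N h, E_pull N h1 (.there a ((Ins.here ℓ).shift A.l)), ← ZWModAx.assoc]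
    show (U (push A.l _ (a :: ℓ)) ⨾ U ((Ins.here ℓ).shift A.l).pull ⨾ sgn _) ⨾ _ = _
    rw [← ZWModAx.assoc (U _), ← U_comp, push_pull, ZWModAx.assoc]
    have e := E_sw (ζ := ζ) N h2
    rw [ih h2] at e ⊢
    rw [← ZWModAx.assoc (sgn _), sgn_epn, E_cons, ← ZWModAx.assoc (epn _) (push _ _ _),
      epn_nat (push _ _ _),
      ZWModAx.assoc]

end Nets

end ZW

namespace ZW
open PRO

/-! ### Moves on stacks -/

/-- An elementary move on a stack: swapping two adjacent wires, or capping two adjacent wires with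
the same label. -/
inductive Step : ∀ ℓ ℓ' : List ℕ, H ℓ.length ℓ'.length → Prop
  | sw (a b t) : Step (a :: b :: t) (b :: a :: t) (sgn t.length)
  | cap (a t) : Step (a :: a :: t) t (epn t.length)
  | there (x) {ℓ ℓ' g} (h : Step ℓ ℓ' g) : Step (x :: ℓ) (x :: ℓ') (U g)

theorem Ins.pull_there_there {a b x : ℕ} {ℓ u w : List ℕ} (i : Ins a ℓ u) (j : Ins b u w) :
    (Ins.there x i).pull ⨾ U (Ins.there x j).pull =
      U (i.pull ⨾ U j.pull) ⨾ sgn (w.length + 1) ⨾ U (sgn w.length) := by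
  show (U i.pull ⨾ sgn _) ⨾ U (U j.pull ⨾ sgn _) = _
  rw [U_comp, U_comp, ZWModAx.assoc, ← ZWModAx.assoc (sgn _), sgn_nat]
  simp only [ZWModAx.assoc]

/-- Wherever a move takes place in the stack, pulling its two wires to the top turns it into a swap
or a cap of the two topmost wires. So `E_step` follows from `E_sw` and `E_cap`. -/
theorem Step.spec {ℓ ℓ' : List ℕ} {g} (h : Step ℓ ℓ' g) :
    (∃ (a b : ℕ) (u v w : List ℕ) (i : Ins b ℓ u) (j : Ins a u w) (i' : Ins a ℓ' v)
      (j' : Ins b v w), i.pull ⨾ U j.pull ⨾ sgn w.length = g ⨾ i'.pull ⨾ U j'.pull) ∨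
    ∃ (a : ℕ) (u : List ℕ) (i : Ins a ℓ u) (j : Ins a u ℓ'), i.pull ⨾ U j.pull ⨾ epn _ = g := by
  induction h with
  | sw a b t =>
    refine .inl ⟨a, b, _, _, _, .there a (.here t), .here t, .there b (.here t), .here t, ?_⟩
    show (U (ZWModAx.id _) ⨾ sgn _) ⨾ U (ZWModAx.id _) ⨾ sgn _ =
      sgn _ ⨾ (U (ZWModAx.id _) ⨾ sgn _) ⨾ U (ZWModAx.id _)
    simp only [U_id, ZWModAx.id_comp, ZWModAx.comp_id]
  | cap a t =>
    refine .inr ⟨a, _, .here _, .here _, ?_⟩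
    show ZWModAx.id _ ⨾ U (ZWModAx.id _) ⨾ epn _ = epn _
    simp only [U_id, ZWModAx.id_comp]
  | there x h ih =>
    rcases ih with ⟨a, b, u, v, w, i, j, i', j', e⟩ | ⟨a, u, i, j, e⟩
    · refine .inl ⟨a, b, _, _, _, .there x i, .there x j, .there x i', .there x j', ?_⟩
      have e' := congrArg U e
      simp only [U_comp] at e'
      rw [← ZWModAx.assoc, Ins.pull_there_there, Ins.pull_there_there]
      simp only [ZWModAx.assoc, U_comp]
      show _ ⨾ _ ⨾ sgn _ ⨾ U (sgn w.length) ⨾ sgn (w.length + 1) = _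
      rw [← sgn_yb, ← ZWModAx.assoc (U (U j.pull)), ← ZWModAx.assoc (U i.pull), e']
      simp only [ZWModAx.assoc]
    · refine .inr ⟨a, _, .there x i, .there x j, ?_⟩
      rw [← ZWModAx.assoc, Ins.pull_there_there, ← e]
      simp only [ZWModAx.assoc, U_comp]
      rw [epn_slide]
      rfl

theorem Step.perm_or {ℓ ℓ' : List ℕ} {g} (h : Step ℓ ℓ' g) :
    ℓ.Perm ℓ' ∨ ∃ a, ℓ.Perm (a :: a :: ℓ') := by
  rcases h.spec with ⟨a, b, u, v, w, i, j, i', j', -⟩ | ⟨a, u, i, j, -⟩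
  · exact .inl ((i.perm.trans (j.perm.cons b)).trans ((List.Perm.swap a b w).trans
      (i'.perm.trans (j'.perm.cons a)).symm))
  · exact .inr ⟨a, i.perm.trans (j.perm.cons a)⟩

variable {ζ : ℕ → ℂ}

theorem OK.step {ℓ ℓ' : List ℕ} {g} (h : Step ℓ ℓ' g) {N : List Atom} (hN : OK (labs N ℓ)) :
    OK (labs N ℓ') := by
  rcases h.perm_or with p | ⟨a, p⟩
  · exact hN.perm (labs_perm N p)
  · have h' := hN.perm (labs_perm N p)
    rw [ok_iff] at *
    intro b
    have := h' b
    rw [labs_count] at this ⊢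
    simp only [List.count_cons] at this
    split_ifs at this <;> simp at this <;> omega

theorem E_step {ℓ ℓ' : List ℕ} {g} (h : Step ℓ ℓ' g) {N : List Atom} (hN : OK (labs N ℓ)) :
    E ζ N ℓ = g ⨾ E ζ N ℓ' := by
  have hN' := hN.step h
  rcases h.spec with ⟨a, b, u, v, w, i, j, i', j', e⟩ | ⟨a, u, i, j, e⟩
  · have h1 := hN.perm (labs_perm N i.perm)
    have h2 := hN'.perm (labs_perm N i'.perm)
    have h3 : OK (labs N (a :: b :: w)) :=
      h2.perm (labs_perm N (j'.perm.cons a))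
    have e' := congrArg (ZWModAx.comp · (sgn w.length)) e
    simp only [ZWModAx.assoc] at e'
    rw [sgn_sgn, ZWModAx.comp_id] at e'
    rw [E_pull N hN i, E_pull N h1 (.there b j), E_pull N hN' i', E_pull N h2 (.there a j')]
    show _ ⨾ (U j.pull ⨾ sgn _) ⨾ E ζ N (a :: b :: w) =
      g ⨾ _ ⨾ (U j'.pull ⨾ sgn _) ⨾ E ζ N (b :: a :: w)
    rw [E_sw N h3, ZWModAx.assoc, ← ZWModAx.assoc (sgn _), sgn_sgn, ← ZWModAx.assoc i.pull, e']
    simp only [ZWModAx.assoc, ZWModAx.id_comp]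
  · have h1 := hN.perm (labs_perm N i.perm)
    have h2 : OK (labs N (a :: a :: ℓ')) := h1.perm (labs_perm N (j.perm.cons a))
    rw [E_pull N hN i, E_pull N h1 (.there a j), ← e]
    show _ ⨾ (U j.pull ⨾ sgn _) ⨾ E ζ N (a :: a :: ℓ') = _
    rw [E_cap N h2, ZWModAx.assoc, ← ZWModAx.assoc (sgn _), sgn_epn]
    simp only [ZWModAx.assoc]

/-- Sequences of elementary moves. -/
inductive Steps : ∀ ℓ ℓ' : List ℕ, H ℓ.length ℓ'.length → Prop
  | refl (ℓ) : Steps ℓ ℓ (ZWModAx.id _)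
  | head {ℓ ℓ' ℓ'' g g'} (h : Step ℓ ℓ' g) (h' : Steps ℓ' ℓ'' g') : Steps ℓ ℓ'' (g ⨾ g')

theorem Steps.trans {ℓ ℓ' ℓ'' : List ℕ} {g g'} (h : Steps ℓ ℓ' g) (h' : Steps ℓ' ℓ'' g') :
    Steps ℓ ℓ'' (g ⨾ g') := by
  induction h with
  | refl => rwa [ZWModAx.id_comp]
  | head h _ ih => rw [ZWModAx.assoc]; exact .head h (ih h')

theorem Steps.there (x : ℕ) {ℓ ℓ' : List ℕ} {g} (h : Steps ℓ ℓ' g) :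
    Steps (x :: ℓ) (x :: ℓ') (U g) := by
  induction h with
  | refl => rw [U_id]; exact .refl _
  | head h _ ih => rw [U_comp]; exact .head (.there x h) ih

theorem Step.single {ℓ ℓ' : List ℕ} {g} (h : Step ℓ ℓ' g) : Steps ℓ ℓ' g := by
  have := Steps.head h (.refl _)
  rwa [ZWModAx.comp_id] at this

theorem Steps.under {ℓ ℓ' : List ℕ} {g} (h : Steps ℓ ℓ' g) (J : List ℕ) :
    Steps (J ++ ℓ) (J ++ ℓ') (under g J) := by
  induction J with
  | nil => exact h
  | cons x J ih => exact ih.there x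

theorem Steps.ok {ℓ ℓ' : List ℕ} {g} (h : Steps ℓ ℓ' g) {N : List Atom} (hN : OK (labs N ℓ)) :
    OK (labs N ℓ') := by
  induction h with
  | refl => exact hN
  | head h _ ih => exact ih (hN.step h)

theorem E_steps {ℓ ℓ' : List ℕ} {g} (h : Steps ℓ ℓ' g) {N : List Atom} (hN : OK (labs N ℓ)) :
    E ζ N ℓ = g ⨾ E ζ N ℓ' := by
  induction h with
  | refl => exact (ZWModAx.id_comp _).symm
  | head h _ ih => rw [E_step h hN, ih (hN.step h), ZWModAx.assoc]

theorem Steps.of_perm {ℓ ℓ' : List ℕ} (h : ℓ.Perm ℓ') : ∃ g, Steps ℓ ℓ' g := by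
  induction h with
  | nil => exact ⟨_, .refl _⟩
  | cons x _ ih => obtain ⟨g, hg⟩ := ih; exact ⟨_, hg.there x⟩
  | swap a b t => exact ⟨_, (Step.sw b a t).single⟩
  | trans _ _ ih ih' =>
    obtain ⟨g, hg⟩ := ih
    obtain ⟨g', hg'⟩ := ih'
    exact ⟨_, hg.trans hg'⟩

/-- Labels that occur twice in `L` do not occur in `o`, and their wires are capped with each other.
What remains has no repetition and is a permutation of `o`. -/
theorem Steps.of_ok (L o : List ℕ) (ho : o.Nodup) (h : OK (L ++ o)) : ∃ g, Steps L o g := by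
  rw [ok_iff] at h
  by_cases hL : L.Nodup
  · refine Steps.of_perm (List.perm_iff_count.2 fun a => ?_)
    have := h a
    rw [List.count_append] at this
    have := List.nodup_iff_count_le_one.1 hL a
    have := List.nodup_iff_count_le_one.1 ho a
    omega
  · rw [List.nodup_iff_count_le_one] at hL
    push Not at hL
    obtain ⟨a, ha⟩ := hL
    obtain ⟨t, ⟨i⟩⟩ := Ins.exists_of_mem (List.count_pos_iff.1 (by omega : 0 < L.count a))
    have hi := i.perm.count_eq a
    rw [List.count_cons_self] at hi
    obtain ⟨t', ⟨j⟩⟩ := Ins.exists_of_mem (List.count_pos_iff.1 (by omega : 0 < t.count a))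
    have p : L.Perm (a :: a :: t') := i.perm.trans (j.perm.cons a)
    have hlt : t'.length < L.length := by have := p.length_eq; simp at this; omega
    obtain ⟨g, hg⟩ := Steps.of_perm p
    obtain ⟨g', hg'⟩ := Steps.of_ok t' o ho (ok_iff.2 fun b => by
      have := h b
      rw [List.count_append, p.count_eq] at this
      rw [List.count_append]
      simp only [List.count_cons] at this
      split_ifs at this <;> simp at this <;> omega)
    exact ⟨_, hg.trans ((Step.cap a t').single.trans hg')⟩
termination_by L.length

/-- An equality of nets proved for the open ends `o` may be used in a context: the stack `L` is led
to `o` by moves, and these contribute the same factor to both sides. -/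
theorem E_replace {N N' : List Atom} {o : List ℕ} (ho : o.Nodup) (h : E ζ N o = E ζ N' o)
    {L : List ℕ} (hL : OK (L ++ o)) (hN : OK (labs N L)) (hN' : OK (labs N' L)) :
    E ζ N L = E ζ N' L := by
  obtain ⟨g, hg⟩ := Steps.of_ok L o ho hL
  rw [E_steps hg hN, E_steps hg hN', h]

theorem Steps.pull {a : ℕ} {t t' : List ℕ} (i : Ins a t t') : Steps t (a :: t') i.pull := by
  induction i with
  | here t => exact .refl _
  | there b i ih => exact (ih.there b).trans (Step.sw _ _ _).single

theorem steps_push (l : List ℕ) (s : H 0 l.length) (J ℓ : List ℕ) :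
    ∃ g, Steps (l ++ (J ++ ℓ)) (J ++ (l ++ ℓ)) g ∧ push l s (J ++ ℓ) ⨾ g = under (push l s ℓ) J :=
        by
  induction J with
  | nil => exact ⟨_, .refl _, ZWModAx.comp_id _⟩
  | cons x J ih =>
    obtain ⟨g, hg, e⟩ := ih
    refine ⟨_, (Steps.pull ((Ins.here (J ++ ℓ)).shift l)).trans (hg.there x), ?_⟩
    show push l s (x :: (J ++ ℓ)) ⨾ _ = U (under (push l s ℓ) J)
    rw [← ZWModAx.assoc, push_pull, ← U_comp, e]

theorem E_push_under (A : Atom) (N : List Atom) (J ℓ : List ℕ)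
    (h : OK (labs (A :: N) (J ++ ℓ))) :
    E ζ (A :: N) (J ++ ℓ) = under (push A.l (kst ζ A.k _) ℓ) J ⨾ E ζ N (J ++ (A.l ++ ℓ)) := by
  obtain ⟨g, hg, e⟩ := steps_push A.l (kst ζ A.k _) J ℓ
  rw [E_cons, E_steps hg h, ← ZWModAx.assoc, e]

theorem labs_perm_left {N N' : List Atom} (h : N.Perm N') (ℓ : List ℕ) :
    (labs N ℓ).Perm (labs N' ℓ) := by
  induction h generalizing ℓ with
  | nil => rfl
  | cons A _ ih => exact ih _
  | swap A B N =>
    refine labs_perm N ?_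
    rw [← List.append_assoc, ← List.append_assoc]
    exact List.perm_append_comm.append_right _
  | trans _ _ ih ih' => exact (ih ℓ).trans (ih' ℓ)

theorem E_perm {N N' : List Atom} (h : N.Perm N') {ℓ : List ℕ} (hN : OK (labs N ℓ)) :
    E ζ N ℓ = E ζ N' ℓ := by
  induction h generalizing ℓ with
  | nil => rfl
  | cons A _ ih => rw [E_cons, E_cons, ih hN]
  | swap A B N =>
    have hN' : OK (labs (A :: N) (B.l ++ ℓ)) := hN
    rw [E_cons, E_push_under A N B.l ℓ hN', ← ZWModAx.assoc, ← push_nat, ZWModAx.assoc, E_cons,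
      E_cons]
  | trans p _ ih ih' => rw [ih hN, ih' (hN.perm (labs_perm_left p ℓ))]

/-! ### Renaming labels -/

def Atom.map (φ : ℕ → ℕ) (A : Atom) : Atom := ⟨A.k, A.l.map φ⟩

def Ins.map (φ : ℕ → ℕ) {a : ℕ} : ∀ {t t' : List ℕ}, Ins a t t' →
    Ins (φ a) (t.map φ) (t'.map φ)
  | _, _, .here t => .here (t.map φ)
  | _, _, .there b i => .there (φ b) (i.map φ)

theorem Ins.map_pull_heq (φ : ℕ → ℕ) {a : ℕ} {t t' : List ℕ} (i : Ins a t t') :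
    HEq (i.map φ).pull i.pull := by
  induction i with
  | here t => exact id_heq (by simp)
  | there b i ih =>
    exact comp_heq (by simp) (by simp) (by simp)
      (tensor_heq (by simp) (by simp) rfl rfl ih HEq.rfl) (sgn_heq (by simp))

theorem epn_heq {m n : ℕ} (h : m = n) : HEq (epn m) (epn n) := by subst h; rfl

theorem U_heq {a b a' b' : ℕ} (ha : a = a') (hb : b = b') {f : H a b} {g : H a' b'}
    (h : HEq f g) : HEq (U f) (U g) := tensor_heq ha hb rfl rfl h HEq.rfl

theorem Mt.map (φ : ℕ → ℕ) {ℓ : List ℕ} {f} (h : Mt ℓ f) : ∃ g, Mt (ℓ.map φ) g ∧ HEq g f := by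
  induction h with
  | nil => exact ⟨_, .nil, HEq.rfl⟩
  | cons i h ih =>
    obtain ⟨g, hg, e⟩ := ih
    refine ⟨_, .cons (i.map φ) hg, ?_⟩
    exact comp_heq (by simp) (by simp) rfl (U_heq (by simp) (by simp) (i.map_pull_heq φ))
      (comp_heq (by simp) (by simp) rfl (epn_heq (by simp)) e)

theorem labs_map (φ : ℕ → ℕ) (N : List Atom) (ℓ : List ℕ) :
    labs (N.map (Atom.map φ)) (ℓ.map φ) = (labs N ℓ).map φ := by
  induction N generalizing ℓ with
  | nil => rfl
  | cons A N ih =>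
    show labs (N.map (Atom.map φ)) (A.l.map φ ++ ℓ.map φ) = _
    rw [← List.map_append, ih]
    rfl

theorem kst_heq (k : Kind) {m n : ℕ} (h : m = n) : HEq (kst ζ k m) (kst ζ k n) := by
  subst h; rfl

theorem T_heq {k k' a b a' b' : ℕ} (hk : k = k') (ha : a = a') (hb : b = b') {f : H a b}
    {g : H a' b'} (h : HEq f g) : HEq (T k f) (T k' g) :=
  tensor_heq hk hk ha hb (id_heq hk) h

theorem net_map (φ : ℕ → ℕ) (N : List Atom) (ℓ : List ℕ) :
    HEq (net ζ (N.map (Atom.map φ)) (ℓ.map φ)) (net ζ N ℓ) := by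
  induction N generalizing ℓ with
  | nil => exact id_heq (by simp)
  | cons A N ih =>
    have h1 : ∀ l', l' = (A.l ++ ℓ).map φ →
        HEq (net ζ (N.map (Atom.map φ)) l') (net ζ N (A.l ++ ℓ)) := by
      rintro _ rfl; exact ih _
    refine comp_heq (by simp) (by simp [Atom.map]) ?_ ?_ (h1 _ (by simp [Atom.map]))
    · show (labs ((A :: N).map (Atom.map φ)) (ℓ.map φ)).length = _
      rw [labs_map]; simp
    · refine (push_heq _ _ _).trans (HEq.trans ?_ (push_heq _ _ _).symm)
      exact T_heq (by simp) rfl (by simp [Atom.map]) (kst_heq _ (by simp [Atom.map]))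

/-- Renaming carries a matching of a stack to a matching of the renamed stack, and matchings are
unique. Injectivity of `φ` is not needed, only that labels still occur in pairs. -/
theorem E_map (φ : ℕ → ℕ) (N : List Atom) (ℓ : List ℕ) (h : OK (labs N ℓ))
    (h' : OK (labs (N.map (Atom.map φ)) (ℓ.map φ))) :
    HEq (E ζ (N.map (Atom.map φ)) (ℓ.map φ)) (E ζ N ℓ) := by
  refine comp_heq (by simp) (by rw [labs_map]; simp) rfl (net_map φ N ℓ) ?_
  obtain ⟨g, hg, e⟩ := (mt_spec h).map φ
  have : ∀ l', l' = (labs N ℓ).map φ → OK l' → HEq (mt l') (mt (labs N ℓ)) := by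
    rintro _ rfl hl
    rw [(mt_spec hl).unique hg hl]
    exact e
  exact this _ (labs_map φ N ℓ) h'

end ZW

/-! ### Contraction of lines in a net -/

namespace ZW
open PRO

variable {ζ : ℕ → ℂ}

theorem under_comp {ℓ ℓ' ℓ'' : List ℕ} (f : H ℓ.length ℓ'.length) (g : H ℓ'.length ℓ''.length)
    (J : List ℕ) : under (ℓ' := ℓ'') (f ⨾ g) J = under f J ⨾ under g J := by
  induction J with
  | nil => rfl
  | cons a J ih => exact (congrArg U ih).trans (U_comp _ _)

theorem push_loop (a b : ℕ) (R : List ℕ) :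
    push [a, b] et (a :: b :: R) ⨾ U (sgn (R.length + 1)) ⨾ epn (R.length + 2) ⨾ epn R.length =
      epn R.length := by
  have h1 : U (sgn (R.length + 1)) ⨾ epn (R.length + 2) =
      sgn (R.length + 2) ⨾ U (epn (R.length + 1)) := by
    rw [epn_slide, ← ZWModAx.assoc (sgn _), sgn_sgn, ZWModAx.id_comp]
  have h2 : push [a, b] et (a :: b :: R) = T (R.length + 2) et := eq_of_heq (push_heq _ _ _)
  have h3 : T (R.length + 2) et ⨾ sgn (R.length + 2) = T (R.length + 2) et := by
    unfold sgn
    rw [← T_comp, et_sg]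
  have h4 : T (R.length + 2) et ⨾ U (epn (R.length + 1)) = ZWModAx.id _ := by
    have := congrArg (T (R.length + 1)) snake
    rw [T_comp, T_id, T_U, eq_of_heq (T_T_heq (R.length + 1) 1 et)] at this
    exact this
  rw [← ZWModAx.assoc (U _), h1, h2, ← ZWModAx.assoc, ← ZWModAx.assoc, h3]
  exact (congrArg (ZWModAx.comp · (epn R.length)) h4).trans (ZWModAx.id_comp _)

theorem E_loop (a b : ℕ) (C : List Atom) (J R : List ℕ)
    (h : OK (labs (⟨.e, [a, b]⟩ :: C) (J ++ (a :: b :: R)))) :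
    OK (labs C (J ++ R)) ∧
    E ζ (⟨.e, [a, b]⟩ :: C) (J ++ (a :: b :: R)) =
      under (ℓ := a :: b :: R) (ℓ' := R) (epn R.length) J ⨾ E ζ C (J ++ R) := by
  have s : Steps (a :: b :: a :: b :: R) R
      (U (sgn (R.length + 1)) ⨾ epn (R.length + 2) ⨾ epn R.length) :=
    ((Step.there a (.sw b a (b :: R))).single).trans
      ((Step.cap a (b :: b :: R)).single.trans (Step.cap b R).single)
  obtain ⟨g, hg, -⟩ := steps_push [a, b] et J (a :: b :: R)
  have h1 : OK (labs C (J ++ (a :: b :: a :: b :: R))) := hg.ok (N := C) h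
  refine ⟨(s.under J).ok h1, ?_⟩
  rw [E_push_under _ _ _ _ h]
  show under (push [a, b] et (a :: b :: R)) J ⨾ E ζ C (J ++ (a :: b :: a :: b :: R)) = _
  rw [E_steps (s.under J) h1, ← ZWModAx.assoc, ← under_comp, push_loop]

theorem Step.map (φ : ℕ → ℕ) {ℓ ℓ' : List ℕ} {g} (h : Step ℓ ℓ' g) :
    ∃ g', Step (ℓ.map φ) (ℓ'.map φ) g' ∧ HEq g' g := by
  induction h with
  | sw a b t => exact ⟨_, .sw _ _ _, sgn_heq (by simp)⟩
  | cap a t => exact ⟨_, .cap _ _, epn_heq (by simp)⟩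
  | there x _ ih =>
    obtain ⟨g', h, e⟩ := ih
    exact ⟨_, .there _ h, U_heq (by simp) (by simp) e⟩

theorem Steps.map (φ : ℕ → ℕ) {ℓ ℓ' : List ℕ} {g} (h : Steps ℓ ℓ' g) :
    ∃ g', Steps (ℓ.map φ) (ℓ'.map φ) g' ∧ HEq g' g := by
  induction h with
  | refl => exact ⟨_, .refl _, id_heq (by simp)⟩
  | head h _ ih =>
    obtain ⟨g', h', e⟩ := h.map φ
    obtain ⟨g'', h'', e'⟩ := ih
    exact ⟨_, .head h' h'', comp_heq (by simp) (by simp) (by simp) e e'⟩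

/-- A line from `a` to `b` may be contracted by giving both ends the same label. The line is moved
behind all other vertices; then `a` and `b` occur once each on the stack, and by the snake equation
the line acts as a cap on these two wires. -/
theorem E_line (a b : ℕ) (hab : a ≠ b) (N : List Atom) (ℓ : List ℕ)
    (h : OK (labs (⟨.e, [a, b]⟩ :: N) ℓ))
    (h' : OK (labs (N.map (Atom.map fun x => if x = b then a else x))
      (ℓ.map fun x => if x = b then a else x))) :
    HEq (E ζ (N.map (Atom.map fun x => if x = b then a else x))
      (ℓ.map fun x => if x = b then a else x)) (E ζ (⟨.e, [a, b]⟩ :: N) ℓ) := by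
  set φ : ℕ → ℕ := fun x => if x = b then a else x with hφ
  induction N generalizing ℓ with
  | nil =>
    have ho := ok_iff.1 h
    simp only [labs, List.count_append, List.count_cons, List.count_nil] at ho
    have ha := ho a
    have hb := ho b
    simp [hab.symm] at ha
    simp [hab] at hb
    obtain ⟨t, ⟨i⟩⟩ := Ins.exists_of_mem (List.count_pos_iff.1 (by omega : 0 < ℓ.count a))
    have hi := i.perm.count_eq b
    simp [hab] at hi
    obtain ⟨t', ⟨j⟩⟩ := Ins.exists_of_mem (List.count_pos_iff.1 (by omega : 0 < t.count b))
    have p : ℓ.Perm (a :: b :: t') := i.perm.trans (j.perm.cons a)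
    have hbt : b ∉ t' := by
      have := j.perm.count_eq b
      simp at this
      exact List.count_eq_zero.1 (by omega)
    have ht : t'.map φ = t' := by
      conv_rhs => rw [← List.map_id t']
      refine List.map_congr_left fun x hx => ?_
      have : x ≠ b := fun e => hbt (e ▸ hx)
      simp [hφ, this]
    obtain ⟨g, hg⟩ := Steps.of_perm p
    have hφa : φ a = a := by simp [hφ]
    have hφb : φ b = a := by simp [hφ]
    obtain ⟨g', hg', e⟩ : ∃ g', Steps (ℓ.map φ) (a :: a :: t') g' ∧ HEq g' g := by
      have := hg.map φ
      rwa [List.map_cons, List.map_cons, hφa, hφb, ht] at this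
    have h1 := hg.ok h
    have h2 := hg'.ok (N := []) h'
    have h5 : E ζ [⟨.e, [a, b]⟩] (a :: b :: t') = epn _ ⨾ E ζ [] t' := (E_loop a b [] [] t' h1).2
    rw [E_steps hg h, h5]
    show HEq (E ζ [] (ℓ.map φ)) _
    have h6 : E ζ [] (ℓ.map φ) = g' ⨾ epn _ ⨾ E ζ [] t' := by
      rw [E_steps (N := []) hg' h', E_cap [] h2]
    rw [h6]
    exact comp_heq (by simp) (by simp) rfl e HEq.rfl
  | cons A N ih =>
    have hp : (⟨.e, [a, b]⟩ :: A :: N : List Atom).Perm (A :: ⟨.e, [a, b]⟩ :: N) :=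
      List.Perm.swap _ _ _
    have h1 : OK (labs (A :: ⟨.e, [a, b]⟩ :: N) ℓ) := h.perm (labs_perm_left hp ℓ)
    rw [E_perm hp h, E_cons]
    have h2 : OK (labs (N.map (Atom.map φ)) ((A.l ++ ℓ).map φ)) := by
      rw [List.map_append]; exact h'
    have h3 := ih (A.l ++ ℓ) h1 h2
    have h4 : ∀ l', l' = (A.l ++ ℓ).map φ →
        HEq (E ζ (N.map (Atom.map φ)) l') (E ζ (⟨.e, [a, b]⟩ :: N) (A.l ++ ℓ)) := by
      rintro _ rfl; exact h3
    show HEq (E ζ (A.map φ :: N.map (Atom.map φ)) (ℓ.map φ)) _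
    rw [E_cons]
    refine comp_heq (by simp) (by simp [Atom.map]) rfl ?_ (h4 _ (by simp [Atom.map]))
    refine (push_heq _ _ _).trans (HEq.trans ?_ (push_heq _ _ _).symm)
    exact T_heq (by simp) rfl (by simp [Atom.map]) (kst_heq _ (by simp [Atom.map]))

/-! ### From diagrams to nets -/

/-- Operations for diagrams with vertices of all kinds. -/
inductive Sg : ℕ → ℕ → Type
  | sw : Sg 2 2
  | cap : Sg 2 0
  | st (k : Kind) (n : ℕ) : Sg 0 n

noncomputable def sgVal (ζ : ℕ → ℂ) : ∀ {m n : ℕ}, Sg m n → H m n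
  | _, _, .sw => sg
  | _, _, .cap => ep
  | _, _, .st k n => kst ζ k n

/-- The value of a diagram. -/
noncomputable def dval (ζ : ℕ → ℂ) {m n : ℕ} (D : DTerm Sg m n) : H m n :=
  DTerm.eval ZWModAx (sgVal ζ) D

/-- Labels of the outputs, vertices, and first unused label for a diagram whose inputs have the
labels `I`. -/
def run : ∀ {m n : ℕ}, DTerm Sg m n → ℕ → List ℕ → List ℕ × List Atom × ℕ
  | _, _, .gen .sw, c, I => (I.reverse, [], c)
  | _, _, .gen .cap, c, I => ([], [⟨.e, I⟩], c)
  | _, _, .gen (.st k n), c, _ => (List.range' c n, [⟨k, List.range' c n⟩], c + n)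
  | _, _, .id _, c, I => (I, [], c)
  | _, _, .comp f g, c, I =>
    let r := run f c I
    let s := run g r.2.2 r.1
    (s.1, r.2.1 ++ s.2.1, s.2.2)
  | _, _, .tensor (m' := m') f g, c, I =>
    let r := run f c (I.drop m')
    let s := run g r.2.2 (I.take m')
    (s.1 ++ r.1, r.2.1 ++ s.2.1, s.2.2)

theorem labs_append (N C : List Atom) (ℓ : List ℕ) : labs (N ++ C) ℓ = labs C (labs N ℓ) := by
  induction N generalizing ℓ with
  | nil => rfl
  | cons A N ih => exact ih _

theorem V_heq {a b k a' b' k' : ℕ} (ha : a = a') (hb : b = b') (hk : k = k') {f : H a b}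
    {g : H a' b'} (h : HEq f g) : HEq (V f k) (V g k') := by
  subst ha hb hk
  rw [eq_of_heq h]

theorem V_id (a k : ℕ) : V (ZWModAx.id a) k = ZWModAx.id (a + k) := by
  rw [V_eq]; exact ZWModAx.tensor_id _ _

theorem V_V_heq {a b : ℕ} (f : H a b) (j k : ℕ) : HEq (V (V f j) k) (V f (j + k)) := by
  induction k with
  | zero => rfl
  | succ k ih => exact U_heq (Nat.add_assoc _ _ _) (Nat.add_assoc _ _ _) ih

/-- The statement allows arbitrary wires `R` on the left, `J` on the right and a remaining net `C`,
since this is what the induction needs: in a tensor product each factor becomes part of the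
surroundings of the other. The morphism `x` is the value of the rest of the net. Labels are read
from right to left, which explains the order of the lists. -/
theorem run_spec {m n : ℕ} (D : DTerm Sg m n) (c : ℕ) (I : List ℕ) (hI : I.length = m) :
    (run D c I).1.length = n ∧ ∀ (R J : List ℕ) (C : List Atom) (r j : ℕ), R.length = r →
      J.length = j → OK (labs ((run D c I).2.1 ++ C) (J ++ (I ++ R))) →
      OK (labs C (J ++ ((run D c I).1 ++ R))) ∧
      ∀ x : H (r + n + j) 0, HEq x (E ζ C (J ++ ((run D c I).1 ++ R))) →
        HEq (V (T r (dval ζ D)) j ⨾ x) (E ζ ((run D c I).2.1 ++ C) (J ++ (I ++ R))) := by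
  induction D generalizing c I with
  | gen t =>
    cases t with
    | sw =>
      obtain ⟨a, b, rfl⟩ := List.length_eq_two.1 hI
      refine ⟨rfl, fun R J C r j hr hj h => ?_⟩
      subst hr hj
      have s := (Step.sw a b R).single.under J
      refine ⟨s.ok h, fun x hx => ?_⟩
      refine HEq.trans ?_ (heq_of_eq (E_steps s h).symm)
      exact comp_heq (by simp; omega) (by simp; omega) rfl
        (under_heq (ℓ := a :: b :: R) (ℓ' := b :: a :: R) _ J).symm hx
    | cap =>
      obtain ⟨a, b, rfl⟩ := List.length_eq_two.1 hI
      refine ⟨rfl, fun R J C r j hr hj h => ?_⟩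
      subst hr hj
      obtain ⟨h1, h2⟩ := E_loop (ζ := ζ) a b C J R h
      refine ⟨h1, fun x hx => ?_⟩
      refine HEq.trans ?_ (heq_of_eq h2.symm)
      exact comp_heq (by simp; omega) (by simp; omega) rfl
        (under_heq (ℓ := a :: b :: R) (ℓ' := R) _ J).symm hx
    | st k =>
      rename_i n
      obtain rfl := List.length_eq_zero_iff.1 hI
      refine ⟨by simp [run], fun R J C r j hr hj h => ?_⟩
      subst hr hj
      obtain ⟨g, hg, -⟩ := steps_push (List.range' c n) (kst ζ k _) J R
      refine ⟨hg.ok (N := C) h, fun x hx => ?_⟩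
      refine HEq.trans ?_ (heq_of_eq (E_push_under ⟨k, List.range' c n⟩ C J R h).symm)
      refine comp_heq (by simp; omega) (by simp; omega) rfl ?_ hx
      refine HEq.trans ?_ (under_heq _ J).symm
      refine V_heq rfl (by simp; omega) rfl ?_
      exact (T_heq rfl rfl (by simp) (kst_heq k (by simp))).trans (push_heq _ _ _).symm
  | id n =>
    refine ⟨hI, fun R J C r j hr hj h => ⟨h, fun x hx => ?_⟩⟩
    have e : V (T r (dval ζ (DTerm.id n))) j = ZWModAx.id (r + n + j) := by
      show V (T r (ZWModAx.id n)) j = _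
      rw [T_id, V_id]
    rw [e, ZWModAx.id_comp]
    exact hx
  | comp f g hf hg =>
    obtain ⟨hf1, hf2⟩ := hf c I hI
    obtain ⟨hg1, hg2⟩ := hg (run f c I).2.2 (run f c I).1 hf1
    refine ⟨hg1, fun R J C r j hr hj h => ?_⟩
    have h : OK (labs (((run f c I).2.1 ++ (run g (run f c I).2.2 (run f c I).1).2.1) ++ C)
      (J ++ (I ++ R))) := h
    rw [List.append_assoc] at h
    obtain ⟨h1, h2⟩ := hf2 R J _ r j hr hj h
    obtain ⟨h3, h4⟩ := hg2 R J _ r j hr hj h1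
    refine ⟨h3, fun x hx => ?_⟩
    have h5 := h2 _ (h4 x hx)
    have e : V (T r (dval ζ (DTerm.comp f g))) j ⨾ x =
        V (T r (dval ζ f)) j ⨾ V (T r (dval ζ g)) j ⨾ x := by
      show V (T r (dval ζ f ⨾ dval ζ g)) j ⨾ x = _
      rw [T_comp, V_comp, ZWModAx.assoc]
    rw [e]
    refine h5.trans ?_
    show HEq _ (E ζ (((run f c I).2.1 ++ _) ++ C) _)
    rw [List.append_assoc]
  | @tensor m n m' n' f g hf hg =>
    have hd : (I.drop m').length = m := by simp [hI]
    have ht : (I.take m').length = m' := by simp [hI]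
    obtain ⟨hf1, hf2⟩ := hf c (I.drop m') hd
    obtain ⟨hg1, hg2⟩ := hg (run f c (I.drop m')).2.2 (I.take m') ht
    set rf := run f c (I.drop m') with hrf
    set rg := run g rf.2.2 (I.take m') with hrg
    have hrun : run (DTerm.tensor f g) c I = (rg.1 ++ rf.1, rf.2.1 ++ rg.2.1, rg.2.2) := rfl
    rw [hrun]
    refine ⟨by simp [hf1, hg1, Nat.add_comm], fun R J C r j hr hj h => ?_⟩
    dsimp only at h ⊢
    have eI : J ++ (I ++ R) = (J ++ I.take m') ++ (I.drop m' ++ R) := by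
      rw [List.append_assoc, ← List.append_assoc (I.take m'), List.take_append_drop]
    rw [eI, List.append_assoc] at h
    rw [eI, List.append_assoc rf.2.1, List.append_assoc rg.1]
    obtain ⟨h1, h2⟩ := hf2 R (J ++ I.take m') _ r (m' + j) hr
      (by simp [hI, hj, Nat.add_comm]) h
    rw [List.append_assoc] at h1 h2
    obtain ⟨h3, h4⟩ := hg2 (rf.1 ++ R) J C (r + n) j (by simp [hf1, hr, Nat.add_comm]) hj h1
    refine ⟨h3, fun x hx => ?_⟩
    have e1 : r + (n + n') + j = r + n + n' + j := by omega
    have hx' : HEq (cast (congrArg (fun k => H k 0) e1) x) x := cast_heq _ _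
    have h5 := h4 _ (hx'.trans hx)
    have e2 : r + n + m' + j = r + n + (m' + j) := by omega
    have hy : ∀ y : H (r + n + m' + j) 0, HEq (cast (congrArg (fun k => H k 0) e2) y) y :=
      fun y => cast_heq _ _
    have h6 := h2 _ ((hy _).trans h5)
    refine HEq.trans ?_ h6
    have key : HEq (T r (dval ζ f ⊠ dval ζ g)) (V (T r (dval ζ f)) m' ⨾ T (r + n) (dval ζ g)) := by
      rw [← tensor_eq_V]
      exact (ZWModAx.tensor_assoc (ZWModAx.id r) (dval ζ f) (dval ζ g)).symm
    have e3 : HEq (V (T r (dval ζ (DTerm.tensor f g))) j)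
        (V (V (T r (dval ζ f)) m') j ⨾ V (T (r + n) (dval ζ g)) j) := by
      rw [← V_comp]
      exact V_heq (by omega) (by omega) rfl key
    refine (comp_heq (by omega) (by omega) rfl e3 hx'.symm).trans ?_
    rw [ZWModAx.assoc]
    exact comp_heq (by omega) (by omega) rfl (V_V_heq _ _ _) (hy _).symm

end ZW

/-! ### Outputs bent down -/

namespace ZW
open PRO

variable {ζ : ℕ → ℂ}

theorem T_V_heq (n k : ℕ) {a b : ℕ} (f : H a b) : HEq (T n (V f k)) (V (T n f) k) := by
  induction k with
  | zero => rfl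
  | succ k ih =>
    exact (heq_of_eq (T_U n (V f k))).trans
      (U_heq (Nat.add_assoc _ _ _).symm (Nat.add_assoc _ _ _).symm ih)

def capIn (k : ℕ) : H (k + 1 + (k + 1)) (k + k) :=
  cast (by rw [show k + 1 + (k + 1) = k + 2 + k by omega]; rfl) (V (T k ep) k)

theorem capIn_heq (k : ℕ) : HEq (capIn k) (V (T k ep) k) := cast_heq _ _

/-- Nested caps. -/
def nest : ∀ n, H (n + n) 0
  | 0 => ZWModAx.id 0
  | k + 1 => capIn k ⨾ nest k

/-- Nested caps lose no information: the outputs were bent down one at a time, and each is bent back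
by a cup, using the mirrored snake equation `snake'`. -/
theorem nest_inj {m n : ℕ} {f g : H m n} (h : T n f ⨾ nest n = T n g ⨾ nest n) : f = g := by
  induction n generalizing m with
  | zero =>
    have e : ∀ f : H m 0, HEq (T 0 f ⨾ nest 0) f := fun f => by
      show HEq (T 0 f ⨾ ZWModAx.id 0) f
      exact (heq_of_eq (ZWModAx.comp_id _)).trans (T_zero_heq f)
    exact eq_of_heq ((e f).symm.trans ((heq_of_eq h).trans (e g)))
  | succ k ih =>
    obtain ⟨c, hc⟩ : ∃ c : H (1 + (k + 1)) k, HEq c (V ep k) :=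
      ⟨cast (by rw [show 1 + (k + 1) = 2 + k by omega, show (0 : ℕ) + k = k by omega]) (V ep k),
        cast_heq _ _⟩
    have e1 : ∀ f : H m (k + 1), HEq (T (k + 1) f ⨾ nest (k + 1)) (T k (T 1 f ⨾ c) ⨾ nest k) := by
      intro f
      rw [T_comp, ZWModAx.assoc]
      refine comp_heq (by omega) (by omega) rfl (T_T_heq k 1 f).symm ?_
      refine comp_heq (by omega) rfl rfl ((capIn_heq k).trans ?_) HEq.rfl
      refine (T_V_heq k k ep).symm.trans ?_
      exact T_heq rfl (by omega) (by omega) hc.symm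
    have e2 := ih (eq_of_heq ((e1 f).symm.trans ((heq_of_eq h).trans (e1 g))))
    obtain ⟨d, hd⟩ : ∃ d : H (2 + (k + 1)) (1 + k), HEq d (V (T 1 ep) k) :=
      ⟨cast (by rw [show 2 + (k + 1) = 1 + 2 + k by omega]) (V (T 1 ep) k), cast_heq _ _⟩
    have e3 : ∀ f : H m (k + 1), HEq (V et m ⨾ T 2 f ⨾ d) f := by
      intro f
      have h1 : V et m ⨾ T 2 f = T 0 f ⨾ V et (k + 1) := V_T et f
      have h2 : HEq (V et (k + 1)) (V (V et 1) k) := by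
        exact HEq.trans (V_heq rfl rfl (Nat.add_comm k 1) HEq.rfl) (V_V_heq et 1 k).symm
      have h3 : V (V et 1) k ⨾ V (T 1 ep) k = ZWModAx.id (1 + k) := by
        rw [← V_comp]
        show V (U et ⨾ T 1 ep) k = _
        rw [snake', V_id]
      rw [← ZWModAx.assoc, h1, ZWModAx.assoc]
      have h4 : HEq (T 0 f ⨾ V et (k + 1) ⨾ d) (f ⨾ ZWModAx.id (k + 1)) := by
        refine comp_heq (by omega) (by omega) (by omega) (T_zero_heq f) ?_
        refine HEq.trans (comp_heq (by omega) (by omega) rfl h2 hd) ?_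
        exact (heq_of_eq h3).trans (id_heq (by omega))
      rwa [ZWModAx.comp_id] at h4
    have e4 : ∀ f : H m (k + 1), HEq (T 1 (T 1 f ⨾ c)) (T 2 f ⨾ d) := by
      intro f
      rw [T_comp]
      refine comp_heq (by omega) (by omega) (by omega) (T_T_heq 1 1 f) ?_
      exact ((T_heq rfl (by omega) (by omega) hc).trans (T_V_heq 1 k ep)).trans hd.symm
    have e5 : T 2 f ⨾ d = T 2 g ⨾ d :=
      eq_of_heq ((e4 f).symm.trans ((heq_of_eq (congrArg (T 1) e2)).trans (e4 g)))
    refine eq_of_heq ((e3 f).symm.trans (HEq.trans ?_ (e3 g)))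
    rw [e5]

def lines (O R : List ℕ) : List Atom := List.zipWith (fun o r => Atom.mk .e [o, r]) O R

theorem E_lines (n : ℕ) (O R : List ℕ) (hO : O.length = n) (hR : R.length = n)
    (h : OK (labs (lines O R) (O ++ R.reverse))) :
    HEq (nest n) (E ζ (lines O R) (O ++ R.reverse)) := by
  induction n generalizing O R with
  | zero =>
    obtain rfl := List.length_eq_zero_iff.1 hO
    obtain rfl := List.length_eq_zero_iff.1 hR
    refine heq_of_eq ?_
    show ZWModAx.id 0 = ZWModAx.id 0 ⨾ mt []
    rw [ZWModAx.id_comp]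
    exact Mt.unique .nil (mt_spec h) h
  | succ k ih =>
    obtain ⟨O, o, rfl⟩ := List.eq_nil_or_concat O |>.resolve_left (by rintro rfl; simp at hO)
    obtain ⟨R, r, rfl⟩ := List.eq_nil_or_concat R |>.resolve_left (by rintro rfl; simp at hR)
    simp only [List.concat_eq_append, List.length_append, List.length_singleton,
      Nat.add_right_cancel_iff] at hO hR
    have e1 : lines (O.concat o) (R.concat r) = lines O R ++ [Atom.mk .e [o, r]] := by
      simp only [List.concat_eq_append, lines]
      rw [List.zipWith_append (by rw [hO, hR])]
      rfl
    have e2 : O.concat o ++ (R.concat r).reverse = O ++ (o :: r :: R.reverse) := by simp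
    rw [e1, e2] at h ⊢
    have p : (lines O R ++ [Atom.mk .e [o, r]]).Perm (Atom.mk .e [o, r] :: lines O R) :=
      List.perm_append_comm
    rw [E_perm p h]
    have h' := h.perm (labs_perm_left p _)
    obtain ⟨h1, h2⟩ := E_loop (ζ := ζ) o r (lines O R) O R.reverse h'
    rw [h2]
    refine comp_heq (by simp; omega) (by simp; omega) rfl ?_ (ih O R hO hR h1)
    refine (capIn_heq k).trans (HEq.trans ?_ (under_heq _ O).symm)
    exact V_heq (by simp; omega) (by simp; omega) hO.symm (epn_heq (m := k) (by simp [hR]))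

/-- The net of a diagram, with inputs and outputs numbered from right to left. -/
def netOf {m n : ℕ} (D : DTerm Sg m n) : List Atom :=
  (run D (m + n) (List.range m)).2.1 ++
    lines (run D (m + n) (List.range m)).1 (List.range' m n)

/-- The stack of open ends of the net of a diagram. -/
def ends (m n : ℕ) : List ℕ := List.range m ++ (List.range' m n).reverse

theorem netOf_spec {m n : ℕ} (D : DTerm Sg m n) (h : OK (labs (netOf D) (ends m n))) :
    HEq (T n (dval ζ D) ⨾ nest n) (E ζ (netOf D) (ends m n)) := by
  obtain ⟨h1, h2⟩ := run_spec (ζ := ζ) D (m + n) (List.range m) (by simp)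
  obtain ⟨h3, h4⟩ := h2 (List.range' m n).reverse [] _ n 0 (by simp) rfl h
  exact h4 (nest n) (E_lines n _ _ h1 (by simp) h3)

/-- The bridge between diagrams and nets: the effect of the net is the diagram with its outputs bent
down, and bending is injective. -/
theorem dval_eq_iff {m n : ℕ} {D D' : DTerm Sg m n} (h : OK (labs (netOf D) (ends m n)))
    (h' : OK (labs (netOf D') (ends m n))) :
    dval ζ D = dval ζ D' ↔ E ζ (netOf D) (ends m n) = E ζ (netOf D') (ends m n) := by
  have e := netOf_spec (ζ := ζ) D h
  have e' := netOf_spec (ζ := ζ) D' h'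
  constructor
  · intro hd
    rw [hd] at e
    exact eq_of_heq (e.symm.trans e')
  · intro hd
    rw [hd] at e
    exact nest_inj (eq_of_heq (e.trans e'.symm))

end ZW

namespace ZW
open PRO

variable {ζ : ℕ → ℂ}

/-! ### Rewriting nets -/

/-- Transposition of the entries at the positions `i` and `i + 1`. -/
def swapAt : ℕ → List ℕ → List ℕ
  | 0, a :: b :: t => b :: a :: t
  | i + 1, a :: t => a :: swapAt i t
  | _, l => l

def sortAt (i : ℕ) (l : List ℕ) : List ℕ := if l.getD i 0 ≤ l.getD (i + 1) 0 then l else swapAt i l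

def flipOuter : List ℕ → List ℕ
  | [a, b, c, d] => [c, b, a, d]
  | l => l

def flipInner : List ℕ → List ℕ
  | [a, b, c, d] => [a, d, c, b]
  | l => l

def flipBoth : List ℕ → List ℕ
  | [a, b, c, d] => [b, a, d, c]
  | l => l

def sortOuter (l : List ℕ) : List ℕ := if l.getD 0 0 ≤ l.getD 2 0 then l else flipOuter l

def sortInner (l : List ℕ) : List ℕ := if l.getD 1 0 ≤ l.getD 3 0 then l else flipInner l

def sortBoth (l : List ℕ) : List ℕ := if l.getD 0 0 ≤ l.getD 1 0 then l else flipBoth l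

/-- A normal form of the legs of a vertex up to symmetry; the symmetries known are
those of the stage `s`. -/
def canL (s : ℕ) (k : Kind) (l : List ℕ) : List ℕ :=
  match k with
  | .e | .n | .p _ => if l.length = 2 then sortAt 0 l else l
  | .b => if l.length = 3 then sortAt 0 (sortAt 1 (sortAt 0 l)) else l
  | .d => if l.length = 3 ∧ 1 ≤ s then sortAt 0 l else l
  | .c => if l.length = 2 ∧ 2 ≤ s then sortAt 0 l else l
  | .z =>
    if l.length = 4 ∧ 2 ≤ s then sortBoth (sortInner (sortOuter l)) else l
  | .w =>
    if l.length = 4 ∧ 3 ≤ s then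
      sortAt 0 (sortAt 1 (sortAt 2 (sortAt 0 (sortAt 1 (sortAt 0 l)))))
    else l
  | _ => l

def can (s : ℕ) (A : Atom) : Atom := ⟨A.k, canL s A.k A.l⟩

def insertions (a : ℕ) : List ℕ → List (List ℕ)
  | [] => [[a]]
  | b :: l => (a :: b :: l) :: (insertions a l).map (b :: ·)

def arrangements : List ℕ → List (List ℕ)
  | [] => [[]]
  | a :: l => (arrangements l).flatMap (insertions a)

/-- All arrangements of the legs related by the symmetries known at the stage `s`. -/
def variants (s : ℕ) (k : Kind) (l : List ℕ) : List (List ℕ) :=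
  match k with
  | .e | .n | .p _ => [l, swapAt 0 l]
  | .b => arrangements l
  | .d => if 1 ≤ s then [l, swapAt 0 l] else [l]
  | .c => if 2 ≤ s then [l, swapAt 0 l] else [l]
  | .z =>
    if 2 ≤ s then
      let v := [l, flipOuter l]
      let v := v ++ v.map flipInner
      v ++ v.map flipBoth
    else [l]
  | .w => if 3 ≤ s then arrangements l else [l]
  | _ => [l]

def bind1 (x y : ℕ) (σ : List (ℕ × ℕ)) : Option (List (ℕ × ℕ)) :=
  match σ.lookup x with
  | some y' => if y = y' then some σ else none
  | none => if σ.any (fun q => q.2 == y) then none else some ((x, y) :: σ)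

def bindL : List ℕ → List ℕ → List (ℕ × ℕ) → Option (List (ℕ × ℕ))
  | [], [], σ => some σ
  | x :: l, y :: l', σ => (bind1 x y σ).bind (bindL l l')
  | _, _, _ => none

/-- The ways of matching the vertices in the first list with vertices of the second. -/
def search (s : ℕ) : List Atom → List Atom → List (ℕ × ℕ) → List (List (ℕ × ℕ))
  | [], _, σ => [σ]
  | P :: ps, M, σ => M.flatMap fun A =>
      if P.k = A.k then
        (variants s P.k P.l).flatMap fun l =>
          match bindL l A.l σ with
          | some σ' => search s ps (M.erase A) σ'
          | none => []
      else []

/-- Labels bound by the search are renamed as found. The shift by `d` makes the other labels of a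
rule, those internal to its right side, fresh. -/
def app (σ : List (ℕ × ℕ)) (d x : ℕ) : ℕ := (σ.lookup x).getD (x + d)

/-- A rule replaces the vertices `l` by `r`; the open ends of both are `o`. -/
structure Rule where
  l : List Atom
  r : List Atom
  o : List ℕ

def Rule.symm (R : Rule) : Rule := ⟨R.r, R.l, R.o⟩

def Rule.Sound (ζ : ℕ → ℂ) (R : Rule) : Prop := E ζ R.l R.o = E ζ R.r R.o

def rename (φ : ℕ → ℕ) (N : List Atom) : List Atom := N.map (Atom.map φ)

/-- The result of a rule at a place given by a renaming. -/
def rewriteAt (s : ℕ) (R : Rule) (ℓ : List ℕ) (φ : ℕ → ℕ) (M : List Atom) : Option (List Atom) :=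
  let L' := (rename φ R.l).map (can s)
  let M' := M.map (can s)
  let C := M'.diff L'
  if M'.Perm (C ++ L') ∧ OK (labs R.l R.o) ∧ OK (labs R.r R.o) ∧ (R.o.map φ).Nodup ∧
      OK (labs (rename φ R.l) (R.o.map φ)) ∧ OK (labs (rename φ R.r) (R.o.map φ)) ∧
      OK (labs C ℓ ++ R.o.map φ) ∧ OK (labs M ℓ) ∧ OK (labs (C ++ rename φ R.r) ℓ) then
    some (C ++ rename φ R.r)
  else none

def maxLabel (N : List Atom) : ℕ := N.foldr (fun A m => A.l.foldr max m) 0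

/-- The search needs no proof of correctness, because `rewriteAt` checks every condition on which
its soundness rests. -/
def rewrite (s : ℕ) (R : Rule) (ℓ : List ℕ) (σ : List (ℕ × ℕ)) (M : List Atom) :
    Option (List Atom) :=
  match search s R.l M σ with
  | [] => none
  | σ :: _ => rewriteAt s R ℓ (app σ (maxLabel M + 1)) M

def subst (a b x : ℕ) : ℕ := if x = b then a else x

/-- Removal of the line `A` if one of its ends is not an open end. -/
def removeLine (ℓ : List ℕ) (A : Atom) (N : List Atom) : Option (List Atom) :=
  match A with
  | ⟨.e, [a, b]⟩ =>
    if a = b then none else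
    -- Open ends must keep their labels, so the label that disappears is not an open end; a line
    -- between two open ends is refused by the last check.
    let N' := if b ∈ ℓ then rename (subst b a) (N.erase A) else rename (subst a b) (N.erase A)
    if A ∈ N ∧ OK (labs N ℓ) ∧ OK (labs N' ℓ) ∧ (b ∈ ℓ → a ∉ ℓ) then some N' else none
  | _ => none

def removeLines (ℓ : List ℕ) : ℕ → List Atom → List Atom
  | 0, N => N
  | k + 1, N =>
    match N.findSome? fun A => removeLine ℓ A N with
    | some N' => removeLines ℓ k N'
    | none => N

def norm (ℓ : List ℕ) (N : List Atom) : List Atom := removeLines ℓ N.length N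

/-- Insertion of a line at the leg `j` of the vertex `i`. -/
def cut (ℓ : List ℕ) (i j : ℕ) (N : List Atom) : Option (List Atom) :=
  match N[i]? with
  | none => none
  | some A =>
    let a := A.l.getD j 0
    let b := max (maxLabel N) (ℓ.foldr max 0) + 1
    let N' := N.set i ⟨A.k, A.l.set j b⟩
    if rename (subst a b) N' = N ∧ a ≠ b ∧ b ∉ ℓ ∧ OK (labs (⟨.e, [a, b]⟩ :: N') ℓ) ∧
      OK (labs N ℓ) then some (⟨.e, [a, b]⟩ :: N') else none

def cuts (ℓ : List ℕ) : List (ℕ × ℕ) → List Atom → Option (List Atom)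
  | [], N => some N
  | (i, j) :: t, N => (cut ℓ i j N).bind (cuts ℓ t)

/-- A step of a derivation: a rule, constraints on the place of its use, and lines to be
inserted beforehand. -/
structure Move where
  R : Rule
  σ : List (ℕ × ℕ) := []
  c : List (ℕ × ℕ) := []

def exec (s : ℕ) (ℓ : List ℕ) : List Move → List Atom → Option (List Atom)
  | [], N => some N
  | m :: t, N =>
    (cuts ℓ m.c N).bind fun N => (rewrite s m.R ℓ m.σ N).bind fun N => exec s ℓ t (norm ℓ N)

/-- Equality of nets up to symmetry and renaming. -/
def alpha (s : ℕ) (ℓ : List ℕ) (N N' : List Atom) : Bool :=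
  match search s N N' (ℓ.dedup.map fun x => (x, x)) with
  | [] => false
  | σ :: _ =>
    let φ := app σ (maxLabel N' + 1)
    decide (ℓ.map φ = ℓ ∧ ((rename φ N).map (can s)).Perm (N'.map (can s)) ∧ OK (labs N ℓ) ∧
      OK (labs (rename φ N) ℓ) ∧ OK (labs N' ℓ))

def proves (s : ℕ) {m n : ℕ} (D D' : DTerm Sg m n) (t t' : List Move) : Bool :=
  let ℓ := ends m n
  decide (OK (labs (netOf D) ℓ)) && decide (OK (labs (netOf D') ℓ)) &&
  match exec s ℓ t (norm ℓ (netOf D)), exec s ℓ t' (norm ℓ (netOf D')) with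
  | some N, some N' => alpha s ℓ N N'
  | _, _ => false

def ruleOf {m n : ℕ} (D D' : DTerm Sg m n) : Rule :=
  ⟨norm (ends m n) (netOf D), norm (ends m n) (netOf D'), ends m n⟩

/-! Soundness -/

/-- Nets with the same effect. -/
def Same (ζ : ℕ → ℂ) (ℓ : List ℕ) (N N' : List Atom) : Prop :=
  OK (labs N ℓ) → OK (labs N' ℓ) ∧ E ζ N ℓ = E ζ N' ℓ

theorem Same.refl (ℓ : List ℕ) (N : List Atom) : Same ζ ℓ N N := fun h => ⟨h, rfl⟩

theorem Same.trans {ℓ : List ℕ} {N N' N'' : List Atom} (h : Same ζ ℓ N N')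
    (h' : Same ζ ℓ N' N'') : Same ζ ℓ N N'' := fun hN =>
  ⟨(h' (h hN).1).1, (h hN).2.trans (h' (h hN).1).2⟩

/-- The arrangements `l` and `l'` of the legs of a vertex are equivalent. -/
def Inv (ζ : ℕ → ℂ) (k : Kind) (l l' : List ℕ) : Prop :=
  l.Perm l' ∧ ∀ N ℓ, OK (labs (⟨k, l⟩ :: N) ℓ) → E ζ (⟨k, l⟩ :: N) ℓ = E ζ (⟨k, l'⟩ :: N) ℓ

theorem Inv.refl (k : Kind) (l : List ℕ) : Inv ζ k l l := ⟨List.Perm.refl _, fun _ _ _ => rfl⟩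

theorem labs_cons_perm {k : Kind} {l l' : List ℕ} (p : l.Perm l') (N : List Atom) (ℓ : List ℕ) :
    (labs (⟨k, l⟩ :: N) ℓ).Perm (labs (⟨k, l'⟩ :: N) ℓ) := labs_perm N (p.append_right ℓ)

theorem Inv.trans {k : Kind} {l l' l'' : List ℕ} (h : Inv ζ k l l') (h' : Inv ζ k l' l'') :
    Inv ζ k l l'' :=
  ⟨h.1.trans h'.1, fun N ℓ hN =>
    (h.2 N ℓ hN).trans (h'.2 N ℓ (hN.perm (labs_cons_perm h.1 N ℓ)))⟩

/-- The symmetries of `d`, those of `c` and `z`, and those of `w` are available from stage 1, 2 and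
3 on. Each is derived with a lower stage that is already known to be sound, which avoids
circularity. -/
def CanSound (ζ : ℕ → ℂ) (s : ℕ) : Prop := ∀ k l, Inv ζ k l (canL s k l)

theorem CanSound.same {s : ℕ} (hs : CanSound ζ s) (N : List Atom) (ℓ : List ℕ) :
    Same ζ ℓ N (N.map (can s)) := by
  induction N generalizing ℓ with
  | nil => exact Same.refl _ _
  | cons A N ih =>
    intro h
    obtain ⟨p, hA⟩ := hs A.k A.l
    have h1 := h.perm (labs_cons_perm (k := A.k) p N ℓ)
    obtain ⟨h2, h3⟩ := ih _ h1
    refine ⟨h2, (hA N ℓ h).trans ?_⟩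
    rw [List.map_cons, E_cons, E_cons, h3]
    rfl

theorem CanSound.same_of_perm {s : ℕ} (hs : CanSound ζ s) {N N' : List Atom} {ℓ : List ℕ}
    (p : (N.map (can s)).Perm (N'.map (can s))) (h : OK (labs N ℓ)) (h' : OK (labs N' ℓ)) :
    E ζ N ℓ = E ζ N' ℓ := by
  obtain ⟨h1, h2⟩ := hs.same N ℓ h
  rw [h2, (hs.same N' ℓ h').2, E_perm p h1]

theorem CanSound.map_map_can {s : ℕ} (hs : CanSound ζ s) (C N : List Atom) (ℓ : List ℕ)
    (h : OK (labs (C ++ N) ℓ)) :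
    OK (labs (C ++ N.map (can s)) ℓ) ∧ E ζ (C ++ N) ℓ = E ζ (C ++ N.map (can s)) ℓ := by
  induction C generalizing ℓ with
  | nil => exact hs.same N ℓ h
  | cons A C ih =>
    obtain ⟨h1, h2⟩ := ih _ h
    refine ⟨h1, ?_⟩
    rw [List.cons_append, List.cons_append, E_cons, E_cons, h2]

theorem E_append_congr (C : List Atom) {N N' : List Atom} {ℓ : List ℕ}
    (h : E ζ N (labs C ℓ) = E ζ N' (labs C ℓ)) : E ζ (C ++ N) ℓ = E ζ (C ++ N') ℓ := by
  induction C generalizing ℓ with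
  | nil => exact h
  | cons A C ih => rw [List.cons_append, List.cons_append, E_cons, E_cons, ih h]

/-- Up to symmetries of the vertices, `M` consists of the context `C` and the renamed left side of
the rule. The rule is renamed by `E_map`, and then used on the stack that `C` leaves behind by
`E_replace`. -/
theorem rewriteAt_same {s : ℕ} (hs : CanSound ζ s) {R : Rule} (hR : R.Sound ζ) {ℓ : List ℕ}
    {φ : ℕ → ℕ} {M M' : List Atom} (h : rewriteAt s R ℓ φ M = some M') : Same ζ ℓ M M' := by
  unfold rewriteAt at h
  set L := rename φ R.l with hL
  set C := (M.map (can s)).diff (L.map (can s)) with hC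
  dsimp only at h
  split_ifs at h with hc
  obtain rfl := Option.some.inj h
  obtain ⟨p, h1, h2, h3, h4, h5, h6, h7, h8⟩ := hc
  refine fun _ => ⟨h8, ?_⟩
  obtain ⟨k1, k2⟩ := hs.same M ℓ h7
  have k3 := k1.perm (labs_perm_left p ℓ)
  have k4 : OK (labs (C ++ L) ℓ) := by
    refine k3.perm ?_
    rw [labs_append, labs_append]
    have : ∀ (N : List Atom) (ℓ : List ℕ), (labs (N.map (can s)) ℓ).Perm (labs N ℓ) := by
      intro N
      induction N with
      | nil => exact fun ℓ => List.Perm.refl _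
      | cons A N ih =>
        exact fun ℓ => (ih _).trans (labs_perm N ((hs A.k A.l).1.symm.append_right ℓ))
    exact this L _
  rw [k2, E_perm p k1, ← (hs.map_map_can C L ℓ k4).2]
  refine E_append_congr C ?_
  rw [labs_append] at k4 h8
  refine E_replace h3 ?_ h6 k4 h8
  exact eq_of_heq ((E_map φ R.l R.o h1 h4).trans ((heq_of_eq hR).trans (E_map φ R.r R.o h2
      h5).symm))

theorem rewrite_same {s : ℕ} (hs : CanSound ζ s) {R : Rule} (hR : R.Sound ζ) {ℓ : List ℕ}
    {σ : List (ℕ × ℕ)} {M M' : List Atom} (h : rewrite s R ℓ σ M = some M') : Same ζ ℓ M M' := by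
  unfold rewrite at h
  split at h
  · cases h
  · exact rewriteAt_same hs hR h

theorem map_subst_of_notMem {a b : ℕ} {ℓ : List ℕ} (h : b ∉ ℓ) : ℓ.map (subst a b) = ℓ := by
  conv_rhs => rw [← List.map_id ℓ]
  refine List.map_congr_left fun x hx => ?_
  have : x ≠ b := fun e => h (e ▸ hx)
  simp [subst, this]

theorem line_same {a b : ℕ} (hab : a ≠ b) {N : List Atom} {ℓ : List ℕ} (hb : b ∉ ℓ)
    (h : OK (labs (⟨.e, [a, b]⟩ :: N) ℓ)) (h' : OK (labs (rename (subst a b) N) ℓ)) :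
    E ζ (⟨.e, [a, b]⟩ :: N) ℓ = E ζ (rename (subst a b) N) ℓ := by
  have e := map_subst_of_notMem (a := a) hb
  have := E_line (ζ := ζ) a b hab N ℓ h (by
    show OK (labs (rename (subst a b) N) (ℓ.map (subst a b)))
    rwa [e])
  have k : ∀ l, l = ℓ → HEq (E ζ (rename (subst a b) N) l) (E ζ (⟨.e, [a, b]⟩ :: N) ℓ) →
      E ζ (⟨.e, [a, b]⟩ :: N) ℓ = E ζ (rename (subst a b) N) ℓ := by
    rintro _ rfl h; exact (eq_of_heq h).symm
  exact k _ e this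

theorem Inv.e (a b : ℕ) : Inv ζ .e [a, b] [b, a] := by
  refine ⟨List.Perm.swap _ _ _, fun N ℓ h => ?_⟩
  have h0 : OK (labs N (a :: b :: ℓ)) := h
  have e : ∀ a b, push [a, b] et ℓ = T ℓ.length et := fun a b => eq_of_heq (push_heq _ _ _)
  rw [E_cons, E_cons]
  show push [a, b] et ℓ ⨾ E ζ N (a :: b :: ℓ) = push [b, a] et ℓ ⨾ E ζ N (b :: a :: ℓ)
  rw [E_sw N h0, ← ZWModAx.assoc, e, e]
  unfold sgn
  have : T ℓ.length et ⨾ T ℓ.length sg = T ℓ.length et := by rw [← T_comp, et_sg]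
  exact congrArg (ZWModAx.comp · _) this

theorem removeLine_same {ℓ : List ℕ} {A : Atom} {N N' : List Atom}
    (h : removeLine ℓ A N = some N') : Same ζ ℓ N N' := by
  unfold removeLine at h
  split at h
  · rename_i a b
    split_ifs at h with hab hb <;> dsimp only at h <;> split_ifs at h with hc
    · obtain rfl := Option.some.inj h
      obtain ⟨hA, h1, h2, h3⟩ := hc
      refine fun _ => ⟨h2, ?_⟩
      have p := List.perm_cons_erase hA
      have k := h1.perm (labs_perm_left p ℓ)
      rw [E_perm p h1, (Inv.e a b).2 _ _ k]
      exact line_same (Ne.symm hab) (h3 hb) (k.perm (labs_cons_perm (Inv.e (ζ := ζ) a b).1 _ ℓ)) h2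
    · obtain rfl := Option.some.inj h
      obtain ⟨hA, h1, h2, h3⟩ := hc
      refine fun _ => ⟨h2, ?_⟩
      have p := List.perm_cons_erase hA
      have k := h1.perm (labs_perm_left p ℓ)
      rw [E_perm p h1]
      exact line_same hab hb k h2
  · cases h

theorem removeLines_same (ℓ : List ℕ) (k : ℕ) (N : List Atom) :
    Same ζ ℓ N (removeLines ℓ k N) := by
  induction k generalizing N with
  | zero => exact Same.refl _ _
  | succ k ih =>
    unfold removeLines
    split
    · rename_i N' h
      obtain ⟨A, -, hA⟩ := List.exists_of_findSome?_eq_some h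
      exact (removeLine_same hA).trans (ih N')
    · exact Same.refl _ _

theorem norm_same (ℓ : List ℕ) (N : List Atom) : Same ζ ℓ N (norm ℓ N) := removeLines_same _ _ _

theorem cut_same {ℓ : List ℕ} {i j : ℕ} {N N' : List Atom} (h : cut ℓ i j N = some N') :
    Same ζ ℓ N N' := by
  unfold cut at h
  split at h
  · cases h
  · dsimp only at h
    split_ifs at h with hc
    obtain rfl := Option.some.inj h
    obtain ⟨h1, h2, h3, h4, h5⟩ := hc
    refine fun _ => ⟨h4, ?_⟩
    rw [line_same h2 h3 h4 (by rwa [h1]), h1]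

theorem cuts_same {ℓ : List ℕ} (c : List (ℕ × ℕ)) {N N' : List Atom}
    (h : cuts ℓ c N = some N') : Same ζ ℓ N N' := by
  induction c generalizing N with
  | nil => obtain rfl := Option.some.inj h; exact Same.refl _ _
  | cons q c ih =>
    obtain ⟨N1, h1, h2⟩ := Option.bind_eq_some_iff.1 h
    exact (cut_same h1).trans (ih h2)

/-- All rules used are sound. -/
def AllSound (ζ : ℕ → ℂ) : List Move → Prop
  | [] => True
  | m :: t => m.R.Sound ζ ∧ AllSound ζ t

theorem exec_same {s : ℕ} (hs : CanSound ζ s) {ℓ : List ℕ} (t : List Move) (ht : AllSound ζ t)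
    {N N' : List Atom} (h : exec s ℓ t N = some N') : Same ζ ℓ N N' := by
  induction t generalizing N with
  | nil => obtain rfl := Option.some.inj h; exact Same.refl _ _
  | cons m t ih =>
    obtain ⟨N1, h1, h⟩ := Option.bind_eq_some_iff.1 h
    obtain ⟨N2, h2, h3⟩ := Option.bind_eq_some_iff.1 h
    exact (cuts_same _ h1).trans ((rewrite_same hs ht.1 h2).trans ((norm_same _ _).trans
      (ih ht.2 h3)))

theorem alpha_same {s : ℕ} (hs : CanSound ζ s) {ℓ : List ℕ} {N N' : List Atom}
    (h : alpha s ℓ N N' = true) : E ζ N ℓ = E ζ N' ℓ := by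
  unfold alpha at h
  split at h
  · cases h
  · rename_i σ _ _
    obtain ⟨h1, h2, h3, h4, h5⟩ := of_decide_eq_true h
    have e := E_map (ζ := ζ) (app σ (maxLabel N' + 1)) N ℓ h3 (by rw [h1]; exact h4)
    rw [← hs.same_of_perm h2 h4 h5]
    have k : ∀ l, l = ℓ → HEq (E ζ (rename (app σ (maxLabel N' + 1)) N) l) (E ζ N ℓ) →
        E ζ N ℓ = E ζ (rename (app σ (maxLabel N' + 1)) N) ℓ := by
      rintro _ rfl h; exact (eq_of_heq h).symm
    exact k _ h1 e

/-- The sides of a rule are brought to the same net by the given derivations. -/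
def Rule.derives (s : ℕ) (R : Rule) (t t' : List Move) : Bool :=
  decide (OK (labs R.l R.o)) && decide (OK (labs R.r R.o)) &&
    match exec s R.o t R.l, exec s R.o t' R.r with
    | some N, some N' => alpha s R.o N N'
    | _, _ => false

theorem Rule.sound_of_derives {s : ℕ} (hs : CanSound ζ s) {R : Rule}
    (t t' : List Move) (ht : AllSound ζ t) (ht' : AllSound ζ t')
    (h : R.derives s t t' = true) : R.Sound ζ := by
  unfold Rule.derives at h
  simp only [Bool.and_eq_true, decide_eq_true_eq] at h
  obtain ⟨⟨h1, h2⟩, h3⟩ := h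
  split at h3
  · rename_i N N' hN hN'
    show E ζ R.l R.o = E ζ R.r R.o
    rw [(exec_same hs t ht hN h1).2, alpha_same hs h3, ← (exec_same hs t' ht' hN' h2).2]
  · cases h3

theorem dval_eq_of_proves {s : ℕ} (hs : CanSound ζ s) {m n : ℕ} {D D' : DTerm Sg m n}
    (t t' : List Move) (ht : AllSound ζ t) (ht' : AllSound ζ t')
    (h : proves s D D' t t' = true) : dval ζ D = dval ζ D' := by
  unfold proves at h
  simp only [Bool.and_eq_true, decide_eq_true_eq] at h
  obtain ⟨⟨h1, h2⟩, h3⟩ := h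
  split at h3
  · rename_i N N' hN hN'
    rw [dval_eq_iff h1 h2]
    rw [((norm_same _ _).trans (exec_same hs t ht hN) h1).2, alpha_same hs h3,
      ← ((norm_same _ _).trans (exec_same hs t' ht' hN') h2).2]
  · cases h3

theorem ruleOf_sound {m n : ℕ} {D D' : DTerm Sg m n} (h : dval ζ D = dval ζ D')
    (h1 : OK (labs (netOf D) (ends m n))) (h2 : OK (labs (netOf D') (ends m n))) :
    (ruleOf D D').Sound ζ := by
  have e := (dval_eq_iff h1 h2).1 h
  rw [(norm_same _ _ h1).2, (norm_same _ _ h2).2] at e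
  exact e

theorem Rule.Sound.symm {R : Rule} (h : R.Sound ζ) : R.symm.Sound ζ := Eq.symm h

end ZW

namespace ZW
open PRO

variable {ζ : ℕ → ℂ}

/-! ### Diagrams for the operations -/

abbrev Dg (m n : ℕ) : Type := DTerm Sg m n

def Dg.cp {l m n : ℕ} (f : Dg l m) (g : Dg m n) : Dg l n := DTerm.comp f g
def Dg.tn {a b c d : ℕ} (f : Dg a b) (g : Dg c d) : Dg (a + c) (b + d) := DTerm.tensor f g

notation:60 f:61 " ⊳ " g:60 => Dg.cp f g
notation:70 f:71 " ⊛ " g:70 => (Dg.tn f g :)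

namespace Dg

def nl : Dg 0 0 := DTerm.id 0
def w1 : Dg 1 1 := DTerm.id 1
def w2 : Dg 2 2 := DTerm.id 2
def st (k : Kind) (n : ℕ) : Dg 0 n := DTerm.gen (.st k n)
def sw : Dg 2 2 := DTerm.gen .sw
def cap : Dg 2 0 := DTerm.gen .cap
def cup : Dg 0 2 := st .e 2

/-- The gate given by a state with four legs. -/
def gate (k : Kind) : Dg 2 2 :=
  (w2 ⊛ st k 4) ⊳ ((w1 ⊛ cap ⊛ w1) ⊛ w2) ⊳ (cap ⊛ w2)
def fsw : Dg 2 2 := gate .z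
def neg : Dg 1 1 := (w1 ⊛ st .n 2) ⊳ (cap ⊛ w1)
def spl : Dg 1 2 := (w1 ⊛ st .b 3) ⊳ (cap ⊛ w1 ⊛ w1)
def mrg : Dg 2 1 := (w1 ⊛ spl) ⊳ (cap ⊛ w1)
def pha (k : ℕ) : Dg 1 1 := (w1 ⊛ st (.p k) 2) ⊳ (cap ⊛ w1)
def phaDag (k : ℕ) : Dg 2 0 := (w1 ⊛ pha k) ⊳ cap
def proj : Dg 2 2 := gate .w
def crl : Dg 1 1 := (cup ⊛ w1) ⊳ (w1 ⊛ fsw) ⊳ (cap ⊛ w1)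

/-- The loop defining the projector. -/
def loop : Dg 2 2 :=
  (w1 ⊛ st (.p 3) 2 ⊛ w1) ⊳ (fsw ⊛ fsw) ⊳ (neg ⊛ w1 ⊛ w1 ⊛ neg) ⊳ (sw ⊛ sw) ⊳
    (w1 ⊛ phaDag 3 ⊛ w1)

end Dg

open Dg

@[simp] theorem dval_cp {l m n : ℕ} (f : Dg l m) (g : Dg m n) :
    dval ζ (f ⊳ g) = dval ζ f ⨾ dval ζ g := rfl
@[simp] theorem dval_tn {a b c d : ℕ} (f : Dg a b) (g : Dg c d) :
    dval ζ (f ⊛ g) = dval ζ f ⊠ dval ζ g := rfl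
@[simp] theorem dval_w1 : dval ζ w1 = cls wire := rfl
@[simp] theorem dval_pha (k : ℕ) : dval ζ (pha k) = cls (phase (pv ζ k)) := rfl

/-- A symmetry of a state is a symmetry of the vertex. -/
theorem inv_of_dval {k : Kind} {n : ℕ} (D : Dg n n) (h : kst ζ k n ⨾ dval ζ D = kst ζ k n)
    (l : List ℕ) (hl : l.length = n) (hN : (run D 0 l).2.1 = []) (hp : l.Perm (run D 0 l).1) :
    Inv ζ k l (run D 0 l).1 := by
  refine ⟨hp, fun N ℓ hO => ?_⟩
  subst hl
  obtain ⟨h1, h2⟩ := run_spec (ζ := ζ) D 0 l rfl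
  rw [hN] at h2
  obtain ⟨-, h3⟩ := h2 ℓ [] N _ 0 rfl rfl hO
  generalize (run D 0 l).1 = O at *
  have h4 : ℓ.length + l.length + 0 = (O ++ ℓ).length := by simp [h1, Nat.add_comm]
  obtain ⟨x, hx⟩ : ∃ x : H (ℓ.length + l.length + 0) 0, HEq x (E ζ N (O ++ ℓ)) :=
    ⟨cast (by rw [h4]) (E ζ N (O ++ ℓ)), cast_heq _ _⟩
  have h5 := h3 x hx
  rw [E_cons, E_cons]
  refine eq_of_heq (HEq.trans (comp_heq rfl (by simp [Nat.add_comm]) rfl (push_heq _ _ _)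
    h5.symm) ?_)
  refine HEq.trans ?_ (comp_heq rfl h4 rfl ?_ hx)
    (b := T ℓ.length (kst ζ k l.length) ⨾ x)
  · have : T ℓ.length (kst ζ k l.length) ⨾ T ℓ.length (dval ζ D) ⨾ x =
        T ℓ.length (kst ζ k l.length) ⨾ x := by
      rw [← ZWModAx.assoc, ← T_comp, h]
    exact heq_of_eq this
  · refine HEq.trans ?_ (push_heq _ _ _).symm
    exact T_heq rfl rfl h1.symm (kst_heq k h1.symm)

theorem Inv.ite {k : Kind} {l l' : List ℕ} {c : Prop} [Decidable c] (h : Inv ζ k l l') :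
    Inv ζ k l (if c then l else l') := by
  split_ifs
  · exact Inv.refl _ _
  · exact h

theorem inv_two {k : Kind} (h : ∀ a b, Inv ζ k [a, b] [b, a]) (l : List ℕ) (hl : l.length = 2) :
    Inv ζ k l (sortAt 0 l) := by
  obtain ⟨a, b, rfl⟩ := List.length_eq_two.1 hl
  exact (h a b).ite

theorem inv_swap {k : Kind} (h : kst ζ k 2 ⨾ sg = kst ζ k 2) (a b : ℕ) :
    Inv ζ k [a, b] [b, a] := inv_of_dval sw h [a, b] rfl rfl (List.Perm.swap _ _ _)

theorem inv_b_zero (a b c : ℕ) : Inv ζ .b [a, b, c] [b, a, c] :=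
  inv_of_dval (n := 3) (w1 ⊛ sw)
    (show kst ζ .b 3 ⨾ dval ζ (w1 ⊛ sw) = kst ζ .b 3 from cls_ax .black₃_swap_right)
    [a, b, c] rfl rfl (List.Perm.swap _ _ _)

theorem inv_b_one (a b c : ℕ) : Inv ζ .b [a, b, c] [a, c, b] :=
  inv_of_dval (n := 3) (sw ⊛ w1)
    (show kst ζ .b 3 ⨾ dval ζ (sw ⊛ w1) = kst ζ .b 3 from cls_ax .black₃_swap_left)
    [a, b, c] rfl rfl ((List.Perm.swap _ _ _).cons _)

theorem inv_sort_three {k : Kind} (h0 : ∀ a b c, Inv ζ k [a, b, c] [b, a, c])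
    (h1 : ∀ a b c, Inv ζ k [a, b, c] [a, c, b]) (l : List ℕ) (hl : l.length = 3) :
    Inv ζ k l (sortAt 0 (sortAt 1 (sortAt 0 l))) := by
  have k0 : ∀ l : List ℕ, l.length = 3 → Inv ζ k l (sortAt 0 l) := by
    intro l hl
    obtain ⟨a, b, c, rfl⟩ := List.length_eq_three.1 hl
    exact (h0 a b c).ite
  have k1 : ∀ l : List ℕ, l.length = 3 → Inv ζ k l (sortAt 1 l) := by
    intro l hl
    obtain ⟨a, b, c, rfl⟩ := List.length_eq_three.1 hl
    exact (h1 a b c).ite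
  have e0 := k0 l hl
  have e1 := k1 _ (e0.1.length_eq.symm.trans hl)
  exact e0.trans (e1.trans (k0 _ (e1.1.length_eq.symm.trans (e0.1.length_eq.symm.trans hl))))

theorem length_eq_four {l : List ℕ} (h : l.length = 4) : ∃ a b c d, l = [a, b, c, d] := by
  match l, h with
  | [a, b, c, d], _ => exact ⟨a, b, c, d, rfl⟩

theorem inv_sort_four {k : Kind} (h0 : ∀ a b c d, Inv ζ k [a, b, c, d] [b, a, c, d])
    (h1 : ∀ a b c d, Inv ζ k [a, b, c, d] [a, c, b, d])
    (h2 : ∀ a b c d, Inv ζ k [a, b, c, d] [a, b, d, c]) (l : List ℕ) (hl : l.length = 4) :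
    Inv ζ k l (sortAt 0 (sortAt 1 (sortAt 2 (sortAt 0 (sortAt 1 (sortAt 0 l)))))) := by
  have k0 : ∀ l' : List ℕ, Inv ζ k l l' → Inv ζ k l (sortAt 0 l') := by
    intro l' h
    obtain ⟨a, b, c, d, rfl⟩ := length_eq_four (h.1.length_eq.symm.trans hl)
    exact h.trans (h0 a b c d).ite
  have k1 : ∀ l' : List ℕ, Inv ζ k l l' → Inv ζ k l (sortAt 1 l') := by
    intro l' h
    obtain ⟨a, b, c, d, rfl⟩ := length_eq_four (h.1.length_eq.symm.trans hl)
    exact h.trans (h1 a b c d).ite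
  have k2 : ∀ l' : List ℕ, Inv ζ k l l' → Inv ζ k l (sortAt 2 l') := by
    intro l' h
    obtain ⟨a, b, c, d, rfl⟩ := length_eq_four (h.1.length_eq.symm.trans hl)
    exact h.trans (h2 a b c d).ite
  exact k0 _ (k1 _ (k2 _ (k0 _ (k1 _ (k0 _ (Inv.refl _ _))))))

theorem inv_sort_cross {k : Kind} (h0 : ∀ a b c d, Inv ζ k [a, b, c, d] [c, b, a, d])
    (h1 : ∀ a b c d, Inv ζ k [a, b, c, d] [a, d, c, b])
    (h2 : ∀ a b c d, Inv ζ k [a, b, c, d] [b, a, d, c]) (l : List ℕ) (hl : l.length = 4) :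
    Inv ζ k l (sortBoth (sortInner (sortOuter l))) := by
  have k0 : ∀ l' : List ℕ, Inv ζ k l l' → Inv ζ k l (sortOuter l') := by
    intro l' h
    obtain ⟨a, b, c, d, rfl⟩ := length_eq_four (h.1.length_eq.symm.trans hl)
    exact h.trans (h0 a b c d).ite
  have k1 : ∀ l' : List ℕ, Inv ζ k l l' → Inv ζ k l (sortInner l') := by
    intro l' h
    obtain ⟨a, b, c, d, rfl⟩ := length_eq_four (h.1.length_eq.symm.trans hl)
    exact h.trans (h1 a b c d).ite
  have k2 : ∀ l' : List ℕ, Inv ζ k l l' → Inv ζ k l (sortBoth l') := by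
    intro l' h
    obtain ⟨a, b, c, d, rfl⟩ := length_eq_four (h.1.length_eq.symm.trans hl)
    exact h.trans (h2 a b c d).ite
  exact k2 _ (k1 _ (k0 _ (Inv.refl _ _)))

theorem Inv.dite {k : Kind} {l l' : List ℕ} {c : Prop} [Decidable c] (h : c → Inv ζ k l l') :
    Inv ζ k l (if c then l' else l) := by
  by_cases hc : c
  · rw [if_pos hc]; exact h hc
  · rw [if_neg hc]; exact Inv.refl _ _

/-- The normal form of a vertex is sound once the symmetries of the stage are established. -/
theorem canSound {s : ℕ}
    (hd : 1 ≤ s → ∀ a b c, Inv ζ .d [a, b, c] [b, a, c])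
    (hc : 2 ≤ s → ∀ a b, Inv ζ .c [a, b] [b, a])
    (hz : 2 ≤ s → (∀ a b c d, Inv ζ .z [a, b, c, d] [c, b, a, d]) ∧
      (∀ a b c d, Inv ζ .z [a, b, c, d] [a, d, c, b]) ∧
      ∀ a b c d, Inv ζ .z [a, b, c, d] [b, a, d, c])
    (hw : 3 ≤ s → (∀ a b c d, Inv ζ .w [a, b, c, d] [b, a, c, d]) ∧
      (∀ a b c d, Inv ζ .w [a, b, c, d] [a, c, b, d]) ∧
      ∀ a b c d, Inv ζ .w [a, b, c, d] [a, b, d, c]) : CanSound ζ s := by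
  intro k l
  cases k with
  | e => exact Inv.dite (inv_two (inv_swap (show kst ζ .e 2 ⨾ sg = kst ζ .e 2 from et_sg)) l)
  | n => exact Inv.dite (inv_two
      (inv_swap (show kst ζ .n 2 ⨾ sg = kst ζ .n 2 from cls_ax .black₂_swap)) l)
  | b => exact Inv.dite (inv_sort_three inv_b_zero inv_b_one l)
  | p k => exact Inv.dite (inv_two (inv_swap (show kst ζ (.p k) 2 ⨾ sg = kst ζ (.p k) 2 from
      cls_ax (.white_swap _))) l)
  | z => exact Inv.dite fun h => inv_sort_cross (hz h.2).1 (hz h.2).2.1 (hz h.2).2.2 l h.1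
  | c => exact Inv.dite fun h => inv_two (hc h.2) l h.1
  | d =>
    refine Inv.dite fun h => ?_
    obtain ⟨a, b, c, rfl⟩ := List.length_eq_three.1 h.1
    exact (hd h.2 a b c).ite
  | v0 => exact Inv.refl _ _
  | v1 => exact Inv.refl _ _
  | w => exact Inv.dite fun h => inv_sort_four (hw h.2).1 (hw h.2).2.1 (hw h.2).2.2 l h.1

theorem canSound_zero : CanSound ζ 0 := by
  refine canSound ?_ ?_ ?_ ?_ <;> intro h <;> simp at h

/-- In the language of nets every vertex is a state, so a gate is entered with its inputs bent. Here
they are straightened again: `g` moves past the caps (`e2`), and the cups and caps that remain form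
two straight wires (`e0`). -/
theorem gate_eq {k : Kind} {g : H 2 2}
    (h : kst ζ k 4 = (et ⨾ ((ZWModAx.id 1 ⊠ et) ⊠ ZWModAx.id 1)) ⨾ (ZWModAx.id 2 ⊠ g)) :
    dval ζ (gate k) = g := by
  set B : H 6 2 := dval ζ (((w1 ⊛ cap ⊛ w1) ⊛ w2) ⊳ (cap ⊛ w2)) with hB
  have e0 : T 2 (et ⨾ ((ZWModAx.id 1 ⊠ et) ⊠ ZWModAx.id 1)) ⨾ B = ZWModAx.id 2 :=
    dval_eq_of_proves (ζ := ζ) (D := (w2 ⊛ (cup ⊳ ((w1 ⊛ cup) ⊛ w1))) ⊳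
      (((w1 ⊛ cap ⊛ w1) ⊛ w2) ⊳ (cap ⊛ w2))) (D' := w2)
      canSound_zero [] [] trivial trivial (by decide +kernel)
  have e1 : dval ζ (gate k) = T 2 (kst ζ k 4) ⨾ B := rfl
  have e2 : T 2 (T 2 g) ⨾ B = B ⨾ g := by
    have h1 : V (T 1 (ep ⊠ ZWModAx.id 1)) 2 ⨾ T 2 g = T 4 g ⨾ V (T 1 (ep ⊠ ZWModAx.id 1)) 2 :=
      V_T _ _
    have h2 : V ep 2 ⨾ g = T 2 g ⨾ V ep 2 := by
      have := V_T ep g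
      rw [eq_of_heq (T_zero_heq g)] at this
      exact this
    have h3 : B = V (T 1 (ep ⊠ ZWModAx.id 1)) 2 ⨾ V ep 2 := by
      rw [V_eq, V_eq]; rfl
    rw [h3, eq_of_heq (T_T_heq 2 2 g), ZWModAx.assoc, h2, ← ZWModAx.assoc, ← ZWModAx.assoc]
    exact congrArg (ZWModAx.comp · (V ep 2)) h1.symm
  rw [e1, h, T_comp, ZWModAx.assoc]
  refine (congrArg (ZWModAx.comp _) e2).trans ?_
  rw [← ZWModAx.assoc, e0, ZWModAx.id_comp]

@[simp] theorem dval_fsw : dval ζ fsw = cls fswap := gate_eq rfl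
@[simp] theorem dval_proj : dval ζ proj = cls projector := gate_eq rfl
@[simp] theorem dval_crl : dval ζ crl = cls curl := by
  show dval ζ ((cup ⊛ w1) ⊳ (w1 ⊛ fsw) ⊳ (cap ⊛ w1)) = _
  simp only [dval_cp, dval_tn, dval_fsw]
  rfl
theorem dval_loop : dval ζ loop = cls projector := by
  show dval ζ ((w1 ⊛ st (.p 3) 2 ⊛ w1) ⊳ (fsw ⊛ fsw) ⊳ (neg ⊛ w1 ⊛ w1 ⊛ neg) ⊳ (sw ⊛ sw) ⊳
    (w1 ⊛ phaDag 3 ⊛ w1)) = _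
  simp only [dval_cp, dval_tn, dval_fsw]
  rfl

end ZW

namespace ZW
open PRO Dg

variable {ζ : ℕ → ℂ}

/-! ### The axioms as rules -/

namespace Rule

def fswFsw : Rule := ruleOf (fsw ⊳ fsw) (w1 ⊛ w1)
def fswYb : Rule := ruleOf ((fsw ⊛ w1) ⊳ (w1 ⊛ fsw) ⊳ (fsw ⊛ w1)) ((w1 ⊛ fsw) ⊳ (fsw ⊛ w1) ⊳ (w1 ⊛
    fsw))
def swYb : Rule := ruleOf ((sw ⊛ w1) ⊳ (w1 ⊛ fsw) ⊳ (fsw ⊛ w1)) ((w1 ⊛ fsw) ⊳ (fsw ⊛ w1) ⊳ (w1 ⊛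
    sw))
def cupYb : Rule := ruleOf ((cup ⊛ w1) ⊳ (w1 ⊛ fsw) ⊳ (fsw ⊛ w1)) (w1 ⊛ cup)
def fswSw : Rule := ruleOf (fsw ⊳ sw) (sw ⊳ fsw)
def nYb : Rule := ruleOf ((st .n 2 ⊛ w1) ⊳ (w1 ⊛ fsw) ⊳ (fsw ⊛ w1)) (crl ⊛ st .n 2)
def bYb : Rule := ruleOf ((st .b 3 ⊛ w1) ⊳ (w1 ⊛ w1 ⊛ fsw) ⊳ (w1 ⊛ fsw ⊛ w1) ⊳ (fsw ⊛ w1 ⊛ w1))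
    (crl ⊛ st .b 3)
def pYb (k : ℕ) : Rule := ruleOf ((st (.p k) 2 ⊛ w1) ⊳ (w1 ⊛ fsw) ⊳ (fsw ⊛ w1)) (w1 ⊛ st (.p k) 2)
def bFsw : Rule := ruleOf (st .b 3 ⊳ (w1 ⊛ fsw)) (st .b 3)
def negNeg : Rule := ruleOf (neg ⊳ neg) w1
def coassoc : Rule := ruleOf (neg ⊳ spl ⊳ ((neg ⊳ spl) ⊛ w1)) (neg ⊳ spl ⊳ (w1 ⊛ (neg ⊳ spl)))
def counit : Rule := ruleOf (neg ⊳ spl ⊳ ((neg ⊳ spl ⊳ cap) ⊛ w1)) w1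
def bialg : Rule := ruleOf (((neg ⊳ spl) ⊛ (neg ⊳ spl)) ⊳ (w1 ⊛ fsw ⊛ w1) ⊳ ((mrg ⊳ neg) ⊛ (mrg ⊳
    neg))) (mrg ⊳ neg ⊳ neg ⊳ spl)
def unitCopy : Rule := ruleOf ((cup ⊳ mrg ⊳ neg) ⊛ (cup ⊳ mrg ⊳ neg)) (cup ⊳ mrg ⊳ neg ⊳ neg ⊳ spl)
def unitCounit : Rule := ruleOf nl (cup ⊳ mrg ⊳ neg ⊳ neg ⊳ spl ⊳ cap)
def zero : Rule := ruleOf ((cup ⊳ mrg ⊳ neg ⊳ spl ⊳ cap) ⊛ (cup ⊳ mrg ⊳ neg ⊳ spl ⊳ cap)) (cup ⊳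
    mrg ⊳ neg ⊳ spl ⊳ cap)
def pSplit (k : ℕ) : Rule := ruleOf (neg ⊳ spl ⊳ (pha k ⊛ pha k)) (pha k ⊳ neg ⊳ spl)
def pCounit (k : ℕ) : Rule := ruleOf (neg ⊳ spl ⊳ cap) (pha k ⊳ neg ⊳ spl ⊳ cap)
def pOne : Rule := ruleOf (pha 1) w1
def pZero : Rule := ruleOf (pha 0) (neg ⊳ spl ⊳ cap ⊳ cup ⊳ mrg ⊳ neg)
def pAdd (i j k : ℕ) : Rule := ruleOf (neg ⊳ spl ⊳ (pha i ⊛ pha j) ⊳ mrg ⊳ neg) (pha k)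
def wRotate : Rule := ruleOf proj ((w1 ⊛ w1 ⊛ cup) ⊳ (w1 ⊛ proj ⊛ w1) ⊳ (cap ⊛ w1 ⊛ w1))
def wSplit : Rule := ruleOf (((neg ⊳ spl) ⊛ (neg ⊳ spl)) ⊳ (w1 ⊛ sw ⊛ w1) ⊳ (proj ⊛ proj) ⊳
  (w1 ⊛ sw ⊛ w1) ⊳ ((mrg ⊳ neg) ⊛ w1 ⊛ w1)) (proj ⊳ (w1 ⊛ (neg ⊳ spl)))
def wLoop : Rule := ruleOf proj loop
def zCurl : Rule := ruleOf (st .c 2) (st .z 4 ⊳ ((w1 ⊛ cap) ⊛ w1))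
def dBlack : Rule := ruleOf (st .d 3) ((st .n 2 ⊳ (w2 ⊛ st .b 3)) ⊳ ((w1 ⊛ cap) ⊛ w2))
def v0Black : Rule := ruleOf (st .v0 1) (st .d 3 ⊳ (w1 ⊛ cap))
def v1Black : Rule := ruleOf (st .v1 1) (st .b 3 ⊳ (w1 ⊛ cap))

theorem fswFsw_sound : fswFsw.Sound ζ :=
  ruleOf_sound (by simp only [dval_cp, dval_tn, dval_fsw, dval_w1]; exact cls_ax .fswap_fswap)
    (by decide +kernel) (by decide +kernel)
theorem fswYb_sound : fswYb.Sound ζ :=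
  ruleOf_sound (by simp only [dval_cp, dval_tn, dval_fsw, dval_w1]; exact cls_ax .fswap_fslide)
    (by decide +kernel) (by decide +kernel)
theorem swYb_sound : swYb.Sound ζ :=
  ruleOf_sound (by simp only [dval_cp, dval_tn, dval_fsw, dval_w1]; exact cls_ax .swap_fslide)
    (by decide +kernel) (by decide +kernel)
theorem cupYb_sound : cupYb.Sound ζ :=
  ruleOf_sound (by simp only [dval_cp, dval_tn, dval_fsw, dval_w1]; exact cls_ax .dual_fslide)
    (by decide +kernel) (by decide +kernel)
theorem fswSw_sound : fswSw.Sound ζ :=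
  ruleOf_sound (by simp only [dval_cp, dval_fsw]; exact cls_ax .fswap_swap)
    (by decide +kernel) (by decide +kernel)
theorem nYb_sound : nYb.Sound ζ :=
  ruleOf_sound (by simp only [dval_cp, dval_tn, dval_fsw, dval_crl]; exact cls_ax .black₂_fslide)
    (by decide +kernel) (by decide +kernel)
theorem bYb_sound : bYb.Sound ζ :=
  ruleOf_sound (by simp only [dval_cp, dval_tn, dval_fsw, dval_crl]; exact cls_ax .black₃_fslide)
    (by decide +kernel) (by decide +kernel)
theorem bFsw_sound : bFsw.Sound ζ :=
  ruleOf_sound (by simp only [dval_cp, dval_tn, dval_fsw]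
                   exact (cls_ax .black₃_fswap).symm.trans (cls_ax .black₃_swap_right))
    (by decide +kernel) (by decide +kernel)
theorem negNeg_sound : negNeg.Sound ζ :=
  ruleOf_sound (cls_ax .not_not) (by decide +kernel) (by decide +kernel)
theorem coassoc_sound : coassoc.Sound ζ :=
  ruleOf_sound (cls_ax .black_coassoc) (by decide +kernel) (by decide +kernel)
theorem counit_sound : counit.Sound ζ :=
  ruleOf_sound (cls_ax .black_counit) (by decide +kernel) (by decide +kernel)
theorem bialg_sound : bialg.Sound ζ :=
  ruleOf_sound (by simp only [dval_cp, dval_tn, dval_fsw]; exact cls_ax .black_bialgebra)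
    (by decide +kernel) (by decide +kernel)
theorem unitCopy_sound : unitCopy.Sound ζ :=
  ruleOf_sound (cls_ax .black_unit_copy) (by decide +kernel) (by decide +kernel)
theorem unitCounit_sound : unitCounit.Sound ζ :=
  ruleOf_sound (cls_ax .black_unit_counit) (by decide +kernel) (by decide +kernel)
theorem zero_sound : zero.Sound ζ :=
  ruleOf_sound (cls_ax .black_zero) (by decide +kernel) (by decide +kernel)
-- The index 4 denotes the first variable parameter `ζ 0`. As `ζ` is arbitrary, this is the axiom
-- for all parameters, while the indices 0 to 3 stand for the constants 0, 1, -1 and 1/2.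
theorem pYb_sound : (pYb 4).Sound ζ :=
  ruleOf_sound (by simp only [dval_cp, dval_tn, dval_fsw]; exact cls_ax (.white_fslide _))
    (by decide +kernel) (by decide +kernel)
theorem pYbHalf_sound : (pYb 3).Sound ζ :=
  ruleOf_sound (by simp only [dval_cp, dval_tn, dval_fsw]; exact cls_ax (.white_fslide _))
    (by decide +kernel) (by decide +kernel)
theorem pSplit_sound : (pSplit 4).Sound ζ :=
  ruleOf_sound (cls_ax (.phase_split _)) (by decide +kernel) (by decide +kernel)
theorem pCounit_sound : (pCounit 4).Sound ζ :=
  ruleOf_sound (cls_ax (.phase_counit _)) (by decide +kernel) (by decide +kernel)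
theorem pOne_sound : pOne.Sound ζ :=
  ruleOf_sound (cls_ax .phase_one) (by decide +kernel) (by decide +kernel)
theorem pZero_sound : pZero.Sound ζ :=
  ruleOf_sound (cls_ax .phase_zero) (by decide +kernel) (by decide +kernel)
theorem pAdd_sound (i j k : ℕ) (h : pv ζ i + pv ζ j = pv ζ k)
    (h1 : OK (labs (netOf (neg ⊳ spl ⊳ (pha i ⊛ pha j) ⊳ mrg ⊳ neg)) (ends 1 1)))
    (h2 : OK (labs (netOf (pha k)) (ends 1 1))) : (pAdd i j k).Sound ζ :=
  ruleOf_sound (by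
    simp only [dval_cp, dval_tn, dval_pha, ← h]; exact cls_ax (.phase_add _ _)) h1 h2
theorem pAddHalf_sound : (pAdd 3 3 1).Sound ζ :=
  pAdd_sound 3 3 1 (add_halves _) (by decide +kernel) (by decide +kernel)
theorem pAddNeg_sound : (pAdd 1 2 0).Sound ζ :=
  pAdd_sound 1 2 0 (add_neg_cancel _) (by decide +kernel) (by decide +kernel)
theorem wRotate_sound : wRotate.Sound ζ :=
  ruleOf_sound (by simp only [dval_cp, dval_tn, dval_proj]; exact cls_ax .projector_rotate)
    (by decide +kernel) (by decide +kernel)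
theorem wSplit_sound : wSplit.Sound ζ :=
  ruleOf_sound (by simp only [dval_cp, dval_tn, dval_proj]; exact cls_ax .projector_split)
    (by decide +kernel) (by decide +kernel)
theorem wLoop_sound : wLoop.Sound ζ :=
  ruleOf_sound (by rw [dval_loop, dval_proj]) (by decide +kernel) (by decide +kernel)
theorem zCurl_sound : zCurl.Sound ζ := ruleOf_sound rfl (by decide +kernel) (by decide +kernel)
theorem dBlack_sound : dBlack.Sound ζ := ruleOf_sound rfl (by decide +kernel) (by decide +kernel)
theorem v0Black_sound : v0Black.Sound ζ := ruleOf_sound rfl (by decide +kernel) (by decide +kernel)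
theorem v1Black_sound : v1Black.Sound ζ := ruleOf_sound rfl (by decide +kernel) (by decide +kernel)

end Rule
end ZW

namespace ZW
open PRO Dg

variable {ζ : ℕ → ℂ}

/-! ### Symmetries of the crossing -/

theorem inv_of_proves {s : ℕ} (hs : CanSound ζ s) {k : Kind} {n : ℕ} (D : Dg n n)
    (t t' : List Move) (ht : AllSound ζ t) (ht' : AllSound ζ t')
    (h : proves s (st k n ⊳ D) (st k n) t t' = true)
    (l : List ℕ) (hl : l.length = n) (hN : (run D 0 l).2.1 = [])
    (hp : ∀ x, l.count x = (run D 0 l).1.count x) : Inv ζ k l (run D 0 l).1 :=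
  inv_of_dval D (dval_eq_of_proves (D := st k n ⊳ D) (D' := st k n) hs t t' ht ht' h) l hl hN
    (List.perm_iff_count.2 hp)

open Rule

theorem inv_d (a b c : ℕ) : Inv ζ .d [a, b, c] [b, a, c] :=
  inv_of_proves canSound_zero (n := 3) (w1 ⊛ sw) [⟨dBlack, [], []⟩] [⟨dBlack, [], []⟩]
    ⟨dBlack_sound, trivial⟩ ⟨dBlack_sound, trivial⟩ (by decide +kernel)
    [a, b, c] rfl rfl (List.perm_iff_count.1 (List.Perm.swap _ _ _))

theorem canSound_one : CanSound ζ 1 := by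
  refine canSound (fun _ => inv_d) ?_ ?_ ?_ <;> intro h <;> simp at h

theorem inv_z_both (a b c d : ℕ) : Inv ζ .z [a, b, c, d] [b, a, d, c] :=
  inv_of_proves canSound_zero (n := 4) (sw ⊛ sw) [⟨fswSw, [], []⟩] []
    ⟨fswSw_sound, trivial⟩ trivial (by decide +kernel)
    [a, b, c, d] rfl rfl fun x => by
      show [a, b, c, d].count x = [b, a, d, c].count x
      simp only [List.count_cons, List.count_nil]
      omega

/-- A cup slid through a wire creates two crossings. Created next to the given crossing, one of them
cancels with it, and the other is the same crossing with a strand reversed. -/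
theorem inv_z_outer (a b c d : ℕ) : Inv ζ .z [a, b, c, d] [c, b, a, d] :=
  inv_of_proves canSound_one (n := 4) ((w2 ⊛ sw) ⊳ (w1 ⊛ sw ⊛ w1) ⊳ (w2 ⊛ sw))
    [⟨cupYb.symm, [(1, 0), (0, 3)], [(0, 2), (1, 3)]⟩, ⟨fswSw, [(3, 2)], []⟩, ⟨fswFsw, [], []⟩] []
    ⟨cupYb_sound.symm, fswSw_sound, fswFsw_sound, trivial⟩ trivial (by decide +kernel)
    [a, b, c, d] rfl rfl fun x => by
      show [a, b, c, d].count x = [c, b, a, d].count x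
      simp only [List.count_cons, List.count_nil]
      omega

theorem inv_z_inner (a b c d : ℕ) : Inv ζ .z [a, b, c, d] [a, d, c, b] :=
  ((inv_z_both a b c d).trans (inv_z_outer _ _ _ _)).trans (inv_z_both _ _ _ _)

def Rule.zFlip : Rule := ⟨[⟨.z, [0, 1, 2, 3]⟩], [⟨.z, [3, 2, 1, 0]⟩], [0, 1, 2, 3]⟩

theorem Rule.zFlip_sound : zFlip.Sound ζ := by
  have h : ∀ a b c d, Inv ζ .z [a, b, c, d] [d, c, b, a] := fun a b c d =>
    ((inv_z_both a b c d).trans (inv_z_outer _ _ _ _)).trans (inv_z_inner _ _ _ _)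
  exact (h 0 1 2 3).2 _ _ (by decide +kernel)

theorem inv_c (a b : ℕ) : Inv ζ .c [a, b] [b, a] :=
  inv_of_proves canSound_one (n := 2) sw [⟨zCurl, [], []⟩, ⟨zFlip, [], [(0, 1)]⟩] [⟨zCurl, [], []⟩]
    ⟨zCurl_sound, zFlip_sound, trivial⟩ ⟨zCurl_sound, trivial⟩ (by decide +kernel)
    [a, b] rfl rfl (List.perm_iff_count.1 (List.Perm.swap _ _ _))

theorem canSound_two : CanSound ζ 2 := by
  refine canSound (fun _ => inv_d) (fun _ => inv_c)
    (fun _ => ⟨inv_z_outer, inv_z_inner, inv_z_both⟩) ?_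
  intro h; simp at h

end ZW

namespace ZW
open PRO Dg

variable {ζ : ℕ → ℂ}

/-! ### Derived rules -/

namespace Rule

def E' (a b : ℕ) : Atom := ⟨.e, [a, b]⟩
def N' (a b : ℕ) : Atom := ⟨.n, [a, b]⟩
def B' (a b c : ℕ) : Atom := ⟨.b, [a, b, c]⟩
def P' (k a b : ℕ) : Atom := ⟨.p k, [a, b]⟩
def C' (a b : ℕ) : Atom := ⟨.c, [a, b]⟩
/-- A crossing of the strands from `x` to `x'` and from `y` to `y'`. -/
def Z' (x x' y y' : ℕ) : Atom := ⟨.z, [x, y, x', y']⟩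
def D' (a x y : ℕ) : Atom := ⟨.d, [x, y, a]⟩
def O' (a : ℕ) : Atom := ⟨.v0, [a]⟩
def I' (a : ℕ) : Atom := ⟨.v1, [a]⟩
def W' (a b c d : ℕ) : Atom := ⟨.w, [a, b, c, d]⟩

def zz : Rule := ⟨[Z' 0 2 1 3, Z' 2 4 3 5], [E' 0 4, E' 1 5], [0, 1, 4, 5]⟩
theorem zz_sound : zz.Sound ζ :=
sound_of_derives canSound_two [⟨fswFsw, [], []⟩] [] ⟨fswFsw_sound, trivial⟩ trivial
    (by decide +kernel)

def zComm : Rule := ⟨[Z' 0 1 2 3, Z' 1 4 5 6], [Z' 0 1 5 6, Z' 1 4 2 3], [0, 4, 2, 3, 5, 6]⟩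
theorem zComm_sound : zComm.Sound ζ :=
sound_of_derives canSound_two [⟨swYb, [], []⟩] [] ⟨swYb_sound, trivial⟩ trivial
    (by decide +kernel)

def pZ : Rule := ⟨[P' 4 0 1, Z' 1 2 3 4], [Z' 0 1 3 4, P' 4 1 2], [0, 2, 3, 4]⟩
theorem pZ_sound : pZ.Sound ζ :=
sound_of_derives canSound_two [⟨zz.symm, [(0, 0), (1, 4)], [(0, 0), (2, 3)]⟩, ⟨(pYb 4), [], []⟩]
    [] ⟨zz_sound.symm, pYb_sound, trivial⟩ trivial
    (by decide +kernel)

def cZ : Rule := ⟨[C' 0 1, Z' 1 2 3 4], [Z' 0 1 3 4, C' 1 2], [0, 2, 3, 4]⟩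
theorem cZ_sound : cZ.Sound ζ :=
sound_of_derives canSound_two [⟨zCurl, [], []⟩, ⟨zComm, [(1, 1)], [(1, 2)]⟩, ⟨zComm, [(1, 8)],
    [(0, 2)]⟩, ⟨zCurl.symm, [], []⟩] [] ⟨zCurl_sound, zComm_sound, zComm_sound, zCurl_sound.symm,
    trivial⟩ trivial
    (by decide +kernel)

/-- A binary black vertex is odd: it passes through a strand at the cost of a curl on that strand.
In the model the curl is `diag(1, -1)`. -/
def nZ : Rule := ⟨[N' 0 1, Z' 1 2 3 4], [Z' 0 1 3 5, N' 1 2, C' 5 4], [0, 2, 3, 4]⟩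
theorem nZ_sound : nZ.Sound ζ :=
sound_of_derives canSound_two [⟨zz.symm, [(0, 0), (1, 4)], [(0, 0), (2, 3)]⟩, ⟨nYb, [], []⟩,
    ⟨zCurl.symm, [], []⟩, ⟨cZ.symm, [(0, 4)], []⟩] [] ⟨zz_sound.symm, nYb_sound, zCurl_sound.symm,
    cZ_sound.symm, trivial⟩ trivial
    (by decide +kernel)

def bZ : Rule := ⟨[B' 0 1 2, Z' 0 3 1 4], [B' 3 4 2], [2, 3, 4]⟩
theorem bZ_sound : bZ.Sound ζ :=
sound_of_derives canSound_two [⟨bFsw, [], []⟩] [] ⟨bFsw_sound, trivial⟩ trivial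
    (by decide +kernel)

def bZZZ : Rule := ⟨[B' 0 1 2, Z' 0 3 6 7, Z' 1 4 7 8, Z' 2 5 8 9], [B' 3 4 5, C' 6 9], [3, 4, 5,
    6, 9]⟩
theorem bZZZ_sound : bZZZ.Sound ζ :=
sound_of_derives canSound_two [⟨bYb, [], []⟩, ⟨zCurl.symm, [], []⟩] [] ⟨bYb_sound,
    zCurl_sound.symm, trivial⟩ trivial
    (by decide +kernel)

def cc : Rule := ⟨[C' 0 1, C' 1 2], [E' 0 2], [0, 2]⟩
theorem cc_sound : cc.Sound ζ :=
sound_of_derives canSound_two [⟨zCurl, [], []⟩, ⟨zCurl, [], []⟩, ⟨zComm, [(1, 1)], [(0, 2), (2,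
    1)]⟩, ⟨zz, [], [(0, 2)]⟩] [] ⟨zCurl_sound, zCurl_sound, zComm_sound, zz_sound, trivial⟩
    trivial
    (by decide +kernel)

def dEq : Rule := ⟨[D' 0 1 2], [N' 0 3, B' 3 1 2], [0, 1, 2]⟩
theorem dEq_sound : dEq.Sound ζ :=
sound_of_derives canSound_two [⟨dBlack, [], []⟩] [] ⟨dBlack_sound, trivial⟩ trivial
    (by decide +kernel)

def dZ : Rule := ⟨[D' 0 1 2, Z' 1 3 2 4], [D' 0 3 4], [0, 3, 4]⟩
theorem dZ_sound : dZ.Sound ζ :=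
sound_of_derives canSound_two [⟨dEq, [], []⟩, ⟨bZ, [], []⟩] [⟨dEq, [], []⟩] ⟨dEq_sound, bZ_sound,
    trivial⟩ ⟨dEq_sound, trivial⟩
    (by decide +kernel)

def nn : Rule := ⟨[N' 0 1, N' 1 2], [E' 0 2], [0, 2]⟩
theorem nn_sound : nn.Sound ζ :=
sound_of_derives canSound_two [⟨negNeg, [], []⟩] [] ⟨negNeg_sound, trivial⟩ trivial
    (by decide +kernel)

def nD : Rule := ⟨[D' 0 1 2, N' 0 3], [B' 1 2 3], [1, 2, 3]⟩
theorem nD_sound : nD.Sound ζ :=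
sound_of_derives canSound_two [⟨dEq, [], []⟩, ⟨nn, [], []⟩] [] ⟨dEq_sound, nn_sound, trivial⟩
    trivial
    (by decide +kernel)

def v0Eq : Rule := ⟨[O' 0], [N' 0 1, I' 1], [0]⟩
theorem v0Eq_sound : v0Eq.Sound ζ :=
sound_of_derives canSound_two [⟨v0Black, [], []⟩, ⟨dEq, [], [(0, 0)]⟩, ⟨v1Black.symm, [], []⟩] []
    ⟨v0Black_sound, dEq_sound, v1Black_sound.symm, trivial⟩ trivial
    (by decide +kernel)

def nO : Rule := ⟨[N' 0 1, O' 1], [I' 0], [0]⟩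
theorem nO_sound : nO.Sound ζ :=
sound_of_derives canSound_two [⟨v0Eq, [], []⟩, ⟨nn, [], []⟩] [] ⟨v0Eq_sound, nn_sound, trivial⟩
    trivial
    (by decide +kernel)

def dO : Rule := ⟨[D' 0 1 2, O' 2], [E' 0 1], [0, 1]⟩
theorem dO_sound : dO.Sound ζ :=
sound_of_derives canSound_two [⟨v0Eq, [], []⟩, ⟨dEq, [], []⟩, ⟨v1Black, [], []⟩, ⟨counit, [], []⟩]
    [] ⟨v0Eq_sound, dEq_sound, v1Black_sound, counit_sound, trivial⟩ trivial
    (by decide +kernel)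

def bO : Rule := ⟨[B' 0 1 2, O' 2], [N' 0 1], [0, 1]⟩
theorem bO_sound : bO.Sound ζ :=
sound_of_derives canSound_two [⟨nD.symm, [(3, 0), (2, 2)], []⟩, ⟨dO, [], []⟩] [] ⟨nD_sound.symm,
    dO_sound, trivial⟩ trivial
    (by decide +kernel)

def oo : Rule := ⟨[O' 0, O' 0], [], []⟩
theorem oo_sound : oo.Sound ζ :=
sound_of_derives canSound_two [⟨v0Eq, [], [(0, 0)]⟩, ⟨v0Eq, [], []⟩, ⟨v1Black, [], []⟩, ⟨v1Black,
    [], []⟩] [⟨unitCounit, [], []⟩] ⟨v0Eq_sound, v0Eq_sound, v1Black_sound, v1Black_sound,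
    trivial⟩ ⟨unitCounit_sound, trivial⟩
    (by decide +kernel)

def ii : Rule := ⟨[I' 0, I' 0], [], []⟩
theorem ii_sound : ii.Sound ζ :=
sound_of_derives canSound_two [⟨nO.symm, [], [(0, 0)]⟩, ⟨nO.symm, [], []⟩, ⟨nn, [], []⟩, ⟨oo, [],
    []⟩] [] ⟨nO_sound.symm, nO_sound.symm, nn_sound, oo_sound, trivial⟩ trivial
    (by decide +kernel)

def dI : Rule := ⟨[D' 0 1 2, I' 0], [N' 1 2], [1, 2]⟩
theorem dI_sound : dI.Sound ζ :=
sound_of_derives canSound_two [⟨dEq, [], []⟩, ⟨v0Eq.symm, [], []⟩, ⟨bO, [], []⟩] [] ⟨dEq_sound,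
    v0Eq_sound.symm, bO_sound, trivial⟩ trivial
    (by decide +kernel)

def bI : Rule := ⟨[B' 0 1 2, I' 2], [O' 0, O' 1], [0, 1]⟩
theorem bI_sound : bI.Sound ζ :=
sound_of_derives canSound_two [⟨v1Black, [], [(0, 2)]⟩] [⟨v0Eq, [(0, 0)], []⟩, ⟨v0Eq, [(0, 1)],
    []⟩, ⟨v1Black, [], []⟩, ⟨v1Black, [], []⟩, ⟨unitCopy, [], []⟩, ⟨nn, [], []⟩] ⟨v1Black_sound,
    trivial⟩ ⟨v0Eq_sound, v0Eq_sound, v1Black_sound, v1Black_sound, unitCopy_sound, nn_sound,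
    trivial⟩
    (by decide +kernel)

def dOO : Rule := ⟨[D' 0 1 2, O' 0], [O' 1, O' 2], [1, 2]⟩
theorem dOO_sound : dOO.Sound ζ :=
sound_of_derives canSound_two [⟨dEq, [], []⟩, ⟨nO, [], []⟩, ⟨bI, [], []⟩] [] ⟨dEq_sound, nO_sound,
    bI_sound, trivial⟩ trivial
    (by decide +kernel)

def dI' : Rule := ⟨[D' 0 1 2, I' 2], [I' 0, O' 1], [0, 1]⟩
theorem dI'_sound : dI'.Sound ζ :=
sound_of_derives canSound_two [⟨dEq, [], []⟩, ⟨bI, [], []⟩, ⟨nO, [], []⟩] [] ⟨dEq_sound, bI_sound,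
    nO_sound, trivial⟩ trivial
    (by decide +kernel)

def dD : Rule := ⟨[D' 0 1 2, D' 2 3 4], [D' 0 2 4, D' 2 1 3], [0, 1, 3, 4]⟩
theorem dD_sound : dD.Sound ζ :=
sound_of_derives canSound_two [⟨dEq, [], []⟩, ⟨dEq, [], []⟩, ⟨coassoc, [], []⟩] [⟨dEq, [], []⟩,
    ⟨dEq, [], []⟩] ⟨dEq_sound, dEq_sound, coassoc_sound, trivial⟩ ⟨dEq_sound, dEq_sound, trivial⟩
    (by decide +kernel)

/-- The vertex `d` is built from two odd vertices. Each leaves a curl on the strand it passes, and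
the two curls cancel, so that `d` is even. -/
def dZZ : Rule := ⟨[D' 0 4 5, Z' 0 3 6 8], [D' 3 1 2, Z' 1 4 6 7, Z' 2 5 7 8], [3, 4, 5, 6, 8]⟩
theorem dZZ_sound : dZZ.Sound ζ :=
sound_of_derives canSound_two [⟨dEq, [], []⟩, ⟨nZ, [], []⟩] [⟨zz.symm, [(0, 3), (1, 6)], [(0, 2),
    (2, 1)]⟩, ⟨dEq, [], []⟩, ⟨nZ, [], []⟩, ⟨bZZZ, [], []⟩, ⟨nZ, [], []⟩, ⟨cc, [], []⟩] ⟨dEq_sound,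
    nZ_sound, trivial⟩ ⟨zz_sound.symm, dEq_sound, nZ_sound, bZZZ_sound, nZ_sound, cc_sound,
    trivial⟩
    (by decide +kernel)

def oZ : Rule := ⟨[O' 1, Z' 1 2 3 4], [O' 2, E' 3 4], [2, 3, 4]⟩
theorem oZ_sound : oZ.Sound ζ :=
sound_of_derives canSound_two [⟨v0Black, [], []⟩, ⟨dZZ, [], [(1, 0)]⟩, ⟨zz, [], []⟩,
    ⟨v0Black.symm, [], []⟩] [] ⟨v0Black_sound, dZZ_sound, zz_sound, v0Black_sound.symm, trivial⟩
    trivial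
    (by decide +kernel)

def iZ : Rule := ⟨[I' 1, Z' 1 2 3 4], [I' 2, C' 3 4], [2, 3, 4]⟩
theorem iZ_sound : iZ.Sound ζ :=
sound_of_derives canSound_two [⟨nO.symm, [(0, 1)], []⟩, ⟨nZ, [], []⟩, ⟨oZ, [], []⟩, ⟨nO, [], []⟩]
    [] ⟨nO_sound.symm, nZ_sound, oZ_sound, nO_sound, trivial⟩ trivial
    (by decide +kernel)

def pO : Rule := ⟨[P' 4 0 1, O' 1], [O' 0], [0]⟩
theorem pO_sound : pO.Sound ζ :=
sound_of_derives canSound_two [⟨v0Black, [], []⟩, ⟨dEq, [], [(1, 0)]⟩, ⟨(pCounit 4).symm, [], []⟩]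
    [⟨v0Black, [], []⟩, ⟨dEq, [], [(0, 0)]⟩] ⟨v0Black_sound, dEq_sound, pCounit_sound.symm,
    trivial⟩ ⟨v0Black_sound, dEq_sound, trivial⟩
    (by decide +kernel)

def dP : Rule := ⟨[D' 0 1 2, P' 4 0 3], [D' 3 4 5, P' 4 1 4, P' 4 2 5], [1, 2, 3]⟩
theorem dP_sound : dP.Sound ζ :=
sound_of_derives canSound_two [⟨dEq, [], []⟩, ⟨(pSplit 4).symm, [], []⟩] [⟨dEq, [], []⟩]
    ⟨dEq_sound, pSplit_sound.symm, trivial⟩ ⟨dEq_sound, trivial⟩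
    (by decide +kernel)

def p1 : Rule := ⟨[P' 1 0 1], [E' 0 1], [0, 1]⟩
theorem p1_sound : p1.Sound ζ :=
sound_of_derives canSound_two [⟨pOne, [], []⟩] [] ⟨pOne_sound, trivial⟩ trivial
    (by decide +kernel)

def p0 : Rule := ⟨[P' 0 0 1], [O' 0, O' 1], [0, 1]⟩
theorem p0_sound : p0.Sound ζ :=
sound_of_derives canSound_two [⟨pZero, [], []⟩] [⟨v0Black, [], []⟩, ⟨v0Black, [], []⟩, ⟨dEq, [],
    [(0, 0)]⟩, ⟨dEq, [], [(0, 0)]⟩] ⟨pZero_sound, trivial⟩ ⟨v0Black_sound, v0Black_sound,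
    dEq_sound, dEq_sound, trivial⟩
    (by decide +kernel)

def pHalf : Rule := ⟨[D' 0 1 2, P' 3 1 3, P' 3 2 4, D' 5 3 4], [P' 1 0 5], [0, 5]⟩
theorem pHalf_sound : pHalf.Sound ζ :=
sound_of_derives canSound_two [⟨dEq, [], []⟩, ⟨dEq, [], []⟩, ⟨(pAdd 3 3 1), [], []⟩] []
    ⟨dEq_sound, dEq_sound, pAddHalf_sound, trivial⟩ trivial
    (by decide +kernel)

def pNeg : Rule := ⟨[D' 0 1 2, P' 1 1 3, P' 2 2 4, D' 5 3 4], [P' 0 0 5], [0, 5]⟩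
theorem pNeg_sound : pNeg.Sound ζ :=
sound_of_derives canSound_two [⟨dEq, [], []⟩, ⟨dEq, [], []⟩, ⟨(pAdd 1 2 0), [], []⟩] []
    ⟨dEq_sound, dEq_sound, pAddNeg_sound, trivial⟩ trivial
    (by decide +kernel)

/-- In the model this loop is the trace of `diag(1/2, 1/2)`. In the calculus it is `⟨1|1⟩` with `1 =
1/2 + 1/2` inserted: a vertex `d` with its distinguished leg in the state `|1⟩` becomes a negation.
-/
def aTr : Rule := ⟨[P' 3 0 1, N' 1 2, P' 3 2 3, N' 3 0], [], []⟩
theorem aTr_sound : aTr.Sound ζ :=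
sound_of_derives canSound_two [] [⟨ii.symm, [], []⟩, ⟨p1.symm, [], [(0, 0)]⟩, ⟨pHalf.symm, [],
    []⟩, ⟨dI, [], []⟩, ⟨dI, [], []⟩] trivial ⟨ii_sound.symm, p1_sound.symm, pHalf_sound.symm,
    dI_sound, dI_sound, trivial⟩
    (by decide +kernel)

def bialgD : Rule := ⟨[D' 0 4 5, D' 1 6 7, Z' 4 8 6 9, D' 2 8 7, D' 3 9 5], [D' 4 0 1, D' 4 2 3],
    [0, 1, 2, 3]⟩
theorem bialgD_sound : bialgD.Sound ζ :=
sound_of_derives canSound_two [⟨dEq, [], []⟩, ⟨dEq, [], []⟩, ⟨dEq, [], []⟩, ⟨dEq, [], []⟩, ⟨bialg,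
    [], []⟩] [⟨dEq, [], []⟩, ⟨dEq, [], []⟩] ⟨dEq_sound, dEq_sound, dEq_sound, dEq_sound,
    bialg_sound, trivial⟩ ⟨dEq_sound, dEq_sound, trivial⟩
    (by decide +kernel)

/-- In the addition given by `d`, the curl is the negative of the wire. The law comes from the
fermionic bialgebra: feeding `|1⟩` into two of its legs closes the crossing into a curl on one side,
and disconnects the other side into `|0⟩⟨0|`. -/
def bSum : Rule := ⟨[D' 0 1 2, C' 1 3, D' 4 3 2], [O' 0, O' 4], [0, 4]⟩
theorem bSum_sound : bSum.Sound ζ :=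
sound_of_derives canSound_two [⟨zCurl, [], []⟩, ⟨nn.symm, [], [(2, 1)]⟩, ⟨dI.symm, [], []⟩,
    ⟨dI.symm, [], []⟩, ⟨bialgD, [], []⟩, ⟨dI', [], []⟩, ⟨dI', [], []⟩, ⟨ii, [], []⟩] []
    ⟨zCurl_sound, nn_sound.symm, dI_sound.symm, dI_sound.symm, bialgD_sound, dI'_sound, dI'_sound,
    ii_sound, trivial⟩ trivial
    (by decide +kernel)

/-- The curl is the white vertex with parameter `-1`, by uniqueness of negatives: `c = c + (1 + p₋₁)
= (c + 1) + p₋₁ = p₋₁`. The first step uses `p0` and `pNeg`, the second coassociativity, the last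
`bSum`. -/
def cP : Rule := ⟨[C' 0 1], [P' 2 0 1], [0, 1]⟩
theorem cP_sound : cP.Sound ζ :=
sound_of_derives canSound_two [⟨dO.symm, [(0, 0)], [(0, 0)]⟩, ⟨dO.symm, [(0, 1)], [(0, 0)]⟩,
    ⟨p0.symm, [], []⟩, ⟨pNeg.symm, [], []⟩, ⟨p1, [], []⟩, ⟨dD, [(1, 2)], []⟩, ⟨dD, [], []⟩, ⟨bSum,
    [], []⟩, ⟨dO, [], []⟩, ⟨dO, [], []⟩] [] ⟨dO_sound.symm, dO_sound.symm, p0_sound.symm,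
    pNeg_sound.symm, p1_sound, dD_sound, dD_sound, bSum_sound, dO_sound, dO_sound, trivial⟩
    trivial
    (by decide +kernel)

def pZh : Rule := ⟨[P' 3 0 1, Z' 1 2 3 4], [Z' 0 1 3 4, P' 3 1 2], [0, 2, 3, 4]⟩
theorem pZh_sound : pZh.Sound ζ :=
sound_of_derives canSound_two [⟨zz.symm, [(0, 0), (1, 4)], [(0, 0), (2, 3)]⟩, ⟨(pYb 3), [], []⟩]
    [] ⟨zz_sound.symm, pYbHalf_sound, trivial⟩ trivial
    (by decide +kernel)

/-- The structural swaps at the top of the loop leave no trace in the net. What remains are two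
strands and one loop that crosses each of them once; the vertices on the loop are collected in one
place. -/
def wEq : Rule := ⟨[W' 0 1 2 3], [Z' 0 3 4 5, Z' 1 2 5 6, P' 3 6 7, N' 7 8, P' 3 8 9, N' 9 4], [0,
    1, 2, 3]⟩
theorem wEq_sound : wEq.Sound ζ :=
sound_of_derives canSound_two [⟨wLoop, [], []⟩, ⟨pZh, [], []⟩] [] ⟨wLoop_sound, pZh_sound,
    trivial⟩ trivial
    (by decide +kernel)

end Rule
end ZW

/-! ### Symmetries of the quaternary white vertex -/

namespace ZW
open PRO Dg

variable {ζ : ℕ → ℂ}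

namespace Rule

def wInner : Rule := ⟨[W' 0 1 2 3], [W' 0 2 1 3], [0, 1, 2, 3]⟩
theorem wInner_sound : wInner.Sound ζ :=
sound_of_derives canSound_two [⟨wEq, [], []⟩] [⟨wEq, [], []⟩] ⟨wEq_sound, trivial⟩ ⟨wEq_sound,
    trivial⟩
    (by decide +kernel)

def wO' : Rule := ⟨[W' 0 1 2 3, O' 0], [O' 3, Z' 1 2 4 6, P' 3 6 7, N' 7 8, P' 3 8 9, N' 9 4], [1,
    2, 3]⟩
theorem wO'_sound : wO'.Sound ζ :=
sound_of_derives canSound_two [⟨wEq, [], []⟩, ⟨oZ, [], []⟩] [] ⟨wEq_sound, oZ_sound, trivial⟩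
    trivial
    (by decide +kernel)

def wI' : Rule := ⟨[W' 0 1 2 3, I' 0], [I' 3, Z' 1 2 4 5, C' 5 6, P' 3 6 7, N' 7 8, P' 3 8 9, N' 9
    4], [1, 2, 3]⟩
theorem wI'_sound : wI'.Sound ζ :=
sound_of_derives canSound_two [⟨wEq, [], []⟩, ⟨iZ, [], []⟩, ⟨cZ, [], []⟩] [] ⟨wEq_sound, iZ_sound,
    cZ_sound, trivial⟩ trivial
    (by decide +kernel)

def wMove0 : Rule := ⟨[W' 0 1 2 3, Z' 0 4 5 6], [W' 4 1 2 7, Z' 3 7 5 6], [1, 2, 3, 4, 5, 6]⟩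
theorem wMove0_sound : wMove0.Sound ζ :=
sound_of_derives canSound_two [⟨wEq, [], []⟩, ⟨zComm, [], []⟩] [⟨wEq, [], []⟩] ⟨wEq_sound,
    zComm_sound, trivial⟩ ⟨wEq_sound, trivial⟩
    (by decide +kernel)

def wRot : Rule := ⟨[W' 0 1 2 3], [W' 1 2 3 0], [0, 1, 2, 3]⟩
theorem wRot_sound : wRot.Sound ζ :=
sound_of_derives canSound_two [⟨wRotate, [], []⟩] [] ⟨wRotate_sound, trivial⟩ trivial
    (by decide +kernel)

end Rule

open Rule

theorem inv_w_inner (a b c d : ℕ) : Inv ζ .w [a, b, c, d] [a, c, b, d] :=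
  inv_of_proves canSound_two (n := 4) (w1 ⊛ sw ⊛ w1) [⟨wInner, [], []⟩] []
    ⟨wInner_sound, trivial⟩ trivial (by decide +kernel)
    [a, b, c, d] rfl rfl fun x => by
      show [a, b, c, d].count x = [a, c, b, d].count x
      simp only [List.count_cons, List.count_nil]
      omega

theorem inv_w_rot (a b c d : ℕ) : Inv ζ .w [a, b, c, d] [b, c, d, a] :=
  inv_of_proves canSound_two (n := 4) ((w2 ⊛ sw) ⊳ (w1 ⊛ sw ⊛ w1) ⊳ (sw ⊛ w2))
    [⟨wRot, [], []⟩] []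
    ⟨wRot_sound, trivial⟩ trivial (by decide +kernel)
    [a, b, c, d] rfl rfl fun x => by
      show [a, b, c, d].count x = [b, c, d, a].count x
      simp only [List.count_cons, List.count_nil]
      omega

/-- The rotation of the four legs is an axiom, and the exchange of the two inner legs only reverses
a strand in the loop form. Conjugating this exchange by rotations gives all adjacent transpositions.
-/
theorem canSound_three : CanSound ζ 3 := by
  have hr : ∀ a b c d, Inv ζ .w [a, b, c, d] [d, a, b, c] := fun a b c d =>
    ((inv_w_rot a b c d).trans (inv_w_rot _ _ _ _)).trans (inv_w_rot _ _ _ _)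
  refine canSound (fun _ => inv_d) (fun _ => inv_c)
    (fun _ => ⟨inv_z_outer, inv_z_inner, inv_z_both⟩)
    fun _ => ⟨fun a b c d => ?_, inv_w_inner, fun a b c d => ?_⟩
  · exact ((hr a b c d).trans (inv_w_inner _ _ _ _)).trans (inv_w_rot _ _ _ _)
  · exact ((inv_w_rot a b c d).trans (inv_w_inner _ _ _ _)).trans (hr _ _ _ _)

end ZW

/-! ### Laws of the quaternary white vertex -/

namespace ZW
open PRO Dg

variable {ζ : ℕ → ℂ}

namespace Rule

/-- The loop around one strand projects it to `|0⟩`. The factor `⟨0|0⟩ = 1` is inserted to complete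
the picture to a quaternary vertex with two legs in the state `|0⟩`. By its symmetry the vertex may
be evaluated with another pairing of its legs, which cuts the strand and leaves the scalar `aTr`. In
`rI` an additional curl on the loop projects to `|1⟩` instead. -/
def rO : Rule := ⟨[Z' 0 1 4 6, P' 3 6 7, N' 7 8, P' 3 8 9, N' 9 4], [O' 0, O' 1], [0, 1]⟩
theorem rO_sound : rO.Sound ζ :=
sound_of_derives canSound_three [⟨oo.symm, [], []⟩, ⟨wO'.symm, [], []⟩, ⟨wO', [(0, 10), (3, 0)],
    []⟩, ⟨oZ, [], []⟩, ⟨aTr, [], []⟩] [] ⟨oo_sound.symm, wO'_sound.symm, wO'_sound, oZ_sound,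
    aTr_sound, trivial⟩ trivial
    (by decide +kernel)

def rI : Rule := ⟨[Z' 0 1 4 5, C' 5 6, P' 3 6 7, N' 7 8, P' 3 8 9, N' 9 4], [I' 0, I' 1], [0, 1]⟩
theorem rI_sound : rI.Sound ζ :=
sound_of_derives canSound_three [⟨ii.symm, [], []⟩, ⟨wI'.symm, [], []⟩, ⟨wI', [(0, 11), (3, 0)],
    []⟩, ⟨iZ, [], []⟩, ⟨cc, [], []⟩, ⟨aTr, [], []⟩] [] ⟨ii_sound.symm, wI'_sound.symm, wI'_sound,
    iZ_sound, cc_sound, aTr_sound, trivial⟩ trivial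
    (by decide +kernel)

def wO : Rule := ⟨[W' 0 1 2 3, O' 0], [O' 1, O' 2, O' 3], [1, 2, 3]⟩
theorem wO_sound : wO.Sound ζ :=
sound_of_derives canSound_three [⟨wO', [], []⟩, ⟨rO, [], []⟩] [] ⟨wO'_sound, rO_sound, trivial⟩
    trivial
    (by decide +kernel)

def wI : Rule := ⟨[W' 0 1 2 3, I' 0], [I' 1, I' 2, I' 3], [1, 2, 3]⟩
theorem wI_sound : wI.Sound ζ :=
sound_of_derives canSound_three [⟨wI', [], []⟩, ⟨rI, [], []⟩] [] ⟨wI'_sound, rI_sound, trivial⟩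
    trivial
    (by decide +kernel)

def wTr : Rule := ⟨[W' 0 1 2 2], [E' 0 1], [0, 1]⟩
theorem wTr_sound : wTr.Sound ζ :=
sound_of_derives canSound_three [⟨wEq, [(0, 0), (1, 1)], [(0, 2)]⟩, ⟨zz, [], []⟩, ⟨aTr, [], []⟩]
    [] ⟨wEq_sound, zz_sound, aTr_sound, trivial⟩ trivial
    (by decide +kernel)

def wMove : Rule := ⟨[W' 0 1 2 3, Z' 0 4 5 6], [W' 4 1 2 7, Z' 3 7 5 6], [1, 2, 3, 4, 5, 6]⟩
theorem wMove_sound : wMove.Sound ζ :=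
sound_of_derives canSound_three [⟨wMove0, [], []⟩] [] ⟨wMove0_sound, trivial⟩ trivial
    (by decide +kernel)

def wZ : Rule := ⟨[W' 0 1 2 3, Z' 0 4 1 5], [W' 4 6 2 3, C' 6 5], [2, 3, 4, 5]⟩
theorem wZ_sound : wZ.Sound ζ :=
sound_of_derives canSound_three [⟨wMove, [(3, 1)], [(1, 1)]⟩, ⟨zCurl.symm, [], []⟩] []
    ⟨wMove_sound, zCurl_sound.symm, trivial⟩ trivial
    (by decide +kernel)

def wC : Rule := ⟨[W' 0 1 2 3, C' 0 4], [W' 4 7 2 3, C' 1 7], [1, 2, 3, 4]⟩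
theorem wC_sound : wC.Sound ζ :=
sound_of_derives canSound_three [⟨wZ.symm, [], []⟩, ⟨wZ, [(5, 1)], []⟩] [] ⟨wZ_sound.symm,
    wZ_sound, trivial⟩ trivial
    (by decide +kernel)

def wP : Rule := ⟨[W' 0 1 2 3, P' 4 0 4], [W' 4 5 2 3, P' 4 1 5], [1, 2, 3, 4]⟩
theorem wP_sound : wP.Sound ζ :=
sound_of_derives canSound_three [⟨wEq, [(0, 0), (3, 1)], []⟩, ⟨pZ, [], []⟩] [⟨wEq, [(0, 4), (3,
    5)], []⟩] ⟨wEq_sound, pZ_sound, trivial⟩ ⟨wEq_sound, trivial⟩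
    (by decide +kernel)

def wW : Rule := ⟨[W' 0 1 2 3, W' 3 4 5 6], [W' 0 1 4 3, W' 3 2 5 6], [0, 1, 2, 4, 5, 6]⟩
theorem wW_sound : wW.Sound ζ :=
sound_of_derives canSound_three [⟨wEq, [(0, 3), (3, 4)], []⟩, ⟨wMove, [(0, 3), (3, 2)], []⟩,
    ⟨wEq.symm, [], []⟩] [] ⟨wEq_sound, wMove_sound, wEq_sound.symm, trivial⟩ trivial
    (by decide +kernel)

def wD : Rule := ⟨[W' 0 1 2 3, D' 3 4 5], [D' 0 6 7, D' 1 8 9, D' 2 10 11, W' 6 8 10 4, W' 7 9 11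
    5], [0, 1, 2, 4, 5]⟩
theorem wD_sound : wD.Sound ζ :=
sound_of_derives canSound_three [] [⟨dEq, [], []⟩, ⟨dEq, [], []⟩, ⟨dEq, [], []⟩, ⟨wSplit, [], []⟩,
    ⟨dEq.symm, [], []⟩] trivial ⟨dEq_sound, dEq_sound, dEq_sound, wSplit_sound, dEq_sound.symm,
    trivial⟩
    (by decide +kernel)

def fZ : Rule := ⟨[N' 1 2, W' 2 3 4 5, D' 6 1 3, Z' 6 7 8 9], [N' 1 2, W' 2 3 4 5, D' 7 1 3, C' 8
    9], [4, 5, 7, 8, 9]⟩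
theorem fZ_sound : fZ.Sound ζ :=
sound_of_derives canSound_three [⟨dZZ, [], []⟩, ⟨wMove, [(0, 3), (3, 2)], []⟩, ⟨nZ, [], []⟩, ⟨zz,
    [], []⟩] [] ⟨dZZ_sound, wMove_sound, nZ_sound, zz_sound, trivial⟩ trivial
    (by decide +kernel)

/-- A free line next to `|1⟩` is the same as a quaternary vertex controlled by `|1⟩`; this is how
cups are later expressed by operators. An inserted loop of value 1 becomes, by `fZ`, a loop around
the leg `6`, which projects it to `|1⟩`; the rest then collapses to a line by `wTr`. -/
def ins : Rule := ⟨[N' 1 2, W' 2 3 4 5, D' 6 1 3], [I' 6, E' 4 5], [4, 5, 6]⟩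
theorem ins_sound : ins.Sound ζ :=
sound_of_derives canSound_three [⟨aTr.symm, [], []⟩, ⟨cc.symm, [], [(3, 0)]⟩, ⟨fZ.symm, [], []⟩,
    ⟨rI, [], []⟩, ⟨dI, [], []⟩, ⟨nn, [], []⟩, ⟨wTr, [], []⟩] [] ⟨aTr_sound.symm, cc_sound.symm,
    fZ_sound.symm, rI_sound, dI_sound, nn_sound, wTr_sound, trivial⟩ trivial
    (by decide +kernel)

/-- The scalar `⟨0|1⟩`, which is 0 in the model, is idempotent by the axiom `black_zero`. -/
def zOI : Rule := ⟨[O' 0, I' 0, O' 1, I' 1], [O' 0, I' 0], []⟩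
theorem zOI_sound : zOI.Sound ζ :=
sound_of_derives canSound_three [⟨v0Eq, [(0, 0)], []⟩, ⟨v0Eq, [(0, 1)], []⟩, ⟨v1Black, [], []⟩,
    ⟨v1Black, [], []⟩, ⟨v1Black, [], []⟩, ⟨v1Black, [], []⟩, ⟨zero, [], []⟩] [⟨v0Eq, [], []⟩,
    ⟨v1Black, [], []⟩, ⟨v1Black, [], []⟩] ⟨v0Eq_sound, v0Eq_sound, v1Black_sound, v1Black_sound,
    v1Black_sound, v1Black_sound, zero_sound, trivial⟩ ⟨v0Eq_sound, v1Black_sound, v1Black_sound,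
    trivial⟩
    (by decide +kernel)

end Rule
end ZW

namespace ZW
open PRO Dg

/-! ### Operators on a stack of wires -/

/-- Operators on `n` wires controlled by a wire on their right; the first one has its control
rightmost and acts last. -/
inductive Ops (n : ℕ) : ℕ → Type
  | nil : Ops n 0
  | cons {q : ℕ} (K : H (n + 1) n) (Q : Ops n q) : Ops n (q + 1)

infixr:67 " ∷ " => Ops.cons

namespace Ops

variable {n : ℕ}

def appl : ∀ {q}, Ops n q → H (n + q) n
  | _, nil => ZWModAx.id n
  | _, cons K Q => U (appl Q) ⨾ K

def append : ∀ {q r}, Ops n q → Ops n r → Ops n (r + q)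
  | _, _, nil, R => R
  | _, _, cons K Q, R => cons K (append Q R)

/-- The operator `K` behind a wire that crosses its control. -/
def lft {n : ℕ} (K : H (n + 1) n) : H (n + 1 + 1) (n + 1) := T n fs ⨾ U K

def map : ∀ {q}, Ops n q → Ops (n + 1) q
  | _, nil => nil
  | _, cons K Q => cons (lft K) (map Q)

theorem appl_one (K : H (n + 1) n) : appl (K ∷ nil) = K := by
  show U (ZWModAx.id n) ⨾ K = K
  rw [U_id, ZWModAx.id_comp]

theorem appl_append_heq : ∀ {q r} (Q : Ops n q) (R : Ops n r),
    HEq (appl (append Q R)) (V (appl R) q ⨾ appl Q)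
  | _, _, nil, R => heq_of_eq (ZWModAx.comp_id _).symm
  | q + 1, r, cons K Q, R => by
    show HEq (U (appl (append Q R)) ⨾ K) (U (V (appl R) q) ⨾ U (appl Q) ⨾ K)
    rw [← ZWModAx.assoc, ← U_comp]
    refine comp_heq (by omega) rfl rfl ?_ HEq.rfl
    exact tensor_heq (by omega) rfl rfl rfl (appl_append_heq Q R) HEq.rfl

theorem appl_map : ∀ {q} (Q : Ops n q), appl (map Q) = X' fs n q ⨾ U (appl Q)
  | _, nil => by
    show ZWModAx.id (n + 1) = ZWModAx.id (n + 1) ⨾ U (ZWModAx.id n)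
    rw [U_id, ZWModAx.id_comp]
  | q + 1, cons K Q => by
    show U (appl (map Q)) ⨾ (T n fs ⨾ U K) = (U (X' fs n q) ⨾ T (n + q) fs) ⨾ U (U (appl Q) ⨾ K)
    rw [appl_map Q, U_comp, U_comp, ZWModAx.assoc, ZWModAx.assoc, ← ZWModAx.assoc (U (U (appl Q))),
      ← ZWModAx.assoc (T (n + q) fs)]
    have : U (U (appl Q)) ⨾ T n fs = T (n + q) fs ⨾ U (U (appl Q)) := V_T (appl Q) fs
    rw [this]

end Ops

open Ops

/-- The diagram `g` turns the operators `Q` into the operators `P`. -/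
def Loc {n p q : ℕ} (g : H p q) (P : Ops n p) (Q : Ops n q) : Prop := T n g ⨾ appl Q = appl P

namespace Loc

variable {n : ℕ}

theorem id {q : ℕ} (Q : Ops n q) : Loc (ZWModAx.id q) Q Q := by
  show T n (ZWModAx.id q) ⨾ appl Q = appl Q
  rw [T_id, ZWModAx.id_comp]

theorem comp {p q r : ℕ} {g : H p q} {h : H q r} {P : Ops n p} {Q : Ops n q} {R : Ops n r}
    (hg : Loc g P Q) (hh : Loc h Q R) : Loc (g ⨾ h) P R := by
  show T n (g ⨾ h) ⨾ appl R = appl P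
  rw [T_comp, ZWModAx.assoc, hh, hg]

theorem up {p q : ℕ} {g : H p q} {P : Ops n p} {Q : Ops n q} (hg : Loc g P Q)
    (K : H (n + 1) n) : Loc (U g) (K ∷ P) (K ∷ Q) := by
  show T n (U g) ⨾ U (appl Q) ⨾ K = U (appl P) ⨾ K
  rw [T_U, ← ZWModAx.assoc, ← U_comp, hg]

theorem below {p q r : ℕ} {g : H p q} {P : Ops n p} {Q : Ops n q} (hg : Loc g P Q)
    (R : Ops n r) : Loc (T r g) (append P R) (append Q R) := by
  have e : V (appl R) p ⨾ T n g ⨾ appl Q = V (appl R) p ⨾ appl P := by rw [hg]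
  rw [← ZWModAx.assoc, V_T, ZWModAx.assoc] at e
  refine eq_of_heq (HEq.trans ?_ ((heq_of_eq e).trans (appl_append_heq P R).symm))
  exact comp_heq (by omega) (by omega) rfl (T_T_heq n r g) (appl_append_heq Q R)

/-- The additional wire is moved across all the controls at once; `g` slides through it, after which
the old identity applies beside it. -/
theorem lft {p q : ℕ} {g : H p q} (hs : Slides fs g)
    {P : Ops n p} {Q : Ops n q} (hg : Loc g P Q) : Loc g P.map Q.map := by
  have e : T (n + 1) g ⨾ X' fs n q = X' fs n p ⨾ U (T n g) := by
    have h := congrArg (fun t => X' fs n p ⨾ (t ⨾ X' fs n q)) (hs n)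
    simp only [ZWModAx.assoc] at h
    rw [X_X' fs_fs, ZWModAx.comp_id, ← ZWModAx.assoc (X' fs n p) (X fs n p), X'_X fs_fs,
      ZWModAx.id_comp] at h
    exact h.symm
  show T (n + 1) g ⨾ appl Q.map = appl P.map
  rw [appl_map, appl_map, ← ZWModAx.assoc, e, ZWModAx.assoc, ← U_comp, hg]

theorem congr {p q : ℕ} {g g' : H p q} (h : g = g') {P : Ops n p} {Q : Ops n q}
    (hg : Loc g P Q) : Loc g' P Q := h ▸ hg

/-- An operator is recovered from any expansion of its control. Identities between operators thus
reduce to identities between diagrams on the controls. -/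
theorem unique {q : ℕ} {g : H 1 q} {K K' : H (n + 1) n} {Q : Ops n q}
    (h : Loc g (K ∷ nil) Q) (h' : Loc g (K' ∷ nil) Q) : K = K' := by
  have := h.symm.trans h'
  rwa [appl_one, appl_one] at this

end Loc

end ZW

namespace ZW
open PRO

variable {ζ : ℕ → ℂ}

namespace Dg

/-- `g` between `r` wires on its left and `s` wires on its right. -/
def mid {a b : ℕ} (r : ℕ) (g : Dg a b) : ∀ s, Dg (r + a + s) (r + b + s)
  | 0 => DTerm.id r ⊛ g
  | s + 1 => mid r g s ⊛ w1

/-- In the model `k0` and `k1` are the basis states, `b0` is `⟨0|`, and `cpy` sends `|b⟩` to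
`|bbb⟩`. The map `dl` sends `|0⟩` to `|00⟩` and `|1⟩` to `|10⟩ + |01⟩`; `mul` is its transpose, so
`|11⟩` goes to 0. The wire is the Grassmann algebra on one generator `|1⟩`, and `mul` its product.
-/
def k0 : Dg 0 1 := st .v0 1
def k1 : Dg 0 1 := st .v1 1
def b0 : Dg 1 0 := (w1 ⊛ k0) ⊳ cap
def dl : Dg 1 2 := (w1 ⊛ st .d 3) ⊳ mid 0 cap 2
def mul : Dg 2 1 :=
  (w2 ⊛ st .d 3) ⊳ mid 2 sw 1 ⊳ mid 3 sw 0 ⊳ mid 1 cap 2 ⊳ mid 0 cap 1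
def cpy : Dg 1 3 := (w1 ⊛ st .w 4) ⊳ mid 0 cap 3

end Dg

open Dg Rule

/-! ### Identities between small diagrams -/

theorem mul_assoc : dval ζ (mid 0 mul 1 ⊳ mul) = dval ζ (mid 1 mul 0 ⊳ mul) :=
  dval_eq_of_proves canSound_three [⟨dD, [], []⟩, ⟨dD, [], []⟩] [] ⟨dD_sound, dD_sound, trivial⟩
    trivial
    (by decide +kernel)

theorem mul_unit : dval ζ (mid 1 k0 0 ⊳ mul) = dval ζ (w1) :=
  dval_eq_of_proves canSound_three [⟨dO, [], []⟩] [] ⟨dO_sound, trivial⟩ trivial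
    (by decide +kernel)

theorem mul_comm_left : dval ζ (mid 1 fsw 0 ⊳ mid 0 mul 1 ⊳ mul) = dval ζ (mid 0 mul 1 ⊳ mul) :=
  dval_eq_of_proves canSound_three [⟨dD, [], []⟩, ⟨dD, [], []⟩, ⟨dZ, [], []⟩] [⟨dD, [], []⟩,
    ⟨dD, [], []⟩] ⟨dD_sound, dD_sound, dZ_sound, trivial⟩ ⟨dD_sound, dD_sound, trivial⟩
    (by decide +kernel)

theorem mul_fsw : dval ζ (mid 0 mul 1 ⊳ fsw) = dval ζ (mid 1 fsw 0 ⊳ mid 0 fsw 1 ⊳ mid 1 mul 0) :=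
  dval_eq_of_proves canSound_three [] [⟨dZZ.symm, [], []⟩] trivial ⟨dZZ_sound.symm, trivial⟩
    (by decide +kernel)

theorem dl_assoc : dval ζ (dl ⊳ mid 0 dl 1) = dval ζ (dl ⊳ mid 1 dl 0) :=
  dval_eq_of_proves canSound_three [⟨dD, [], []⟩] [] ⟨dD_sound, trivial⟩ trivial
    (by decide +kernel)

theorem dl_comm : dval ζ (dl ⊳ fsw) = dval ζ (dl) :=
  dval_eq_of_proves canSound_three [⟨dZ, [], []⟩] [] ⟨dZ_sound, trivial⟩ trivial
    (by decide +kernel)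

theorem dl_counit : dval ζ (dl ⊳ mid 1 b0 0) = dval ζ (w1) :=
  dval_eq_of_proves canSound_three [⟨dO, [], []⟩] [] ⟨dO_sound, trivial⟩ trivial
    (by decide +kernel)

theorem dl_mul : dval ζ (mul ⊳ dl) = dval ζ (mid 0 dl 1 ⊳ mid 2 dl 0 ⊳ mid 1 fsw 1 ⊳ mid 0 mul 2 ⊳
    mid 1 mul 0) :=
  dval_eq_of_proves canSound_three [] [⟨bialgD, [], []⟩] trivial ⟨bialgD_sound, trivial⟩
    (by decide +kernel)

theorem dl_fsw : dval ζ (mid 0 dl 1 ⊳ mid 1 fsw 0 ⊳ mid 0 fsw 1) = dval ζ (fsw ⊳ mid 1 dl 0) :=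
  dval_eq_of_proves canSound_three [⟨dZZ.symm, [], []⟩] [] ⟨dZZ_sound.symm, trivial⟩ trivial
    (by decide +kernel)

theorem k0_b0 : dval ζ (k0 ⊳ b0) = dval ζ (nl) :=
  dval_eq_of_proves canSound_three [⟨oo, [], []⟩] [] ⟨oo_sound, trivial⟩ trivial
    (by decide +kernel)

theorem mul_b0 : dval ζ (mul ⊳ b0) = dval ζ (mid 0 b0 1 ⊳ b0) :=
  dval_eq_of_proves canSound_three [⟨dOO, [], []⟩] [] ⟨dOO_sound, trivial⟩ trivial
    (by decide +kernel)

theorem k0_dl : dval ζ (k0 ⊳ dl) = dval ζ (k0 ⊳ mid 0 k0 1) :=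
  dval_eq_of_proves canSound_three [⟨dOO, [], []⟩] [] ⟨dOO_sound, trivial⟩ trivial
    (by decide +kernel)

theorem k0_pha : dval ζ (k0 ⊳ pha 4) = dval ζ (k0) :=
  dval_eq_of_proves canSound_three [⟨pO, [], []⟩] [] ⟨pO_sound, trivial⟩ trivial
    (by decide +kernel)

theorem mul_pha : dval ζ (mul ⊳ pha 4) = dval ζ (mid 0 (pha 4) 1 ⊳ mid 1 (pha 4) 0 ⊳ mul) :=
  dval_eq_of_proves canSound_three [⟨dP, [], []⟩] [] ⟨dP_sound, trivial⟩ trivial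
    (by decide +kernel)

theorem pha_zero : dval ζ (pha 0) = dval ζ (b0 ⊳ k0) :=
  dval_eq_of_proves canSound_three [⟨p0, [], []⟩] [] ⟨p0_sound, trivial⟩ trivial
    (by decide +kernel)

theorem k0_cpy : dval ζ (k0 ⊳ cpy) = dval ζ (k0 ⊳ mid 0 k0 1 ⊳ mid 0 k0 2) :=
  dval_eq_of_proves canSound_three [⟨wO, [], []⟩] [] ⟨wO_sound, trivial⟩ trivial
    (by decide +kernel)

theorem cpy_b0 : dval ζ (cpy ⊳ mid 0 b0 2) = dval ζ (b0 ⊳ k0 ⊳ mid 0 k0 1) :=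
  dval_eq_of_proves canSound_three [⟨wO, [], []⟩] [] ⟨wO_sound, trivial⟩ trivial
    (by decide +kernel)

theorem cpy_fsw_left : dval ζ (cpy ⊳ mid 0 fsw 1) = dval ζ (pha 2 ⊳ cpy) :=
  dval_eq_of_proves canSound_three [⟨wZ, [], []⟩, ⟨wC, [(1, 0)], []⟩, ⟨cP, [], []⟩] []
    ⟨wZ_sound, wC_sound, cP_sound, trivial⟩ trivial
    (by decide +kernel)

theorem cpy_fsw_right : dval ζ (cpy ⊳ mid 1 fsw 0) = dval ζ (pha 2 ⊳ cpy) :=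
  dval_eq_of_proves canSound_three [⟨wZ, [], []⟩, ⟨wC, [(1, 0)], []⟩, ⟨cP, [], []⟩] []
    ⟨wZ_sound, wC_sound, cP_sound, trivial⟩ trivial
    (by decide +kernel)

theorem cpy_cpy_fsw : dval ζ (cpy ⊳ mid 0 cpy 2 ⊳ mid 2 fsw 1) = dval ζ (pha 2 ⊳ cpy ⊳ mid 0 cpy
    2) :=
  dval_eq_of_proves canSound_three [⟨wW, [(2, 1), (4, 16)], []⟩, ⟨wZ, [], []⟩, ⟨wC, [(1, 0)],
    []⟩, ⟨cP, [], []⟩] [⟨wW, [(2, 1), (4, 3)], []⟩] ⟨wW_sound, wZ_sound, wC_sound, cP_sound,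
    trivial⟩ ⟨wW_sound, trivial⟩
    (by decide +kernel)

theorem cpy_pha : dval ζ (pha 4 ⊳ cpy) = dval ζ (cpy ⊳ mid 0 (pha 4) 2) :=
  dval_eq_of_proves canSound_three [⟨wP, [(1, 3)], []⟩] [] ⟨wP_sound, trivial⟩ trivial
    (by decide +kernel)

theorem cpy_dl_left : dval ζ (cpy ⊳ mid 0 dl 2) = dval ζ (dl ⊳ mid 0 cpy 1 ⊳ mid 3 cpy 0 ⊳ mid 2
    fsw 2 ⊳ mid 1 fsw 3 ⊳ mid 3 fsw 1 ⊳ mid 2 mul 2 ⊳ mid 3 mul 0) :=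
  dval_eq_of_proves canSound_three [⟨wD, [], []⟩] [⟨wMove, [(0, 27), (3, 19)], []⟩, ⟨zz, [],
    []⟩, ⟨wMove, [(0, 22), (3, 11)], []⟩, ⟨wMove, [(0, 23), (3, 15)], []⟩, ⟨dZ, [], []⟩]
    ⟨wD_sound, trivial⟩ ⟨wMove_sound, zz_sound, wMove_sound, wMove_sound, dZ_sound, trivial⟩
    (by decide +kernel)

theorem mul_cpy : dval ζ (mul ⊳ cpy) = dval ζ (mid 0 cpy 1 ⊳ mid 3 cpy 0 ⊳ mid 2 fsw 2 ⊳ mid 1 fsw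
    3 ⊳ mid 3 fsw 1 ⊳ mid 0 mul 4 ⊳ mid 1 mul 2 ⊳ mid 2 mul 0) :=
  dval_eq_of_proves canSound_three [⟨wD, [], []⟩] [⟨wMove, [(0, 24), (3, 16)], []⟩, ⟨zz, [],
    []⟩, ⟨wMove, [(0, 19), (3, 15)], []⟩, ⟨wMove, [(0, 20), (3, 32)], []⟩, ⟨dZ, [], []⟩]
    ⟨wD_sound, trivial⟩ ⟨wMove_sound, zz_sound, wMove_sound, wMove_sound, dZ_sound, trivial⟩
    (by decide +kernel)

theorem cpy_fsw : dval ζ (mid 0 cpy 1 ⊳ mid 2 fsw 0 ⊳ mid 1 fsw 1 ⊳ mid 0 fsw 2) = dval ζ (fsw ⊳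
    mid 1 cpy 0) :=
  dval_eq_of_proves canSound_three [⟨wMove, [(0, 12), (3, 16)], []⟩, ⟨zz, [], []⟩, ⟨wMove, [(0,
    20), (3, 1)], []⟩] [] ⟨wMove_sound, zz_sound, wMove_sound, trivial⟩ trivial
    (by decide +kernel)

theorem b0_fsw : dval ζ (fsw ⊳ mid 1 b0 0) = dval ζ (mid 0 b0 1) :=
  dval_eq_of_proves canSound_three [⟨oZ, [], []⟩] [] ⟨oZ_sound, trivial⟩ trivial
    (by decide +kernel)

theorem k0_fsw : dval ζ (mid 0 k0 1 ⊳ fsw) = dval ζ (mid 1 k0 0) :=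
  dval_eq_of_proves canSound_three [⟨oZ, [], []⟩] [] ⟨oZ_sound, trivial⟩ trivial
    (by decide +kernel)

theorem fsw_fsw : dval ζ (mid 0 fsw 1 ⊳ mid 1 fsw 0 ⊳ mid 0 fsw 1) = dval ζ (mid 1 fsw 0 ⊳ mid 0
    fsw 1 ⊳ mid 1 fsw 0) :=
  dval_eq_of_proves canSound_three [⟨fswYb, [], []⟩] [] ⟨fswYb_sound, trivial⟩ trivial
    (by decide +kernel)

theorem pha_fsw : dval ζ (mid 0 (pha 4) 1 ⊳ fsw) = dval ζ (fsw ⊳ mid 1 (pha 4) 0) :=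
  dval_eq_of_proves canSound_three [⟨Rule.pZ, [], []⟩] [] ⟨Rule.pZ_sound, trivial⟩ trivial
    (by decide +kernel)

theorem pha_dl : dval ζ (pha 4 ⊳ dl) = dval ζ (dl ⊳ mid 0 (pha 4) 1 ⊳ mid 1 (pha 4) 0) :=
  dval_eq_of_proves canSound_three [⟨dP, [], []⟩] [] ⟨dP_sound, trivial⟩ trivial
    (by decide +kernel)

end ZW

namespace ZW
open PRO Dg Ops

variable {ζ : ℕ → ℂ} {n : ℕ}

/-! ### Controlled operators -/

namespace Loc

theorem ctx {p q : ℕ} {g : Dg p q} {P : Ops n p} {Q : Ops n q} (h : Loc (dval ζ g) P Q)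
    {r s : ℕ} (R : Ops n r) (S : Ops n s) :
    Loc (dval ζ (mid r g s)) (append S (append P R)) (append S (append Q R)) := by
  induction S with
  | nil => exact h.below R
  | cons K S ih => exact ih.up K

/-- To prove a local identity, the operator on the output may be expanded. -/
theorem expand {p q : ℕ} {g : H p 1} {d : H 1 q} {P : Ops n p} {K : H (n + 1) n} {Q : Ops n q}
    (hd : Loc d (K ∷ nil) Q) (h : Loc (g ⨾ d) P Q) : Loc g P (K ∷ nil) := by
  have e : T n (g ⨾ d) ⨾ appl Q = appl P := h
  rw [T_comp, ZWModAx.assoc] at e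
  exact (congrArg (T n g ⨾ ·) hd.symm).trans e

end Loc

/-- The operator `K` is the identity if its control is in the state `0`, and turns sums of
controls into composites. -/
structure Act (K : H (n + 1) n) : Prop where
  unit : ∀ ζ, Loc (dval ζ k0) nil (K ∷ nil)
  mul : ∀ ζ, Loc (dval ζ mul) (K ∷ K ∷ nil) (K ∷ nil)

/-- The operators commute up to a crossing of their controls. -/
def Com (K K' : H (n + 1) n) : Prop := ∀ ζ, Loc (dval ζ fsw) (K' ∷ K ∷ nil) (K ∷ K' ∷ nil)

noncomputable def ph (z : ℂ) : H 1 1 := cls (phase z)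

/-- If `K` stands for `1 + θA`, these diagrams on the control give the sum, a multiple, zero and a
product of three operators. For `appl (B ∷ A ∷ nil)` the operator `A` acts first. -/
noncomputable def addO (A B : H (n + 1) n) : H (n + 1) n := T n (dval 0 dl) ⨾ appl (B ∷ A ∷ nil)
noncomputable def smulO (z : ℂ) (A : H (n + 1) n) : H (n + 1) n := T n (ph z) ⨾ appl (A ∷ nil)
noncomputable def zeroO (n : ℕ) : H (n + 1) n := T n (dval 0 b0)
noncomputable def triO (A B C : H (n + 1) n) : H (n + 1) n := T n (dval 0 cpy) ⨾ appl (C ∷ B ∷ A ∷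
    nil)

theorem loc_single {q : ℕ} {g : H 1 q} {Q : Ops n q} {K : H (n + 1) n} (h : K = T n g ⨾ appl Q) :
    Loc g (K ∷ nil) Q := by
  show T n g ⨾ appl Q = appl (K ∷ nil)
  rw [appl_one, h]

theorem loc_addO (ζ) (A B : H (n + 1) n) : Loc (dval ζ dl) (addO A B ∷ nil) (B ∷ A ∷ nil) :=
  loc_single rfl

theorem loc_triO (ζ) (A B C : H (n + 1) n) :
    Loc (dval ζ cpy) (triO A B C ∷ nil) (C ∷ B ∷ A ∷ nil) := loc_single rfl

theorem loc_smulO {k : ℕ} {z : ℂ} (h : pv ζ k = z) (A : H (n + 1) n) :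
    Loc (dval ζ (pha k)) (smulO z A ∷ nil) (A ∷ nil) :=
  loc_single (by rw [dval_pha, h]; rfl)

theorem loc_zeroO (ζ) (n : ℕ) : Loc (dval ζ b0) (zeroO n ∷ nil) nil :=
  loc_single (ZWModAx.comp_id _).symm

theorem Com.symm {A B : H (n + 1) n} (h : Com A B) : Com B A := fun ζ => by
  have e : T n (dval ζ fsw) ⨾ appl (A ∷ B ∷ nil) = appl (B ∷ A ∷ nil) := h ζ
  show T n (dval ζ fsw) ⨾ appl (B ∷ A ∷ nil) = appl (A ∷ B ∷ nil)
  have f : dval ζ fsw ⨾ dval ζ fsw = ZWModAx.id 2 := by rw [dval_fsw]; exact fs_fs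
  rw [← e, ← ZWModAx.assoc, ← T_comp, f, T_id, ZWModAx.id_comp]

/-- This is the fermionic bialgebra law on the controls, with `Com` exchanging the middle ones. In
the model: a sum of two anticommuting operators of square zero has square zero. -/
theorem Act.addO {A B : H (n + 1) n} (hA : Act A) (hB : Act B) (h : Com A B) :
    Act (addO A B) where
  unit ζ := (loc_addO ζ A B).expand <|
    (((hB.unit ζ).comp (((hA.unit ζ).ctx nil (B ∷ nil)))).congr k0_dl.symm)
  mul ζ := (loc_addO ζ A B).expand <|
    ((((loc_addO ζ A B).ctx nil (ZW.addO A B ∷ nil)).comp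
    (((loc_addO ζ A B).ctx (B ∷ A ∷ nil) nil).comp
    (((h.symm ζ).ctx (A ∷ nil) (B ∷ nil)).comp
    (((hA.mul ζ).ctx nil (B ∷ B ∷ nil)).comp ((hB.mul ζ).ctx (A ∷ nil) nil))))).congr dl_mul.symm)

theorem Act.zeroO : Act (zeroO n) where
  unit ζ := (loc_zeroO ζ n).expand <| (Loc.id _).congr k0_b0.symm
  mul ζ := (loc_zeroO ζ n).expand <|
    (((loc_zeroO ζ n).ctx nil (ZW.zeroO n ∷ nil)).comp (loc_zeroO ζ n)).congr mul_b0.symm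

theorem Act.smulO {A : H (n + 1) n} (hA : Act A) (z : ℂ) : Act (smulO z A) :=
  have h : Loc (dval (fun _ => z) (pha 4)) (ZW.smulO z A ∷ nil) (A ∷ nil) := loc_smulO rfl A
  { unit := fun _ => h.expand <| (hA.unit fun _ => z).congr k0_pha.symm
    mul := fun _ => h.expand <| ((h.ctx nil (ZW.smulO z A ∷ nil)).comp
      ((h.ctx (A ∷ nil) nil).comp (hA.mul _))).congr mul_pha.symm }

theorem Act.triO {A B C : H (n + 1) n} (hA : Act A) (hB : Act B) (hC : Act C) (hAB : Com A B)
    (hAC : Com A C) (hBC : Com B C) : Act (triO A B C) where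
  unit ζ := (loc_triO ζ A B C).expand <|
    ((hC.unit ζ).comp (((hB.unit ζ).ctx nil (C ∷ nil)).comp
    ((hA.unit ζ).ctx nil (C ∷ B ∷ nil)))).congr k0_cpy.symm
  mul ζ := (loc_triO ζ A B C).expand <|
    (((loc_triO ζ A B C).ctx nil (ZW.triO A B C ∷ nil)).comp
    (((loc_triO ζ A B C).ctx (C ∷ B ∷ A ∷ nil) nil).comp
    (((hAC.symm ζ).ctx (B ∷ A ∷ nil) (C ∷ B ∷ nil)).comp
    (((hAB.symm ζ).ctx (A ∷ nil) (C ∷ B ∷ C ∷ nil)).comp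
    (((hBC.symm ζ).ctx (B ∷ A ∷ A ∷ nil) (C ∷ nil)).comp
    (((hA.mul ζ).ctx nil (C ∷ C ∷ B ∷ B ∷ nil)).comp
    (((hB.mul ζ).ctx (A ∷ nil) (C ∷ C ∷ nil)).comp
    ((hC.mul ζ).ctx (B ∷ A ∷ nil) nil)))))))).congr mul_cpy.symm

theorem Loc.swap_expand {q : ℕ} {d : H 1 q} {f : H 2 2} {P : Ops n 2} {A B : H (n + 1) n}
    {Q : Ops n q} (hd : Loc d (A ∷ nil) Q) (h : Loc (f ⨾ T 1 d) P (append Q (B ∷ nil))) :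
    Loc f P (A ∷ B ∷ nil) := by
  have e : T n (f ⨾ T 1 d) ⨾ appl (append Q (B ∷ nil)) = appl P := h
  rw [T_comp, ZWModAx.assoc] at e
  exact (congrArg (T n f ⨾ ·) (hd.below (B ∷ nil)).symm).trans e

theorem Com.addO {A B C : H (n + 1) n} (hA : Com A C) (hB : Com B C) : Com (addO A B) C :=
  fun ζ => (loc_addO ζ A B).swap_expand <|
    (((loc_addO ζ A B).ctx nil (C ∷ nil)).comp
    (((hB ζ).ctx (A ∷ nil) nil).comp ((hA ζ).ctx nil (B ∷ nil)))).congr dl_fsw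

theorem Com.zeroO (C : H (n + 1) n) : Com (zeroO n) C :=
  fun ζ => (loc_zeroO ζ n).swap_expand <| ((loc_zeroO ζ n).ctx nil (C ∷ nil)).congr b0_fsw.symm

theorem Com.smulO {A C : H (n + 1) n} (hA : Com A C) (z : ℂ) : Com (smulO z A) C := fun _ =>
  have h : Loc (dval (fun _ => z) (pha 4)) (ZW.smulO z A ∷ nil) (A ∷ nil) := loc_smulO rfl A
  h.swap_expand <| ((h.ctx nil (C ∷ nil)).comp (hA _)).congr pha_fsw

theorem Com.triO {A B C D : H (n + 1) n} (hA : Com A D) (hB : Com B D) (hC : Com C D) :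
    Com (triO A B C) D :=
  fun ζ => (loc_triO ζ A B C).swap_expand <|
    (((loc_triO ζ A B C).ctx nil (D ∷ nil)).comp
    (((hC ζ).ctx (B ∷ A ∷ nil) nil).comp
    (((hB ζ).ctx (A ∷ nil) (C ∷ nil)).comp ((hA ζ).ctx nil (C ∷ B ∷ nil))))).congr cpy_fsw

theorem addO_assoc (A B C : H (n + 1) n) : addO (addO A B) C = addO A (addO B C) :=
  (((loc_addO 0 (addO A B) C).comp ((loc_addO 0 A B).ctx nil (C ∷ nil))).congr dl_assoc).unique
    ((loc_addO 0 A (addO B C)).comp ((loc_addO 0 B C).ctx (A ∷ nil) nil))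

theorem addO_comm {A B : H (n + 1) n} (h : Com A B) : addO A B = addO B A :=
  (((loc_addO 0 A B).comp (h 0)).congr dl_comm).unique (loc_addO 0 B A)

theorem addO_zeroO (A : H (n + 1) n) : addO A (zeroO n) = A :=
  (((loc_addO 0 A (zeroO n)).comp ((loc_zeroO 0 n).ctx (A ∷ nil) nil)).congr dl_counit).unique
    (Loc.id _)

theorem zeroO_addO (A : H (n + 1) n) : addO (zeroO n) A = A := by
  rw [addO_comm (Com.zeroO A), addO_zeroO]

theorem smulO_addO (z : ℂ) (A B : H (n + 1) n) :
    smulO z (addO A B) = addO (smulO z A) (smulO z B) :=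
  ((loc_smulO (ζ := fun _ => z) (k := 4) rfl (addO A B)).comp (loc_addO _ A B)).unique
    (((loc_addO _ (smulO z A) (smulO z B)).comp (((loc_smulO rfl A).ctx nil (smulO z B ∷ nil)).comp
      ((loc_smulO rfl B).ctx (A ∷ nil) nil))).congr pha_dl.symm)

theorem smulO_smulO (z w : ℂ) (A : H (n + 1) n) : smulO z (smulO w A) = smulO (z * w) A := by
  have e : ph z ⨾ ph w = ph (z * w) := cls_ax (.phase_mul z w)
  unfold smulO
  rw [appl_one, appl_one, ← ZWModAx.assoc, ← T_comp, e]

theorem smulO_one (A : H (n + 1) n) : smulO 1 A = A := by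
  have e : ph 1 = ZWModAx.id 1 := cls_ax .phase_one
  unfold smulO
  rw [appl_one, e, T_id, ZWModAx.id_comp]

theorem smulO_zero {A : H (n + 1) n} (hA : Act A) : smulO 0 A = zeroO n :=
  (loc_smulO (ζ := 0) (k := 0) rfl A).unique
    (((loc_zeroO 0 n).comp (hA.unit 0)).congr pha_zero.symm)

theorem addO_smulO {A : H (n + 1) n} (hA : Act A) (z w : ℂ) :
    addO (smulO z A) (smulO w A) = smulO (z + w) A := by
  -- The indices 4, 5, 6 in the rules below stand for `ζ 0`, `ζ 1`, `ζ 2`.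
  let ζ : ℕ → ℂ
    | 0 => z
    | 1 => w
    | _ => z + w
  have h : dval ζ (dl ⊳ mid 0 (pha 4) 1 ⊳ mid 1 (pha 5) 0 ⊳ mul) = dval ζ (pha 6) :=
    dval_eq_of_proves canSound_three
      [⟨Rule.dEq, [], []⟩, ⟨Rule.dEq, [], []⟩, ⟨Rule.pAdd 4 5 6, [], []⟩] []
      ⟨Rule.dEq_sound, Rule.dEq_sound, Rule.pAdd_sound 4 5 6 rfl (by decide +kernel)
        (by decide +kernel), trivial⟩ trivial (by decide +kernel)
  exact (((loc_addO ζ _ _).comp (((loc_smulO rfl A).ctx nil (smulO w A ∷ nil)).comp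
    (((loc_smulO rfl A).ctx (A ∷ nil) nil).comp (hA.mul ζ)))).congr h).unique (loc_smulO rfl A)

theorem triO_smulO (z : ℂ) (A B C : H (n + 1) n) :
    triO (smulO z A) B C = smulO z (triO A B C) :=
  (((loc_triO (fun _ => z) (smulO z A) B C).comp
    ((loc_smulO rfl A).ctx nil (C ∷ B ∷ nil))).congr cpy_pha.symm).unique
    ((loc_smulO rfl _).comp (loc_triO _ A B C))

theorem triO_addO_left {A A' B C : H (n + 1) n} (hB : Act B) (hC : Act C) (hAB : Com A' B)
    (hAC : Com A' C) (hBC : Com B C) :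
    triO (addO A A') B C = addO (triO A B C) (triO A' B C) :=
  have h : Loc (dval 0 (cpy ⊳ mid 0 dl 2)) (addO (triO A B C) (triO A' B C) ∷ nil)
      (C ∷ B ∷ A' ∷ A ∷ nil) :=
    ((loc_addO 0 _ _).comp (((loc_triO 0 A B C).ctx nil (triO A' B C ∷ nil)).comp
    (((loc_triO 0 A' B C).ctx (C ∷ B ∷ A ∷ nil) nil).comp
    (((hAC.symm 0).ctx (B ∷ A ∷ nil) (C ∷ B ∷ nil)).comp
    (((hAB.symm 0).ctx (A ∷ nil) (C ∷ B ∷ C ∷ nil)).comp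
    (((hBC.symm 0).ctx (B ∷ A' ∷ A ∷ nil) (C ∷ nil)).comp
    (((hB.mul 0).ctx (A' ∷ A ∷ nil) (C ∷ C ∷ nil)).comp
    ((hC.mul 0).ctx (B ∷ A' ∷ A ∷ nil) nil)))))))).congr cpy_dl_left.symm
  ((loc_triO 0 (addO A A') B C).comp ((loc_addO 0 A A').ctx nil (C ∷ B ∷ nil))).unique h

theorem triO_zeroO {B C : H (n + 1) n} (hB : Act B) (hC : Act C) :
    triO (zeroO n) B C = zeroO n :=
  (((loc_triO 0 (zeroO n) B C).comp
    ((loc_zeroO 0 n).ctx nil (C ∷ B ∷ nil))).congr cpy_b0).unique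
    ((loc_zeroO 0 n).comp ((hC.unit 0).comp ((hB.unit 0).ctx nil (C ∷ nil))))

/-- Operators are exchanged by crossing their controls, and crossing two legs of a quaternary white
vertex leaves a curl, which is the factor `-1` by `cP`. -/
theorem triO_swap_right {A B C : H (n + 1) n} (h : Com B C) :
    triO A C B = smulO (-1) (triO A B C) :=
  (((loc_triO 0 A C B).comp ((h.symm 0).ctx (A ∷ nil) nil)).congr cpy_fsw_right).unique
    ((loc_smulO rfl _).comp (loc_triO 0 A B C))

theorem triO_swap_left {A B C : H (n + 1) n} (h : Com A B) :
    triO B A C = smulO (-1) (triO A B C) :=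
  (((loc_triO 0 B A C).comp ((h.symm 0).ctx nil (C ∷ nil))).congr cpy_fsw_left).unique
    ((loc_smulO rfl _).comp (loc_triO 0 A B C))

/-- Exchange of neighbours that lie in different triples of a longer product. By `wW` the legs of
two joined quaternary vertices may be regrouped so that both lie on the same vertex. -/
theorem triO_triO_swap {A B C D F : H (n + 1) n} (h : Com C D) :
    triO (triO A B D) C F = smulO (-1) (triO (triO A B C) D F) :=
  (((loc_triO 0 (triO A B D) C F).comp (((loc_triO 0 A B D).ctx nil (F ∷ C ∷ nil)).comp
    ((h.symm 0).ctx (B ∷ A ∷ nil) (F ∷ nil)))).congr cpy_cpy_fsw).unique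
    ((loc_smulO rfl _).comp ((loc_triO 0 (triO A B C) D F).comp
      ((loc_triO 0 A B C).ctx nil (F ∷ D ∷ nil))))

/-! ### Operators behind a wire -/

theorem X_fs_one : X fs 0 1 = dval ζ fsw := by
  rw [dval_fsw]
  show (T 0 fs) ⨾ (U (ZWModAx.id 1)) = fs
  rw [U_id]
  exact (ZWModAx.comp_id _).trans (eq_of_heq (T_zero_heq fs))

theorem U_T_zero {m k : ℕ} (f : H m k) : HEq (U (T 0 f)) (U f) :=
  tensor_heq (by omega) (by omega) rfl rfl (T_zero_heq f) HEq.rfl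

theorem X_fs_two : X fs 0 2 = dval ζ (mid 1 fsw 0 ⊳ mid 0 fsw 1) := by
  show T 1 fs ⨾ U (X fs 0 1) = T 1 (dval ζ fsw) ⨾ U (T 0 (dval ζ fsw))
  rw [X_fs_one (ζ := ζ), dval_fsw]
  exact congrArg (T 1 fs ⨾ ·) (eq_of_heq (U_T_zero fs)).symm

theorem X_fs_three : X fs 0 3 = dval ζ (mid 2 fsw 0 ⊳ mid 1 fsw 1 ⊳ mid 0 fsw 2) := by
  show T 2 fs ⨾ U (X fs 0 2) = T 2 (dval ζ fsw) ⨾ U (T 1 (dval ζ fsw)) ⨾ U (U (T 0 (dval ζ fsw)))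
  rw [X_fs_two (ζ := ζ), dval_fsw]
  show T 2 fs ⨾ U (T 1 (dval ζ fsw) ⨾ U (T 0 (dval ζ fsw))) = _
  rw [U_comp, dval_fsw]
  rfl

theorem slides_fs_cpy : Slides fs (dval ζ cpy) := slides_of (by
  rw [X_fs_three (ζ := ζ)]
  refine (cpy_fsw (ζ := ζ)).trans ?_
  rw [X_fs_one (ζ := ζ)]
  rfl)

theorem slides_fs_dl : Slides fs (dval ζ dl) := slides_of (by
  rw [X_fs_two (ζ := ζ)]
  refine (dl_fsw (ζ := ζ)).trans ?_
  rw [X_fs_one (ζ := ζ)]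
  rfl)

theorem slides_fs_mul : Slides fs (dval ζ Dg.mul) := slides_of (by
  rw [X_fs_one (ζ := ζ)]
  refine (mul_fsw (ζ := ζ)).trans ?_
  rw [X_fs_two (ζ := ζ)]
  exact ZWModAx.assoc _ _ _ |>.symm)

theorem slides_fs_fsw : Slides fs (dval ζ fsw) := slides_of (by
  rw [X_fs_two (ζ := ζ)]
  exact (fsw_fsw (ζ := ζ)).trans (ZWModAx.assoc _ _ _ |>.symm))

theorem slides_fs_pha (z : ℂ) : Slides fs (ph z) :=
  slides_of (f := dval (fun _ => z) (pha 4)) (by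
    rw [X_fs_one (ζ := fun _ => z)]
    exact pha_fsw)

theorem slides_fs_b0 : Slides fs (dval ζ b0) := slides_of (by
  rw [X_fs_one (ζ := ζ)]
  exact (ZWModAx.comp_id _).trans b0_fsw.symm)

theorem slides_fs_k0 : Slides fs (dval ζ k0) := slides_of (by
  rw [X_fs_one (ζ := ζ)]
  exact k0_fsw.trans (ZWModAx.id_comp _).symm)

theorem lft_addO (A B : H (n + 1) n) : lft (addO A B) = addO (lft A) (lft B) :=
  ((loc_addO 0 A B).lft slides_fs_dl).unique (loc_addO 0 (lft A) (lft B))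

theorem lft_triO (A B C : H (n + 1) n) : lft (triO A B C) = triO (lft A) (lft B) (lft C) :=
  ((loc_triO 0 A B C).lft slides_fs_cpy).unique (loc_triO 0 (lft A) (lft B) (lft C))

theorem lft_smulO (z : ℂ) (A : H (n + 1) n) : lft (smulO z A) = smulO z (lft A) :=
  ((loc_smulO (ζ := fun _ => z) (k := 4) rfl A).lft (slides_fs_pha z)).unique
    (loc_smulO (ζ := fun _ => z) (k := 4) rfl (lft A))

theorem lft_zeroO : lft (zeroO n) = zeroO (n + 1) :=
  ((loc_zeroO 0 n).lft slides_fs_b0).unique (loc_zeroO 0 (n + 1))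

theorem Act.lft {A : H (n + 1) n} (h : Act A) : Act (lft A) where
  unit ζ := (h.unit ζ).lft slides_fs_k0
  mul ζ := (h.mul ζ).lft slides_fs_mul

theorem Com.lft {A B : H (n + 1) n} (h : Com A B) : Com (lft A) (lft B) :=
  fun ζ => (h ζ).lft slides_fs_fsw

end ZW

namespace ZW
open PRO Dg Ops

variable {ζ : ℕ → ℂ} {n : ℕ}

section
open Rule
theorem mul_fsw_left : dval ζ (mid 1 mul 0 ⊳ fsw) = dval ζ (mid 0 fsw 1 ⊳ mid 1 fsw 0 ⊳ mid 0 mul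
    1) :=
  dval_eq_of_proves canSound_three [⟨dZZ, [(4, 0)], []⟩] [] ⟨dZZ_sound, trivial⟩ trivial
    (by decide +kernel)

end

/-! ### Creation operators -/

/-- The operator that adds a particle in the rightmost wire. -/
noncomputable def mulO (n : ℕ) : H (n + 1 + 1) (n + 1) := T n (dval 0 Dg.mul)

theorem act_mulO (n : ℕ) : Act (mulO n) where
  unit ζ := by
    have e : T n (T 1 (dval ζ k0)) = T (n + 1) (dval ζ k0) := eq_of_heq (T_T_heq n 1 _)
    show T (n + 1) (dval ζ k0) ⨾ appl (mulO n ∷ nil) = ZWModAx.id (n + 1)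
    rw [appl_one, ← e]
    refine (T_comp n _ _).symm.trans ?_
    exact (congrArg (T n) (mul_unit (ζ := ζ))).trans (T_id n 1)
  mul ζ := by
    have e : T n (T 1 (dval ζ Dg.mul)) = T (n + 1) (dval ζ Dg.mul) := eq_of_heq (T_T_heq n 1 _)
    show T (n + 1) (dval ζ Dg.mul) ⨾ appl (mulO n ∷ nil) = U (appl (mulO n ∷ nil)) ⨾ mulO n
    rw [appl_one, ← e]
    refine (T_comp n _ _).symm.trans ?_
    refine (congrArg (T n) (mul_assoc (ζ := ζ))).symm.trans ?_
    refine (T_comp n _ _).trans ?_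
    refine congrArg (· ⨾ mulO n) ((T_U n (T 0 (dval ζ Dg.mul))).trans ?_)
    exact congrArg U (congrArg (T n) (eq_of_heq (T_zero_heq (dval ζ Dg.mul))))

theorem T_mid_heq (n r : ℕ) {a b : ℕ} (g : Dg a b) : ∀ s,
    HEq (T n (dval ζ (mid r g s))) (V (T (n + r) (dval ζ g)) s)
  | 0 => T_T_heq n r (dval ζ g)
  | s + 1 => by
    refine HEq.trans (heq_of_eq (T_U n (dval ζ (mid r g s)))) ?_
    exact tensor_heq (show n + (r + a + s) = n + r + a + s by omega)
      (show n + (r + b + s) = n + r + b + s by omega) rfl rfl (T_mid_heq n r g s) HEq.rfl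

theorem T_cp (n : ℕ) {a b c : ℕ} (f : Dg a b) (g : Dg b c) :
    T n (dval ζ (f ⊳ g)) = T n (dval ζ f) ⨾ T n (dval ζ g) := T_comp n _ _

theorem com_mulO_mulO (n : ℕ) : Com (mulO n) (mulO n) := fun ζ => by
  have h := congrArg (T n) (mul_comm_left (ζ := ζ))
  have e1 : T n (dval ζ (mid 1 fsw 0)) = T (n + 1) (dval ζ fsw) := eq_of_heq (T_mid_heq n 1 fsw 0)
  have e2 : T n (dval ζ (mid 0 Dg.mul 1)) = U (mulO n) := eq_of_heq (T_mid_heq n 0 Dg.mul 1)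
  rw [T_cp, T_cp, e2] at h
  show T (n + 1) (dval ζ fsw) ⨾ U (appl (mulO n ∷ nil)) ⨾ mulO n =
    U (appl (mulO n ∷ nil)) ⨾ mulO n
  rw [appl_one, ← e1]
  exact h

theorem mulO_fs (n : ℕ) :
    U (mulO n) ⨾ T n fs = T (n + 1) fs ⨾ U (T n fs) ⨾ T (n + 1) (dval 0 Dg.mul) := by
  have h := congrArg (T n) (mul_fsw (ζ := 0))
  have e1 : T n (dval 0 (mid 1 fsw 0)) = T (n + 1) (dval 0 fsw) := eq_of_heq (T_mid_heq n 1 fsw 0)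
  have e2 : T n (dval 0 (mid 0 fsw 1)) = U (T n (dval 0 fsw)) := eq_of_heq (T_mid_heq n 0 fsw 1)
  have e3 : T n (dval 0 (mid 0 Dg.mul 1)) = U (mulO n) := eq_of_heq (T_mid_heq n 0 Dg.mul 1)
  have e4 : T n (dval 0 (mid 1 Dg.mul 0)) = T (n + 1) (dval 0 Dg.mul) :=
    eq_of_heq (T_mid_heq n 1 Dg.mul 0)
  rw [show fs = dval 0 fsw from dval_fsw.symm, ← e1, ← e2, ← e3, ← e4]
  rw [T_cp, T_cp, T_cp] at h
  exact h

/-- The control of `lft K` crosses the last wire, and multiplication on that wire slides through the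
crossing by `mulO_fs`. The operator `K` itself acts on other wires. -/
theorem com_mulO_lft (K : H (n + 1) n) : Com (mulO n) (lft K) := fun ζ => by
  have h' : T (n + 1) (dval 0 Dg.mul) ⨾ U K = U (U K) ⨾ mulO n := (V_T K _).symm
  show T (n + 1) (dval ζ fsw) ⨾ U (appl (lft K ∷ nil)) ⨾ mulO n =
    U (appl (mulO n ∷ nil)) ⨾ lft K
  rw [appl_one, appl_one, dval_fsw]
  show T (n + 1) fs ⨾ U (T n fs ⨾ U K) ⨾ mulO n = U (mulO n) ⨾ T n fs ⨾ U K
  rw [← ZWModAx.assoc (U (mulO n)), mulO_fs, U_comp]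
  simp only [ZWModAx.assoc]
  rw [h']

/-- The operator that adds a particle in the `i`-th wire from the right. -/
noncomputable def letter : ∀ n, ℕ → H (n + 1) n
  | 0, _ => zeroO 0
  | n + 1, 0 => mulO n
  | n + 1, i + 1 => lft (letter n i)

/-- The operator that adds particles in an odd number of wires. -/
noncomputable def word (n : ℕ) : List ℕ → H (n + 1) n
  | [] => zeroO n
  | [i] => letter n i
  | i :: j :: w => triO (word n w) (letter n j) (letter n i)

/-- Operators generated by the creation operators. -/
inductive IsOp : ∀ {m : ℕ}, H (m + 1) m → Prop
  | zero {m : ℕ} : IsOp (zeroO m)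
  | letter {m : ℕ} (i : ℕ) : IsOp (letter m i)
  | add {m : ℕ} {A B : H (m + 1) m} : IsOp A → IsOp B → IsOp (addO A B)
  | smul {m : ℕ} {A : H (m + 1) m} (z : ℂ) : IsOp A → IsOp (smulO z A)
  | tri {m : ℕ} {A B C : H (m + 1) m} : IsOp A → IsOp B → IsOp C → IsOp (triO A B C)

theorem com_letter : ∀ n i j, Com (letter n i) (letter n j)
  | 0, _, _ => Com.zeroO _
  | n + 1, 0, 0 => com_mulO_mulO n
  | _ + 1, 0, _ + 1 => com_mulO_lft _
  | _ + 1, _ + 1, 0 => (com_mulO_lft _).symm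
  | n + 1, i + 1, j + 1 => (com_letter n i j).lft

theorem act_letter : ∀ n i, Act (letter n i)
  | 0, _ => Act.zeroO
  | n + 1, 0 => act_mulO n
  | n + 1, i + 1 => (act_letter n i).lft

namespace IsOp

/-- It is enough to know that the letters commute with `C`, since the constructions of operators
preserve this. Applied on both sides, it reduces `com` to pairs of letters. -/
theorem com_of {A C : H (n + 1) n} (hA : IsOp A) (h : ∀ i, Com (ZW.letter n i) C) : Com A C := by
  revert C
  induction hA with
  | zero => exact fun _ => Com.zeroO _
  | letter i => exact fun h => h i
  | add _ _ h1 h2 => exact fun h => (h1 h).addO (h2 h)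
  | smul z _ h1 => exact fun h => (h1 h).smulO z
  | tri _ _ _ h1 h2 h3 => exact fun h => (h1 h).triO (h2 h) (h3 h)

theorem com {A B : H (n + 1) n} (hA : IsOp A) (hB : IsOp B) : Com A B :=
  hA.com_of fun i => (hB.com_of fun j => com_letter n j i).symm

theorem act {A : H (n + 1) n} (hA : IsOp A) : Act A := by
  induction hA with
  | zero => exact Act.zeroO
  | letter i => exact act_letter _ i
  | add hA hB h1 h2 => exact h1.addO h2 (hA.com hB)
  | smul z _ h1 => exact h1.smulO z
  | tri hA hB hC h1 h2 h3 => exact h1.triO h2 h3 (hA.com hB) (hA.com hC) (hB.com hC)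

theorem lft {A : H (n + 1) n} (hA : IsOp A) : IsOp (lft A) := by
  induction hA with
  | zero => rw [lft_zeroO]; exact .zero
  | letter i => exact .letter (i + 1)
  | add _ _ h1 h2 => rw [lft_addO]; exact .add h1 h2
  | smul z _ h1 => rw [lft_smulO]; exact .smul z h1
  | tri _ _ _ h1 h2 h3 => rw [lft_triO]; exact .tri h1 h2 h3

theorem word (n : ℕ) : ∀ w, IsOp (word n w)
  | [] => .zero
  | [i] => .letter i
  | i :: j :: w => .tri (word n w) (.letter j) (.letter i)

end IsOp

theorem lft_word (n : ℕ) : ∀ w, lft (word n w) = word (n + 1) (w.map Nat.succ)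
  | [] => lft_zeroO
  | [i] => rfl
  | i :: j :: w => by
    show lft (triO _ _ _) = triO (word (n + 1) (w.map Nat.succ)) (lft _) (lft _)
    rw [lft_triO, lft_word n w]

/-- Exchange of two neighbours in a word. -/
theorem word_swap (n a b : ℕ) (v : List ℕ) : ∀ u : List ℕ,
    (u ++ a :: b :: v).length % 2 = 1 →
    word n (u ++ b :: a :: v) = smulO (-1) (word n (u ++ a :: b :: v))
  | [], _ => triO_swap_right ((IsOp.letter b).com (.letter a))
  -- The exchanged letters are the second and third. They belong to the same triple only if the word
  -- has three letters, and otherwise to consecutive triples.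
  | [c], h => by
    match v with
    | [] => exact triO_swap_left ((IsOp.letter b).com (.letter a))
    | d :: v => exact triO_triO_swap ((IsOp.letter b).com (.letter a))
  | c :: d :: u, h => by
    show triO (word n (u ++ b :: a :: v)) _ _ = smulO (-1) (triO _ _ _)
    rw [word_swap n a b v u (by simp only [List.cons_append, List.length_cons] at h; omega),
      triO_smulO]
    rfl

/-! ### Linear combinations of words -/

noncomputable def comb (n : ℕ) : List (ℂ × List ℕ) → H (n + 1) n
  | [] => zeroO n
  | p :: L => addO (smulO p.1 (word n p.2)) (comb n L)

theorem IsOp.comb (n : ℕ) : ∀ L, IsOp (comb n L)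
  | [] => .zero
  | _ :: L => .add (.smul _ (.word n _)) (IsOp.comb n L)

theorem addO_comm' {A B : H (n + 1) n} (hA : IsOp A) (hB : IsOp B) : addO A B = addO B A :=
  addO_comm (hA.com hB)

theorem comb_append (n : ℕ) : ∀ L L', comb n (L ++ L') = addO (comb n L) (comb n L')
  | [], L' => (zeroO_addO _).symm
  | p :: L, L' => by
    show addO _ (comb n (L ++ L')) = addO (addO _ _) _
    rw [comb_append n L L', addO_assoc]

theorem smulO_zeroO (z : ℂ) : smulO z (zeroO n) = zeroO n := by
  rw [← smulO_zero (Act.zeroO (n := n)), smulO_smulO, mul_zero]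

/-- Linear combinations of words in `S`. -/
def Spn (n : ℕ) (S : List ℕ → Prop) (K : H (n + 1) n) : Prop :=
  ∃ L : List (ℂ × List ℕ), (∀ p ∈ L, S p.2) ∧ K = comb n L

namespace Spn

variable {S S' : List ℕ → Prop} {A B : H (n + 1) n}

theorem isOp (h : Spn n S A) : IsOp A := by
  obtain ⟨L, -, rfl⟩ := h
  exact .comb n L

theorem zero : Spn n S (zeroO n) := ⟨[], by simp, rfl⟩

theorem add (hA : Spn n S A) (hB : Spn n S B) : Spn n S (addO A B) := by
  obtain ⟨L, hL, rfl⟩ := hA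
  obtain ⟨L', hL', rfl⟩ := hB
  exact ⟨L ++ L', fun p hp => (List.mem_append.1 hp).elim (hL p) (hL' p), (comb_append n L L').symm⟩

theorem single (z : ℂ) {w : List ℕ} (hw : S w) : Spn n S (smulO z (word n w)) :=
  ⟨[(z, w)], by simpa using hw, (addO_zeroO _).symm⟩

theorem word {w : List ℕ} (hw : S w) : Spn n S (word n w) := by
  rw [← smulO_one (ZW.word n w)]
  exact single 1 hw

/-- Induction on linear combinations. -/
theorem ind {motive : H (n + 1) n → Prop} (hA : Spn n S A) (zero : motive (zeroO n))
    (word : ∀ w, S w → motive (ZW.word n w)) (smul : ∀ z K, IsOp K → motive K → motive (smulO z K))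
    (add : ∀ K K', IsOp K → IsOp K' → motive K → motive K' → motive (addO K K')) : motive A := by
  obtain ⟨L, hL, rfl⟩ := hA
  induction L with
  | nil => exact zero
  | cons p L ih =>
    exact add _ _ (.smul _ (.word n _)) (.comb n L)
      (smul _ _ (.word n _) (word _ (hL p (by simp)))) (ih fun q hq => hL q (by simp [hq]))

theorem smul (z : ℂ) (hA : Spn n S A) : Spn n S (smulO z A) := by
  obtain ⟨L, hL, rfl⟩ := hA
  induction L with
  | nil => exact smulO_zeroO (n := n) z ▸ zero
  | cons p L ih =>
    show Spn n S (smulO z (addO _ _))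
    rw [smulO_addO, smulO_smulO]
    exact (single _ (hL p (by simp))).add (ih fun q hq => hL q (by simp [hq]))

theorem mono (hA : Spn n S A) (h : ∀ w, S w → S' w) : Spn n S' A := by
  obtain ⟨L, hL, rfl⟩ := hA
  exact ⟨L, fun p hp => h _ (hL p hp), rfl⟩

end Spn

end ZW

/-! ### Diagrams for the closure of the normal forms -/

namespace ZW
open PRO

variable {ζ : ℕ → ℂ}

namespace Dg

/-- The controlled sign. -/
def zg : Dg 2 2 := fsw ⊳ sw
def b1 : Dg 1 0 := mid 1 k1 0 ⊳ cap
def bb : Dg 2 0 := mid 0 b1 1 ⊳ b1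
def clo : Dg 2 0 := mid 0 (pha 2 ⊳ pha 3 ⊳ neg ⊳ pha 3 ⊳ neg) 1 ⊳ cap
/-- The projector on the occupied state, as a loop. -/
def lp : Dg 1 1 := mid 1 cup 0 ⊳ mid 0 zg 1 ⊳ mid 1 clo 0
-- The third wire has a controlled sign with the first in `zN`, and with both others in `zJ`.
def zN : Dg 3 3 := mid 1 sw 0 ⊳ mid 0 zg 1 ⊳ mid 1 sw 0
def zJ : Dg 3 3 := mid 1 zg 0 ⊳ zN
def zJJ : Dg 4 4 := mid 2 zg 0 ⊳ mid 2 sw 0 ⊳ mid 0 zJ 1 ⊳ mid 2 sw 0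
def zJN : Dg 4 4 := mid 2 zg 0 ⊳ mid 2 sw 0 ⊳ mid 0 zN 1 ⊳ mid 2 sw 0
def lf2 : Dg 3 3 := mid 1 fsw 0 ⊳ mid 0 fsw 1
def tri1 : Dg 2 3 := mid 1 cpy 0 ⊳ mid 0 fsw 2 ⊳ mid 1 fsw 1 ⊳ mid 2 mul 0
def tri2 : Dg 3 3 := mid 2 cpy 0 ⊳ mid 1 fsw 2 ⊳ mid 0 fsw 3 ⊳ mid 2 fsw 1 ⊳ mid 1 mul 2 ⊳ mid 2
    mul 0
def kk1 : Dg 0 3 := k0 ⊳ mid 1 k0 0 ⊳ mid 2 k1 0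
def pair : Dg 1 3 := dl ⊳ mid 1 cpy 0 ⊳ mid 0 mul 2
def dist : Dg 2 2 := mid 0 dl 1 ⊳ mid 2 dl 0 ⊳ mid 1 fsw 1 ⊳ mid 0 mul 2 ⊳ mid 2 (pha 2) 0 ⊳ mid 1
    mul 0
/-- Two cups with a controlled sign. -/
def cupz : Dg 0 4 := cup ⊳ mid 2 cup 0 ⊳ mid 1 zg 1

end Dg

section
open Dg Rule

def Rule.dPm : Rule := ⟨[D' 0 1 2, P' 2 0 3], [D' 3 4 5, P' 2 1 4, P' 2 2 5], [1, 2, 3]⟩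

theorem Rule.pSplitNeg_sound : (pSplit 2).Sound ζ :=
  ruleOf_sound (cls_ax (.phase_split _)) (by decide +kernel) (by decide +kernel)

theorem Rule.dPm_sound : dPm.Sound ζ :=
  sound_of_derives canSound_two [⟨dEq, [], []⟩, ⟨(pSplit 2).symm, [], []⟩] [⟨dEq, [], []⟩]
    ⟨dEq_sound, pSplitNeg_sound.symm, trivial⟩ ⟨dEq_sound, trivial⟩ (by decide +kernel)

theorem lp_bb : dval ζ (mid 1 lp 0 ⊳ bb) = dval ζ (bb) :=
  dval_eq_of_proves canSound_three [⟨cP.symm, [], []⟩, ⟨rI, [], []⟩, ⟨ii, [], []⟩] []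
    ⟨cP_sound.symm, rI_sound, ii_sound, trivial⟩ trivial
    (by decide +kernel)

theorem lp_fsw_bb : dval ζ (mid 1 lp 0 ⊳ fsw ⊳ bb) = dval ζ (fsw ⊳ bb) :=
  dval_eq_of_proves canSound_three [⟨cP.symm, [], []⟩, ⟨iZ, [], []⟩, ⟨rI, [], []⟩, ⟨ii, [], []⟩]
    [⟨iZ, [], []⟩] ⟨cP_sound.symm, iZ_sound, rI_sound, ii_sound, trivial⟩ ⟨iZ_sound, trivial⟩
    (by decide +kernel)

theorem kk1_tri2_bb : dval ζ (kk1 ⊳ tri2 ⊳ mid 1 (fsw ⊳ bb) 0) = dval ζ (k1 ⊳ pha 2) :=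
  dval_eq_of_proves canSound_three [⟨oZ, [], []⟩, ⟨oZ, [], []⟩, ⟨oZ, [], []⟩, ⟨dO, [], []⟩, ⟨dO,
    [], []⟩, ⟨iZ, [], []⟩, ⟨wC, [(1, 0)], []⟩, ⟨wI, [], []⟩, ⟨ii, [], []⟩, ⟨ii, [], []⟩, ⟨cP,
    [], []⟩] [] ⟨oZ_sound, oZ_sound, oZ_sound, dO_sound, dO_sound, iZ_sound, wC_sound, wI_sound,
    ii_sound, ii_sound, cP_sound, trivial⟩ trivial
    (by decide +kernel)

/-- The cap is written with operations that are easy to control on words. Two new wires in the state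
`|00⟩ - |11⟩` are merged with the two given ones, and both results are required to be occupied; the
signs of the crossings make the two surviving terms agree. -/
theorem cap_eq : dval ζ (mid 2 (st (.p 2) 2) 0 ⊳ mid 2 fsw 0 ⊳ mid 1 fsw 1 ⊳ mid 2 mul 0 ⊳ mid 1
    fsw 0 ⊳ mid 0 fsw 1 ⊳ mid 1 mul 0 ⊳ fsw ⊳ bb) = dval ζ (cap) :=
  dval_eq_of_proves canSound_three [⟨iZ, [], []⟩, ⟨cZ, [(1, 28)], []⟩, ⟨iZ, [], []⟩, ⟨cZ, [(1,
    22)], []⟩, ⟨iZ, [], []⟩, ⟨dI, [], []⟩, ⟨cP, [(1, 18)], []⟩, ⟨dPm, [], []⟩, ⟨dI, [], []⟩,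
    ⟨cP.symm, [], []⟩, ⟨cP.symm, [], []⟩, ⟨cP.symm, [], []⟩, ⟨cZ, [(1, 13)], []⟩, ⟨cc, [], []⟩,
    ⟨zCurl.symm, [], []⟩, ⟨cZ, [(1, 12)], []⟩, ⟨nZ, [(1, 29)], []⟩, ⟨cZ, [(1, 30)], [(3, 0)]⟩,
    ⟨zCurl.symm, [], []⟩, ⟨cc, [], []⟩, ⟨cc, [], []⟩, ⟨nn, [], []⟩, ⟨cc, [], []⟩] [] ⟨iZ_sound,
    cZ_sound, iZ_sound, cZ_sound, iZ_sound, dI_sound, cP_sound, dPm_sound, dI_sound,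
    cP_sound.symm, cP_sound.symm, cP_sound.symm, cZ_sound, cc_sound, zCurl_sound.symm, cZ_sound,
    nZ_sound, cZ_sound, zCurl_sound.symm, cc_sound, cc_sound, nn_sound, cc_sound, trivial⟩
    trivial
    (by decide +kernel)

theorem pair_pair_zg : dval ζ (k1 ⊳ pair ⊳ mid 0 pair 2 ⊳ mid 2 zg 1) = dval ζ (kk1 ⊳ mid 2 (dl ⊳
    mid 1 cpy 0 ⊳ mid 0 dist 2) 0 ⊳ mid 0 (mid 0 lf2 1 ⊳ mid 1 tri2 0 ⊳ mid 0 mul 2) 2) :=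
  dval_eq_of_proves canSound_three [⟨wMove, [(0, 28), (3, 22)], []⟩, ⟨wMove, [(0, 29), (3, 14)],
    []⟩, ⟨bialgD.symm, [], []⟩, ⟨dZZ, [(0, 22), (4, 53), (7, 1000)], []⟩, ⟨wMove, [(0, 45), (3,
    12)], []⟩, ⟨zComm, [(1, 54)], []⟩, ⟨dD, [(1, 12), (4, 51)], []⟩, ⟨dZ, [], []⟩, ⟨dD, [(3,
    54)], []⟩, ⟨dZZ, [(0, 14), (4, 53), (8, 57)], [(6, 1)]⟩, ⟨zCurl.symm, [], []⟩, ⟨cZ, [(1,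
    1017)], []⟩, ⟨dZ, [], []⟩, ⟨cP, [], []⟩] [⟨oZ, [], []⟩, ⟨oZ, [], []⟩, ⟨oZ, [], []⟩, ⟨oZ, [],
    []⟩, ⟨oZ, [], []⟩, ⟨dO, [], []⟩, ⟨dO, [], []⟩] ⟨wMove_sound, wMove_sound, bialgD_sound.symm,
    dZZ_sound, wMove_sound, zComm_sound, dD_sound, dZ_sound, dD_sound, dZZ_sound,
    zCurl_sound.symm, cZ_sound, dZ_sound, cP_sound, trivial⟩ ⟨oZ_sound, oZ_sound, oZ_sound,
    oZ_sound, oZ_sound, dO_sound, dO_sound, trivial⟩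
    (by decide +kernel)

/-- On `|1⟩`, each `pair` produces a free cup beside `|1⟩`, by `dI` and `ins`. -/
theorem cupz_pair : dval ζ (k1 ⊳ mid 1 cupz 0) = dval ζ (k1 ⊳ pair ⊳ mid 0 pair 2 ⊳ mid 2 zg 1) :=
  dval_eq_of_proves canSound_three [] [⟨dI, [], []⟩, ⟨ins, [], []⟩, ⟨dI, [], []⟩, ⟨ins, [], []⟩]
    trivial ⟨dI_sound, ins_sound, dI_sound, ins_sound, trivial⟩
    (by decide +kernel)

theorem kk1_tri2_dl : dval ζ (kk1 ⊳ mid 2 dl 0 ⊳ mid 0 lf2 1 ⊳ mid 1 tri2 0) = dval ζ (k1 ⊳ dl ⊳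
    mid 1 cpy 0) :=
  dval_eq_of_proves canSound_three [⟨oZ, [], []⟩, ⟨oZ, [], []⟩, ⟨oZ, [], []⟩, ⟨oZ, [], []⟩, ⟨oZ,
    [], []⟩, ⟨dO, [], []⟩, ⟨dO, [], []⟩] [] ⟨oZ_sound, oZ_sound, oZ_sound, oZ_sound, oZ_sound,
    dO_sound, dO_sound, trivial⟩ trivial
    (by decide +kernel)

theorem kk1_tri2 : dval ζ (kk1 ⊳ tri2) = dval ζ (k1 ⊳ mid 1 k1 0 ⊳ mid 2 k1 0) :=
  dval_eq_of_proves canSound_three [⟨oZ, [], []⟩, ⟨oZ, [], []⟩, ⟨oZ, [], []⟩, ⟨dO, [], []⟩, ⟨dO,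
    [], []⟩, ⟨wI, [], []⟩] [] ⟨oZ_sound, oZ_sound, oZ_sound, dO_sound, dO_sound, wI_sound,
    trivial⟩ trivial
    (by decide +kernel)

theorem k1_dl_lp : dval ζ (k0 ⊳ mid 1 k1 0 ⊳ mid 1 dl 0 ⊳ mid 3 cup 0 ⊳ mid 0 zJN 1 ⊳ mid 3 clo 0)
    = dval ζ (kk1) :=
  dval_eq_of_proves canSound_three [⟨oZ, [], []⟩, ⟨dI, [], []⟩, ⟨cP.symm, [], []⟩, ⟨rI, [], []⟩,
    ⟨v0Eq.symm, [], []⟩] [] ⟨oZ_sound, dI_sound, cP_sound.symm, rI_sound, v0Eq_sound.symm,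
    trivial⟩ trivial
    (by decide +kernel)

theorem lft_zN : dval ζ (mid 0 fsw 1 ⊳ mid 1 zg 0) = dval ζ (zN ⊳ mid 0 fsw 1) :=
  dval_eq_of_proves canSound_three [⟨zComm, [], []⟩] [] ⟨zComm_sound, trivial⟩ trivial
    (by decide +kernel)

theorem mul_zJ : dval ζ (mid 0 mul 1 ⊳ zg) = dval ζ (zJ ⊳ mid 0 mul 1) :=
  dval_eq_of_proves canSound_three [⟨dZZ, [], []⟩] [] ⟨dZZ_sound, trivial⟩ trivial
    (by decide +kernel)

theorem tri1_zJ : dval ζ (mid 0 tri1 1 ⊳ mid 2 zg 0) = dval ζ (zJ ⊳ mid 0 tri1 1) :=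
  dval_eq_of_proves canSound_three [⟨dZZ, [], []⟩, ⟨wMove, [(0, 20), (3, 1)], []⟩, ⟨zComm, [(0,
    26), (1, 19)], []⟩, ⟨zComm, [(1, 17), (2, 3)], []⟩] [] ⟨dZZ_sound, wMove_sound, zComm_sound,
    zComm_sound, trivial⟩ trivial
    (by decide +kernel)

theorem dl_zJ : dval ζ (mid 1 dl 1 ⊳ zJJ) = dval ζ (zJ ⊳ mid 1 dl 1) :=
  dval_eq_of_proves canSound_three [⟨dZZ.symm, [], []⟩] [] ⟨dZZ_sound.symm, trivial⟩ trivial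
    (by decide +kernel)

theorem pha_zJ : dval ζ (mid 1 (pha 4) 1 ⊳ zJ) = dval ζ (zJ ⊳ mid 1 (pha 4) 1) :=
  dval_eq_of_proves canSound_three [⟨Rule.pZ, [], []⟩] [] ⟨Rule.pZ_sound, trivial⟩ trivial
    (by decide +kernel)

theorem b0_zJ : dval ζ (mid 1 b0 1 ⊳ zg) = dval ζ (zJ ⊳ mid 1 b0 1) :=
  dval_eq_of_proves canSound_three [] [⟨oZ, [], []⟩] trivial ⟨oZ_sound, trivial⟩
    (by decide +kernel)

/-- A structural swap is a fermionic swap with a controlled sign; the sign is supplied by `cupz` and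
the connections are made by caps. -/
theorem sw_eq : dval ζ (mid 2 cupz 0 ⊳ mid 3 fsw 1 ⊳ mid 1 cap 3 ⊳ mid 0 cap 2) = dval ζ (sw) :=
  dval_eq_of_proves canSound_three [⟨zz, [], []⟩] [] ⟨zz_sound, trivial⟩ trivial
    (by decide +kernel)

theorem dl_eq : dval ζ (mid 1 cup 0 ⊳ mid 3 cup 0 ⊳ mid 2 fsw 1 ⊳ mid 1 mul 2 ⊳ mid 0 cap 2) =
    dval ζ (dl) :=
  dval_eq_of_proves canSound_three [⟨dZ, [], []⟩] [] ⟨dZ_sound, trivial⟩ trivial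
    (by decide +kernel)

theorem n_eq : dval ζ (k1 ⊳ dl) = dval ζ (st .n 2) :=
  dval_eq_of_proves canSound_three [⟨dI, [], []⟩] [] ⟨dI_sound, trivial⟩ trivial
    (by decide +kernel)

theorem b_eq : dval ζ (k1 ⊳ dl ⊳ mid 0 dl 1) = dval ζ (st .b 3) :=
  dval_eq_of_proves canSound_three [⟨dI, [], []⟩, ⟨nD, [], []⟩] [] ⟨dI_sound, nD_sound, trivial⟩
    trivial
    (by decide +kernel)

end

end ZW

namespace ZW
open PRO Dg Ops

variable {ζ : ℕ → ℂ} {n m : ℕ}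

theorem addO_eq (A B : H (n + 1) n) : addO A B = T n (dval 0 dl) ⨾ U A ⨾ B := by
  show T n (dval 0 dl) ⨾ U (appl (A ∷ nil)) ⨾ B = _
  rw [appl_one]

theorem smulO_eq (z : ℂ) (A : H (n + 1) n) : smulO z A = T n (ph z) ⨾ A := by
  rw [smulO, appl_one]

theorem triO_eq (A B C : H (n + 1) n) :
    triO A B C = T n (dval 0 cpy) ⨾ U (U A ⨾ B) ⨾ C := by
  show T n (dval 0 cpy) ⨾ U (U (appl (A ∷ nil)) ⨾ B) ⨾ C = _
  rw [appl_one]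

/-! ### Maps that intertwine operators -/

/-- The map `G` intertwines the operators `K` and `K'`. -/
def Int (G : H n m) (K : H (n + 1) n) (K' : H (m + 1) m) : Prop := K ⨾ G = U G ⨾ K'

namespace Int

variable {G : H n m} {A B C : H (n + 1) n} {A' B' C' : H (m + 1) m}

theorem zero : Int G (zeroO n) (zeroO m) := (V_T G (dval 0 b0)).symm

theorem smul (h : Int G A A') (z : ℂ) : Int G (smulO z A) (smulO z A') := by
  show smulO z A ⨾ G = U G ⨾ smulO z A'
  have e : U G ⨾ T m (ph z) = T n (ph z) ⨾ U G := V_T G (ph z)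
  rw [smulO_eq, smulO_eq, ZWModAx.assoc, h, ← ZWModAx.assoc, ← e, ZWModAx.assoc]

theorem add (hA : Int G A A') (hB : Int G B B') : Int G (addO A B) (addO A' B') := by
  show addO A B ⨾ G = U G ⨾ addO A' B'
  have e : U G ⨾ T m (dval 0 dl) = T n (dval 0 dl) ⨾ U (U G) := V_T G (dval 0 dl)
  rw [addO_eq, addO_eq, ZWModAx.assoc, ZWModAx.assoc, hB, ← ZWModAx.assoc (U A), ← U_comp, hA,
    U_comp, ZWModAx.assoc, ← ZWModAx.assoc (U G), e, ZWModAx.assoc]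

theorem tri (hA : Int G A A') (hB : Int G B B') (hC : Int G C C') :
    Int G (triO A B C) (triO A' B' C') := by
  show triO A B C ⨾ G = U G ⨾ triO A' B' C'
  have e : U G ⨾ T m (dval 0 cpy) = T n (dval 0 cpy) ⨾ U (U (U G)) := V_T G (dval 0 cpy)
  have f : (U A ⨾ B) ⨾ G = U (U G) ⨾ U A' ⨾ B' := by
    rw [ZWModAx.assoc, hB, ← ZWModAx.assoc, ← U_comp, hA, U_comp, ZWModAx.assoc]
  rw [triO_eq, triO_eq, ZWModAx.assoc, ZWModAx.assoc, hC, ← ZWModAx.assoc (U _), ← U_comp, f,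
    U_comp, ZWModAx.assoc, ← ZWModAx.assoc (U G), e, ZWModAx.assoc]

theorem lft (h : Int G A A') : Int (U G) (lft A) (lft A') := by
  show (T n fs ⨾ U A) ⨾ U G = U (U G) ⨾ T m fs ⨾ U A'
  have e : U (U G) ⨾ T m fs = T n fs ⨾ U (U G) := V_T G fs
  rw [ZWModAx.assoc, ← U_comp, h, U_comp, ← ZWModAx.assoc (U (U G)), e, ZWModAx.assoc]

theorem mulO : Int (U G) (mulO n) (mulO m) := (V_T G (dval 0 Dg.mul)).symm

theorem word {f : ℕ → ℕ} (h : ∀ i, Int G (letter n i) (letter m (f i))) :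
    ∀ w, Int G (word n w) (word m (w.map f))
  | [] => zero
  | [i] => h i
  | _ :: j :: w => tri (word h w) (h j) (h _)

end Int

theorem mulO_mul (n : ℕ) : Int (T n (dval 0 Dg.mul)) (mulO (n + 1)) (mulO n) := by
  have h := congrArg (T n) (mul_assoc (ζ := 0))
  have e1 : T n (dval 0 (mid 1 Dg.mul 0)) = mulO (n + 1) := eq_of_heq (T_mid_heq n 1 Dg.mul 0)
  have e2 : T n (dval 0 (mid 0 Dg.mul 1)) = U (mulO n) := eq_of_heq (T_mid_heq n 0 Dg.mul 1)
  rw [T_cp, T_cp, e1, e2] at h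
  exact h.symm

theorem lft_mulO_mul (n : ℕ) : Int (T n (dval 0 Dg.mul)) (lft (mulO n)) (mulO n) := by
  have h := congrArg (T n) (mul_comm_left (ζ := 0))
  have e1 : T n (dval 0 (mid 1 fsw 0)) = T (n + 1) fs :=
    (eq_of_heq (T_mid_heq n 1 fsw 0)).trans (by rw [dval_fsw]; rfl)
  have e2 : T n (dval 0 (mid 0 Dg.mul 1)) = U (mulO n) := eq_of_heq (T_mid_heq n 0 Dg.mul 1)
  rw [T_cp, T_cp, e1, e2] at h
  show (T (n + 1) fs ⨾ U (mulO n)) ⨾ T n (dval 0 Dg.mul) = U (mulO n) ⨾ T n (dval 0 Dg.mul)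
  rw [ZWModAx.assoc]
  exact h

theorem lft_lft_mul (K : H (n + 1) n) : Int (T n (dval 0 Dg.mul)) (lft (lft K)) (lft K) := by
  have h : T (n + 1) (dval 0 Dg.mul) ⨾ U K = U (U K) ⨾ mulO n := (V_T K _).symm
  show (T (n + 1) fs ⨾ U (T n fs ⨾ U K)) ⨾ mulO n = U (mulO n) ⨾ T n fs ⨾ U K
  rw [← ZWModAx.assoc (U (mulO n)), mulO_fs, U_comp]
  simp only [ZWModAx.assoc]
  rw [h]

/-- Merging the last two wires identifies the letters 0 and 1 and lowers all others by one.
Truncated subtraction is what makes `i - 1` correct at `i = 0`. -/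
theorem letter_mul (n : ℕ) :
    ∀ i, Int (T n (dval 0 Dg.mul)) (letter (n + 2) i) (letter (n + 1) (i - 1))
  | 0 => mulO_mul n
  | 1 => lft_mulO_mul n
  | i + 2 => lft_lft_mul (letter n i)

theorem T_fs_fs (n : ℕ) : T n fs ⨾ T n fs = ZWModAx.id (n + 2) := by
  rw [← T_comp, fs_fs, T_id]

theorem mulO_fs_top (n : ℕ) : Int (T n fs) (mulO (n + 1)) (lft (mulO n)) := by
  have h := congrArg (T n) (mul_fsw_left (ζ := 0))
  have e1 : T n (dval 0 (mid 1 fsw 0)) = T (n + 1) fs :=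
    (eq_of_heq (T_mid_heq n 1 fsw 0)).trans (by rw [dval_fsw]; rfl)
  have e2 : T n (dval 0 (mid 0 fsw 1)) = U (T n fs) :=
    (eq_of_heq (T_mid_heq n 0 fsw 1)).trans (by rw [dval_fsw]; rfl)
  have e3 : T n (dval 0 (mid 0 Dg.mul 1)) = U (mulO n) := eq_of_heq (T_mid_heq n 0 Dg.mul 1)
  have e4 : T n (dval 0 (mid 1 Dg.mul 0)) = mulO (n + 1) := eq_of_heq (T_mid_heq n 1 Dg.mul 0)
  rw [T_cp, T_cp, T_cp, e1, e2, e3, e4, dval_fsw] at h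
  exact h

theorem Int.symm {G : H n n} (hG : G ⨾ G = ZWModAx.id n) {A B : H (n + 1) n} (h : Int G A B) :
    Int G B A := by
  show B ⨾ G = U G ⨾ A
  have e : U G ⨾ (A ⨾ G) ⨾ G = U G ⨾ (U G ⨾ B) ⨾ G := by rw [h]
  rw [ZWModAx.assoc, hG, ZWModAx.comp_id, ZWModAx.assoc, ← ZWModAx.assoc (U G) (U G), ← U_comp, hG,
    U_id, ZWModAx.id_comp] at e
  exact e.symm

theorem lft_lft_fs (K : H (n + 1) n) : Int (T n fs) (lft (lft K)) (lft (lft K)) := by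
  have h := congrArg (T n) fs_yb
  rw [T_comp, T_comp, T_comp, T_comp, T_U, eq_of_heq (T_T_heq n 1 fs)] at h
  have e : U (U K) ⨾ T n fs = T (n + 1) fs ⨾ U (U K) := V_T K fs
  show (T (n + 1) fs ⨾ U (T n fs ⨾ U K)) ⨾ T n fs = U (T n fs) ⨾ T (n + 1) fs ⨾ U (T n fs ⨾ U K)
  rw [U_comp]
  simp only [ZWModAx.assoc]
  rw [e, ← ZWModAx.assoc (U (T n fs)), ← ZWModAx.assoc (T (n + 1) fs)]
  rw [← ZWModAx.assoc (U (T n fs)) (T (n + 1) fs), ← ZWModAx.assoc (U (T n fs) ⨾ T (n + 1) fs)]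
  refine Eq.trans ?_ (congrArg (· ⨾ U (U K)) ((ZWModAx.assoc _ _ _).trans h).symm)
  simp only [ZWModAx.assoc]

theorem letter_fs (k : ℕ) : ∀ d i,
    Int (V (T k fs) d) (letter (k + 2 + d) i) (letter (k + 2 + d) (Equiv.swap d (d + 1) i))
  | 0, 0 => by
    rw [Equiv.swap_apply_left]
    exact mulO_fs_top k
  | 0, 1 => by
    rw [Equiv.swap_apply_right]
    exact (mulO_fs_top k).symm (T_fs_fs k)
  | 0, i + 2 => by
    rw [Equiv.swap_apply_of_ne_of_ne (by omega) (by omega)]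
    exact lft_lft_fs (letter k i)
  | d + 1, 0 => by
    rw [Equiv.swap_apply_of_ne_of_ne (by omega) (by omega)]
    exact Int.mulO
  | d + 1, i + 1 => by
    have e : Equiv.swap (d + 1) (d + 1 + 1) (i + 1) = Equiv.swap d (d + 1) i + 1 := by
      simp only [Equiv.swap_apply_def]
      split_ifs <;> omega
    rw [e]
    exact (letter_fs k d i).lft

/-! ### Sorted words -/

/-- From `X = -X` follows `2X = 0`, and 2 is invertible. -/
theorem eq_zeroO_of_eq_neg {X : H (n + 1) n} (hX : IsOp X) (h : X = smulO (-1) X) :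
    X = zeroO n := by
  have e : addO X X = zeroO n := by
    conv_lhs => rw [← smulO_one X]
    conv_lhs => arg 2; rw [smulO_one, h]
    rw [addO_smulO hX.act, add_neg_cancel, smulO_zero hX.act]
  have f : addO X X = smulO 2 X := by
    conv_lhs => rw [← smulO_one X]
    rw [addO_smulO hX.act]
    norm_num
  rw [f] at e
  have g := congrArg (smulO (2⁻¹ : ℂ)) e
  rwa [smulO_smulO, inv_mul_cancel₀ two_ne_zero, smulO_one, smulO_zeroO] at g

/-- The prefix `u` absorbs the common heads in the induction on permutations, so every transposition
is an instance of `word_swap`. -/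
theorem word_perm (n : ℕ) {w w' : List ℕ} (p : w.Perm w') : ∀ u : List ℕ,
    (u ++ w).length % 2 = 1 → ∃ c : ℂ, word n (u ++ w) = smulO c (word n (u ++ w')) := by
  induction p with
  | nil => exact fun u _ => ⟨1, (smulO_one _).symm⟩
  | cons x _ ih =>
    intro u h
    have := ih (u ++ [x]) (by simpa using h)
    simpa using this
  | swap x y l => exact fun u h => ⟨-1, word_swap n x y l u (by simpa using h)⟩
  | trans p _ h1 h2 =>
    intro u h
    obtain ⟨c, hc⟩ := h1 u h
    obtain ⟨d, hd⟩ := h2 u (by rw [List.length_append, ← p.length_eq, ← List.length_append, h])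
    exact ⟨c * d, by rw [hc, hd, smulO_smulO]⟩

/-- Sorted words of odd length. -/
def Wd (n : ℕ) (w : List ℕ) : Prop := w.Pairwise (· < ·) ∧ w.length % 2 = 1 ∧ ∀ i ∈ w, i < n

/-- Two equal letters are brought to the front; exchanging them changes the sign but not the word.
-/
theorem word_eq_zero_of_not_nodup (n : ℕ) {w : List ℕ} (h : w.length % 2 = 1) (hw : ¬ w.Nodup) :
    word n w = zeroO n := by
  obtain ⟨a, ha⟩ : ∃ a, List.Sublist [a, a] w := by
    by_contra! h'
    exact hw (List.nodup_iff_sublist.2 h')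
  obtain ⟨v, hv⟩ := ha.exists_perm_append
  obtain ⟨c, hc⟩ := word_perm n hv [] h
  have e := word_swap n a a v [] (by rw [← h, hv.length_eq]; rfl)
  have z := eq_zeroO_of_eq_neg (.word n _) e
  have hc' : word n w = smulO c (word n ([] ++ a :: a :: v)) := hc
  rw [hc', z, smulO_zeroO]

theorem spn_word (n : ℕ) {w : List ℕ} (h : w.length % 2 = 1) (hn : ∀ i ∈ w, i < n) :
    Spn n (fun w' => Wd n w' ∧ w'.Perm w) (word n w) := by
  by_cases hw : w.Nodup
  · have p := List.mergeSort_perm w (· ≤ ·)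
    obtain ⟨c, hc⟩ := word_perm n p.symm [] h
    rw [List.nil_append, List.nil_append] at hc
    rw [hc]
    refine .single c ⟨⟨?_, by rw [p.length_eq, h], fun i hi => hn i (p.mem_iff.1 hi)⟩, p⟩
    have h1 := List.pairwise_mergeSort' (· ≤ ·) w
    exact (h1.and (p.nodup_iff.2 hw)).imp fun h => lt_of_le_of_ne h.1 h.2
  · rw [word_eq_zero_of_not_nodup n h hw]
    exact Spn.zero

end ZW

namespace ZW
open PRO Dg Ops

variable {ζ : ℕ → ℂ} {n m : ℕ}

section
open Rule

theorem k1_white : dval ζ ((k1 ⊳ dl ⊳ mid 1 cpy 0) ⊳ mid 0 (mid 1 (pha 4) 0 ⊳ mul) 2) = dval ζ (k1 ⊳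
    mid 1 (st (.p 4) 2) 0) :=
  dval_eq_of_proves canSound_three [⟨wP, [(1, 1)], []⟩, ⟨dI, [], []⟩, ⟨ins, [], []⟩] []
    ⟨wP_sound, dI_sound, ins_sound, trivial⟩ trivial
    (by decide +kernel)

end

/-! ### States given by operators -/

/-- All wires are in the state `0`. -/
noncomputable def vac : ∀ n, H 0 n
  | 0 => ZWModAx.id 0
  | n + 1 => vac n ⨾ T n (dval 0 k0)

/-- The state that results if the operator `K` acts on the vacuum, with control in the
state `1`. -/
noncomputable def stt (K : H (n + 1) n) : H 0 n := vac n ⨾ T n (dval 0 k1) ⨾ K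

/-- The states given by linear combinations of sorted words. -/
def W (n : ℕ) (x : H 0 n) : Prop := ∃ K, Spn n (Wd n) K ∧ x = stt K

theorem vac_two (n : ℕ) : vac (n + 2) = vac n ⨾ T n (dval 0 (k0 ⊳ mid 1 k0 0)) := by
  have e : T n (dval 0 (mid 1 k0 0)) = T (n + 1) (dval 0 k0) := eq_of_heq (T_mid_heq n 1 k0 0)
  rw [T_cp, e]
  exact ZWModAx.assoc _ _ _

theorem stt_two (K : H (n + 2 + 1) (n + 2)) : stt K = vac n ⨾ T n (dval 0 kk1) ⨾ K := by
  have e : T n (dval 0 (mid 2 k1 0)) = T (n + 2) (dval 0 k1) := eq_of_heq (T_mid_heq n 2 k1 0)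
  have f : T n (dval 0 kk1) = T n (dval 0 (k0 ⊳ mid 1 k0 0)) ⨾ T (n + 2) (dval 0 k1) := by
    rw [← e, ← T_cp]
    exact congrArg (T n) (ZWModAx.assoc _ _ _).symm
  rw [stt, vac_two, f]
  simp only [ZWModAx.assoc]

theorem lft_lft_eq (A : H (n + 1) n) : lft (lft A) = T n (dval 0 lf2) ⨾ V A 2 := by
  have e1 : T n (dval 0 (mid 1 fsw 0)) = T (n + 1) fs :=
    (eq_of_heq (T_mid_heq n 1 fsw 0)).trans (by rw [dval_fsw]; rfl)
  have e2 : T n (dval 0 (mid 0 fsw 1)) = U (T n fs) :=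
    (eq_of_heq (T_mid_heq n 0 fsw 1)).trans (by rw [dval_fsw]; rfl)
  rw [show T n (dval 0 lf2) = _ from T_cp n _ _, e1, e2, ZWModAx.assoc]
  show T (n + 1) fs ⨾ U (T n fs ⨾ U A) = _
  rw [U_comp]
  rfl

theorem tri_two_eq (A : H (n + 1) n) :
    triO (lft (lft A)) (letter (n + 2) 1) (letter (n + 2) 0) = T n (dval 0 tri2) ⨾ V A 2 := by
  have e0 : T n (dval 0 (mid 2 cpy 0)) = T (n + 2) (dval 0 cpy) := eq_of_heq (T_mid_heq n 2 cpy 0)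
  have e1 : T n (dval 0 (mid 1 fsw 2)) = V (T (n + 1) fs) 2 :=
    (eq_of_heq (T_mid_heq n 1 fsw 2)).trans (by rw [dval_fsw]; rfl)
  have e2 : T n (dval 0 (mid 0 fsw 3)) = V (T n fs) 3 :=
    (eq_of_heq (T_mid_heq n 0 fsw 3)).trans (by rw [dval_fsw]; rfl)
  have e3 : T n (dval 0 (mid 2 fsw 1)) = V (T (n + 2) fs) 1 :=
    (eq_of_heq (T_mid_heq n 2 fsw 1)).trans (by rw [dval_fsw]; rfl)
  have e4 : T n (dval 0 (mid 1 Dg.mul 2)) = V (T (n + 1) (dval 0 Dg.mul)) 2 :=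
    eq_of_heq (T_mid_heq n 1 Dg.mul 2)
  have e5 : T n (dval 0 (mid 2 Dg.mul 0)) = T (n + 2) (dval 0 Dg.mul) :=
    eq_of_heq (T_mid_heq n 2 Dg.mul 0)
  have h : T n (dval 0 tri2) = T (n + 2) (dval 0 cpy) ⨾ V (T (n + 1) fs) 2 ⨾ V (T n fs) 3 ⨾
      V (T (n + 2) fs) 1 ⨾ V (T (n + 1) (dval 0 Dg.mul)) 2 ⨾ T (n + 2) (dval 0 Dg.mul) := by
    rw [← e0, ← e1, ← e2, ← e3, ← e4, ← e5]
    simp only [← T_cp]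
    rfl
  have f1 : U (U (U A)) ⨾ T (n + 1) fs = T (n + 2) fs ⨾ U (U (U A)) := V_T (U A) fs
  have f2 : U (U A) ⨾ T n (dval 0 Dg.mul) = T (n + 1) (dval 0 Dg.mul) ⨾ U A :=
    V_T (a := 2) (b := 1) A _
  have f3 : U (U (U A)) ⨾ T (n + 1) (dval 0 Dg.mul) = T (n + 2) (dval 0 Dg.mul) ⨾ U (U A) :=
    V_T (a := 2) (b := 1) (U A) _
  have g : U (U (U (U A))) ⨾ U (T (n + 1) fs ⨾ U (T n (dval 0 Dg.mul))) ⨾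
      T (n + 1) (dval 0 Dg.mul) = U (T (n + 2) fs) ⨾ U (U (T (n + 1) (dval 0 Dg.mul))) ⨾
        T (n + 2) (dval 0 Dg.mul) ⨾ U (U A) := by
    rw [← f3, ← ZWModAx.assoc, ← U_comp, ← ZWModAx.assoc, f1, ZWModAx.assoc, ← U_comp, f2, U_comp,
      U_comp, U_comp]
    simp only [ZWModAx.assoc]
  rw [h, triO_eq]
  show T (n + 2) (dval 0 cpy) ⨾ U (U (T (n + 1) fs ⨾ U (T n fs ⨾ U A)) ⨾ T (n + 1) fs ⨾
    U (T n (dval 0 Dg.mul))) ⨾ T (n + 1) (dval 0 Dg.mul) = _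
  simp only [U_comp, ZWModAx.assoc] at g ⊢
  rw [g]
  rfl

theorem U_tri_two (A B : H (n + 1) n) :
    U (lft (lft A)) ⨾ triO (lft (lft B)) (letter (n + 2) 1) (letter (n + 2) 0) =
      T n (dval 0 (mid 0 lf2 1 ⊳ mid 1 tri2 0)) ⨾ V (U A ⨾ B) 2 := by
  have e1 : T n (dval 0 (mid 0 lf2 1)) = U (T n (dval 0 lf2)) := eq_of_heq (T_mid_heq n 0 lf2 1)
  have e2 : T n (dval 0 (mid 1 tri2 0)) = T (n + 1) (dval 0 tri2) :=
    eq_of_heq (T_mid_heq n 1 tri2 0)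
  have f : V A 3 ⨾ T n (dval 0 tri2) = T (n + 1) (dval 0 tri2) ⨾ V A 3 := V_T A _
  rw [lft_lft_eq, tri_two_eq, T_cp, e1, e2, V_comp, U_comp, ZWModAx.assoc,
    ← ZWModAx.assoc (U (V A 2))]
  refine (congrArg (fun t => U (T n (dval 0 lf2)) ⨾ t ⨾ V B 2) f).trans ?_
  simp only [ZWModAx.assoc]
  rfl

/-- The operators `A` and `B` do not touch the two new wires, so everything on the controls and new
wires can be collected in front of them. There it is evaluated by `kk1_tri2_dl`, using that the new
wires are in the state `|0⟩`. -/
theorem stt_pair (A B : H (n + 1) n) :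
    stt (addO (lft (lft A)) (triO (lft (lft B)) (letter (n + 2) 1) (letter (n + 2) 0))) =
      vac n ⨾ T n (dval 0 (k1 ⊳ dl ⊳ mid 1 cpy 0)) ⨾ V (U A ⨾ B) 2 := by
  have e : T n (dval 0 (mid 2 dl 0)) = T (n + 2) (dval 0 dl) := eq_of_heq (T_mid_heq n 2 dl 0)
  rw [stt_two, addO_eq, U_tri_two, ← e, ← ZWModAx.assoc (T n (dval 0 (mid 2 dl 0))), ← T_cp,
    ← ZWModAx.assoc (T n (dval 0 kk1)), ← T_cp, ← kk1_tri2_dl]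

theorem stt_T {a : ℕ} (K : H (n + 1) n) (g : H 0 a) :
    stt K ⨾ T n g = vac n ⨾ T n (dval 0 k1) ⨾ T (n + 1) g ⨾ V K a := by
  have e : K ⨾ T n g = T (n + 1) g ⨾ V K a := V_T (a := 0) K g
  rw [stt, ZWModAx.assoc, ZWModAx.assoc, e]

theorem act_mul {K : H (n + 1) n} (hK : Act K) : U K ⨾ K = T n (dval 0 Dg.mul) ⨾ K := by
  have e : T n (dval 0 Dg.mul) ⨾ appl (K ∷ nil) = U (appl (K ∷ nil)) ⨾ K := hK.mul 0
  rw [appl_one] at e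
  exact e.symm

/-- In the model, with `A` the operator of `K`, the vector `A|0…0⟩ ⊗ (|00⟩ + z|11⟩)` is the sum of
`A` and `z` times `A` followed by the creation of both new particles, applied to the vacuum. -/
theorem stt_white {K : H (n + 1) n} (hK : Act K) (z : ℂ) :
    stt K ⨾ T n (om z) = stt (addO (lft (lft K))
      (smulO z (triO (lft (lft K)) (letter (n + 2) 1) (letter (n + 2) 0)))) := by
  rw [← triO_smulO, ← lft_smulO, ← lft_smulO, stt_pair, smulO_eq, stt_T]
  have e2 : U K ⨾ T n (ph z) = T (n + 1) (ph z) ⨾ U K := V_T K _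
  have e3 : U K ⨾ T n (ph z) ⨾ K = T n (dval (fun _ => z) (mid 1 (pha 4) 0 ⊳ Dg.mul)) ⨾ K := by
    have e1 : T n (dval (fun _ => z) (mid 1 (pha 4) 0)) = T (n + 1) (ph z) :=
      eq_of_heq (T_mid_heq n 1 _ 0)
    rw [← ZWModAx.assoc, e2, ZWModAx.assoc, act_mul hK, T_cp, e1]
    exact (ZWModAx.assoc _ _ _).symm
  have e4 : V (T n (dval (fun _ => z) (mid 1 (pha 4) 0 ⊳ Dg.mul))) 2 =
      T n (dval (fun _ => z) (mid 0 (mid 1 (pha 4) 0 ⊳ Dg.mul) 2)) :=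
    (eq_of_heq (T_mid_heq n 0 (mid 1 (pha 4) 0 ⊳ Dg.mul) 2)).symm
  have e5 : T n (dval (fun _ => z) (mid 1 (st (.p 4) 2) 0)) = T (n + 1) (om z) :=
    eq_of_heq (T_mid_heq n 1 _ 0)
  have e6 := congrArg (T n) (k1_white (ζ := fun _ => z))
  rw [e3, V_comp, e4, ← e5, ← ZWModAx.assoc (T n (dval 0 k1)),
    ← ZWModAx.assoc (T n (dval 0 (k1 ⊳ dl ⊳ mid 1 cpy 0)))]
  exact congrArg (fun t => vac n ⨾ t ⨾ V K 2) (((T_comp n _ _).symm.trans e6.symm).trans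
    (T_comp n _ _))

end ZW

/-! ### Two cups with a controlled sign -/

namespace ZW
open PRO Dg Ops

variable {ζ : ℕ → ℂ} {n m : ℕ}

/-- The two controls of `A` are merged into one, and so are those of `B`, the second after a change
of sign. The crossing in `dist` comes from exchanging `A` and `B`. -/
theorem U_addO_addO {A B : H (n + 1) n} (hA : IsOp A) (hB : IsOp B) :
    U (addO A B) ⨾ addO A (smulO (-1) B) = T n (dval 0 dist) ⨾ U A ⨾ B := by
  have h1 : Loc (dval 0 dist) (addO A (smulO (-1) B) ∷ addO A B ∷ nil) (B ∷ A ∷ nil) :=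
    ((loc_addO 0 A B).ctx nil (addO A (smulO (-1) B) ∷ nil)).comp
    (((loc_addO 0 A (smulO (-1) B)).ctx (B ∷ A ∷ nil) nil).comp
    ((((hB.com hA) 0).ctx (A ∷ nil) (smulO (-1) B ∷ nil)).comp
    (((hA.act.mul 0).ctx nil (smulO (-1) B ∷ B ∷ nil)).comp
    (((loc_smulO (k := 2) (z := -1) rfl B).ctx (B ∷ A ∷ nil) nil).comp
    ((hB.act.mul 0).ctx (A ∷ nil) nil)))))
  have : T n (dval 0 dist) ⨾ U (appl (A ∷ nil)) ⨾ B =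
    U (appl (addO A B ∷ nil)) ⨾ addO A (smulO (-1) B) := h1
  rw [appl_one, appl_one] at this
  exact this.symm

theorem U_tri_two_self {K : H (n + 1) n} (hK : Act K) :
    U (lft (lft K)) ⨾ triO (lft (lft K)) (letter (n + 2) 1) (letter (n + 2) 0) =
      T n (dval 0 (mid 0 lf2 1 ⊳ mid 1 tri2 0 ⊳ mid 0 Dg.mul 2)) ⨾ V K 2 := by
  have e : V (T n (dval 0 Dg.mul)) 2 = T n (dval 0 (mid 0 Dg.mul 2)) :=
    (eq_of_heq (T_mid_heq n 0 Dg.mul 2)).symm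
  rw [U_tri_two, act_mul hK, V_comp, e, ← ZWModAx.assoc, ← T_comp]
  exact congrArg (· ⨾ V K 2) (congrArg (T n) (ZWModAx.assoc _ _ _))

theorem T_kk1 (n : ℕ) : T n (dval 0 kk1) = T n (dval 0 (k0 ⊳ mid 1 k0 0)) ⨾ T (n + 2) (dval 0 k1)
    := by
  have e : T n (dval 0 (mid 2 k1 0)) = T (n + 2) (dval 0 k1) := eq_of_heq (T_mid_heq n 2 k1 0)
  rw [← e, ← T_cp]
  exact congrArg (T n) (ZWModAx.assoc _ _ _).symm

theorem stt_cupz_aux (n : ℕ) :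
    T n (dval 0 (k0 ⊳ mid 1 k0 0)) ⨾ T (n + 2) (dval 0 (k1 ⊳ dl ⊳ mid 1 cpy 0)) ⨾
      T (n + 2) (dval 0 (mid 0 dist 2)) ⨾
        T n (dval 0 (mid 0 (mid 0 lf2 1 ⊳ mid 1 tri2 0 ⊳ mid 0 Dg.mul 2) 2)) =
      T n (dval 0 k1) ⨾ T (n + 1) (dval 0 cupz) := by
  have e1 : T n (dval 0 (mid 1 cupz 0)) = T (n + 1) (dval 0 cupz) := eq_of_heq (T_mid_heq n 1 _ 0)
  have e2 : T n (dval 0 (mid 2 (dl ⊳ mid 1 cpy 0 ⊳ mid 0 dist 2) 0)) =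
      T (n + 2) (dval 0 (dl ⊳ mid 1 cpy 0 ⊳ mid 0 dist 2)) := eq_of_heq (T_mid_heq n 2 _ 0)
  have e5 := congrArg (T n) ((cupz_pair (ζ := 0)).trans pair_pair_zg)
  rw [T_cp, T_cp, T_cp, T_kk1, e1, e2] at e5
  rw [e5, T_cp (n + 2) k1, T_cp (n + 2) dl, T_cp (n + 2) dl, T_cp (n + 2) (mid 1 cpy 0)]
  simp only [ZWModAx.assoc]

/-- The first cup adds no or two particles. If the second cup is occupied, the controlled sign
changes the sign of the term with two particles in the first, hence the factor `-1` in the last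
summand. -/
theorem stt_cupz {K : H (n + 1) n} (hK : IsOp K) : stt K ⨾ T n (dval 0 cupz) = stt
    (addO (lft (lft (addO (lft (lft K)) (triO (lft (lft K)) (letter (n + 2) 1) (letter (n + 2)
        0)))))
      (triO (lft (lft (addO (lft (lft K))
        (smulO (-1) (triO (lft (lft K)) (letter (n + 2) 1) (letter (n + 2) 0))))))
        (letter (n + 4) 1) (letter (n + 4) 0))) := by
  have e3 : V (T (n + 2) (dval 0 dist)) 2 = T (n + 2) (dval 0 (mid 0 dist 2)) :=
    (eq_of_heq (T_mid_heq (n + 2) 0 dist 2)).symm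
  have e4 : V (T n (dval 0 (mid 0 lf2 1 ⊳ mid 1 tri2 0 ⊳ mid 0 Dg.mul 2))) 2 =
      T n (dval 0 (mid 0 (mid 0 lf2 1 ⊳ mid 1 tri2 0 ⊳ mid 0 Dg.mul 2) 2)) :=
    (eq_of_heq (T_mid_heq n 0 _ 2)).symm
  have h := congrArg (fun t => vac n ⨾ t ⨾ V K 4) (stt_cupz_aux n)
  rw [stt_T]
  refine Eq.trans ?_ (stt_pair (n := n + 2) _ _).symm
  rw [U_addO_addO hK.lft.lft (.tri hK.lft.lft (.letter _) (.letter _)), U_tri_two_self hK.act,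
    V_comp, V_comp, e3, e4, vac_two]
  simp only [ZWModAx.assoc] at h ⊢
  exact h.symm

end ZW

namespace ZW
open PRO Dg Ops

variable {ζ : ℕ → ℂ} {n m : ℕ}

section
open Rule

theorem k0_k0_fsw' : dval ζ (k0 ⊳ mid 1 k0 0 ⊳ fsw) = dval ζ (k0 ⊳ mid 1 k0 0) :=
  dval_eq_of_proves canSound_three [⟨oZ, [], []⟩] [] ⟨oZ_sound, trivial⟩ trivial
    (by decide +kernel)

theorem k0_k0_mul : dval ζ (k0 ⊳ mid 1 k0 0 ⊳ mul) = dval ζ (k0) :=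
  dval_eq_of_proves canSound_three [⟨dO, [], []⟩] [] ⟨dO_sound, trivial⟩ trivial
    (by decide +kernel)

end

/-! ### Linear combinations of sorted words under changes of the wires -/

namespace Spn

variable {S S' : List ℕ → Prop} {A : H (n + 1) n}

theorem bind (hA : Spn n S A) (h : ∀ w, S w → Spn n S' (ZW.word n w)) : Spn n S' A := by
  obtain ⟨L, hL, rfl⟩ := hA
  induction L with
  | nil => exact zero
  | cons p L ih => exact ((h _ (hL p (by simp))).smul p.1).add (ih fun q hq => hL q (by simp [hq]))

theorem lft (hA : Spn n S A) (h : ∀ w, S w → S' (w.map Nat.succ)) : Spn (n + 1) S' (lft A) := by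
  obtain ⟨L, hL, rfl⟩ := hA
  induction L with
  | nil =>
    show Spn (n + 1) S' (Ops.lft (zeroO n))
    rw [lft_zeroO]
    exact zero
  | cons p L ih =>
    show Spn (n + 1) S' (Ops.lft (addO _ _))
    rw [lft_addO, lft_smulO, lft_word]
    exact (single _ (h _ (hL p (by simp)))).add (ih fun q hq => hL q (by simp [hq]))

theorem tri {i j : ℕ} (hA : Spn n S A) (h : ∀ w, S w → S' (i :: j :: w)) :
    Spn n S' (triO A (letter n j) (letter n i)) := by
  obtain ⟨L, hL, rfl⟩ := hA
  induction L with
  | nil =>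
    show Spn n S' (triO (zeroO n) _ _)
    rw [triO_zeroO (act_letter n j) (act_letter n i)]
    exact zero
  | cons p L ih =>
    show Spn n S' (triO (addO _ _) _ _)
    have hL' := IsOp.comb n L
    rw [triO_addO_left (act_letter n j) (act_letter n i) (hL'.com (.letter j))
      (hL'.com (.letter i)) (com_letter n j i), triO_smulO]
    exact (single (w := i :: j :: p.2) _ (h _ (hL p (by simp)))).add
      (ih fun q hq => hL q (by simp [hq]))

theorem split {P Q : List ℕ → Prop} (hA : Spn n S A) (h : ∀ w, S w → P w ∨ Q w) :
    ∃ B C, Spn n P B ∧ Spn n Q C ∧ A = addO B C := by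
  obtain ⟨L, hL, rfl⟩ := hA
  induction L with
  | nil => exact ⟨_, _, zero, zero, (addO_zeroO _).symm⟩
  | cons p L ih =>
    obtain ⟨B, C, hB, hC, e⟩ := ih fun q hq => hL q (by simp [hq])
    have hw := IsOp.smul p.1 (IsOp.word n p.2)
    rcases h _ (hL p (by simp)) with h | h
    · exact ⟨_, _, (single p.1 h).add hB, hC, by
        show addO _ (comb n L) = _
        rw [e, addO_assoc]⟩
    · refine ⟨_, _, hB, (single p.1 h).add hC, ?_⟩
      show addO _ (comb n L) = _
      rw [e, ← addO_assoc, addO_comm' hw hB.isOp, addO_assoc]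

theorem of_map {P : List ℕ → Prop} {A' : H (n + 1 + 1) (n + 1)} (hA : Spn (n + 1) S A')
    (h : ∀ w, S w → ∃ v, P v ∧ w = v.map Nat.succ) : ∃ B, Spn n P B ∧ A' = Ops.lft B := by
  obtain ⟨L, hL, rfl⟩ := hA
  induction L with
  | nil => exact ⟨_, zero, lft_zeroO.symm⟩
  | cons p L ih =>
    obtain ⟨B, hB, e⟩ := ih fun q hq => hL q (by simp [hq])
    obtain ⟨v, hv, e'⟩ := h _ (hL p (by simp))
    refine ⟨_, (single p.1 hv).add hB, ?_⟩
    rw [lft_addO, lft_smulO, lft_word, ← e', ← e]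
    rfl

theorem of_tri {P : List ℕ → Prop} {i j : ℕ} (hA : Spn n S A)
    (h : ∀ w, S w → ∃ v, P v ∧ w = i :: j :: v) :
    ∃ B, Spn n P B ∧ A = triO B (letter n j) (letter n i) := by
  obtain ⟨L, hL, rfl⟩ := hA
  induction L with
  | nil => exact ⟨_, zero, (triO_zeroO (act_letter n j) (act_letter n i)).symm⟩
  | cons p L ih =>
    obtain ⟨B, hB, e⟩ := ih fun q hq => hL q (by simp [hq])
    obtain ⟨v, hv, e'⟩ := h _ (hL p (by simp))
    refine ⟨_, (single p.1 hv).add hB, ?_⟩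
    rw [triO_addO_left (act_letter n j) (act_letter n i) (hB.isOp.com (.letter j))
      (hB.isOp.com (.letter i)) (com_letter n j i), triO_smulO, ← e]
    show addO (smulO p.1 (ZW.word n p.2)) _ = _
    rw [e']
    rfl

theorem int {G : H n m} {f : ℕ → ℕ} (h : ∀ i, Int G (letter n i) (letter m (f i)))
    (hA : Spn n S A) (hS : ∀ w, S w → S' (w.map f)) : ∃ B, Spn m S' B ∧ Int G A B := by
  obtain ⟨L, hL, rfl⟩ := hA
  induction L with
  | nil => exact ⟨_, zero, Int.zero⟩
  | cons p L ih =>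
    obtain ⟨B, hB, e⟩ := ih fun q hq => hL q (by simp [hq])
    exact ⟨_, (single p.1 (hS _ (hL p (by simp)))).add hB, ((Int.word h p.2).smul p.1).add e⟩

end Spn

theorem Wd.lft {w : List ℕ} (h : Wd n w) : Wd (n + 1) (w.map Nat.succ) := by
  refine ⟨List.pairwise_map.2 (h.1.imp fun h => by omega), by simpa using h.2.1, ?_⟩
  simpa using h.2.2

theorem Wd.cons_cons {w : List ℕ} (h : Wd n w) :
    Wd (n + 2) (0 :: 1 :: (w.map Nat.succ).map Nat.succ) := by
  refine ⟨?_, by simp only [List.length_cons, List.length_map]; have := h.2.1; omega, ?_⟩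
  · simp only [List.pairwise_cons]
    exact ⟨by simp, by simp, h.lft.lft.1⟩
  · have := h.lft.lft.2.2
    simp only [List.mem_cons]
    rintro i (rfl | rfl | hi)
    · omega
    · omega
    · exact this i hi

theorem Wd.of_zero_notMem {w : List ℕ} (h : Wd (n + 1) w) (h0 : 0 ∉ w) :
    ∃ v, Wd n v ∧ w = v.map Nat.succ := by
  have e : w = (w.map Nat.pred).map Nat.succ := by
    rw [List.map_map]
    refine (List.map_id w).symm.trans (List.map_congr_left fun i hi => ?_)
    exact (Nat.succ_pred fun e => h0 (e ▸ hi)).symm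
  refine ⟨_, ⟨?_, ?_, ?_⟩, e⟩
  · have := h.1
    rw [e, List.pairwise_map] at this
    exact this.imp fun h => by simpa using h
  · have := h.2.1
    rw [e] at this
    simpa using this
  · have := h.2.2
    rw [e] at this
    simpa using this

theorem Wd.of_zero_mem {w : List ℕ} (h : Wd n w) (h0 : 0 ∈ w) : ∃ v, w = 0 :: v ∧ 0 ∉ v := by
  match w with
  | [] => simp at h0
  | i :: v =>
    have h1 := (List.pairwise_cons.1 h.1).1
    have hi : i = 0 := by
      rcases List.mem_cons.1 h0 with e | e
      · exact e.symm
      · exact absurd (h1 0 e) (by omega)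
    subst hi
    exact ⟨v, rfl, fun h => absurd (h1 0 h) (by omega)⟩

theorem Wd.of_zero_one_mem {w : List ℕ} (h : Wd (n + 2) w) (h0 : 0 ∈ w) (h1 : 1 ∈ w) :
    ∃ v, Wd n v ∧ w = 0 :: 1 :: (v.map Nat.succ).map Nat.succ := by
  obtain ⟨u, rfl, hu⟩ := h.of_zero_mem h0
  have hp := (List.pairwise_cons.1 h.1).2
  match u with
  | [] => simp at h1
  | i :: v =>
    have hi : i = 1 := by
      have hi0 : i ≠ 0 := fun e => hu (by simp [e])
      rcases List.mem_cons.1 h1 with e | e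
      · omega
      · rcases List.mem_cons.1 e with e | e
        · exact e.symm
        · have := (List.pairwise_cons.1 hp).1 1 e
          omega
    subst hi
    have h2 := List.pairwise_cons.1 hp
    have hv : Wd (n + 2) v := ⟨h2.2, by have := h.2.1; simp only [List.length_cons] at this; omega,
      fun i hi => h.2.2 i (by simp [hi])⟩
    obtain ⟨v', hv', rfl⟩ := hv.of_zero_notMem fun h => absurd (h2.1 0 h) (by omega)
    obtain ⟨v'', hv'', rfl⟩ := hv'.of_zero_notMem fun h =>
      absurd (h2.1 1 (List.mem_map.2 ⟨0, h, rfl⟩)) (by omega)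
    exact ⟨v'', hv'', rfl⟩

/-! ### Maps that preserve linear combinations of words -/

theorem stt_int {G : H n m} {K : H (n + 1) n} {K' : H (m + 1) m} (h : Int G K K')
    (hG : vac n ⨾ G = vac m) : stt K ⨾ G = stt K' := by
  have e : G ⨾ T m (dval 0 k1) = T n (dval 0 k1) ⨾ U G := V_T G (dval 0 k1)
  rw [stt, stt, ← hG, ZWModAx.assoc, ZWModAx.assoc, h, ZWModAx.assoc, ← ZWModAx.assoc G, e,
    ZWModAx.assoc]

theorem vac_fs (k : ℕ) : ∀ d, vac (k + 2 + d) ⨾ V (T k fs) d = vac (k + 2 + d)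
  | 0 => by
    have h := congrArg (T k) (k0_k0_fsw' (ζ := 0))
    show vac (k + 2) ⨾ T k fs = vac (k + 2)
    rw [vac_two, ZWModAx.assoc]
    refine congrArg (vac k ⨾ ·) (Eq.trans ?_ h)
    rw [show fs = dval 0 fsw from dval_fsw.symm, ← T_cp]
    exact congrArg (T k) (ZWModAx.assoc _ _ _)
  | d + 1 => by
    have e : V (T k fs) d ⨾ T (k + 2 + d) (dval 0 k0) = T (k + 2 + d) (dval 0 k0) ⨾ U (V (T k fs)
        d) :=
      V_T _ (dval 0 k0)
    show (vac (k + 2 + d) ⨾ T (k + 2 + d) (dval 0 k0)) ⨾ U (V (T k fs) d) = _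
    rw [ZWModAx.assoc, ← e, ← ZWModAx.assoc, vac_fs k d]
    rfl

theorem vac_mul (n : ℕ) : vac (n + 2) ⨾ T n (dval 0 Dg.mul) = vac (n + 1) := by
  have h := congrArg (T n) (k0_k0_mul (ζ := 0))
  rw [vac_two, ZWModAx.assoc]
  refine congrArg (vac n ⨾ ·) (Eq.trans ?_ h)
  rw [← T_cp]
  exact congrArg (T n) (ZWModAx.assoc _ _ _)

/-- A fermionic swap fixes the vacuum and permutes the letters (`letter_fs`). The new words need not
be sorted, so they are sorted again by `spn_word`. -/
theorem W.fs {k d : ℕ} {x : H 0 (k + 2 + d)} (h : W (k + 2 + d) x) :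
    W (k + 2 + d) (x ⨾ V (T k fs) d) := by
  obtain ⟨K, hK, rfl⟩ := h
  obtain ⟨B, hB, e⟩ := hK.int (letter_fs k d)
    (S' := fun w => w.length % 2 = 1 ∧ ∀ i ∈ w, i < k + 2 + d) fun w hw => by
      refine ⟨by simpa using hw.2.1, ?_⟩
      simp only [List.mem_map]
      rintro _ ⟨i, hi, rfl⟩
      have := hw.2.2 i hi
      simp only [Equiv.swap_apply_def]
      split_ifs <;> omega
  exact ⟨B, hB.bind fun w hw => (spn_word _ hw.1 hw.2).mono fun _ h => h.1,
    stt_int e (vac_fs k d)⟩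

theorem W.mul {x : H 0 (n + 2)} (h : W (n + 2) x) : W (n + 1) (x ⨾ T n (dval 0 Dg.mul)) := by
  obtain ⟨K, hK, rfl⟩ := h
  obtain ⟨B, hB, e⟩ := hK.int (letter_mul n)
    (S' := fun w => w.length % 2 = 1 ∧ ∀ i ∈ w, i < n + 1) fun w hw => by
      refine ⟨by simpa using hw.2.1, ?_⟩
      simp only [List.mem_map]
      rintro _ ⟨i, hi, rfl⟩
      have := hw.2.2 i hi
      omega
  exact ⟨B, hB.bind fun w hw => (spn_word _ hw.1 hw.2).mono fun _ h => h.1,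
    stt_int e (vac_mul n)⟩

theorem Spn.lft_lft {K : H (n + 1) n} (h : Spn n (Wd n) K) :
    Spn (n + 2) (Wd (n + 2)) (Ops.lft (Ops.lft K)) :=
  (h.lft (S' := Wd (n + 1)) fun _ h => h.lft).lft fun _ h => h.lft

theorem Spn.tri_two {K : H (n + 1) n} (h : Spn n (Wd n) K) :
    Spn (n + 2) (Wd (n + 2))
      (triO (Ops.lft (Ops.lft K)) (letter (n + 2) 1) (letter (n + 2) 0)) :=
  ((h.lft (S' := fun w => ∃ v, Wd n v ∧ w = v.map Nat.succ) fun w h => ⟨w, h, rfl⟩).lft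
    (S' := fun w => ∃ v, Wd n v ∧ w = (v.map Nat.succ).map Nat.succ)
    fun _ ⟨v, h, e⟩ => ⟨v, h, e ▸ rfl⟩).tri fun _ ⟨_, h, e⟩ => e ▸ h.cons_cons

theorem W.om {x : H 0 n} (h : W n x) (z : ℂ) : W (n + 2) (x ⨾ T n (om z)) := by
  obtain ⟨K, hK, rfl⟩ := h
  exact ⟨_, hK.lft_lft.add (hK.tri_two.smul z), stt_white hK.isOp.act z⟩

theorem W.cupz {x : H 0 n} (h : W n x) : W (n + 4) (x ⨾ T n (dval 0 cupz)) := by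
  obtain ⟨K, hK, rfl⟩ := h
  exact ⟨_, (hK.lft_lft.add hK.tri_two).lft_lft.add
    (hK.lft_lft.add (hK.tri_two.smul (-1))).tri_two, stt_cupz hK.isOp⟩

theorem W.k1k1 {x : H 0 n} (h : W n x) : W (n + 2) (x ⨾ T n (dval 0 (k1 ⊳ mid 1 k1 0))) := by
  obtain ⟨K, hK, rfl⟩ := h
  refine ⟨_, hK.tri_two, ?_⟩
  have e1 : T n (dval 0 (mid 1 k1 0)) = T (n + 1) (dval 0 k1) := eq_of_heq (T_mid_heq n 1 _ 0)
  have e2 : T n (dval 0 (mid 2 k1 0)) = T (n + 2) (dval 0 k1) := eq_of_heq (T_mid_heq n 2 _ 0)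
  have e3 : T (n + 1) (dval 0 (mid 1 k1 0)) = T (n + 2) (dval 0 k1) :=
    eq_of_heq (T_mid_heq (n + 1) 1 _ 0)
  have e4 := congrArg (T n) (kk1_tri2 (ζ := 0))
  rw [T_cp, T_cp, T_cp, e1, e2] at e4
  rw [stt_T, stt_two, tri_two_eq, ← ZWModAx.assoc (T n (dval 0 kk1)), e4, T_cp, e3]
  simp only [ZWModAx.assoc]

end ZW

namespace ZW
open PRO Dg Ops

variable {ζ : ℕ → ℂ} {n m : ℕ}

/-! ### Operators and controlled signs -/

/-- A controlled sign after `K`, between its last wire and a wire next to it, can be moved before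
`K`, where it becomes `D`. -/
def Sgn (D : Dg 3 3) (K : H (n + 2) (n + 1)) : Prop :=
  U K ⨾ T n (dval 0 zg) = T n (dval 0 D) ⨾ U K

namespace Sgn

variable {A B : H (n + 2) (n + 1)} {D : Dg 3 3}

/-- Here `K` does not act on the last wire, so the sign stays with that wire and avoids the control.
-/
theorem lft (K : H (n + 1) n) : Sgn zN (lft K) := by
  have e1 : T n (dval 0 (mid 0 fsw 1)) = U (T n fs) :=
    (eq_of_heq (T_mid_heq n 0 fsw 1)).trans (by rw [dval_fsw]; rfl)
  have e2 : T n (dval 0 (mid 1 zg 0)) = T (n + 1) (dval 0 zg) := eq_of_heq (T_mid_heq n 1 zg 0)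
  have h := congrArg (T n) (lft_zN (ζ := 0))
  rw [T_cp, T_cp, e1, e2] at h
  have f : U (U K) ⨾ T n (dval 0 zg) = T (n + 1) (dval 0 zg) ⨾ U (U K) := V_T (a := 2) (b := 2) K _
  show U (T n fs ⨾ U K) ⨾ T n (dval 0 zg) = T n (dval 0 zN) ⨾ U (T n fs ⨾ U K)
  rw [U_comp, ZWModAx.assoc, f, ← ZWModAx.assoc, h, ZWModAx.assoc]

/-- The occupation of the last wire is the sum of its former occupation and the control, so the sign
is distributed over both. The same form `zJ` holds for all combinations of words containing the
letter 0. -/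
theorem mulO (n : ℕ) : Sgn zJ (mulO n) := by
  have e1 : T n (dval 0 (mid 0 Dg.mul 1)) = U (ZW.mulO n) := eq_of_heq (T_mid_heq n 0 Dg.mul 1)
  have h := congrArg (T n) (mul_zJ (ζ := 0))
  rw [T_cp, T_cp, e1] at h
  exact h

theorem zeroO (n : ℕ) : Sgn zJ (zeroO (n + 1)) := by
  have e1 : T n (dval 0 (mid 1 b0 1)) = U (T (n + 1) (dval 0 b0)) := eq_of_heq (T_mid_heq n 1 b0 1)
  have h := congrArg (T n) (b0_zJ (ζ := 0))
  rw [T_cp, T_cp, e1] at h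
  exact h

theorem smulO (hA : Sgn zJ A) (z : ℂ) : Sgn zJ (smulO z A) := by
  have e1 : T n (dval (fun _ => z) (mid 1 (pha 4) 1)) = U (T (n + 1) (ph z)) :=
    eq_of_heq (T_mid_heq n 1 (pha 4) 1)
  have h := congrArg (T n) (pha_zJ (ζ := fun _ => z))
  rw [T_cp, T_cp, e1] at h
  have e2 : dval (fun _ => z) zJ = dval 0 zJ := rfl
  rw [e2] at h
  show U (ZW.smulO z A) ⨾ T n (dval 0 zg) = T n (dval 0 zJ) ⨾ U (ZW.smulO z A)
  rw [smulO_eq, U_comp, ZWModAx.assoc, hA, ← ZWModAx.assoc, h, ZWModAx.assoc]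

/-- The controls of two operators and a wire, where `D` connects the last two. -/
def join (D : Dg 3 3) : Dg 4 4 := mid 2 zg 0 ⊳ mid 2 sw 0 ⊳ mid 0 D 1 ⊳ mid 2 sw 0

theorem U_zJ (hA : Sgn D A) :
    U (U A) ⨾ T n (dval 0 zJ) = T n (dval 0 (join D)) ⨾ U (U A) := by
  have e1 : T n (dval 0 (mid 1 zg 0)) = T (n + 1) (dval 0 zg) := eq_of_heq (T_mid_heq n 1 zg 0)
  have e2 : T n (dval 0 (mid 1 sw 0)) = T (n + 1) (dval 0 sw) := eq_of_heq (T_mid_heq n 1 sw 0)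
  have e3 : T n (dval 0 (mid 0 zg 1)) = U (T n (dval 0 zg)) := eq_of_heq (T_mid_heq n 0 zg 1)
  have e4 : T n (dval 0 (mid 2 zg 0)) = T (n + 2) (dval 0 zg) := eq_of_heq (T_mid_heq n 2 zg 0)
  have e5 : T n (dval 0 (mid 2 sw 0)) = T (n + 2) (dval 0 sw) := eq_of_heq (T_mid_heq n 2 sw 0)
  have e6 : T n (dval 0 (mid 0 D 1)) = U (T n (dval 0 D)) := eq_of_heq (T_mid_heq n 0 D 1)
  have f1 : U (U A) ⨾ T (n + 1) (dval 0 zg) = T (n + 2) (dval 0 zg) ⨾ U (U A) := V_T (a := 2) (b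
      := 2) A _
  have f2 : U (U A) ⨾ T (n + 1) (dval 0 sw) = T (n + 2) (dval 0 sw) ⨾ U (U A) := V_T (a := 2) (b
      := 2) A _
  have f3 : U (U A) ⨾ U (T n (dval 0 zg)) = U (T n (dval 0 D)) ⨾ U (U A) := by
    rw [← U_comp, ← U_comp, hA]
  show U (U A) ⨾ T n (dval 0 (mid 1 zg 0 ⊳ mid 1 sw 0 ⊳ mid 0 zg 1 ⊳ mid 1 sw 0)) =
    T n (dval 0 (mid 2 zg 0 ⊳ mid 2 sw 0 ⊳ mid 0 D 1 ⊳ mid 2 sw 0)) ⨾ U (U A)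
  simp only [T_cp, e1, e2, e3, e4, e5, e6]
  rw [← ZWModAx.assoc, f1, ZWModAx.assoc, ← ZWModAx.assoc (U (U A)), f2, ZWModAx.assoc,
    ← ZWModAx.assoc (U (U A)), f3, ZWModAx.assoc, f2]
  simp only [ZWModAx.assoc]

theorem addO (hA : Sgn zJ A) (hB : Sgn zJ B) : Sgn zJ (addO A B) := by
  have e1 : T n (dval 0 (mid 1 dl 1)) = U (T (n + 1) (dval 0 dl)) := eq_of_heq (T_mid_heq n 1 dl 1)
  have h : T n (dval 0 (mid 1 dl 1)) ⨾ T n (dval 0 (join zJ)) = _ :=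
    (T_cp n _ _).symm.trans (congrArg (T n) (dl_zJ (ζ := 0)))
  rw [T_cp, e1] at h
  show U (ZW.addO A B) ⨾ T n (dval 0 zg) = T n (dval 0 zJ) ⨾ U (ZW.addO A B)
  rw [addO_eq, U_comp, U_comp, ZWModAx.assoc, ZWModAx.assoc, hB, ← ZWModAx.assoc (U (U A)),
    hA.U_zJ, ZWModAx.assoc, ← ZWModAx.assoc, h, ZWModAx.assoc]

theorem tri_eq (A B : H (n + 1) n) : triO (Ops.lft A) (Ops.lft B) (ZW.mulO n) =
    T n (dval 0 tri1) ⨾ U (U A) ⨾ U B := by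
  have e1 : T n (dval 0 (mid 1 cpy 0)) = T (n + 1) (dval 0 cpy) := eq_of_heq (T_mid_heq n 1 cpy 0)
  have e2 : T n (dval 0 (mid 0 fsw 2)) = U (U (T n fs)) :=
    (eq_of_heq (T_mid_heq n 0 fsw 2)).trans (by rw [dval_fsw]; rfl)
  have e3 : T n (dval 0 (mid 1 fsw 1)) = U (T (n + 1) fs) :=
    (eq_of_heq (T_mid_heq n 1 fsw 1)).trans (by rw [dval_fsw]; rfl)
  have e4 : T n (dval 0 (mid 2 Dg.mul 0)) = T (n + 2) (dval 0 Dg.mul) :=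
    eq_of_heq (T_mid_heq n 2 Dg.mul 0)
  have f1 : U (U A) ⨾ T n fs = T (n + 1) fs ⨾ U (U A) := V_T (a := 2) (b := 2) A _
  have f2 : U (U B) ⨾ T n (dval 0 Dg.mul) = T (n + 1) (dval 0 Dg.mul) ⨾ U B :=
    V_T (a := 2) (b := 1) B _
  have f3 : U (U (U A)) ⨾ T (n + 1) (dval 0 Dg.mul) = T (n + 2) (dval 0 Dg.mul) ⨾ U (U A) :=
    V_T (a := 2) (b := 1) (U A) _
  show _ = T n (dval 0 (mid 1 cpy 0 ⊳ mid 0 fsw 2 ⊳ mid 1 fsw 1 ⊳ mid 2 Dg.mul 0)) ⨾ _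
  simp only [T_cp, e1, e2, e3, e4]
  rw [triO_eq]
  show T (n + 1) (dval 0 cpy) ⨾ U (U (T n fs ⨾ U A) ⨾ T n fs ⨾ U B) ⨾ T n (dval 0 Dg.mul) = _
  rw [U_comp (T n fs), ZWModAx.assoc, ← ZWModAx.assoc (U (U A)), f1, ZWModAx.assoc, U_comp, U_comp,
    U_comp]
  simp only [ZWModAx.assoc]
  rw [f2, ← ZWModAx.assoc (U (U (U A))), f3, ZWModAx.assoc]

theorem tri (A B : H (n + 1) n) : Sgn zJ (triO (Ops.lft A) (Ops.lft B) (ZW.mulO n)) := by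
  have e1 : T n (dval 0 (mid 0 tri1 1)) = U (T n (dval 0 tri1)) := eq_of_heq (T_mid_heq n 0 tri1 1)
  have e2 : T n (dval 0 (mid 2 zg 0)) = T (n + 2) (dval 0 zg) := eq_of_heq (T_mid_heq n 2 zg 0)
  have h := congrArg (T n) (tri1_zJ (ζ := 0))
  rw [T_cp, T_cp, e1, e2] at h
  have f1 : U (U (U A)) ⨾ T (n + 1) (dval 0 zg) = T (n + 2) (dval 0 zg) ⨾ U (U (U A)) :=
    V_T (a := 2) (b := 2) (U A) _
  have f2 : U (U B) ⨾ T n (dval 0 zg) = T (n + 1) (dval 0 zg) ⨾ U (U B) := V_T (a := 2) (b := 2) B _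
  show U (triO (Ops.lft A) (Ops.lft B) (ZW.mulO n)) ⨾ T n (dval 0 zg) =
    T n (dval 0 zJ) ⨾ U (triO (Ops.lft A) (Ops.lft B) (ZW.mulO n))
  rw [tri_eq, U_comp, U_comp, ZWModAx.assoc, ZWModAx.assoc, f2, ← ZWModAx.assoc (U (U (U A))), f1,
    ZWModAx.assoc, ← ZWModAx.assoc, h, ZWModAx.assoc]

theorem word {w : List ℕ} (h : Wd (n + 1) w) (h0 : 0 ∈ w) : Sgn zJ (word (n + 1) w) := by
  obtain ⟨v, rfl, hv⟩ := h.of_zero_mem h0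
  match v with
  | [] => exact mulO n
  | j :: v =>
    have e : ∀ i ∈ j :: v, Nat.succ (Nat.pred i) = i := fun i hi => Nat.succ_pred fun e => hv (e ▸
        hi)
    have e' : v = (v.map Nat.pred).map Nat.succ := by
      rw [List.map_map]
      exact (List.map_id v).symm.trans (List.map_congr_left fun i hi => (e i (by simp [hi])).symm)
    have hj : letter (n + 1) j = Ops.lft (letter n j.pred) := by
      rw [← e j (by simp)]
      rfl
    show Sgn zJ (triO (ZW.word (n + 1) v) (letter (n + 1) j) (ZW.mulO n))
    rw [e', ← lft_word, hj]
    exact tri _ _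

theorem spn {K : H (n + 2) (n + 1)} (h : Spn (n + 1) (fun w => Wd (n + 1) w ∧ 0 ∈ w) K) :
    Sgn zJ K :=
  h.ind (zeroO n) (fun _ h => word h.1 h.2) (fun z _ _ h => h.smulO z) fun _ _ _ _ h h' => h.addO h'

end Sgn

/-- In the model the loop projects to vectors with the last wire occupied, and `lft A` creates no
particle there. In the calculus the loop is moved in front of the operators. There it meets the last
wire, still in the state `|0⟩`, and the control of `B`, but not that of `A`. So it forces the
control of `B` to be `|1⟩`; by `dl` the control of `A` is `|0⟩`, which switches `A` off. -/
theorem stt_addO_lft_loop {A : H (n + 1) n} {B : H (n + 2) (n + 1)} (hA : IsOp A)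
    (hB : Sgn zJ B) : stt (addO (lft A) B) ⨾ T n (dval 0 lp) = stt B := by
  have e1 : T n (dval 0 (mid 1 cup 0)) = T (n + 1) (dval 0 cup) := eq_of_heq (T_mid_heq n 1 cup 0)
  have e2 : T n (dval 0 (mid 0 zg 1)) = U (T n (dval 0 zg)) := eq_of_heq (T_mid_heq n 0 zg 1)
  have e3 : T n (dval 0 (mid 1 clo 0)) = T (n + 1) (dval 0 clo) := eq_of_heq (T_mid_heq n 1 clo 0)
  have e4 : T n (dval 0 (mid 1 k1 0)) = T (n + 1) (dval 0 k1) := eq_of_heq (T_mid_heq n 1 k1 0)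
  have e5 : T n (dval 0 (mid 1 dl 0)) = T (n + 1) (dval 0 dl) := eq_of_heq (T_mid_heq n 1 dl 0)
  have e6 : T n (dval 0 (mid 3 cup 0)) = T (n + 3) (dval 0 cup) := eq_of_heq (T_mid_heq n 3 cup 0)
  have e7 : T n (dval 0 (mid 0 zJN 1)) = U (T n (dval 0 zJN)) := eq_of_heq (T_mid_heq n 0 zJN 1)
  have e8 : T n (dval 0 (mid 3 clo 0)) = T (n + 3) (dval 0 clo) := eq_of_heq (T_mid_heq n 3 clo 0)
  have e9 : T n (dval 0 (mid 1 k0 0)) = T (n + 1) (dval 0 k0) := eq_of_heq (T_mid_heq n 1 k0 0)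
  have h := congrArg (T n) (k1_dl_lp (ζ := 0))
  rw [T_cp, T_cp, T_cp, T_cp, T_cp, e4, e5, e6, e7, e8, T_kk1, T_cp, e9] at h
  have f1 : B ⨾ T (n + 1) (dval 0 cup) = T (n + 2) (dval 0 cup) ⨾ U (U B) := V_T (a := 0) B _
  have f2 : U (lft A) ⨾ T (n + 2) (dval 0 cup) = T (n + 3) (dval 0 cup) ⨾ U (U (U (lft A))) :=
    V_T (a := 0) (U (lft A)) _
  have f3 : U (U B) ⨾ T (n + 1) (dval 0 clo) = T (n + 2) (dval 0 clo) ⨾ B :=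
    V_T (a := 2) (b := 0) B _
  have f4 : U (U (U (lft A))) ⨾ T (n + 2) (dval 0 clo) = T (n + 3) (dval 0 clo) ⨾ U (lft A) :=
    V_T (a := 2) (b := 0) (U (lft A)) _
  have f5 : U (U B) ⨾ U (T n (dval 0 zg)) = U (T n (dval 0 zJ)) ⨾ U (U B) := by
    rw [← U_comp, hB, U_comp]
  have f6 : U (U (U (lft A))) ⨾ U (T n (dval 0 zJ)) = U (T n (dval 0 zJN)) ⨾ U (U (U (lft A))) := by
    rw [← U_comp, (Sgn.lft A).U_zJ, U_comp]
    rfl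
  have f7 : T (n + 2) (dval 0 k1) ⨾ U (lft A) = lft A ⨾ T (n + 1) (dval 0 k1) :=
    (V_T (a := 0) (b := 1) (lft A) _).symm
  have f8 : T (n + 1) (dval 0 k0) ⨾ lft A = ZWModAx.id (n + 1) := by
    have : T (n + 1) (dval 0 k0) ⨾ appl (lft A ∷ nil) = _ := hA.lft.act.unit 0
    rwa [appl_one] at this
  show _ ⨾ T n (dval 0 (mid 1 cup 0 ⊳ mid 0 zg 1 ⊳ mid 1 clo 0)) = _
  rw [T_cp, T_cp, e1, e2, e3, stt, stt, addO_eq]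
  simp only [ZWModAx.assoc]
  rw [← ZWModAx.assoc B, f1, ZWModAx.assoc, ← ZWModAx.assoc (U (U B)), f5, ZWModAx.assoc, f3,
    ← ZWModAx.assoc (U (lft A)), f2, ZWModAx.assoc, ← ZWModAx.assoc (U (U (U (lft A)))), f6,
    ZWModAx.assoc, ← ZWModAx.assoc (U (U (U (lft A)))), f4]
  have h' := congrArg (fun t => vac n ⨾ t ⨾ U (lft A) ⨾ B) h
  simp only [ZWModAx.assoc] at h'
  rw [← ZWModAx.assoc (T (n + 2) (dval 0 k1)), f7, ZWModAx.assoc, ← ZWModAx.assoc (T (n + 1) (dval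
      0 k0)),
    f8, ZWModAx.id_comp] at h'
  show (vac n ⨾ T n (dval 0 k0)) ⨾ _ = (vac n ⨾ T n (dval 0 k0)) ⨾ _
  simp only [ZWModAx.assoc]
  exact h'

theorem stt_addO_lft {A : H (n + 1) n} {B : H (n + 2) (n + 1)} (hA : IsOp A) (hB : Sgn zJ B)
    {g : H (n + 1) m} (hg : T n (dval 0 lp) ⨾ g = g) :
    stt (addO (lft A) B) ⨾ g = stt B ⨾ g := by
  conv_lhs => rw [← hg]
  rw [← ZWModAx.assoc, stt_addO_lft_loop hA hB]

end ZW

/-! ### Closure under caps -/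

namespace ZW
open PRO Dg Ops

variable {ζ : ℕ → ℂ} {n m : ℕ}

/-- Words without a particle in the last wire are annihilated by any map that is invariant under
the loop. -/
theorem Spn.kill {S : List ℕ → Prop} {K : H (n + 2) (n + 1)} (hK : Spn (n + 1) S K)
    (hS : ∀ w, S w → Wd (n + 1) w) {g : H (n + 1) m} (hg : T n (dval 0 lp) ⨾ g = g) :
    ∃ B, Spn (n + 1) (fun w => S w ∧ 0 ∈ w) B ∧ stt K ⨾ g = stt B ⨾ g := by
  obtain ⟨A, B, hA, hB, rfl⟩ := hK.split (P := fun w => S w ∧ 0 ∉ w) (Q := fun w => S w ∧ 0 ∈ w)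
    fun w h => by by_cases h0 : 0 ∈ w <;> simp [h, h0]
  obtain ⟨A', hA', rfl⟩ := hA.of_map (P := Wd n) fun w h => (hS w h.1).of_zero_notMem h.2
  exact ⟨B, hB, stt_addO_lft hA'.isOp
    (Sgn.spn (hB.mono fun w h => ⟨hS w h.1, h.2⟩)) hg⟩

theorem stt_tri_two_bb (A : H (n + 1) n) :
    stt (triO (lft (lft A)) (letter (n + 2) 1) (letter (n + 2) 0)) ⨾ T n (dval 0 (fsw ⊳ bb)) =
      stt (smulO (-1) A) := by
  have e1 : T n (dval 0 (mid 1 (fsw ⊳ bb) 0)) = T (n + 1) (dval 0 (fsw ⊳ bb)) :=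
    eq_of_heq (T_mid_heq n 1 _ 0)
  have f : V A 2 ⨾ T n (dval 0 (fsw ⊳ bb)) = T (n + 1) (dval 0 (fsw ⊳ bb)) ⨾ A :=
    V_T (a := 2) (b := 0) A _
  have h := congrArg (T n) (kk1_tri2_bb (ζ := 0))
  rw [T_cp, T_cp, T_cp, e1] at h
  have h' := congrArg (fun t => vac n ⨾ t ⨾ A) h
  simp only [ZWModAx.assoc] at h'
  rw [stt_two, tri_two_eq, stt, smulO_eq]
  simp only [ZWModAx.assoc]
  rw [f]
  exact h'

/-- The effect requires both wires to be occupied, so it absorbs the loop on either of them. By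
`Spn.kill`, used once for each wire, only words with both letters 0 and 1 contribute, and from these
the two letters can be removed. -/
theorem W.bb {x : H 0 (n + 2)} (h : W (n + 2) x) : W n (x ⨾ T n (dval 0 bb)) := by
  obtain ⟨K, hK, rfl⟩ := h
  have e1 : T n (dval 0 (mid 1 lp 0)) = T (n + 1) (dval 0 lp) := eq_of_heq (T_mid_heq n 1 _ 0)
  have hg : T (n + 1) (dval 0 lp) ⨾ T n (dval 0 Dg.bb) = T n (dval 0 Dg.bb) := by
    rw [← e1, ← T_cp, lp_bb]
  have hg' : T (n + 1) (dval 0 lp) ⨾ T n (dval 0 (fsw ⊳ Dg.bb)) = T n (dval 0 (fsw ⊳ Dg.bb)) := by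
    rw [← e1, ← T_cp]
    exact congrArg (T n) lp_fsw_bb
  obtain ⟨B, hB, e⟩ := hK.kill (fun _ h => h) hg
  have hf : T n (dval 0 fsw) = V (T n ZW.fs) 0 := by rw [dval_fsw]; rfl
  -- To treat the other wire in the same way, it is brought to the end by a crossing that is undone
  -- in front of the effect; this exchanges the letters 0 and 1.
  have ef : stt B ⨾ T n (dval 0 Dg.bb) =
      (stt B ⨾ V (T n ZW.fs) 0) ⨾ T n (dval 0 (fsw ⊳ Dg.bb)) := by
    rw [T_cp, hf, ZWModAx.assoc, ← ZWModAx.assoc (V (T n ZW.fs) 0)]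
    show _ = stt B ⨾ (T n ZW.fs ⨾ T n ZW.fs) ⨾ _
    rw [T_fs_fs, ZWModAx.id_comp]
  obtain ⟨C, hC, e'⟩ := hB.int (letter_fs n 0)
    (S' := fun w => 1 ∈ w ∧ w.length % 2 = 1 ∧ ∀ i ∈ w, i < n + 2) fun w hw => by
      refine ⟨List.mem_map.2 ⟨0, hw.2, rfl⟩, by simpa using hw.1.2.1, ?_⟩
      simp only [List.mem_map]
      rintro _ ⟨i, hi, rfl⟩
      have := hw.1.2.2 i hi
      simp only [Equiv.swap_apply_def]
      split_ifs <;> omega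
  have hC' : Spn (n + 2) (fun w => Wd (n + 2) w ∧ 1 ∈ w) C := hC.bind fun w hw =>
    (spn_word _ hw.2.1 hw.2.2).mono fun _ h => ⟨h.1, h.2.mem_iff.2 hw.1⟩
  obtain ⟨D, hD, e''⟩ := hC'.kill (fun _ h => h.1) hg'
  obtain ⟨D1, hD1, rfl⟩ := hD.of_tri
    (P := fun w => ∃ v, Wd n v ∧ w = (v.map Nat.succ).map Nat.succ) fun w h => by
      obtain ⟨v, hv, rfl⟩ := h.1.1.of_zero_one_mem h.2 h.1.2
      exact ⟨_, ⟨v, hv, rfl⟩, rfl⟩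
  obtain ⟨D2, hD2, rfl⟩ := hD1.of_map (P := fun w => ∃ v, Wd n v ∧ w = v.map Nat.succ)
    fun w ⟨v, hv, e⟩ => ⟨_, ⟨v, hv, rfl⟩, e⟩
  obtain ⟨D3, hD3, rfl⟩ := hD2.of_map (P := Wd n) fun w h => h
  refine ⟨_, hD3.smul (-1), ?_⟩
  rw [e, ef, stt_int e' (vac_fs n 0)]
  exact e''.trans (stt_tri_two_bb D3)

theorem W.cap {x : H 0 (n + 2)} (h : W (n + 2) x) : W n (x ⨾ T n (dval 0 cap)) := by
  have e1 : T n (dval 0 (mid 2 (st (.p 2) 2) 0)) = T (n + 2) (ZW.om (-1)) := eq_of_heq (T_mid_heq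
      n 2 _ 0)
  have e2 : T n (dval 0 (mid 2 fsw 0)) = T (n + 2) ZW.fs :=
    (eq_of_heq (T_mid_heq n 2 fsw 0)).trans (by rw [dval_fsw]; rfl)
  have e3 : T n (dval 0 (mid 1 fsw 1)) = V (T (n + 1) ZW.fs) 1 :=
    (eq_of_heq (T_mid_heq n 1 fsw 1)).trans (by rw [dval_fsw]; rfl)
  have e4 : T n (dval 0 (mid 2 Dg.mul 0)) = T (n + 2) (dval 0 Dg.mul) :=
    eq_of_heq (T_mid_heq n 2 Dg.mul 0)
  have e5 : T n (dval 0 (mid 1 fsw 0)) = T (n + 1) ZW.fs :=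
    (eq_of_heq (T_mid_heq n 1 fsw 0)).trans (by rw [dval_fsw]; rfl)
  have e6 : T n (dval 0 (mid 0 fsw 1)) = V (T n ZW.fs) 1 :=
    (eq_of_heq (T_mid_heq n 0 fsw 1)).trans (by rw [dval_fsw]; rfl)
  have e7 : T n (dval 0 (mid 1 Dg.mul 0)) = T (n + 1) (dval 0 Dg.mul) :=
    eq_of_heq (T_mid_heq n 1 Dg.mul 0)
  have e8 : T n (dval 0 fsw) = T n ZW.fs := by rw [dval_fsw]; rfl
  rw [← cap_eq]
  simp only [T_cp, e1, e2, e3, e4, e5, e6, e7, e8, ← ZWModAx.assoc]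
  exact ((((((((h.om (-1)).fs (k := n + 2) (d := 0)).fs (k := n + 1) (d := 1)).mul
    (n := n + 2)).fs (k := n + 1) (d := 0)).fs (k := n) (d := 1)).mul (n := n + 1)).fs (k := n)
    (d := 0)).bb

end ZW

namespace ZW
open PRO Dg Ops

variable {ζ : ℕ → ℂ} {n m : ℕ}

/-! ### Closure of the states under all diagrams -/

/-- The map `G` preserves the property `P` of states. -/
def Pres (P : ∀ n, H 0 n → Prop) (G : H m n) : Prop := ∀ x, P m x → P n (x ⨾ G)

/-- The property `P` of states is preserved by `f` on any consecutive wires. -/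
def Cl (P : ∀ n, H 0 n → Prop) {a b : ℕ} (f : H a b) : Prop := ∀ n k, Pres P (V (T n f) k)

variable {P : ∀ n, H 0 n → Prop}

namespace Pres

theorem comp {l : ℕ} {F : H l m} {G : H m n} (hF : Pres P F) (hG : Pres P G) : Pres P (F ⨾ G) :=
  fun x hx => by
    rw [← ZWModAx.assoc]
    exact hG _ (hF x hx)

theorem id (n : ℕ) : Pres P (ZWModAx.id n) := fun x hx => by rwa [ZWModAx.comp_id]

theorem of_heq {m' n' : ℕ} {G : H m n} {G' : H m' n'} (hm : m = m') (hn : n = n') (h : HEq G G')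
    (hG : Pres P G) : Pres P G' := by
  subst hm hn
  rwa [← eq_of_heq h]

end Pres

namespace Cl

variable {a b : ℕ}

theorem id (a : ℕ) : Cl P (ZWModAx.id a) := fun n k => by
  rw [T_id, V_id]
  exact Pres.id _

theorem comp {c : ℕ} {f : H a b} {g : H b c} (hf : Cl P f) (hg : Cl P g) : Cl P (f ⨾ g) :=
  fun n k => by
    rw [T_comp, V_comp]
    exact (hf n k).comp (hg n k)

theorem V {f : H a b} (hf : Cl P f) (j : ℕ) : Cl P (V f j) := fun n k =>
  (hf n (j + k)).of_heq (by omega) (by omega)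
    ((V_heq (by omega) (by omega) rfl (T_V_heq n j f)).trans (V_V_heq (PRO.T n f) j k)).symm

theorem T {f : H a b} (hf : Cl P f) (r : ℕ) : Cl P (T r f) := fun n k =>
  (hf (n + r) k).of_heq (by omega) (by omega) (V_heq (by omega) (by omega) rfl (T_T_heq n r f)).symm

theorem tensor {c d : ℕ} {f : H a b} {g : H c d} (hf : Cl P f) (hg : Cl P g) : Cl P (f ⊠ g) := by
  rw [tensor_eq_V]
  exact (hf.V c).comp (hg.T b)

theorem mid {g : Dg a b} (hg : Cl P (dval ζ g)) (r : ℕ) : ∀ s, Cl P (dval ζ (mid r g s))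
  | 0 => hg.T r
  | s + 1 => (hg.mid r s).V 1

theorem pres_X {s : H 2 2} (hs : Cl P s) (a : ℕ) : ∀ n k, Pres P (PRO.V (X s a n) k)
  | 0, k => by
    rw [X, V_id]
    exact Pres.id _
  | n + 1, k => by
    show Pres P (PRO.V (PRO.T (a + n) s ⨾ U (X s a n)) k)
    rw [V_comp]
    exact (hs _ _).comp ((pres_X hs a n (1 + k)).of_heq (by omega) (by omega)
      (V_V_heq (X s a n) 1 k).symm)

theorem pres_X' {s : H 2 2} (hs : Cl P s) (a : ℕ) : ∀ n k, Pres P (PRO.V (X' s a n) k)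
  | 0, k => by
    rw [X', V_id]
    exact Pres.id _
  | n + 1, k => by
    show Pres P (PRO.V (U (X' s a n) ⨾ PRO.T (a + n) s) k)
    rw [V_comp]
    exact ((pres_X' hs a n (1 + k)).of_heq (by omega) (by omega)
      (V_V_heq (X' s a n) 1 k).symm).comp (hs _ _)

/-- Only the rightmost wires need to be considered: other wires are moved out of the way by a swap
that preserves `P`, and moved back after `f`. -/
theorem of_top {s : H 2 2} (hss : s ⨾ s = ZWModAx.id 2) (hs : Cl P s) {f : H a b} (hf : Slides s
    f) (h : ∀ n, Pres P (PRO.T n f)) :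
    Cl P f := by
  suffices ∀ k n, Pres P (PRO.V (PRO.T n f) k) from fun n k => this k n
  intro k
  induction k with
  | zero => exact h
  | succ k ih =>
    intro n
    have e : U (PRO.T n f) = X s n a ⨾ PRO.T (n + 1) f ⨾ X' s n b := by
      rw [← ZWModAx.assoc, ← hf n, ZWModAx.assoc, X_X' hss, ZWModAx.comp_id]
    refine Pres.of_heq (G := PRO.V (U (PRO.T n f)) k) (by omega) (by omega)
      ((V_V_heq (PRO.T n f) 1 k).trans (V_heq rfl rfl (Nat.add_comm 1 k) HEq.rfl)) ?_
    rw [e, V_comp, V_comp]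
    exact (pres_X hs n a k).comp ((ih (n + 1)).comp (pres_X' hs n b k))

end Cl

theorem X_fs_two_eq : X fs 0 2 = T 1 fs ⨾ U fs := by
  show T 1 fs ⨾ U (X fs 0 1) = _
  rw [X_fs_one (ζ := 0), dval_fsw]
  rfl

theorem slides_fs_om (z : ℂ) : Slides fs (om z) := slides_of (by
  rw [X_fs_two_eq, eq_of_heq (T_zero_heq (om z))]
  have h : cls ((white z ⊠ wire) ⨾ (wire ⊠ fswap) ⨾ (fswap ⊠ wire)) = cls (wire ⊠ white z) :=
    cls_ax (.white_fslide z)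
  exact h.trans (ZWModAx.id_comp _).symm)

theorem slides_fs_ep : Slides fs ep := slides_of (by
  rw [X_fs_two_eq, eq_of_heq (T_zero_heq ep), ZWModAx.assoc]
  have h : cls (dualDag ⊠ wire) = cls ((wire ⊠ fswap) ⨾ (fswap ⊠ wire) ⨾ (wire ⊠ dualDag)) :=
    cls_ax .dualDag_fslide
  exact (ZWModAx.comp_id _).trans h)

theorem slides_fs_sg : Slides fs sg := slides_of (by
  rw [X_fs_two_eq, eq_of_heq (T_zero_heq sg), ZWModAx.assoc]
  exact cls_ax .swap_fslide)

theorem cup_pha_one : dval ζ (cup ⊳ mid 1 (pha 1) 0) = dval ζ (st (.p 1) 2) :=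
  dval_eq_of_proves canSound_three [] [] trivial trivial
    (by decide +kernel)

theorem om_one : om 1 = et := by
  have h := cup_pha_one (ζ := 0)
  have e : dval 0 (pha 1) = ZWModAx.id 1 := cls_ax .phase_one
  refine h.symm.trans ?_
  show et ⨾ T 1 (dval 0 (pha 1)) = et
  rw [e, T_id, ZWModAx.comp_id]

theorem cl_fs : Cl W fs := fun _ _ _ h => h.fs

theorem cl_om (z : ℂ) : Cl W (om z) := .of_top fs_fs cl_fs (slides_fs_om z) fun _ _ h => h.om z

theorem cl_ep : Cl W ep := .of_top fs_fs cl_fs slides_fs_ep fun _ _ h => h.cap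

theorem cl_et : Cl W et := om_one ▸ cl_om 1

theorem cl_sg : Cl W sg := by
  refine .of_top fs_fs cl_fs slides_fs_sg fun n x h => ?_
  have e1 : T n (dval 0 (mid 2 cupz 0)) = T (n + 2) (dval 0 cupz) := eq_of_heq (T_mid_heq n 2 _ 0)
  have e : T n sg = T (n + 2) (dval 0 cupz) ⨾
      T n (dval 0 (mid 3 fsw 1)) ⨾ T n (dval 0 (mid 1 cap 3)) ⨾ T n (dval 0 (mid 0 cap 2)) := by
    show T n (dval 0 sw) = _
    rw [← sw_eq, T_cp, T_cp, T_cp, e1]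
  have hfs : Cl W (dval 0 fsw) := by rw [dval_fsw]; exact cl_fs
  have hep : Cl W (dval 0 Dg.cap) := cl_ep
  rw [e, ← ZWModAx.assoc]
  exact ((hfs.mid 3 1 n 0).comp ((hep.mid 1 3 n 0).comp (hep.mid 0 2 n 0))) _ h.cupz

theorem cl_mul : Cl W (dval 0 Dg.mul) := .of_top fs_fs cl_fs slides_fs_mul fun n x h => by
  exact W.mul h

theorem cl_dl : Cl W (dval 0 dl) := by
  have hfs : Cl W (dval 0 fsw) := by rw [dval_fsw]; exact cl_fs
  have hep : Cl W (dval 0 Dg.cap) := cl_ep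
  have het : Cl W (dval 0 cup) := cl_et
  rw [← dl_eq]
  exact (het.mid 1 0).comp ((het.mid 3 0).comp ((hfs.mid 2 1).comp ((cl_mul.mid 1 2).comp
    (hep.mid 0 2))))

/-- States that are linear combinations of words, possibly after adding a wire in the state `1`. -/
def Good (n : ℕ) (x : H 0 n) : Prop := W n x ∨ W (n + 1) (x ⨾ T n (dval 0 k1))

theorem Good.comp {a b : ℕ} {f : H a b} (hf : Cl W f) : Cl Good f := fun n k x hx => by
  rcases hx with hx | hx
  · exact .inl (hf n k x hx)
  · refine .inr ?_
    have e : V (T n f) k ⨾ T (n + b + k) (dval 0 Dg.k1) =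
      T (n + a + k) (dval 0 Dg.k1) ⨾ V (T n f) (k + 1) :=
      V_T (a := 0) (b := 1) (V (T n f) k) (dval 0 Dg.k1)
    rw [ZWModAx.assoc, e, ← ZWModAx.assoc]
    exact hf n (k + 1) _ hx

theorem Good.k1 {x : H 0 n} (h : Good n x) : Good (n + 1) (x ⨾ T n (dval 0 k1)) := by
  rcases h with h | h
  · refine .inr ?_
    have e : T n (dval 0 (mid 1 Dg.k1 0)) = T (n + 1) (dval 0 Dg.k1) := eq_of_heq (T_mid_heq n 1 _
        0)
    rw [ZWModAx.assoc, ← e, ← T_cp]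
    exact h.k1k1
  · exact .inl h

/-- The state `|1⟩` is odd and does not slide through a fermionic crossing without a curl, so the
structural swap is used to move it. -/
theorem cl_k1 : Cl Good (dval 0 k1) :=
  .of_top sg_sg (Good.comp cl_sg) (slides _) fun _ _ h => h.k1

theorem cl_gen {a b : ℕ} (g : ZWSig a b) : Cl Good (cls (freePRO.gen g)) := by
  cases g with
  | swap => exact (Good.comp cl_sg)
  | dual => exact (Good.comp cl_et)
  | dualDag => exact (Good.comp cl_ep)
  | fswap => exact (Good.comp cl_fs)
  | white z => exact Good.comp (cl_om z)
  | black₂ =>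
    show Cl Good (dval 0 (st .n 2))
    rw [← n_eq]
    exact cl_k1.comp (Good.comp cl_dl)
  | black₃ =>
    show Cl Good (dval 0 (st .b 3))
    rw [← b_eq]
    exact cl_k1.comp ((Good.comp cl_dl).comp ((Good.comp cl_dl).mid 0 1))

theorem cl_all {a b : ℕ} (f : H a b) : Cl Good f := by
  induction f using Quotient.ind with | _ f
  induction f using Quotient.ind with | _ f
  induction f with
  | gen g => exact cl_gen g
  | id n => exact Cl.id n
  | comp f g hf hg => exact hf.comp hg
  | tensor f g hf hg => exact hf.tensor hg

theorem k0_k1_mul : dval ζ (k0 ⊳ mid 1 k1 0 ⊳ mul) = dval ζ (k1) :=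
  dval_eq_of_proves canSound_three [⟨Rule.dO, [], []⟩] [] ⟨Rule.dO_sound, trivial⟩ trivial
    (by decide +kernel)

/-- The empty diagram becomes good after adding `|1⟩`, which is one particle created on the vacuum
of one wire: the word `[0]`. -/
theorem good_id : Good 0 (ZWModAx.id 0) := .inr (by
  refine ⟨_, Spn.word (w := [0]) ⟨by simp, rfl, by simp⟩, ?_⟩
  have e0 : T 0 (dval 0 k0) = dval 0 k0 := eq_of_heq (T_zero_heq _)
  have e1 : T 0 (dval 0 Dg.mul) = dval 0 Dg.mul := eq_of_heq (T_zero_heq _)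
  have e2 : T 0 (dval 0 k1) = dval 0 k1 := eq_of_heq (T_zero_heq _)
  show ZWModAx.id 0 ⨾ T 0 (dval 0 k1) =
    (ZWModAx.id 0 ⨾ T 0 (dval 0 k0)) ⨾ T 1 (dval 0 k1) ⨾ T 0 (dval 0 Dg.mul)
  rw [e2, e0, e1]
  refine (ZWModAx.id_comp _).trans (k0_k1_mul.symm.trans ?_)
  exact congrArg (· ⨾ T 1 (dval 0 k1) ⨾ dval 0 Dg.mul) (ZWModAx.id_comp (dval 0 k0)).symm)

/-- Every state is a linear combination of words, possibly after adding a wire in the state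
`1`. -/
theorem good (x : H 0 n) : Good n x := by
  have h := (cl_all x 0 0).of_heq (G' := x) rfl (Nat.zero_add n) (T_zero_heq x) _ good_id
  rwa [ZWModAx.id_comp] at h

end ZW

namespace ZW
open PRO Modes

/-! ### Soundness

Diagrams are evaluated on basis states with coefficients that are polynomials in two parameters. -/

/-- Parameters of white vertices. -/
inductive Par
  | z | w | add | mul | zero | one | half

noncomputable def Par.val (z w : ℂ) : Par → ℂ
  | .z => z
  | .w => w
  | .add => z + w
  | .mul => z * w
  | .zero => 0
  | .one => 1
  | .half => 1 / 2

/-- The terms of a parameter, as coefficients of `z ^ i * w ^ j`. -/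
def Par.terms : Par → List (ℚ × ℕ × ℕ)
  | .z => [(1, 1, 0)]
  | .w => [(1, 0, 1)]
  | .add => [(1, 1, 0), (1, 0, 1)]
  | .mul => [(1, 1, 1)]
  | .zero => []
  | .one => [(1, 0, 0)]
  | .half => [(1 / 2, 0, 0)]

/-- The signature of the calculus with named parameters. -/
inductive PSig : ℕ → ℕ → Type
  | swap : PSig 2 2
  | dual : PSig 0 2
  | dualDag : PSig 2 0
  | fswap : PSig 2 2
  | black₂ : PSig 0 2
  | black₃ : PSig 0 3
  | white (p : Par) : PSig 0 2

noncomputable def PSig.val (z w : ℂ) : ∀ {m n}, PSig m n → ZWSig m n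
  | _, _, .swap => .swap
  | _, _, .dual => .dual
  | _, _, .dualDag => .dualDag
  | _, _, .fswap => .fswap
  | _, _, .black₂ => .black₂
  | _, _, .black₃ => .black₃
  | _, _, .white p => .white (p.val z w)

/-- A coefficient, the exponents of the parameters, and a basis state. -/
abbrev Tm := ℚ × ℕ × ℕ × List Bool

def Tm.smul (s t : Tm) : Tm := (s.1 * t.1, s.2.1 + t.2.1, s.2.2.1 + t.2.2.1, t.2.2.2)

def pad (n : ℕ) (l : List Bool) : List Bool := List.ofFn fun i : Fin n => l.getD i false

def PSig.run : ∀ {m n}, PSig m n → List Bool → List Tm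
  | _, _, .swap, l => [(1, 0, 0, [l.getD 1 false, l.getD 0 false])]
  | _, _, .dual, _ => [(1, 0, 0, [false, false]), (1, 0, 0, [true, true])]
  | _, _, .dualDag, l => if l.getD 0 false = l.getD 1 false then [(1, 0, 0, [])] else []
  | _, _, .fswap, l => [(if l.getD 0 false ∧ l.getD 1 false then -1 else 1, 0, 0,
      [l.getD 1 false, l.getD 0 false])]
  | _, _, .black₂, _ => [(1, 0, 0, [true, false]), (1, 0, 0, [false, true])]
  | _, _, .black₃, _ => [(1, 0, 0, [true, false, false]), (1, 0, 0, [false, true, false]),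
      (1, 0, 0, [false, false, true])]
  | _, _, .white p, _ => (1, 0, 0, [false, false]) ::
      p.terms.map fun t => (t.1, t.2.1, t.2.2, [true, true])

/-- Bit strings are lists of any length, read with default value `false`. In a tensor product the
first output is padded to its arity, so that the second one starts at the right place. -/
def amps : ∀ {m n}, DTerm PSig m n → List Bool → List Tm
  | _, _, .gen g, l => g.run l
  | _, _, .id _, l => [(1, 0, 0, l)]
  | _, _, .comp f g, l => (amps f l).flatMap fun t => (amps g t.2.2.2).map t.smul
  | _, _, .tensor (m := m) (n := n) f g, l => (amps f l).flatMap fun t =>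
      (amps g (l.drop m)).map fun s => t.smul (s.1, s.2.1, s.2.2.1, pad n t.2.2.2 ++ s.2.2.2)

def bits (n : ℕ) (l : List Bool) : Fin n → Bool := fun i => l.getD i false

theorem bits_ofFn {n : ℕ} (b : Fin n → Bool) : bits n (List.ofFn b) = b := by
  ext i
  simp [bits, List.getD]

theorem bits_pad (n : ℕ) (l : List Bool) : bits n (pad n l) = bits n l := bits_ofFn _

theorem bits_append (m n : ℕ) (l l' : List Bool) :
    bits (m + n) (pad m l ++ l') = Fin.append (bits m l) (bits n l') := by
  have h : (pad m l).length = m := by simp [pad]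
  ext i
  refine Fin.addCases (fun j => ?_) (fun j => ?_) i
  · rw [Fin.append_left, ← bits_pad m l, bits, bits]
    exact List.getD_append _ _ _ _ (by simp [h])
  · rw [Fin.append_right, bits, bits, List.getD_append_right _ _ _ _ (by simp [h]), h]
    simp

section
variable (z w : ℂ)

noncomputable def Tm.cf (t : ℕ × ℕ × List Bool) : ℂ := z ^ t.1 * w ^ t.2.1

noncomputable def den (n : ℕ) (L : List Tm) : Modes n :=
  (L.map fun t => ((t.1 : ℂ) * Tm.cf z w t.2) • ket (bits n t.2.2.2)).sum

noncomputable def lval {m n : ℕ} (D : DTerm PSig m n) : LFM.Hom m n :=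
  DTerm.eval LFM (fun g => interpGen (g.val z w)) D

theorem den_cons (n : ℕ) (t : Tm) (L : List Tm) : den z w n (t :: L) =
    ((t.1 : ℂ) * Tm.cf z w t.2) • ket (bits n t.2.2.2) + den z w n L := by
  simp [den]

theorem den_append (n : ℕ) (L L' : List Tm) :
    den z w n (L ++ L') = den z w n L + den z w n L' := by simp [den]

theorem den_smul (n : ℕ) (t : Tm) (L : List Tm) :
    den z w n (L.map t.smul) = ((t.1 : ℂ) * Tm.cf z w t.2) • den z w n L := by
  induction L with
  | nil => simp [den]
  | cons s L ih =>
    rw [List.map_cons, den_cons, den_cons, ih, smul_add, smul_smul]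
    congr 2
    simp only [Tm.smul, Tm.cf]
    push_cast
    ring

theorem den_flatMap (n : ℕ) (L : List Tm) {m : ℕ} (F : Modes m →ₗ[ℂ] Modes n)
    (k : Tm → List Tm)
    (h : ∀ t ∈ L, den z w n (k t) = ((t.1 : ℂ) * Tm.cf z w t.2) • F (ket (bits m t.2.2.2))) :
    den z w n (L.flatMap k) = F (den z w m L) := by
  induction L with
  | nil => simp [den]
  | cons t L ih =>
    rw [List.flatMap_cons, den_append, den_cons, map_add, map_smul, h t (by simp),
      ih fun s hs => h s (by simp [hs])]

theorem Par.val_eq (p : Par) :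
    ∀ n (b : List Bool), den z w n (p.terms.map fun t => (t.1, t.2.1, t.2.2, b)) =
      p.val z w • ket (bits n b) := by
  intro n b
  cases p <;> simp [den, Par.terms, Par.val, Tm.cf, add_smul]

theorem PSig.run_spec {m n : ℕ} (g : PSig m n) (l : List Bool) :
    (interpGen (g.val z w)).1 (ket (bits m l)) = den z w n (g.run l) := by
  have e2 (a b : Bool) : bits 2 [a, b] = ![a, b] := by ext i; fin_cases i <;> rfl
  have e3 (a b c : Bool) : bits 3 [a, b, c] = ![a, b, c] := by ext i; fin_cases i <;> rfl
  cases g with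
  | white p =>
    refine (ofKets_ket _ _).trans ?_
    simp only [PSig.run]
    rw [den_cons, Par.val_eq, e2, e2]
    simp [Tm.cf]
  | dualDag =>
    refine (ofKets_ket _ _).trans ?_
    simp only [bits, PSig.run]
    show (if l.getD 0 false = l.getD 1 false then _ else _) = _
    split_ifs with h
    · simp only [den, Tm.cf, List.map_cons, List.map_nil, List.sum_cons, List.sum_nil]
      simp only [Rat.cast_one, pow_zero, mul_one, one_smul, add_zero]
      exact congrArg ket (Subsingleton.elim _ _)
    · simp [den]
  | fswap =>
    refine (ofKets_ket _ _).trans ?_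
    simp only [PSig.run, den, List.map_cons, List.map_nil, List.sum_cons, List.sum_nil, add_zero,
      e2, Tm.cf, pow_zero, mul_one]
    show (if l.getD 0 false = true ∧ l.getD 1 false = true then (-1 : ℂ) else 1) •
      ket ![l.getD 1 false, l.getD 0 false] = _
    split_ifs <;> simp
  | swap =>
    refine (ofKets_ket _ _).trans ?_
    simp only [PSig.run, den, List.map_cons, List.map_nil, List.sum_cons, List.sum_nil, add_zero,
      e2, Tm.cf, pow_zero, mul_one, Rat.cast_one, one_smul]
    rfl
  | dual => exact (ofKets_ket _ _).trans (by simp [PSig.run, den, e2, Tm.cf])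
  | black₂ => exact (ofKets_ket _ _).trans (by simp [PSig.run, den, e2, Tm.cf])
  | black₃ => exact (ofKets_ket _ _).trans (by simp [PSig.run, den, e3, Tm.cf, add_assoc])

theorem amps_spec {m n : ℕ} (D : DTerm PSig m n) : ∀ l,
    (lval z w D).1 (ket (bits m l)) = den z w n (amps D l) := by
  induction D with
  | gen g => exact g.run_spec z w
  | id n => exact fun l => by simp [den, amps, Tm.cf]; rfl
  | comp f g hf hg =>
    intro l
    show (lval z w g).1 ((lval z w f).1 (ket _)) = _
    rw [hf, amps, den_flatMap z w _ _ (lval z w g).1]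
    intro t _
    rw [den_smul, hg]
  | @tensor m n m' n' f g hf hg =>
    intro l
    show tensorMap (lval z w f).1 (lval z w g).1 (ket _) = _
    have e1 : (fun i => bits (m + m') l (Fin.castAdd m' i)) = bits m l := rfl
    have e2 : (fun i => bits (m + m') l (Fin.natAdd m i)) = bits m' (l.drop m) := by
      ext i
      simp [bits, List.getD]
    rw [ket_eq_tmul, tensorMap_tmul, e1, e2, hf, hg, amps,
      den_flatMap z w _ _ ((tmul n n').flip (den z w n' (amps g (l.drop m))))]
    · rfl
    intro t _
    rw [← Function.comp_def t.smul, ← List.map_map, den_smul]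
    congr 1
    show _ = tmul n n' _ (den z w n' _)
    generalize amps g (l.drop m) = L
    induction L with
    | nil => simp [den]
    | cons s L ih =>
      rw [List.map_cons, den_cons, den_cons, map_add, map_smul, ih, bits_append, tmul_ket]
      rfl

def key (n : ℕ) (t : Tm) : ℕ × ℕ × List Bool := (t.2.1, t.2.2.1, pad n t.2.2.2)

def coef (n : ℕ) (L : List Tm) (k : ℕ × ℕ × List Bool) : ℚ :=
  L.foldr (fun t c => if key n t = k then t.1 + c else c) 0

theorem den_eq_sum (n : ℕ) (S : Finset (ℕ × ℕ × List Bool)) (L : List Tm)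
    (h : ∀ t ∈ L, key n t ∈ S) : den z w n L =
      ∑ k ∈ S, ((coef n L k : ℂ) * Tm.cf z w k) • ket (bits n k.2.2) := by
  induction L with
  | nil => simp [den, coef]
  | cons t L ih =>
    have e : ∀ k, (coef n (t :: L) k : ℂ) = (if key n t = k then (t.1 : ℂ) else 0) + coef n L k :=
        by
      intro k
      show (((if key n t = k then t.1 + coef n L k else coef n L k : ℚ)) : ℂ) = _
      split_ifs <;> simp
    rw [den_cons, ih fun s hs => h s (by simp [hs])]
    simp only [e, add_mul, add_smul, Finset.sum_add_distrib]
    congr 1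
    simp only [ite_mul, zero_mul, ite_smul, zero_smul, Finset.sum_ite_eq]
    rw [if_pos (h t (by simp))]
    show _ = _ • ket (bits n (pad n t.2.2.2))
    rw [bits_pad]
    rfl

/-- It is enough to compare the coefficients at the monomials and basis states that occur in one of
the lists; elsewhere both are 0. The test does not involve the values of the parameters, so it
settles the equality for all of them. -/
def same (n : ℕ) (L L' : List Tm) : Bool :=
  (L ++ L').all fun t => coef n L (key n t) = coef n L' (key n t)

def allBits : ℕ → List (List Bool)
  | 0 => [[]]
  | n + 1 => (allBits n).flatMap fun l => [false :: l, true :: l]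

theorem mem_allBits : ∀ l : List Bool, l ∈ allBits l.length
  | [] => by simp [allBits]
  | b :: l => by
    have := mem_allBits l
    cases b <;> simp [allBits, this]

theorem den_eq {n : ℕ} {L L' : List Tm} (h : same n L L' = true) :
    den z w n L = den z w n L' := by
  have h' := List.all_eq_true.1 h
  let S := ((L ++ L').map (key n)).toFinset
  rw [den_eq_sum z w n S L fun t ht => by
      simp only [S, List.mem_toFinset, List.mem_map]; exact ⟨t, by simp [ht]⟩,
    den_eq_sum z w n S L' fun t ht => by
      simp only [S, List.mem_toFinset, List.mem_map]; exact ⟨t, by simp [ht]⟩]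
  refine Finset.sum_congr rfl fun k hk => ?_
  simp only [S, List.mem_toFinset, List.mem_map] at hk
  obtain ⟨t, ht, rfl⟩ := hk
  rw [of_decide_eq_true (h' t ht)]

/-- Diagrams are equal in the model if they agree on basis states. -/
theorem lval_eq {m n : ℕ} (D D' : DTerm PSig m n)
    (h : ((allBits m).all fun l => same n (amps D l) (amps D' l)) = true) :
    lval z w D = lval z w D' := by
  refine Subtype.ext (hom_ext fun b => ?_)
  have hb := List.all_eq_true.1 h (List.ofFn b) (by simpa using mem_allBits (List.ofFn b))
  rw [← bits_ofFn b, amps_spec, amps_spec, den_eq z w hb]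

end

end ZW

namespace ZW
open PRO Modes

namespace Snd

abbrev Di (m n : ℕ) : Type := DTerm PSig m n

def swap : Di 2 2 := .gen .swap
def dual : Di 0 2 := .gen .dual
def dualDag : Di 2 0 := .gen .dualDag
def fswap : Di 2 2 := .gen .fswap
def black₂ : Di 0 2 := .gen .black₂
def black₃ : Di 0 3 := .gen .black₃
def white (p : Par) : Di 0 2 := .gen (.white p)
def wire : Di 1 1 := .id 1
def empty : Di 0 0 := .id 0

local notation:60 f:61 " ⨟ " g:60 => DTerm.comp f g
local notation:70 f:71 " ⊙ " g:70 => (DTerm.tensor f g :)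

def not : Di 1 1 := (wire ⊙ black₂) ⨟ (dualDag ⊙ wire)
def split : Di 1 2 := (wire ⊙ black₃) ⨟ (dualDag ⊙ wire ⊙ wire)
def merge : Di 2 1 := (wire ⊙ split) ⨟ (dualDag ⊙ wire)
def phase (p : Par) : Di 1 1 := (wire ⊙ white p) ⨟ (dualDag ⊙ wire)
def phaseDag (p : Par) : Di 2 0 := (wire ⊙ phase p) ⨟ dualDag
def projector : Di 2 2 :=
  (wire ⊙ white .half ⊙ wire) ⨟ (fswap ⊙ fswap) ⨟ (not ⊙ wire ⊙ wire ⊙ not) ⨟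
    (swap ⊙ swap) ⨟ (wire ⊙ phaseDag .half ⊙ wire)
def curl : Di 1 1 := (dual ⊙ wire) ⨟ (wire ⊙ fswap) ⨟ (dualDag ⊙ wire)

/-- The axioms hold in the model. -/
theorem sound {m n : ℕ} {f g : ZW.Hom m n} (h : Ax m n f g) : interp.map f = interp.map g := by
  cases h with
  | dual_snake =>
    -- The diagrams with named parameters unfold to those of the axiom; in axioms without variables
    -- the values `0 0` are arbitrary.
    exact lval_eq 0 0 (((wire ⊙ dual) ⨟ (dualDag ⊙ wire))) (wire) (by decide +kernel)
  | dual_swap =>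
    exact lval_eq 0 0 ((dual ⨟ swap)) (dual) (by decide +kernel)
  | swap_swap =>
    exact lval_eq 0 0 ((swap ⨟ swap)) ((wire ⊙ wire)) (by decide +kernel)
  | swap_slide =>
    exact lval_eq 0 0 (((swap ⊙ wire) ⨟ (wire ⊙ swap) ⨟ (swap ⊙ wire))) (((wire ⊙ swap) ⨟ (swap
      ⊙ wire) ⨟ (wire ⊙ swap))) (by decide +kernel)
  | dual_slide =>
    exact lval_eq 0 0 (((dual ⊙ wire) ⨟ (wire ⊙ swap) ⨟ (swap ⊙ wire))) ((wire ⊙ dual))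
        (by decide +kernel)
  | dualDag_slide =>
    exact lval_eq 0 0 ((dualDag ⊙ wire)) (((wire ⊙ swap) ⨟ (swap ⊙ wire) ⨟ (wire ⊙ dualDag)))
      (by decide +kernel)
  | black₂_slide =>
    exact lval_eq 0 0 (((black₂ ⊙ wire) ⨟ (wire ⊙ swap) ⨟ (swap ⊙ wire))) ((wire ⊙ black₂))
        (by decide +kernel)
  | black₃_slide =>
    exact lval_eq 0 0 (((black₃ ⊙ wire) ⨟ (wire ⊙ wire ⊙ swap) ⨟ (wire ⊙ swap ⊙ wire) ⨟ (swap ⊙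
      wire ⊙ wire))) ((wire ⊙ black₃)) (by decide +kernel)
  | white_slide z =>
    exact lval_eq z 0 (((white .z ⊙ wire) ⨟ (wire ⊙ swap) ⨟ (swap ⊙ wire))) ((wire ⊙ white .z))
      (by decide +kernel)
  | fswap_slide =>
    exact lval_eq 0 0 (((fswap ⊙ wire) ⨟ (wire ⊙ swap) ⨟ (swap ⊙ wire))) (((wire ⊙ swap) ⨟ (swap
      ⊙ wire) ⨟ (wire ⊙ fswap))) (by decide +kernel)
  | fswap_fswap =>
    exact lval_eq 0 0 ((fswap ⨟ fswap)) ((wire ⊙ wire)) (by decide +kernel)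
  | fswap_fslide =>
    exact lval_eq 0 0 (((fswap ⊙ wire) ⨟ (wire ⊙ fswap) ⨟ (fswap ⊙ wire))) (((wire ⊙ fswap) ⨟
      (fswap ⊙ wire) ⨟ (wire ⊙ fswap))) (by decide +kernel)
  | dual_fslide =>
    exact lval_eq 0 0 (((dual ⊙ wire) ⨟ (wire ⊙ fswap) ⨟ (fswap ⊙ wire))) ((wire ⊙ dual))
        (by decide +kernel)
  | dualDag_fslide =>
    exact lval_eq 0 0 ((dualDag ⊙ wire)) (((wire ⊙ fswap) ⨟ (fswap ⊙ wire) ⨟ (wire ⊙ dualDag)))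
      (by decide +kernel)
  | fswap_swap =>
    exact lval_eq 0 0 ((fswap ⨟ swap)) ((swap ⨟ fswap)) (by decide +kernel)
  | swap_fslide =>
    exact lval_eq 0 0 (((swap ⊙ wire) ⨟ (wire ⊙ fswap) ⨟ (fswap ⊙ wire))) (((wire ⊙ fswap) ⨟
      (fswap ⊙ wire) ⨟ (wire ⊙ swap))) (by decide +kernel)
  | black₂_fslide =>
    exact lval_eq 0 0 (((black₂ ⊙ wire) ⨟ (wire ⊙ fswap) ⨟ (fswap ⊙ wire))) ((curl ⊙ black₂))
      (by decide +kernel)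
  | black₃_fslide =>
    exact lval_eq 0 0 (((black₃ ⊙ wire) ⨟ (wire ⊙ wire ⊙ fswap) ⨟ (wire ⊙ fswap ⊙ wire) ⨟ (fswap
      ⊙ wire ⊙ wire))) ((curl ⊙ black₃)) (by decide +kernel)
  | white_fslide z =>
    exact lval_eq z 0 (((white .z ⊙ wire) ⨟ (wire ⊙ fswap) ⨟ (fswap ⊙ wire))) ((wire ⊙ white
      .z)) (by decide +kernel)
  | black₂_swap =>
    exact lval_eq 0 0 ((black₂ ⨟ swap)) (black₂) (by decide +kernel)
  | black₃_swap_left =>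
    exact lval_eq 0 0 ((black₃ ⨟ (swap ⊙ wire))) (black₃) (by decide +kernel)
  | black₃_swap_right =>
    exact lval_eq 0 0 ((black₃ ⨟ (wire ⊙ swap))) (black₃) (by decide +kernel)
  | black₃_fswap =>
    exact lval_eq 0 0 ((black₃ ⨟ (wire ⊙ swap))) ((black₃ ⨟ (wire ⊙ fswap))) (by decide +kernel)
  | not_not =>
    exact lval_eq 0 0 ((not ⨟ not)) (wire) (by decide +kernel)
  | black_coassoc =>
    exact lval_eq 0 0 ((not ⨟ split ⨟ ((not ⨟ split) ⊙ wire))) ((not ⨟ split ⨟ (wire ⊙ (not ⨟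
      split)))) (by decide +kernel)
  | black_counit =>
    exact lval_eq 0 0 ((not ⨟ split ⨟ ((not ⨟ split ⨟ dualDag) ⊙ wire))) (wire)
      (by decide +kernel)
  | black_bialgebra =>
    exact lval_eq 0 0 ((((not ⨟ split) ⊙ (not ⨟ split)) ⨟ (wire ⊙ fswap ⊙ wire) ⨟ ((merge ⨟ not)
      ⊙ (merge ⨟ not)))) ((merge ⨟ not ⨟ not ⨟ split)) (by decide +kernel)
  | black_unit_copy =>
    exact lval_eq 0 0 (((dual ⨟ merge ⨟ not) ⊙ (dual ⨟ merge ⨟ not))) ((dual ⨟ merge ⨟ not ⨟ not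
      ⨟ split)) (by decide +kernel)
  | black_unit_counit =>
    exact lval_eq 0 0 (empty) ((dual ⨟ merge ⨟ not ⨟ not ⨟ split ⨟ dualDag)) (by decide +kernel)
  | black_zero =>
    exact lval_eq 0 0 (((dual ⨟ merge ⨟ not ⨟ split ⨟ dualDag) ⊙ (dual ⨟ merge ⨟ not ⨟ split ⨟
      dualDag))) ((dual ⨟ merge ⨟ not ⨟ split ⨟ dualDag)) (by decide +kernel)
  | white_swap z =>
    exact lval_eq z 0 ((white .z ⨟ swap)) ((white .z)) (by decide +kernel)
  | phase_split z =>
    exact lval_eq z 0 ((not ⨟ split ⨟ (phase .z ⊙ phase .z))) ((phase .z ⨟ not ⨟ split))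
        (by decide +kernel)
  | phase_counit z =>
    exact lval_eq z 0 ((not ⨟ split ⨟ dualDag)) ((phase .z ⨟ not ⨟ split ⨟ dualDag))
      (by decide +kernel)
  | phase_one =>
    exact lval_eq 0 0 ((phase .one)) (wire) (by decide +kernel)
  | phase_zero =>
    exact lval_eq 0 0 ((phase .zero)) ((not ⨟ split ⨟ dualDag ⨟ dual ⨟ merge ⨟ not))
      (by decide +kernel)
  | phase_add z w =>
    exact lval_eq z w ((not ⨟ split ⨟ (phase .z ⊙ phase .w) ⨟ merge ⨟ not)) ((phase .add))
        (by decide +kernel)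
  | phase_mul z w =>
    exact lval_eq z w ((phase .z ⨟ phase .w)) ((phase .mul)) (by decide +kernel)
  | projector_rotate =>
    exact lval_eq 0 0 (projector) (((wire ⊙ wire ⊙ dual) ⨟ (wire ⊙ projector ⊙ wire) ⨟ (dualDag
      ⊙ wire ⊙ wire))) (by decide +kernel)
  | projector_split =>
    exact lval_eq 0 0 ((((not ⨟ split) ⊙ (not ⨟ split)) ⨟ (wire ⊙ swap ⊙ wire) ⨟ (projector ⊙
      projector) ⨟ (wire ⊙ swap ⊙ wire) ⨟ ((merge ⨟ not) ⊙ wire ⊙ wire))) ((projector ⨟ (wire ⊙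
      (not ⨟ split)))) (by decide +kernel)

def mid (r : ℕ) {a b : ℕ} (g : Di a b) : ∀ s, Di (r + a + s) (r + b + s)
  | 0 => (DTerm.id r ⊙ g)
  | s + 1 => (mid r g s ⊙ wire)

def dst : Di 0 3 := (black₂ ⨟ (DTerm.id 2 ⊙ black₃)) ⨟ ((wire ⊙ dualDag) ⊙ DTerm.id 2)
def wst : Di 0 4 := (dual ⨟ ((wire ⊙ dual) ⊙ wire)) ⨟ (DTerm.id 2 ⊙ projector)
def k0 : Di 0 1 := dst ⨟ (wire ⊙ dualDag)
def k1 : Di 0 1 := black₃ ⨟ (wire ⊙ dualDag)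
def b0 : Di 1 0 := (wire ⊙ k0) ⨟ dualDag
def b1 : Di 1 0 := mid 1 k1 0 ⨟ dualDag
def dl : Di 1 2 := (wire ⊙ dst) ⨟ mid 0 dualDag 2
def mul : Di 2 1 :=
  (DTerm.id 2 ⊙ dst) ⨟ mid 2 swap 1 ⨟ mid 3 swap 0 ⨟ mid 1 dualDag 2 ⨟ mid 0 dualDag 1
def cpy : Di 1 3 := (wire ⊙ wst) ⨟ mid 0 dualDag 3

end Snd

end ZW

/-! ### The induced functor and its values on basis states -/

namespace ZW
open PRO Modes Dg

variable {ζ : ℕ → ℂ} {n m : ℕ}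

theorem interp_eq_of_derivable {f g : ZW.Hom m n} (h : ZW.Derivable Ax f g) :
    interp.map f = interp.map g := by
  induction h with
  | of h => exact Snd.sound h
  | refl => rfl
  | symm _ ih => exact ih.symm
  | trans _ _ h1 h2 => exact h1.trans h2
  | comp _ _ h1 h2 => rw [interp.map_comp, interp.map_comp, h1, h2]
  | tensor _ _ h1 h2 => rw [interp.map_tensor, interp.map_tensor, h1, h2]

/-- The interpretation of diagrams modulo the axioms. -/
noncomputable def interpE : PROHom ZWModAx LFM where
  map := Quotient.lift interp.map fun _ _ h => interp_eq_of_derivable h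
  map_id := interp.map_id
  map_comp := by rintro _ _ _ ⟨f⟩ ⟨g⟩; exact interp.map_comp f g
  map_tensor := by rintro _ _ _ _ ⟨f⟩ ⟨g⟩; exact interp.map_tensor f g

/-- The linear map of a diagram. -/
noncomputable def ev (x : H m n) : Modes m →ₗ[ℂ] Modes n := (interpE.map x).1

theorem ev_comp {l : ℕ} (f : H l m) (g : H m n) (x : Modes l) : ev (f ⨾ g) x = ev g (ev f x) := by
  unfold ev
  rw [interpE.map_comp]
  rfl

theorem ev_id (x : Modes n) : ev (ZWModAx.id n) x = x := by
  unfold ev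
  rw [interpE.map_id]
  rfl

theorem ev_tensor {a b : ℕ} (f : H m n) (g : H a b) (x : Modes m) (y : Modes a) :
    ev (f ⊠ g) (tmul m a x y) = tmul n b (ev f x) (ev g y) := by
  unfold ev
  rw [interpE.map_tensor]
  exact tensorMap_tmul _ _ _ _

theorem ev_T {a b : ℕ} (g : H a b) (x : Modes n) (y : Modes a) :
    ev (T n g) (tmul n a x y) = tmul n b x (ev g y) := by
  rw [T, ev_tensor, ev_id]

theorem ev_U (f : H m n) (x : Modes m) (y : Modes 1) :
    ev (U f) (tmul m 1 x y) = tmul n 1 (ev f x) y := by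
  rw [U, ev_tensor, ev_id]

/-- The basis states of a wire. -/
noncomputable def q (c : Bool) : Modes 1 := ket ![c]

/-- The state of no wires. -/
noncomputable def nu : Modes 0 := ket ![]

theorem tmul_nu (x : Modes n) : tmul n 0 x nu = x := by
  ext b
  rw [tmul_apply, nu, ket_apply, if_pos (Subsingleton.elim _ _), mul_one]
  rfl

theorem tmul_assoc {a : ℕ} (x : Modes n) (y : Modes a) (z : Modes 1) :
    tmul n (a + 1) x (tmul a 1 y z) = tmul (n + a) 1 (tmul n a x y) z := by
  ext b
  have e : (fun j : Fin 1 => b (Fin.natAdd n (Fin.natAdd a j))) =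
      fun j => b (Fin.natAdd (n + a) j) :=
    funext fun j => congrArg b (Fin.ext (Nat.add_assoc n a j).symm)
  refine Eq.trans ?_ (_root_.mul_assoc _ _ _).symm
  exact congrArg (fun t => _ * (_ * z t)) e

theorem ev_of_amps {x : H m n} {z w : ℂ} (D : DTerm PSig m n) (h : interpE.map x = lval z w D)
    (l : List Bool) (L : List Tm) (hL : same n (amps D l) L = true) :
    ev x (ket (bits m l)) = den z w n L := by
  unfold ev
  rw [h, amps_spec, den_eq z w hL]

theorem bits_one (a : Bool) : bits 1 [a] = ![a] := by ext i; fin_cases i; rfl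
theorem bits_two (a b : Bool) : ket (bits 2 [a, b]) = tmul 1 1 (q a) (q b) := by
  rw [q, q, tmul_ket]
  congr 1
  ext i; fin_cases i <;> rfl
theorem bits_three (a b c : Bool) :
    ket (bits 3 [a, b, c]) = tmul 2 1 (tmul 1 1 (q a) (q b)) (q c) := by
  rw [q, q, q, tmul_ket, tmul_ket]
  congr 1
  ext i; fin_cases i <;> rfl
theorem bits_zero (l : List Bool) : ket (bits 0 l) = nu := congrArg ket (Subsingleton.elim _ _)

theorem ket_bits_one (a : Bool) : ket (bits 1 [a]) = q a := by rw [bits_one, q]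

theorem ev_k0 : ev (dval ζ k0) nu = q false := by
  rw [← bits_zero [], ev_of_amps (z := 0) (w := 0) Snd.k0 rfl [] [(1, 0, 0, [false])]
    (by decide +kernel)]
  simp [den, Tm.cf, ket_bits_one]

theorem ev_k1 : ev (dval ζ k1) nu = q true := by
  rw [← bits_zero [], ev_of_amps (z := 0) (w := 0) Snd.k1 rfl [] [(1, 0, 0, [true])]
    (by decide +kernel)]
  simp [den, Tm.cf, ket_bits_one]

theorem ev_b0_true : ev (dval ζ b0) (q true) = 0 := by
  refine (congrArg _ (ket_bits_one _).symm).trans ?_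
  rw [ev_of_amps (z := 0) (w := 0) Snd.b0 rfl [true] [] (by decide +kernel)]
  simp [den]

theorem ev_b1_true : ev (dval ζ b1) (q true) = nu := by
  refine (congrArg _ (ket_bits_one _).symm).trans ?_
  rw [ev_of_amps (z := 0) (w := 0) Snd.b1 rfl [true] [(1, 0, 0, [])]
    (by decide +kernel)]
  simp [den, Tm.cf, bits_zero]

theorem ev_dl_true : ev (dval ζ dl) (q true) =
    tmul 1 1 (q true) (q false) + tmul 1 1 (q false) (q true) := by
  refine (congrArg _ (ket_bits_one _).symm).trans ?_
  rw [ev_of_amps (z := 0) (w := 0) Snd.dl rfl [true]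
    [(1, 0, 0, [true, false]), (1, 0, 0, [false, true])] (by decide +kernel)]
  simp [den, Tm.cf, bits_two]

theorem ev_cpy_true : ev (dval ζ cpy) (q true) =
    tmul 2 1 (tmul 1 1 (q true) (q true)) (q true) := by
  refine (congrArg _ (ket_bits_one _).symm).trans ?_
  rw [ev_of_amps (z := 0) (w := 0) Snd.cpy rfl [true]
    [(1, 0, 0, [true, true, true])] (by decide +kernel)]
  simp [den, Tm.cf, bits_three]

theorem ev_mul_false_true : ev (dval ζ mul) (tmul 1 1 (q false) (q true)) = q true := by
  refine (congrArg _ (bits_two _ _).symm).trans ?_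
  rw [ev_of_amps (z := 0) (w := 0) Snd.mul rfl [false, true]
    [(1, 0, 0, [true])] (by decide +kernel)]
  simp [den, Tm.cf, ket_bits_one]

theorem ev_fs_false_true : ev fs (tmul 1 1 (q false) (q true)) = tmul 1 1 (q true) (q false) := by
  refine (congrArg _ (bits_two _ _).symm).trans ?_
  rw [ev_of_amps (z := 0) (w := 0) Snd.fswap rfl [false, true]
    [(1, 0, 0, [true, false])] (by decide +kernel)]
  simp [den, Tm.cf, bits_two]

theorem ev_ph_true (z : ℂ) : ev (ph z) (q true) = z • q true := by
  refine (congrArg _ (ket_bits_one _).symm).trans ?_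
  rw [ev_of_amps (z := z) (w := 0) (Snd.phase .z) rfl [true]
    [(1, 1, 0, [true])] (by decide +kernel)]
  simp [den, Tm.cf, ket_bits_one]

end ZW

namespace ZW
open PRO Modes Dg Ops

variable {ζ : ℕ → ℂ} {n m : ℕ}

/-! ### The linear maps of operators -/

/-- The linear map of an operator, with control in the state `1`. -/
noncomputable def on (K : H (n + 1) n) (x : Modes n) : Modes n := ev K (tmul n 1 x (q true))

/-- On the control `|1⟩`, `dl` gives `|10⟩ + |01⟩`, so in each term exactly one of the two operators
is switched on. -/
theorem on_addO {A B : H (n + 1) n} (hA : Act A) (hB : Act B) (x : Modes n) :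
    on (addO A B) x = on A x + on B x := by
  have off {K : H (n + 1) n} (hK : Act K) (x : Modes n) : ev K (tmul n 1 x (q false)) = x := by
    have h : T n (dval 0 k0) ⨾ appl (K ∷ nil) = ZWModAx.id n := hK.unit 0
    rw [appl_one] at h
    rw [← ev_k0 (ζ := 0), ← ev_T, ← ev_comp, h, tmul_nu, ev_id]
  unfold on
  rw [addO_eq, ev_comp, ev_comp, ev_T, ev_dl_true, map_add, tmul_assoc, tmul_assoc, map_add,
      map_add,
    ev_U, ev_U, off hA, off hB]

theorem on_smulO (z : ℂ) (A : H (n + 1) n) (x : Modes n) : on (smulO z A) x = z • on A x := by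
  unfold on
  rw [smulO_eq, ev_comp, ev_T, ev_ph_true, map_smul, map_smul]

theorem on_zeroO (x : Modes n) : on (zeroO n) x = 0 := by
  unfold on zeroO
  rw [ev_T, ev_b0_true, map_zero]

theorem on_triO (A B C : H (n + 1) n) (x : Modes n) :
    on (triO A B C) x = on C (on B (on A x)) := by
  unfold on
  rw [triO_eq, ev_comp, ev_comp, ev_T, ev_cpy_true, tmul_assoc, ev_U, tmul_assoc, ev_comp, ev_U]

/-- The basis state with the wires of `S`, counted from the right, in the state `1`. -/
noncomputable def qs : ∀ n, (ℕ → Bool) → Modes n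
  | 0, _ => nu
  | n + 1, S => tmul n 1 (qs n fun i => S (i + 1)) (q (S 0))

theorem qs_eq : ∀ n S, qs n S = ket fun k => S (n - 1 - k)
  | 0, _ => congrArg ket (Subsingleton.elim _ _)
  | n + 1, S => by
    show tmul n 1 (qs n _) (ket _) = _
    rw [qs_eq n, tmul_ket]
    congr 1
    ext k
    refine Fin.addCases (fun i => ?_) (fun j => ?_) k
    · rw [Fin.append_left]
      have := i.2
      exact congrArg S (show n - 1 - i + 1 = n + 1 - 1 - i by omega)
    · rw [Fin.append_right, Subsingleton.elim j 0]
      exact congrArg S (show 0 = n + 1 - 1 - (n + 0) by omega)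

/-- As the wires that the control has to cross are empty, no sign appears. In `on_word` this
hypothesis is satisfied since the letters of a sorted word act in decreasing order. -/
theorem on_letter : ∀ n i S, i < n → (∀ j ≤ i, S j = false) →
    on (letter n i) (qs n S) = qs n (Function.update S i true)
  | n + 1, 0, S, _, hS => by
    unfold on qs
    rw [hS 0 le_rfl, ← tmul_assoc]
    refine (ev_T _ _ _).trans ?_
    rw [ev_mul_false_true]
    rfl
  | n + 1, i + 1, S, hi, hS => by
    have ih := on_letter n i (fun k => S (k + 1)) (by omega) fun j hj => hS _ (by omega)
    unfold on at *
    rw [qs, qs, hS 0 (Nat.zero_le _), ← tmul_assoc, letter, lft, ev_comp, ev_T, ev_fs_false_true,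
      tmul_assoc, ev_U, ih, Function.update_of_ne (by omega), hS 0 (Nat.zero_le _)]
    congr 3
    ext k
    by_cases h : k = i
    · subst h; simp
    · rw [Function.update_of_ne h, Function.update_of_ne (by omega)]

theorem on_word (n : ℕ) : ∀ w, Wd n w →
    on (word n w) (qs n fun _ => false) = qs n fun k => decide (k ∈ w)
  | [], h => absurd h.2.1 (by simp)
  | [i], h => by
    rw [word, on_letter n i _ (h.2.2 i (by simp)) fun _ _ => rfl]
    congr 1
    ext k
    by_cases hk : k = i <;> simp [hk]
  | i :: j :: w, h => by
    have h1 := List.pairwise_cons.1 h.1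
    have h2 := List.pairwise_cons.1 h1.2
    have ij := h1.1 j (by simp)
    rw [word, on_triO, on_word n w ⟨h2.2, by have := h.2.1; simp at this; omega,
        fun k hk => h.2.2 k (by simp [hk])⟩,
      on_letter n j _ (h.2.2 j (by simp)) fun k hk => by
        simpa using fun hm => absurd (h2.1 k hm) (by omega),
      on_letter n i _ (h.2.2 i (by simp)) fun k hk => by
        rw [Function.update_of_ne (by omega)]
        simpa using fun hm => absurd (h1.1 k (by simp [hm])) (by omega)]
    congr 1
    ext k
    by_cases hi : k = i
    · subst hi; simp
    · by_cases hj : k = j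
      · subst hj; simp [hi]
      · simp [hi, hj]

/-! ### The vectors of states -/

/-- The vector of a state. -/
noncomputable def vec (x : H 0 n) : Modes n := ev x nu

theorem vec_vac : ∀ n, vec (vac n) = qs n fun _ => false
  | 0 => ev_id _
  | n + 1 => by
    rw [vec, vac, ev_comp]
    refine Eq.trans ?_ (congrArg (tmul n 1 · (q false)) (vec_vac n))
    rw [← ev_k0 (ζ := 0), ← ev_T, tmul_nu]
    rfl

theorem vec_stt (K : H (n + 1) n) : vec (stt K) = on K (qs n fun _ => false) := by
  rw [← vec_vac, vec, stt, ev_comp, ev_comp, on, ← ev_k1 (ζ := 0), ← ev_T, tmul_nu]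
  rfl

/-- The coefficient of a word. -/
def wcoef : List (ℂ × List ℕ) → List ℕ → ℂ
  | [], _ => 0
  | p :: L, w => (if w = p.2 then p.1 else 0) + wcoef L w

theorem Wd.ext {w w' : List ℕ} (h : Wd n w) (h' : Wd n w')
    (e : (fun k : Fin n => decide (n - 1 - k ∈ w)) = fun k : Fin n => decide (n - 1 - k ∈ w')) :
    w = w' := by
  refine List.Perm.eq_of_pairwise' h.1 h'.1 ?_
  refine (List.perm_ext_iff_of_nodup (h.1.imp ne_of_lt) (h'.1.imp ne_of_lt)).2 fun a => ?_
  have key (ha : a < n) : a ∈ w ↔ a ∈ w' := by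
    have := congrFun e ⟨n - 1 - a, by omega⟩
    have e' : n - 1 - (n - 1 - a) = a := by omega
    simpa [e'] using this
  exact ⟨fun hm => (key (h.2.2 a hm)).1 hm, fun hm => (key (h'.2.2 a hm)).2 hm⟩

theorem on_comb {L : List (ℂ × List ℕ)} (hL : ∀ p ∈ L, Wd n p.2) {w : List ℕ} (hw : Wd n w) :
    on (comb n L) (qs n fun _ => false) (fun k => decide (n - 1 - k ∈ w)) = wcoef L w := by
  induction L with
  | nil => rw [comb, on_zeroO]; rfl
  | cons p L ih =>
    rw [comb, on_addO ((IsOp.word n _).act.smulO _) (IsOp.comb n L).act, on_smulO,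
      on_word n _ (hL p (by simp)), qs_eq, PiLp.add_apply, PiLp.smul_apply, ket_apply,
      ih fun r hr => hL r (by simp [hr]), wcoef]
    congr 1
    by_cases h : w = p.2
    · subst h; simp
    · rw [if_neg h, if_neg fun e => h (hw.ext (hL p (by simp)) e), smul_zero]

theorem comb_add (n : ℕ) (c d : List ℕ → ℂ) : ∀ S : List (List ℕ),
    comb n (S.map fun w => (c w + d w, w)) =
      addO (comb n (S.map fun w => (c w, w))) (comb n (S.map fun w => (d w, w)))
  | [] => (zeroO_addO _).symm
  | w :: S => by
    have hw := IsOp.word n w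
    simp only [List.map_cons, comb]
    rw [comb_add n c d S, ← addO_smulO hw.act, addO_assoc, addO_assoc, ← addO_assoc (smulO (d w) _),
      addO_comm' (.smul _ hw) (.comb n _), addO_assoc]

theorem comb_zero (n : ℕ) {c : List ℕ → ℂ} : ∀ {S : List (List ℕ)}, (∀ w ∈ S, c w = 0) →
    comb n (S.map fun w => (c w, w)) = zeroO n
  | [], _ => rfl
  | w :: S, h => by
    simp only [List.map_cons, comb]
    rw [comb_zero n fun v hv => h v (by simp [hv]), h w (by simp), smulO_zero (IsOp.word n w).act,
      addO_zeroO]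

theorem comb_single (n : ℕ) (z : ℂ) {w : List ℕ} : ∀ {S : List (List ℕ)}, S.Nodup → w ∈ S →
    comb n (S.map fun v => (if v = w then z else 0, v)) = smulO z (word n w)
  | v :: S, hS, hw => by
    have hS' := List.nodup_cons.1 hS
    simp only [List.map_cons, comb]
    by_cases h : v = w
    · subst h
      rw [comb_zero n fun u hu => if_neg fun e : u = v => hS'.1 (e ▸ hu), if_pos rfl, addO_zeroO]
    · rw [comb_single n z hS'.2 ((List.mem_cons.1 hw).resolve_left (Ne.symm h)), if_neg h,
        smulO_zero (IsOp.word n v).act, zeroO_addO]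

/-- Terms with the same word are collected. This makes linear combinations comparable term by term,
over a common list `S` of words. -/
theorem comb_eq_coef (n : ℕ) {S : List (List ℕ)} (hS : S.Nodup) : ∀ {L : List (ℂ × List ℕ)},
    (∀ p ∈ L, p.2 ∈ S) → comb n L = comb n (S.map fun w => (wcoef L w, w))
  | [], _ => (comb_zero n fun _ _ => rfl).symm
  | p :: L, h => by
    simp only [wcoef]
    rw [comb_add n _ (wcoef L) S, comb_single n p.1 hS (h p (by simp)),
      ← comb_eq_coef n hS fun r hr => h r (by simp [hr])]
    rfl

/-- The coefficient of a sorted word is the coordinate of the vector at the corresponding basis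
state (`on_comb`), so equal vectors have equal coefficients. -/
theorem W.injective {x y : H 0 n} (hx : W n x) (hy : W n y) (h : vec x = vec y) : x = y := by
  obtain ⟨_, ⟨L, hL, rfl⟩, rfl⟩ := hx
  obtain ⟨_, ⟨L', hL', rfl⟩, rfl⟩ := hy
  have hS : ((L ++ L').map Prod.snd).dedup.Nodup := List.nodup_dedup _
  rw [comb_eq_coef n (L := L) hS (by simp; grind), comb_eq_coef n (L := L') hS (by simp; grind)]
  congr 2
  refine List.map_congr_left fun w hw => ?_
  have hw' : Wd n w := by
    obtain ⟨p, hp, rfl⟩ := List.mem_map.1 (List.mem_dedup.1 hw)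
    exact (List.mem_append.1 hp).elim (hL p) (hL' p)
  rw [← on_comb hL hw', ← on_comb hL' hw', ← vec_stt, ← vec_stt, h]

end ZW

/-! ### The zero state and bijectivity on states -/

namespace ZW
open PRO Modes Dg Ops

variable {ζ : ℕ → ℂ} {n m : ℕ}

section
open Rule

/-- An odd scalar absorbs signs. -/
def Rule.zC : Rule := ⟨[O' 0, I' 0, C' 1 2], [O' 0, I' 0, E' 1 2], [1, 2]⟩
theorem Rule.zC_sound : zC.Sound ζ :=
  sound_of_derives canSound_three [⟨iZ.symm, [], []⟩, ⟨oZ, [], []⟩] []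
    ⟨iZ_sound.symm, oZ_sound, trivial⟩ trivial (by decide +kernel)

/-- The sum of the states `1` and `-1` times `1`. -/
def Dg.diff : Dg 0 1 := k1 ⊳ pha 4 ⊳ dl ⊳ mid 0 (pha 1) 1 ⊳ mid 1 (pha 2) 0 ⊳ mul

/-- Evaluating `1 + (-1) = 0` inside `diff` leaves `|0⟩` and another factor `⟨0|1⟩`, which is
absorbed as `⟨0|1⟩` is idempotent. -/
theorem k1_b0_diff :
    dval ζ (k1 ⊳ b0 ⊳ diff) = dval ζ (k0 ⊳ mid 1 k1 0 ⊳ mid 1 b0 0) :=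
  dval_eq_of_proves canSound_three [⟨dEq, [], []⟩, ⟨dEq, [], []⟩, ⟨pAdd 1 2 0, [], []⟩,
    ⟨p0, [], []⟩, ⟨pO, [], []⟩, ⟨zOI, [], []⟩] [] ⟨dEq_sound, dEq_sound, pAddNeg_sound, p0_sound,
    pO_sound, zOI_sound, trivial⟩ trivial (by decide +kernel)

/-- In the presence of `⟨0|1⟩` the sign in `diff` disappears by `zC`, so for the parameter `1/2` the
sum is `1/2 + 1/2 = 1` and leaves `|1⟩`. -/
theorem k1_b0_diff' :
    dval (fun _ => 1 / 2) (k1 ⊳ b0 ⊳ diff) = dval (fun _ => 1 / 2) (k1 ⊳ b0 ⊳ k1) :=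
  dval_eq_of_proves canSound_three [⟨p1, [], []⟩, ⟨cP.symm, [], []⟩, ⟨zC, [], []⟩, ⟨dP, [], []⟩,
    ⟨dEq, [], []⟩, ⟨dEq, [], []⟩, ⟨pAdd 4 4 1, [], []⟩, ⟨p1, [], []⟩] []
    ⟨p1_sound, cP_sound.symm, zC_sound, dP_sound, dEq_sound, dEq_sound,
      pAdd_sound 4 4 1 (by norm_num [pv]) (by decide +kernel) (by decide +kernel), p1_sound,
      trivial⟩ trivial (by decide +kernel)

theorem k1_b1 : dval ζ (k1 ⊳ b1) = dval ζ nl :=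
  dval_eq_of_proves canSound_three [⟨ii, [], []⟩] [] ⟨ii_sound, trivial⟩ trivial
    (by decide +kernel)

end

/-- The two evaluations of `diff` show that the scalar `⟨0|1⟩` does not distinguish `|0⟩` from
`|1⟩`. So the zero states of both parities are compatible, as `stt_zeroO_k1` makes precise. -/
theorem k1_b0_k1 : dval 0 (k1 ⊳ b0 ⊳ k1) = dval 0 (k0 ⊳ mid 1 k1 0 ⊳ mid 1 b0 0) :=
  k1_b0_diff'.symm.trans (k1_b0_diff (ζ := fun _ => 1 / 2))

theorem stt_zeroO_k1 (n : ℕ) : stt (zeroO n) ⨾ T n (dval 0 k1) = stt (zeroO (n + 1)) := by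
  have h := congrArg (T n) k1_b0_k1
  have e1 : T n (dval 0 (mid 1 k1 0)) = T (n + 1) (dval 0 k1) := eq_of_heq (T_mid_heq n 1 _ 0)
  have e2 : T n (dval 0 (mid 1 b0 0)) = T (n + 1) (dval 0 b0) := eq_of_heq (T_mid_heq n 1 _ 0)
  rw [T_cp, T_cp, T_cp, T_cp, e1, e2] at h
  simp only [stt, zeroO, vac, ZWModAx.assoc]
  exact congrArg (vac n ⨾ ·) h

theorem k1_b1_cancel (x : H 0 n) : (x ⨾ T n (dval 0 k1)) ⨾ T n (dval 0 b1) = x := by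
  rw [ZWModAx.assoc, ← T_cp, k1_b1]
  exact (congrArg (x ⨾ ·) (T_id n 0)).trans (ZWModAx.comp_id x)

theorem vec_k1 (x : H 0 n) : vec (x ⨾ T n (dval 0 k1)) = tmul n 1 (vec x) (q true) := by
  rw [vec, ev_comp, ← ev_k1 (ζ := 0), ← ev_T, tmul_nu]
  rfl

theorem ev_T_b1 (x : Modes n) : ev (T n (dval 0 b1)) (tmul n 1 x (q true)) = x := by
  rw [ev_T, ev_b1_true, tmul_nu]

/-! ### Parity -/

theorem apply_eq_zero_of_mem_part {p : ZMod 2} {x : Modes n} (hx : x ∈ part n p)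
    {b : Fin n → Bool} (hb : parity b ≠ p) : x b = 0 := by
  induction hx using Submodule.span_induction with
  | mem x h =>
    obtain ⟨c, rfl, rfl⟩ := h
    rw [ket_apply, if_neg fun e : b = c => hb (congrArg parity e)]
  | zero => rfl
  | add x y _ _ hx hy => rw [PiLp.add_apply, hx, hy, add_zero]
  | smul a x _ hx => rw [PiLp.smul_apply, hx, smul_zero]

theorem eq_zero_of_mem_parts {p p' : ZMod 2} (hp : p ≠ p') {x : Modes n} (hx : x ∈ part n p)
    (hx' : x ∈ part n p') : x = 0 := by
  ext b
  by_cases h : parity b = p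
  · exact apply_eq_zero_of_mem_part hx' (h ▸ hp)
  · exact apply_eq_zero_of_mem_part hx h

theorem parity_eq_length {w : List ℕ} (hw : w.Nodup) (hn : ∀ i ∈ w, i < n) :
    parity (fun k : Fin n => decide (n - 1 - k ∈ w)) = w.length := by
  have e := Fin.sum_univ_eq_sum_range (fun k => if n - 1 - k ∈ w then (1 : ZMod 2) else 0) n
  have e' := Finset.sum_range_reflect (fun k => if k ∈ w then (1 : ZMod 2) else 0) n
  have f : (Finset.range n).filter (· ∈ w) = w.toFinset := by
    ext k
    simpa using hn k
  rw [parity]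
  simp only [decide_eq_true_eq]
  rw [e, e', Finset.sum_ite, Finset.sum_const_zero, add_zero, Finset.sum_const, f,
    List.toFinset_card_of_nodup hw, nsmul_one]

theorem length_cast_eq_one (w : List ℕ) : (w.length : ZMod 2) = 1 ↔ w.length % 2 = 1 := by
  simpa using ZMod.natCast_eq_natCast_iff' w.length 1 2

theorem qs_word_mem {w : List ℕ} (h : Wd n w) : (qs n fun k => decide (k ∈ w)) ∈ part n 1 := by
  rw [qs_eq]
  exact ket_mem_part ((parity_eq_length (h.1.imp ne_of_lt) h.2.2).trans
    ((length_cast_eq_one w).2 h.2.1))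

theorem on_mem_part {K : H (n + 1) n} (hK : Spn n (Wd n) K) :
    on K (qs n fun _ => false) ∈ part n 1 := by
  refine hK.ind (motive := fun K => on K (qs n fun _ => false) ∈ part n 1) ?_ ?_ ?_ ?_
  · rw [on_zeroO]; exact Submodule.zero_mem _
  · intro w hw
    rw [on_word n w hw]
    exact qs_word_mem hw
  · intro z K _ h
    rw [on_smulO]
    exact Submodule.smul_mem _ _ h
  · intro K K' hK hK' h h'
    rw [on_addO hK.act hK'.act]
    exact Submodule.add_mem _ h h'

theorem W.vec_mem {x : H 0 n} (h : W n x) : vec x ∈ part n 1 := by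
  obtain ⟨K, hK, rfl⟩ := h
  rw [vec_stt]
  exact on_mem_part hK

theorem q_true_mem : q true ∈ part 1 1 := ket_mem_part (by decide)

theorem tmul_q_true_mem {p : ZMod 2} {x : Modes n} (hx : x ∈ part n p) :
    tmul n 1 x (q true) ∈ part (n + 1) (p + 1) := tmul_mem_part hx q_true_mem

/-! ### States are determined by their vectors -/

theorem eq_stt_zeroO {x : H 0 n} (hx : W n x) (h : vec x = 0) : x = stt (zeroO n) :=
  hx.injective ⟨_, .zero, rfl⟩ (by rw [h, vec_stt, on_zeroO])

/-- The vector of `x` is odd. That of `y` becomes odd when `|1⟩` is added, so it is even. Being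
equal, both vanish, and `x` and `y` are identified through the normal forms of zero. -/
theorem eq_of_W_of_W_k1 {x y : H 0 n} (hx : W n x) (hy : W (n + 1) (y ⨾ T n (dval 0 k1)))
    (h : vec x = vec y) : x = y := by
  have h1 := hy.vec_mem
  have h2 := tmul_q_true_mem hx.vec_mem
  rw [h, ← vec_k1] at h2
  have h0 := eq_zero_of_mem_parts (by decide) h1 h2
  have hv : vec y = 0 := by rw [← ev_T_b1 (vec y), ← vec_k1, h0, map_zero]
  rw [← k1_b1_cancel x, ← k1_b1_cancel y, eq_stt_zeroO hx (h.trans hv), stt_zeroO_k1,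
    eq_stt_zeroO hy h0]

theorem vec_injective {x y : H 0 n} (h : vec x = vec y) : x = y := by
  rcases good x with hx | hx <;> rcases good y with hy | hy
  · exact hx.injective hy h
  · exact eq_of_W_of_W_k1 hx hy h
  · exact (eq_of_W_of_W_k1 hy hx h.symm).symm
  · rw [← k1_b1_cancel x, ← k1_b1_cancel y, hx.injective hy (by rw [vec_k1, vec_k1, h])]

/-! ### Pure vectors are vectors of states -/

theorem exists_W {v : Modes n} (hv : v ∈ part n 1) : ∃ K, Spn n (Wd n) K ∧ vec (stt K) = v := by
  induction hv using Submodule.span_induction with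
  | mem x h =>
    obtain ⟨b, hb, rfl⟩ := h
    -- The occupied wires of `b`; letters count wires from the right, whence `n - 1 - i`.
    let w := (List.range n).filter fun i => ∃ h : i < n, b ⟨n - 1 - i, by omega⟩ = true
    have e : (fun k : Fin n => decide (n - 1 - k ∈ w)) = b := by
      ext k
      have h1 : n - 1 - (n - 1 - k) = k := by omega
      have h2 : n - 1 - k < n := by omega
      simp [w, h1, h2]
    have hw : w.Pairwise (· < ·) := List.pairwise_lt_range.filter _
    have hn : ∀ i ∈ w, i < n := fun i hi => List.mem_range.1 (List.mem_of_mem_filter hi)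
    have hl : w.length % 2 = 1 := by
      rw [← length_cast_eq_one, ← parity_eq_length (hw.imp ne_of_lt) hn, e, hb]
    refine ⟨word n w, .word ⟨hw, hl, hn⟩, ?_⟩
    rw [vec_stt, on_word n w ⟨hw, hl, hn⟩, qs_eq, e]
  | zero => exact ⟨_, .zero, by rw [vec_stt, on_zeroO]⟩
  | add x y _ _ hx hy =>
    obtain ⟨K, hK, rfl⟩ := hx
    obtain ⟨K', hK', rfl⟩ := hy
    exact ⟨_, hK.add hK', by rw [vec_stt, vec_stt, vec_stt, on_addO hK.isOp.act hK'.isOp.act]⟩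
  | smul a x _ hx =>
    obtain ⟨K, hK, rfl⟩ := hx
    exact ⟨_, hK.smul a, by rw [vec_stt, vec_stt, on_smulO]⟩

/-- An even vector becomes odd when a wire in the state `|1⟩` is added; the effect `b1` removes this
wire again. -/
theorem exists_vec_eq {v : Modes n} {p : ZMod 2} (hv : v ∈ part n p) : ∃ x : H 0 n, vec x = v := by
  rcases (by decide : ∀ p : ZMod 2, p = 0 ∨ p = 1) p with rfl | rfl
  · have h1 := tmul_q_true_mem hv
    rw [zero_add] at h1
    obtain ⟨K, -, h⟩ := exists_W h1
    refine ⟨stt K ⨾ T n (dval 0 b1), (ev_comp _ _ _).trans ?_⟩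
    exact (congrArg (ev (T n (dval 0 b1))) h).trans (ev_T_b1 v)
  · obtain ⟨K, -, h⟩ := exists_W hv
    exact ⟨stt K, h⟩

end ZW

/-! ### From states to a monoidal equivalence -/

namespace PROHom
open PRO

variable {P Q : PRO} (F : PROHom P Q)

theorem map_T (n : ℕ) {a b : ℕ} (g : P.Hom a b) : F.map (T n g) = T n (F.map g) := by
  rw [T, F.map_tensor, F.map_id]
  rfl

theorem map_U {m n : ℕ} (h : P.Hom m n) : F.map (U h) = U (F.map h) := by
  rw [U, F.map_tensor, F.map_id]
  rfl

theorem unbend_bend {m n : ℕ} {e : P.Hom 0 2} {c : P.Hom 2 0} (h : U e ⨾ T 1 c = P.id 1)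
    (f : P.Hom (m + 1) n) : U (T m e ⨾ U f) ⨾ T n c = f := by
  have h1 : U (U f) ⨾ T n c = T (m + 1) c ⨾ f := V_T f c
  have h2 : T m (T 1 c) = T (m + 1) c := eq_of_heq (T_T_heq m 1 c)
  rw [U_comp, P.assoc, h1, ← P.assoc, ← h2]
  refine (congrArg (· ⨾ f) ?_).trans (P.id_comp f)
  refine (congrArg (· ⨾ T m (T 1 c)) (T_U m e).symm).trans ((T_comp m _ _).symm.trans ?_)
  rw [h, T_id]

/-- In the presence of a cup and a cap, a morphism of PROs that is bijective on states is
bijective. -/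
theorem bijective_of_states {e : P.Hom 0 2} {c : P.Hom 2 0} (h : U e ⨾ T 1 c = P.id 1)
    (hF : ∀ n, Function.Bijective (F.map : P.Hom 0 n → Q.Hom 0 n)) :
    ∀ m n, Function.Bijective (F.map : P.Hom m n → Q.Hom m n)
  | 0, n => hF n
  | m + 1, n => by
    -- The last input is bent into an additional output, which leaves a morphism with one input
    -- less; `unbend_bend` reverses this in both PROs.
    have ih := bijective_of_states h hF m (n + 1)
    have h' : U (F.map e) ⨾ T 1 (F.map c) = Q.id 1 := by
      rw [← F.map_U, ← F.map_T, ← F.map_comp, h, F.map_id]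
    have bend (x : P.Hom (m + 1) n) : F.map (T m e ⨾ U x) = T m (F.map e) ⨾ U (F.map x) := by
      rw [F.map_comp, F.map_T, F.map_U]
    refine ⟨fun x y hxy => ?_, fun f => ?_⟩
    · have e' := ih.1 ((bend x).trans ((congrArg (T m (F.map e) ⨾ U ·) hxy).trans (bend y).symm))
      rw [← unbend_bend h x, e', unbend_bend h y]
    · obtain ⟨x, hx⟩ := ih.2 (T m (F.map e) ⨾ U f)
      refine ⟨U x ⨾ T n c, ?_⟩
      rw [F.map_comp, F.map_U, F.map_T, hx, unbend_bend h']

/-- A bijective morphism of PROs is a monoidal equivalence. -/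
theorem isMonoidalEquivalence
    (hF : ∀ m n, Function.Bijective (F.map : P.Hom m n → Q.Hom m n)) :
    IsMonoidalEquivalence F.functor := by
  have : F.functor.Faithful := ⟨fun h => (hF _ _).1 h⟩
  have : F.functor.Full := ⟨fun f => (hF _ _).2 f⟩
  have : F.functor.EssSurj := ⟨fun X => ⟨⟨X.n⟩, ⟨Iso.refl _⟩⟩⟩
  have hE : F.functor.IsEquivalence := {}
  let : F.functor.asEquivalence.functor.Monoidal := inferInstanceAs F.functor.Monoidal
  let : F.functor.asEquivalence.inverse.Monoidal := F.functor.asEquivalence.inverseMonoidal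
  exact ⟨hE, F.functor.asEquivalence.inverseMonoidal,
    { leftAdjoint_ε := rfl, leftAdjoint_μ := fun _ _ => rfl }⟩

end PROHom

/-! ### Completeness -/

namespace ZW
open PRO Modes

theorem interpE_bijective_states (n : ℕ) :
    Function.Bijective (interpE.map : H 0 n → LFM.Hom 0 n) := by
  refine ⟨fun x y h => vec_injective (congrArg (fun f => f.1 nu) h), fun f => ?_⟩
  obtain ⟨e, he⟩ := (isPure_iff f.1).1 f.2
  obtain ⟨x, hx⟩ := exists_vec_eq ((hasDegree_iff f.1 e).1 he ![])
  refine ⟨x, Subtype.ext (hom_ext fun b => ?_)⟩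
  rw [Subsingleton.elim b ![]]
  exact hx

theorem interpE_bijective : ∀ m n, Function.Bijective (interpE.map : H m n → LFM.Hom m n) :=
  interpE.bijective_of_states snake' interpE_bijective_states

end ZW

theorem mainTheorem1 :
    ∃ fE : PROHom ZWModAx LFM,
      ZW.toModAx.comp fE = ZW.interp ∧
      IsMonoidalEquivalence fE.functor ∧
      ∀ (m n : ℕ) (D D' : ZW.Hom m n),
        ZW.interp.map D = ZW.interp.map D' ↔ ZW.toModAx.map D = ZW.toModAx.map D' :=
  ⟨ZW.interpE, rfl, ZW.interpE.isMonoidalEquivalence ZW.interpE_bijective, fun m n _ _ =>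
    ⟨fun h => (ZW.interpE_bijective m n).1 h, fun h => congrArg ZW.interpE.map h⟩⟩
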